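/- Let $(M,\lambda)$ be a smooth three-dimensional contact manifold ($\lambda$ a contact form), let $\mathcal L\subset M$ be a Legendrian knot, and let $\mathcal D\subset M$ be a compact, oriented, smoothly embedded surface with $\partial\mathcal D=\mathcal L$. Orient $\mathcal L$ so that $(v,\nu)$ is positively oriented in $T\mathcal D$ whenever $v$ is tangent to $\mathcal L$ and positive and $\nu$ points into $\mathcal D$. A point $p\in\mathcal D$ is singular if $T_p\mathcal D=\ker\lambda(p)$; it is positive (negative) if the orientation of $T_p\mathcal D$ agrees (disagrees) with the orientation of $\ker\lambda(p)$ given by $d\lambda$. Let $\sigma$ be a positive area form on $\mathcal D$ and $Z$ the vector field on $\mathcal D$ with $i_Z\sigma=\lambda|_{T\mathcal D}$. A singular point $p$ is non-degenerate if no eigenvalue of the linearization $Z'(p)$ is purely imaginary (or zero); it is then elliptic if the product of the two eigenvalues is positive and hyperbolic if it is negative. Assume that all singular points of $\mathcal D$ are non-degenerate. Then there are only finitely many singular points on $\mathcal L$. Denote them by $e_1,\dots,e_N$ ($N\ge 0$), ordered cyclically by moving along $\mathcal L$ in the direction of its orientation. There is an embedded surface $\mathcal D'$ with $\partial\mathcal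 D'=\mathcal L$ and with the same singular points as $\mathcal D$, obtained from $\mathcal D$ by an arbitrarily $C^0$-small perturbation which is supported in an arbitrarily small neighbourhood of $\mathcal L$ and fixes $\mathcal L$, so that the following holds. There are a (not necessarily open) neighbourhood $U$ of $\mathcal L$ and a diffeomorphism $\Phi$ from an open set containing $U$ onto an open subset of $S^1\times\mathbb R^2$, where $S^1=\mathbb R/\mathbb Z$ and the coordinates are $(\theta,x,y)$, such that * $\Phi^*(dy+x\,d\theta)=\lambda$; * $\Phi(\mathcal L)=S^1\times\{(0,0)\}$; * $\Phi(e_k)=(\theta_k,0,0)$ with $0\le\theta_1<\dots<\theta_N<1$; * $\Phi(U\cap\mathcal D')=\{(\theta,a(\theta)r,b(\theta)r) : \theta,r\in[0,1]\}$, where $a,b:\mathbb R\to\mathbb R$ are smooth 1-periodic functions with the following properties: * for $\theta\in[0,1)$, $b(\theta)=0$ if and only if $\theta=\theta_k$ for some $k$; * $a(\theta_k)<0$ if $e_k$ is positive, and $a(\theta_k)>0$ if $e_k$ is negative; * if $e_k$ is elliptic, then $-1<b'(\theta_k)/a(\theta_k)<0$; * if $e_k$ is hyperbolic, then $b'(\theta_k)/a(\theta_k)<-1$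 or $b'(\theta_k)/a(\theta_k)>0$; * $a$ has exactly one zero in each interval $[\theta_k,\theta_{k+1}]$, $1\le k\le N-1$, and, if $N\ge1$, exactly one zero in $[\theta_N,\theta_1+1]$ (the arc $[\theta_N,1]\cup[0,\theta_1]$ of the circle); * if $e_k$ is elliptic, then $b(\theta)=-\tfrac12a(\theta)(\theta-\theta_k)$ for all $\theta$ sufficiently near $\theta_k$. -/

import Mathlib

open Set Function Topology
open scoped Manifold ContDiff

noncomputable section

namespace ContactSurface

abbrev E2 : Type := EuclideanSpace ℝ (Fin 2)

abbrev E3 : Type := EuclideanSpace ℝ (Fin 3)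

section ContactManifold

variable {M : Type*} [TopologicalSpace M] [ChartedSpace E3 M] [IsManifold (𝓡 3) ∞ M]

/-- The 1-form `α` is smooth, as a section of the cotangent bundle of the 3-manifold `M`. -/
def IsSmoothOneForm (α : ∀ p : M, TangentSpace (𝓡 3) p →L[ℝ] ℝ) : Prop :=
  ContMDiff (𝓡 3) ((𝓡 3).prod 𝓘(ℝ, E3 →L[ℝ] ℝ)) ∞
    (fun p ↦ Bundle.TotalSpace.mk' (E3 →L[ℝ] ℝ)
      (E := fun p : M ↦ TangentSpace (𝓡 3) p →L[ℝ] Bundle.Trivial M ℝ p) p (α p))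

/-- The coordinate representation of the 1-form `α` in the preferred chart at `p`,
i.e. its pullback under the inverse of this chart. -/
def oneFormInChart (α : ∀ p : M, TangentSpace (𝓡 3) p →L[ℝ] ℝ) (p : M) (x : E3) : E3 →L[ℝ] ℝ :=
  (α ((extChartAt (𝓡 3) p).symm x)).comp
    (mfderiv 𝓘(ℝ, E3) (𝓡 3) (extChartAt (𝓡 3) p).symm x)

/-- The exterior derivative `dα` at `p`, computed in the preferred chart at `p` by
`dα(u, v) = ∂_u (α v) - ∂_v (α u)` for coordinate-constant `u`, `v`. -/
def extD (α : ∀ p : M, TangentSpace (𝓡 3) p →L[ℝ] ℝ) (p : M) (u v : TangentSpace (𝓡 3) p) : ℝ :=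
  let u' : E3 := mfderiv (𝓡 3) 𝓘(ℝ, E3) (extChartAt (𝓡 3) p) p u
  let v' : E3 := mfderiv (𝓡 3) 𝓘(ℝ, E3) (extChartAt (𝓡 3) p) p v
  fderiv ℝ (oneFormInChart α p) (extChartAt (𝓡 3) p p) u' v' -
    fderiv ℝ (oneFormInChart α p) (extChartAt (𝓡 3) p p) v' u'

/-- `α` is a contact form on the 3-manifold `M`: it is smooth and `α ∧ dα` vanishes nowhere. -/
structure IsContactForm (α : ∀ p : M, TangentSpace (𝓡 3) p →L[ℝ] ℝ) : Prop where
  smooth : IsSmoothOneForm α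
  wedge_ne_zero : ∀ p : M, ∃ u v w : TangentSpace (𝓡 3) p,
    α p u * extD α p v w + α p v * extD α p w u + α p w * extD α p u v ≠ 0

/-- The velocity vector of a curve in `M`. -/
def velocity (γ : ℝ → M) (t : ℝ) : TangentSpace (𝓡 3) (γ t) :=
  mfderiv 𝓘(ℝ, ℝ) (𝓡 3) γ t (1 : ℝ)

/-- `γ` is a regular 1-periodic parametrization of a Legendrian knot `range γ`, i.e. of a
smoothly embedded circle tangent to the contact planes. It also records an orientation. -/
structure IsLegendrianKnot (α : ∀ p : M, TangentSpace (𝓡 3) p →L[ℝ] ℝ) (γ : ℝ → M) : Prop where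
  smooth : ContMDiff 𝓘(ℝ, ℝ) (𝓡 3) ∞ γ
  periodic : Periodic γ 1
  injective : InjOn γ (Ico 0 1)
  regular : ∀ t, velocity γ t ≠ 0
  legendrian : ∀ t, α (γ t) (velocity γ t) = 0

/-- The universal covering of `S¹ × ℝ²`, `S¹ = ℝ/ℤ`. -/
def cover (z : ℝ × ℝ × ℝ) : AddCircle (1 : ℝ) × ℝ × ℝ := ((z.1 : AddCircle (1 : ℝ)), z.2)

/-- `Φ`, a homeomorphism between an open subset of `M` and an open subset of `S¹ × ℝ²`, is a
diffeomorphism with `Φ^*(dy + x dθ) = α`. Since the covering is a local diffeomorphism, this is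
expressed by lifting the inverse `Φ⁻¹` to the coordinates `(θ, x, y) ∈ ℝ³`. -/
structure IsContactCoordinates (α : ∀ p : M, TangentSpace (𝓡 3) p →L[ℝ] ℝ)
    (Φ : OpenPartialHomeomorph M (AddCircle (1 : ℝ) × ℝ × ℝ)) : Prop where
  smooth : ContMDiffOn 𝓘(ℝ, ℝ × ℝ × ℝ) (𝓡 3) ∞ (Φ.symm ∘ cover) (cover ⁻¹' Φ.target)
  bijective : ∀ z ∈ cover ⁻¹' Φ.target,
    Bijective (mfderiv 𝓘(ℝ, ℝ × ℝ × ℝ) (𝓡 3) (Φ.symm ∘ cover) z)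
  pullback : ∀ z ∈ cover ⁻¹' Φ.target, ∀ u : ℝ × ℝ × ℝ,
    α ((Φ.symm ∘ cover) z) (mfderiv 𝓘(ℝ, ℝ × ℝ × ℝ) (𝓡 3) (Φ.symm ∘ cover) z u) =
      u.2.2 + z.2.1 * u.1

end ContactManifold

section Surface

variable {S : Type*} [TopologicalSpace S] [ChartedSpace (EuclideanHalfSpace 2) S]
  [IsManifold (𝓡∂ 2) ∞ S]

/-- `σ` is a smooth area form on the surface `S` (in particular it orients `S`). -/
structure IsAreaForm
    (σ : ∀ q : S, TangentSpace (𝓡∂ 2) q →L[ℝ] TangentSpace (𝓡∂ 2) q →L[ℝ] ℝ) : Prop where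
  smooth : ContMDiff (𝓡∂ 2) ((𝓡∂ 2).prod 𝓘(ℝ, E2 →L[ℝ] E2 →L[ℝ] ℝ)) ∞
    (fun q ↦ Bundle.TotalSpace.mk' (E2 →L[ℝ] E2 →L[ℝ] ℝ)
      (E := fun q : S ↦ TangentSpace (𝓡∂ 2) q →L[ℝ] TangentSpace (𝓡∂ 2) q →L[ℝ]
        Bundle.Trivial S ℝ q) q (σ q))
  alternating : ∀ q v, σ q v v = 0
  ne_zero : ∀ q, ∃ v w, σ q v w ≠ 0


/-- The tangent vector `ν` at a boundary point `q` points into `S`. -/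
def IsInward (q : S) (ν : TangentSpace (𝓡∂ 2) q) : Prop :=
  let ν' : E2 := mfderiv (𝓡∂ 2) 𝓘(ℝ, E2) (extChartAt (𝓡∂ 2) q) q ν
  0 < ν' 0

/-- The linearization at `q` of a vector field `Z` on `S` (meaningful at a zero `q` of `Z`): the
derivative of the coordinate representation of `Z` in the preferred chart at `q`. -/
def linearization (Z : ∀ q : S, TangentSpace (𝓡∂ 2) q) (q : S) : E2 →L[ℝ] E2 :=
  fderivWithin ℝ
    (fun x : E2 ↦ (VectorField.mpullbackWithin 𝓘(ℝ, E2) (𝓡∂ 2) (extChartAt (𝓡∂ 2) q).symm Z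
      (range (𝓡∂ 2)) x : E2))
    (range (𝓡∂ 2)) (extChartAt (𝓡∂ 2) q q)

end Surface

/-- The two complex eigenvalues, with multiplicity, of an endomorphism of the plane. -/
def eigenvalues (A : E2 →L[ℝ] E2) : Multiset ℂ :=
  ((A : E2 →ₗ[ℝ] E2).charpoly.map (algebraMap ℝ ℂ)).roots

section EmbeddedSurface

variable {M : Type*} [TopologicalSpace M] [ChartedSpace E3 M] [IsManifold (𝓡 3) ∞ M]
  {S : Type*} [TopologicalSpace S] [ChartedSpace (EuclideanHalfSpace 2) S]
  [IsManifold (𝓡∂ 2) ∞ S]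
  (α : ∀ p : M, TangentSpace (𝓡 3) p →L[ℝ] ℝ)
  (σ : ∀ q : S, TangentSpace (𝓡∂ 2) q →L[ℝ] TangentSpace (𝓡∂ 2) q →L[ℝ] ℝ)
  (j : S → M)

/-- `j q` is a singular point of the surface `j(S)`: the tangent plane is the contact plane. -/
def IsSingular (q : S) : Prop :=
  LinearMap.range (mfderiv (𝓡∂ 2) (𝓡 3) j q).toLinearMap = LinearMap.ker (α (j q)).toLinearMap

open Classical in
/-- The vector field `Z` on `S` with `i_Z σ = j^* α`, which spans the characteristic foliation. -/
def charField (q : S) : TangentSpace (𝓡∂ 2) q :=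
  if h : ∃ z : TangentSpace (𝓡∂ 2) q, ∀ v, σ q z v = α (j q) (mfderiv (𝓡∂ 2) (𝓡 3) j q v)
  then h.choose else 0

/-- The vector field `charField` indeed satisfies its defining equation. -/
theorem charField_spec (hσ : IsAreaForm σ) (q : S) (v : TangentSpace (𝓡∂ 2) q) :
    σ q (charField α σ j q) v = α (j q) (mfderiv (𝓡∂ 2) (𝓡 3) j q v) := by
  have key : ∀ (s : E2 →L[ℝ] E2 →L[ℝ] ℝ), (∀ v, s v v = 0) → (∃ v w, s v w ≠ 0) →
      ∀ f : E2 →L[ℝ] ℝ, ∃ z, ∀ v, s z v = f v := by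
    intro s hs hne f
    let T : E2 →ₗ[ℝ] (E2 →L[ℝ] ℝ) := s.toLinearMap
    have hfr : Module.finrank ℝ E2 = Module.finrank ℝ (E2 →L[ℝ] ℝ) := by
      rw [← (LinearMap.toContinuousLinearMap (𝕜 := ℝ) (E := E2) (F' := ℝ)).finrank_eq]
      simp
    have hanti : ∀ v w, s v w = - s w v := by
      intro v w
      have := hs (v + w)
      simp [hs v, hs w] at this
      linarith
    have hinj : Injective T := by
      rw [← LinearMap.ker_eq_bot, LinearMap.ker_eq_bot']
      intro z hz
      obtain ⟨v, w, hvw⟩ := hne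
      have hzv : ∀ x, s z x = 0 := fun x => by
        have : s z = 0 := hz
        simp [this]
      have hli : LinearIndependent ℝ ![v, w] := by
        rw [LinearIndependent.pair_iff]
        intro c d h
        have h1 := congrArg (fun x => s x w) h
        have h2 := congrArg (fun x => s v x) h
        simp [hs v, hs w] at h1 h2
        exact ⟨by tauto, by tauto⟩
      have hsp := hli.span_eq_top_of_card_eq_finrank (by simp)
      have hz' : z ∈ Submodule.span ℝ (Set.range ![v, w]) := by rw [hsp]; trivial
      simp only [Matrix.range_cons, Matrix.range_empty, Set.union_empty, Set.singleton_union, Submodule.mem_span_pair] at hz'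
      obtain ⟨c, d, rfl⟩ := hz'
      have h1 := hzv w
      have h2 := hzv v
      rw [hanti] at h2
      simp [hs v, hs w] at h1 h2
      have hc : c = 0 := by tauto
      have hd : d = 0 := by tauto
      simp [hc, hd]
    have hsurj := (LinearMap.injective_iff_surjective_of_finrank_eq_finrank hfr).1 hinj
    obtain ⟨z, hz⟩ := hsurj f
    exact ⟨z, fun v => by rw [← hz]; rfl⟩
  have h : ∃ z : TangentSpace (𝓡∂ 2) q, ∀ v, σ q z v = α (j q) (mfderiv (𝓡∂ 2) (𝓡 3) j q v) :=
    key (σ q) (hσ.alternating q) (hσ.ne_zero q) ((α (j q)).comp (mfderiv (𝓡∂ 2) (𝓡 3) j q))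
  unfold charField
  rw [dif_pos h]
  exact h.choose_spec v

/-- A singular point is non-degenerate if no eigenvalue of `Z'` lies on the imaginary axis. -/
def IsNondegenerate (q : S) : Prop :=
  ∀ μ ∈ eigenvalues (linearization (charField α σ j) q), μ.re ≠ 0

/-- A non-degenerate singular point is elliptic if the product of the two eigenvalues of `Z'`
(a real number) is positive. -/
def IsElliptic (q : S) : Prop :=
  IsSingular α j q ∧ IsNondegenerate α σ j q ∧
    0 < (eigenvalues (linearization (charField α σ j) q)).prod.re

/-- A non-degenerate singular point is hyperbolic if the product of the two eigenvalues of `Z'`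
(a real number) is negative. -/
def IsHyperbolic (q : S) : Prop :=
  IsSingular α j q ∧ IsNondegenerate α σ j q ∧
    (eigenvalues (linearization (charField α σ j) q)).prod.re < 0

/-- A singular point is positive if the orientation `σ` of the tangent plane agrees with the
orientation `dα` of the contact plane. -/
def IsPositive (q : S) : Prop :=
  IsSingular α j q ∧ ∀ v w : TangentSpace (𝓡∂ 2) q, 0 < σ q v w →
    0 < extD α (j q) (mfderiv (𝓡∂ 2) (𝓡 3) j q v) (mfderiv (𝓡∂ 2) (𝓡 3) j q w)

/-- A singular point is negative if the two orientations are opposite. -/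
def IsNegative (q : S) : Prop :=
  IsSingular α j q ∧ ∀ v w : TangentSpace (𝓡∂ 2) q, 0 < σ q v w →
    extD α (j q) (mfderiv (𝓡∂ 2) (𝓡 3) j q v) (mfderiv (𝓡∂ 2) (𝓡 3) j q w) < 0

/-- The knot `γ` is the boundary of the surface `j(S)`, and is oriented as such: `(γ', ν)` is
positively oriented for every inward pointing `ν`. -/
structure IsOrientedBoundary (γ : ℝ → M) : Prop where
  image_boundary : j '' (𝓡∂ 2).boundary S = range γ
  oriented : ∀ (t : ℝ) (q : S), q ∈ (𝓡∂ 2).boundary S → j q = γ t →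
    ∀ v ν : TangentSpace (𝓡∂ 2) q,
      (mfderiv (𝓡∂ 2) (𝓡 3) j q v : E3) = velocity γ t → IsInward q ν → 0 < σ q v ν

/-- `e` lists the singular points on the boundary without repetition, in the cyclic order in which
they are met when the knot `γ` is traversed once. -/
structure IsBoundaryListing (γ : ℝ → M) {N : ℕ} (e : Fin N → S) : Prop where
  mem_iff : ∀ q, (∃ k, e k = q) ↔ q ∈ (𝓡∂ 2).boundary S ∧ IsSingular α j q
  ordered : ∃ t : Fin N → ℝ, StrictMono t ∧ (∀ k l, t l < t k + 1) ∧ ∀ k, j (e k) = γ (t k)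

/-- The embedding `j'` is a perturbation of `j`, of `C⁰`-size `W` and supported in `O`, that
keeps the boundary fixed. Here `W` is a neighbourhood of the diagonal of `M`. -/
structure IsPerturbation (j' : S → M) (W : Set (M × M)) (O : Set M) : Prop where
  embedding : Manifold.IsSmoothEmbedding (𝓡∂ 2) (𝓡 3) ∞ j'
  boundary : ∀ q ∈ (𝓡∂ 2).boundary S, j' q = j q
  close : ∀ q, (j q, j' q) ∈ W
  support : ∀ q, j q ∉ O → j' q = j q
  mapsTo : ∀ q, j q ∈ O → j' q ∈ O

end EmbeddedSurface

/-- The functions `a`, `b` (smooth, 1-periodic) and the angles `θ₁ < ⋯ < θ_N` in `[0, 1)` describe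
a normal form with the listed signs and types at the `N` boundary singular points. -/
structure IsNormalForm {N : ℕ} (a b : ℝ → ℝ) (θ : Fin N → ℝ)
    (pos neg ell hyp : Fin N → Prop) : Prop where
  smooth_a : ContDiff ℝ ∞ a
  smooth_b : ContDiff ℝ ∞ b
  periodic_a : Periodic a 1
  periodic_b : Periodic b 1
  θ_mono : StrictMono θ
  θ_mem : ∀ k, θ k ∈ Ico (0 : ℝ) 1
  b_zero_iff : ∀ t ∈ Ico (0 : ℝ) 1, b t = 0 ↔ ∃ k, t = θ k
  a_neg : ∀ k, pos k → a (θ k) < 0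
  a_pos : ∀ k, neg k → 0 < a (θ k)
  elliptic : ∀ k, ell k → -1 < deriv b (θ k) / a (θ k) ∧ deriv b (θ k) / a (θ k) < 0
  hyperbolic : ∀ k, hyp k → deriv b (θ k) / a (θ k) < -1 ∨ 0 < deriv b (θ k) / a (θ k)
  zero_between : ∀ k l : Fin N, (k : ℕ) + 1 = l → ∃! t, t ∈ Icc (θ k) (θ l) ∧ a t = 0
  /- on the remaining arc of the circle, from the last point through `1 = 0` to the first one -/
  zero_last : ∀ k l : Fin N, (k : ℕ) = 0 → (l : ℕ) + 1 = N →
    ∃! t, t ∈ Icc (θ l) (θ k + 1) ∧ a t = 0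
  elliptic_form : ∀ k, ell k → ∃ ε > 0, ∀ t, |t - θ k| < ε →
    b t = -(1 / 2) * a t * (t - θ k)

end ContactSurface

end

/-! Three ingredients: a normal form of the contact form along the knot, a description of the
surface near the knot as a ribbon, and an interpolation between ribbons that creates no singular
points.

Normal form. `exists_tube` parametrizes a neighbourhood of the knot by a periodic map on ℝ × ℝ²
whose axis is the knot, with transverse directions adapted to the contact form. The pulled back form
β becomes dy + x dθ in two moves (`exists_contact_normalForm`). Flowing along the Reeb field from
the slice τ = 0 makes it dτ + β₁(θ, s) dθ + β₂(θ, s) ds (`exists_reeb_flowbox`). If F is the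
primitive of β₂ in s, then x = β₁ - ∂F/∂θ and y = τ + F are the remaining coordinates
(`exists_straightening`). `exists_contact_coordinates` descends to S¹ × ℝ².

Ribbon. Let r be the Euclidean distance from the axis in these coordinates. Near the knot the
surface is (t, r) ↦ (t, r D(t, r)) with |D| = 1 (`exists_collar`), and λ restricts to r (∂D₂/∂t +
D₁) dt + (D₂ + r ∂D₂/∂r) dr. Write (a, b) = D(t, 0). A boundary point is singular exactly when b =
0. The characteristic field then has a triangular linearization whose eigenvalues are b' and -(b' +
a) up to a common positive factor, and dλ(∂/∂t, ∂/∂r) = -a. So non-degeneracy means b' ≠ 0 and b' +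
a ≠ 0, positive points have a < 0, and elliptic points have -1 < b'/a < 0
(`boundary_singular_invariants`). The zeros of b are simple, hence finite in number modulo 1.

Interpolation. The function b is kept, and a is replaced by a periodic a' with the same signs at the
zeros of b, equal to a at the other zeros, equal near an elliptic zero θ to -2 b(t)/(t - θ)
(smoothly extended), and with one zero between consecutive zeros of b
(`exists_modified_coefficient`). The new ribbon is given by (1 - χ(r)) D + χ(r) (a', b). Up to
errors controlled by r and r χ'(r), its radial velocity lies on the segment from (a, b) to (a', b),
and the coefficients of the restricted form (the first divided by r) on the segment from (b' + a, b)
to (b' + a', b). Where b ≠ 0 these segments avoid the origin. Where b = 0 they avoid it because the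
endpoints have equal signs: at an elliptic zero b' = s a with -1 < s < 0, so b' + a = (1 + s) a and
b' + a' = -b' = -s a. A logarithmic cut-off makes r χ'(r) as small as required
(`exists_logarithmic_cutoff`), and `exists_uniform_positivity` then yields immersedness, injectivity
and absence of singular points off the axis. For small r the new ribbon is ruled by the rays through
(a', b), and rescaling r gives the normal form. -/

namespace ContactSurface

/-! ### Superposition operators on spaces of continuous functions. -/

section Nemytskii

open ContinuousMap

variable {X : Type} [TopologicalSpace X] [CompactSpace X]
  {E : Type} [NormedAddCommGroup E] [NormedSpace ℝ E]
  {G : Type} [NormedAddCommGroup G] [NormedSpace ℝ G]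

/-- Pointwise application of a continuous family of operators, as an operator between spaces of
continuous functions. -/
noncomputable def pointwiseCLM (X : Type) [TopologicalSpace X] [CompactSpace X]
    (E : Type) [NormedAddCommGroup E] [NormedSpace ℝ E]
    (G : Type) [NormedAddCommGroup G] [NormedSpace ℝ G] :
    C(X, E →L[ℝ] G) →L[ℝ] C(X, E) →L[ℝ] C(X, G) :=
  LinearMap.mkContinuous₂
    (LinearMap.mk₂ ℝ (fun (A : C(X, E →L[ℝ] G)) (ξ : C(X, E)) ↦
        (⟨fun s ↦ A s (ξ s), by fun_prop⟩ : C(X, G)))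
      (fun A B ξ ↦ by ext s; simp) (fun c A ξ ↦ by ext s; simp)
      (fun A ξ η ↦ by ext s; simp) (fun c A ξ ↦ by ext s; simp)) 1
    (fun A ξ ↦ by
      rw [one_mul]
      refine (ContinuousMap.norm_le _ (by positivity)).2 fun s ↦ ?_
      change ‖A s (ξ s)‖ ≤ _
      refine ((A s).le_opNorm (ξ s)).trans ?_
      gcongr
      · exact A.norm_coe_le_norm s
      · exact ξ.norm_coe_le_norm s)

theorem norm_pointwiseCLM_apply_le (A : C(X, E →L[ℝ] G)) (ξ : C(X, E)) :
    ‖pointwiseCLM X E G A ξ‖ ≤ 1 * ‖A‖ * ‖ξ‖ := by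
  rw [one_mul]
  refine (ContinuousMap.norm_le _ (by positivity)).2 fun s ↦ ?_
  refine ((A s).le_opNorm (ξ s)).trans ?_
  gcongr
  · exact A.norm_coe_le_norm s
  · exact ξ.norm_coe_le_norm s

/-- The superposition operator of a `C¹` function is differentiable. -/
theorem hasFDerivAt_postcomp (f : C(E, G)) (f' : C(E, E →L[ℝ] G))
    (hf : ∀ x, HasFDerivAt f (f' x) x) (ξ : C(X, E)) :
    HasFDerivAt (fun η : C(X, E) ↦ f.comp η) (pointwiseCLM X E G (f'.comp ξ)) ξ := by
  rw [hasFDerivAt_iff_isLittleO]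
  rw [Asymptotics.isLittleO_iff]
  intro c hc
  -- `f'` need not be uniformly continuous on `E`, but it is so near the compact range of `ξ`. This
  -- makes the pointwise mean value estimate below uniform in `s`.
  have hcomp : IsCompact (range ξ) := isCompact_range ξ.continuous
  have hu := hcomp.uniformContinuousAt_of_continuousAt f' (fun a _ ↦ f'.continuous.continuousAt)
    (Metric.dist_mem_uniformity hc)
  obtain ⟨δ, hδ, hu⟩ := Metric.mem_uniformity_dist.1 hu
  filter_upwards [Metric.ball_mem_nhds ξ hδ] with η hη
  refine (ContinuousMap.norm_le _ (by positivity)).2 fun s ↦ ?_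
  have hs : dist (η s) (ξ s) < δ := (ContinuousMap.dist_apply_le_dist s).trans_lt hη
  have key := (convex_ball (ξ s) δ).norm_image_sub_le_of_norm_hasFDerivWithin_le'
    (f := f) (f' := f') (φ := f' (ξ s)) (C := c) (x := ξ s) (y := η s)
    (fun x _ ↦ (hf x).hasFDerivWithinAt)
    (fun x hx ↦ by
      have := hu (a := ξ s) (b := x) (by rw [dist_comm]; exact hx) ⟨s, rfl⟩
      rw [← dist_eq_norm, dist_comm]
      exact le_of_lt this) (Metric.mem_ball_self hδ) hs
  change ‖f (η s) - f (ξ s) - f' (ξ s) (η s - ξ s)‖ ≤ _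
  refine key.trans ?_
  gcongr
  exact (η - ξ).norm_coe_le_norm s

/-- The derivative of the superposition operator of `f` is the superposition operator of `fderiv ℝ
f` followed by a bounded linear map, so each derivative of `f` gives one of the operator. The target
`G` varies in the induction because `fderiv ℝ f` takes values in `E →L[ℝ] G`. -/
theorem contDiff_postcomp_nat (n : ℕ) : ∀ {G : Type} [NormedAddCommGroup G] [NormedSpace ℝ G]
    (f : C(E, G)), ContDiff ℝ n f → ContDiff ℝ n (fun η : C(X, E) ↦ f.comp η) := by
  induction n with
  | zero =>
    intro G _ _ f _
    exact contDiff_zero.2 (ContinuousMap.continuous_postcomp f)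
  | succ n ih =>
    intro G _ _ f hf
    have hd : Differentiable ℝ f := hf.differentiable (by simp)
    have hf' : ContDiff ℝ n (fderiv ℝ f) :=
      hf.fderiv_right (m := n) (by simp)
    let f' : C(E, E →L[ℝ] G) := ⟨fderiv ℝ f, hf'.continuous⟩
    have := ih f' hf'
    rw [Nat.cast_succ, contDiff_succ_iff_hasFDerivAt]
    refine ⟨fun ξ ↦ pointwiseCLM X E G (f'.comp ξ), ?_,
      fun ξ ↦ hasFDerivAt_postcomp f f' (fun x ↦ (hd x).hasFDerivAt) ξ⟩
    have h2 : ContDiff ℝ n (fun A ↦ pointwiseCLM X E G A) :=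
      IsBoundedLinearMap.contDiff ⟨⟨map_add _, map_smul _⟩, 1, one_pos, fun A ↦
        ContinuousLinearMap.opNorm_le_bound _ (by positivity) (norm_pointwiseCLM_apply_le A)⟩
    exact h2.comp this

/-- The superposition operator of a smooth function is smooth. -/
theorem contDiff_postcomp (f : C(E, G)) (hf : ContDiff ℝ ∞ f) :
    ContDiff ℝ ∞ (fun η : C(X, E) ↦ f.comp η) :=
  contDiff_infty.2 fun n ↦ contDiff_postcomp_nat n f (hf.of_le (by exact_mod_cast le_top))

end Nemytskii

/-! ### Integrals depending smoothly on a parameter. -/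

section Integral

open MeasureTheory intervalIntegral

variable {E : Type} [NormedAddCommGroup E] [NormedSpace ℝ E] [CompleteSpace E]

/-- The primitive of a continuous function on the unit interval. -/
noncomputable def primitiveCLM (E : Type) [NormedAddCommGroup E] [NormedSpace ℝ E]
    [CompleteSpace E] : C(unitInterval, E) →L[ℝ] C(unitInterval, E) :=
  LinearMap.mkContinuous
    { toFun := fun ξ ↦ ⟨fun s ↦ ∫ u in (0 : ℝ)..s, IccExtend zero_le_one ξ u, by
        have : Continuous (IccExtend (zero_le_one (α := ℝ)) ξ) := ξ.continuous.Icc_extend'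
        exact (continuous_primitive (fun a b ↦ this.intervalIntegrable a b) 0).comp
          continuous_subtype_val⟩
      map_add' := fun ξ η ↦ by
        ext s
        have h1 : Continuous (IccExtend (zero_le_one (α := ℝ)) ξ) := ξ.continuous.Icc_extend'
        have h2 : Continuous (IccExtend (zero_le_one (α := ℝ)) η) := η.continuous.Icc_extend'
        exact integral_add (h1.intervalIntegrable _ _) (h2.intervalIntegrable _ _)
      map_smul' := fun c ξ ↦ by
        ext s
        exact intervalIntegral.integral_smul c (IccExtend zero_le_one ξ) } 1
    (fun ξ ↦ by
      rw [one_mul]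
      refine (ContinuousMap.norm_le _ (by positivity)).2 fun s ↦ ?_
      refine (norm_integral_le_of_norm_le_const (C := ‖ξ‖)
        fun u _ ↦ ξ.norm_coe_le_norm _).trans ?_
      rw [sub_zero, abs_of_nonneg s.2.1]
      exact mul_le_of_le_one_right (norm_nonneg _) s.2.2)

theorem norm_primitiveCLM_apply_le (ξ : C(unitInterval, E)) : ‖primitiveCLM E ξ‖ ≤ ‖ξ‖ := by
  have h : ‖primitiveCLM E‖ ≤ 1 := LinearMap.mkContinuous_norm_le _ zero_le_one _
  simpa using (primitiveCLM E).le_of_opNorm_le h ξ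

/-- An integral over `[0, 1]` of a smooth function composed with a smooth family of curves. -/
theorem contDiff_integral_comp {P F : Type} [NormedAddCommGroup P] [NormedSpace ℝ P]
    [NormedAddCommGroup F] [NormedSpace ℝ F]
    {f : F → E} (hf : ContDiff ℝ ∞ f) {c : P → C(unitInterval, F)} (hc : ContDiff ℝ ∞ c) :
    ContDiff ℝ ∞ (fun p ↦ ∫ u in (0 : ℝ)..1, f (IccExtend zero_le_one (c p) u)) := by
  -- The integral is the value at 1 of a bounded linear operator applied to a superposition, so
  -- nothing is differentiated under the integral sign.
  have h := (ContinuousMap.evalCLM ℝ (1 : unitInterval)).contDiff.comp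
    ((primitiveCLM E).contDiff.comp
      ((contDiff_postcomp (X := unitInterval) ⟨f, hf.continuous⟩ hf).comp hc))
  exact h

end Integral

/-! ### Smooth flows from the implicit function theorem. -/

section Flow

open MeasureTheory intervalIntegral

variable {E : Type} [NormedAddCommGroup E] [NormedSpace ℝ E] [CompleteSpace E]

theorem norm_postcomp_sub_le {f : E → E} (hf : ContDiff ℝ ∞ f) {K : ℝ}
    (hK : ∀ x, ‖fderiv ℝ f x‖ ≤ K) (ξ η : C(unitInterval, E)) :
    ‖ContinuousMap.comp ⟨f, hf.continuous⟩ ξ - ContinuousMap.comp ⟨f, hf.continuous⟩ η‖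
      ≤ K * ‖ξ - η‖ := by
  have hK0 : 0 ≤ K := (norm_nonneg _).trans (hK 0)
  refine (ContinuousMap.norm_le _ (by positivity)).2 fun s ↦ ?_
  have := convex_univ.norm_image_sub_le_of_norm_fderiv_le (𝕜 := ℝ) (f := f) (C := K)
    (x := η s) (y := ξ s) (fun x _ ↦ (hf.differentiable (by simp)) x) (fun x _ ↦ hK x)
    (mem_univ _) (mem_univ _)
  refine this.trans ?_
  gcongr
  exact (ξ - η).norm_coe_le_norm s

/-- The integral equation of a flow, on the time interval `[0, τ]` rescaled to `[0, 1]`. -/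
noncomputable def picardDefect {f : E → E} (hf : ContDiff ℝ ∞ f)
    (z : (E × ℝ) × C(unitInterval, E)) : C(unitInterval, E) :=
  z.2 - ContinuousMap.const _ z.1.1
    - z.1.2 • primitiveCLM E (ContinuousMap.comp ⟨f, hf.continuous⟩ z.2)

theorem contDiff_picardDefect {f : E → E} (hf : ContDiff ℝ ∞ f) :
    ContDiff ℝ ∞ (picardDefect hf) := by
  have h1 : ContDiff ℝ ∞ fun z : (E × ℝ) × C(unitInterval, E) ↦
      (ContinuousMap.const unitInterval z.1.1 : C(unitInterval, E)) := by
    let L : E →L[ℝ] C(unitInterval, E) := LinearMap.mkContinuous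
      { toFun := fun x ↦ ContinuousMap.const _ x, map_add' := fun _ _ ↦ rfl,
        map_smul' := fun _ _ ↦ rfl } 1
      (fun x ↦ by
        rw [one_mul]
        exact (ContinuousMap.norm_le _ (norm_nonneg _)).2 fun _ ↦ le_rfl)
    exact L.contDiff.comp (contDiff_fst.comp contDiff_fst)
  have h2 : ContDiff ℝ ∞ fun z : (E × ℝ) × C(unitInterval, E) ↦
      primitiveCLM E (ContinuousMap.comp ⟨f, hf.continuous⟩ z.2) :=
    (primitiveCLM E).contDiff.comp
      ((contDiff_postcomp (X := unitInterval) ⟨f, hf.continuous⟩ hf).comp contDiff_snd)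
  exact (contDiff_snd.sub h1).sub ((contDiff_snd.comp contDiff_fst).smul h2)

/-- Zeros of the defect are fixed points of the Picard map, a contraction with constant `|τ| * K` on
rescaled curves. -/
theorem existsUnique_picardDefect_eq_zero {f : E → E} (hf : ContDiff ℝ ∞ f) {K : ℝ}
    (hK : ∀ x, ‖fderiv ℝ f x‖ ≤ K) (p : E × ℝ) (hp : |p.2| * K < 1) :
    ∃! ξ, picardDefect hf (p, ξ) = 0 := by
  have hK0 : 0 ≤ K := (norm_nonneg _).trans (hK 0)
  let Ψ : C(unitInterval, E) → C(unitInterval, E) := fun ξ ↦ ContinuousMap.const _ p.1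
    + p.2 • primitiveCLM E (ContinuousMap.comp ⟨f, hf.continuous⟩ ξ)
  have hΨ : ContractingWith (⟨|p.2| * K, by positivity⟩ : NNReal) Ψ := by
    refine ⟨by exact_mod_cast hp, LipschitzWith.of_dist_le_mul fun ξ η ↦ ?_⟩
    rw [dist_eq_norm, dist_eq_norm]
    have : Ψ ξ - Ψ η = p.2 • primitiveCLM E (ContinuousMap.comp ⟨f, hf.continuous⟩ ξ
        - ContinuousMap.comp ⟨f, hf.continuous⟩ η) := by
      simp only [Ψ, map_sub, smul_sub]
      abel
    rw [this, norm_smul, Real.norm_eq_abs]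
    change _ ≤ |p.2| * K * _
    rw [mul_assoc]
    gcongr
    exact (norm_primitiveCLM_apply_le _).trans (norm_postcomp_sub_le hf hK ξ η)
  have hiff : ∀ ξ, picardDefect hf (p, ξ) = 0 ↔ IsFixedPt Ψ ξ := by
    intro ξ
    simp only [picardDefect, IsFixedPt, Ψ]
    rw [sub_sub, sub_eq_zero, eq_comm]
  refine ⟨ContractingWith.fixedPoint Ψ hΨ, (hiff _).2 (hΨ.fixedPoint_isFixedPt), fun ξ hξ ↦ ?_⟩
  exact hΨ.fixedPoint_unique ((hiff ξ).1 hξ)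

/-- The partial derivative in the curve is the identity minus an operator of norm at most `|τ| * K <
1`, invertible by the Neumann series. -/
theorem isInvertible_fderiv_picardDefect {f : E → E} (hf : ContDiff ℝ ∞ f) {K : ℝ}
    (hK : ∀ x, ‖fderiv ℝ f x‖ ≤ K) (z : (E × ℝ) × C(unitInterval, E)) (hp : |z.1.2| * K < 1) :
    (fderiv ℝ (picardDefect hf) z ∘L .inr ℝ (E × ℝ) C(unitInterval, E)).IsInvertible := by
  have hK0 : 0 ≤ K := (norm_nonneg _).trans (hK 0)
  set f' : C(E, E →L[ℝ] E) := ⟨fderiv ℝ f, hf.continuous_fderiv (by simp)⟩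
  set B : C(unitInterval, E) →L[ℝ] C(unitInterval, E) :=
    z.1.2 • (primitiveCLM E ∘L pointwiseCLM unitInterval E E (f'.comp z.2)) with hB
  have h1 : HasFDerivAt (fun ξ ↦ picardDefect hf (z.1, ξ)) (.id ℝ _ - B) z.2 := by
    have := hasFDerivAt_postcomp (X := unitInterval) ⟨f, hf.continuous⟩ f'
      (fun x ↦ (hf.differentiable (by simp) x).hasFDerivAt) z.2
    have h := (((hasFDerivAt_id (𝕜 := ℝ) z.2).sub_const (ContinuousMap.const _ z.1.1)).sub
      (((primitiveCLM E).hasFDerivAt.comp z.2 this).const_smul z.1.2))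
    exact h
  have h2 : HasFDerivAt (fun ξ ↦ picardDefect hf (z.1, ξ))
      (fderiv ℝ (picardDefect hf) z ∘L .inr ℝ (E × ℝ) C(unitInterval, E)) z.2 := by
    have hd := ((contDiff_picardDefect hf).differentiable (by simp) (z.1, z.2)).hasFDerivAt
    exact hd.comp z.2 (hasFDerivAt_prodMk_right z.1 z.2)
  rw [h2.unique h1]
  have hBn : ‖B‖ < 1 := by
    refine lt_of_le_of_lt (ContinuousLinearMap.opNorm_le_bound _ (by positivity) fun ξ ↦ ?_) hp
    rw [hB, smul_apply, norm_smul, Real.norm_eq_abs, mul_assoc]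
    gcongr
    refine (norm_primitiveCLM_apply_le _).trans ?_
    refine (ContinuousMap.norm_le _ (by positivity)).2 fun s ↦ ?_
    refine (ContinuousLinearMap.le_opNorm _ _).trans ?_
    gcongr
    · exact hK _
    · exact ξ.norm_coe_le_norm s
  exact ⟨ContinuousLinearEquiv.unitsEquiv ℝ _ (Units.oneSub B hBn), rfl⟩

/-- A vector field with bounded derivative has a smooth local flow for a uniform time. -/
theorem exists_smooth_flow {f : E → E} (hf : ContDiff ℝ ∞ f) {K : ℝ}
    (hK : ∀ x, ‖fderiv ℝ f x‖ ≤ K) :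
    ∃ δ > 0, ∃ φ : E × ℝ → E, (∀ p : E × ℝ, |p.2| < δ → ContDiffAt ℝ ∞ φ p) ∧
      (∀ x, φ (x, 0) = x) ∧ (∀ p : E × ℝ, |p.2| < δ →
        HasDerivAt (fun τ ↦ φ (p.1, τ)) (f (φ p)) p.2) ∧
      ∀ e : E, (∀ x, f (x + e) = f x) → ∀ p : E × ℝ, |p.2| < δ → φ (p.1 + e, p.2) = φ p + e := by
  have hK0 : 0 ≤ K := (norm_nonneg _).trans (hK 0)
  have hδ : ∀ τ : ℝ, |τ| < 1 / (K + 1) → |τ| * K < 1 := by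
    intro τ hτ
    rw [lt_div_iff₀ (by positivity)] at hτ
    nlinarith [abs_nonneg τ]
  -- `ξ p` is the whole trajectory from `p.1` over the time `p.2`, rescaled to the unit interval;
  -- the flow is its endpoint.
  choose! ξ hξ hu using fun p hp ↦ existsUnique_picardDefect_eq_zero hf hK p hp
  have hsmooth : ∀ p : E × ℝ, |p.2| * K < 1 → ContDiffAt ℝ ∞ ξ p := by
    intro p hp
    have hcd : ContDiffAt ℝ ∞ (picardDefect hf) (p, ξ p) := (contDiff_picardDefect hf).contDiffAt
    have hinv := isInvertible_fderiv_picardDefect hf hK (p, ξ p) hp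
    refine (hcd.contDiffAt_implicitFunction (by simp) hinv).congr_of_eventuallyEq ?_
    have hopen : ∀ᶠ q : E × ℝ in 𝓝 p, |q.2| * K < 1 :=
      (by fun_prop : Continuous fun q : E × ℝ ↦ |q.2| * K).continuousAt.eventually_lt
        continuousAt_const hp
    filter_upwards [hopen, hcd.eventually_apply_implicitFunction (by simp) hinv] with q hq h
    -- Uniqueness of the zero identifies the local implicit function with `ξ`, so the globally
    -- chosen `ξ` is smooth.
    exact (hu q hq _ (h.trans (hξ p hp))).symm
  have hval : ∀ p : E × ℝ, |p.2| * K < 1 → ∀ s : unitInterval,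
      ξ p s = p.1 + p.2 • ∫ u in (0 : ℝ)..s, f (IccExtend zero_le_one (ξ p) u) := by
    intro p hp s
    have := congrArg (fun η : C(unitInterval, E) ↦ η s) (hξ p hp)
    simp only [picardDefect, ContinuousMap.sub_apply, ContinuousMap.zero_apply, sub_sub,
      sub_eq_zero] at this
    exact this
  set φ : E × ℝ → E := fun p ↦ ξ p 1 with hφ
  have hφs : ∀ p : E × ℝ, |p.2| * K < 1 → ContDiffAt ℝ ∞ φ p := fun p hp ↦
    ContDiffAt.comp (g := fun η : C(unitInterval, E) ↦ η 1) p
      (IsBoundedLinearMap.contDiff ⟨⟨fun _ _ ↦ rfl, fun _ _ ↦ rfl⟩, 1, one_pos,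
        fun η ↦ by simpa using η.norm_coe_le_norm 1⟩).contDiffAt (hsmooth p hp)
  -- An initial piece of a rescaled trajectory, rescaled again, solves the equation for the shorter
  -- time; by uniqueness all points of `ξ p` are values of `φ`.
  have hscale : ∀ p : E × ℝ, |p.2| * K < 1 → ∀ s : unitInterval, ξ p s = φ (p.1, p.2 * s) := by
    intro p hp s
    have hs : |p.2 * s| * K < 1 := by
      refine lt_of_le_of_lt ?_ hp
      refine mul_le_mul_of_nonneg_right ?_ hK0
      rw [abs_mul, abs_of_nonneg s.2.1]
      exact mul_le_of_le_one_right (abs_nonneg _) s.2.2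
    let η : C(unitInterval, E) := (ξ p).comp ⟨fun u ↦ s * u, by fun_prop⟩
    have hη : picardDefect hf ((p.1, p.2 * s), η) = 0 := by
      ext u
      simp only [picardDefect, ContinuousMap.sub_apply, ContinuousMap.zero_apply, sub_sub,
        sub_eq_zero]
      change ξ p (s * u) = _
      rw [hval p hp]
      change _ = p.1 + (p.2 * (s : ℝ)) • ∫ v in (0 : ℝ)..u, IccExtend zero_le_one
        (ContinuousMap.comp ⟨f, hf.continuous⟩ η) v
      rw [mul_smul]
      congr 2
      have h1 : ∀ v ∈ uIcc (0 : ℝ) u, IccExtend zero_le_one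
          (ContinuousMap.comp ⟨f, hf.continuous⟩ η) v
          = f (IccExtend zero_le_one (ξ p) (s * v)) := by
        intro v hv
        rw [uIcc_of_le u.2.1] at hv
        have hv1 : v ∈ Icc (0 : ℝ) 1 := ⟨hv.1, hv.2.trans u.2.2⟩
        have hv2 : (s : ℝ) * v ∈ Icc (0 : ℝ) 1 := unitInterval.mul_mem s.2 hv1
        rw [IccExtend_of_mem _ _ hv1, IccExtend_of_mem _ _ hv2]
        rfl
      rw [intervalIntegral.integral_congr h1]
      have := intervalIntegral.smul_integral_comp_mul_left (a := 0) (b := u)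
        (fun v ↦ f (IccExtend zero_le_one (ξ p) v)) (s : ℝ)
      rw [this]
      simp
    have := hu (p.1, p.2 * s) hs η hη
    have h1 : η 1 = ξ (p.1, p.2 * s) 1 := by rw [this]
    change _ = ξ (p.1, p.2 * s) 1
    rw [← h1]
    simp [η]
  have hint : ∀ p : E × ℝ, |p.2| * K < 1 → φ p = p.1 + ∫ v in (0 : ℝ)..p.2, f (φ (p.1, v)) := by
    intro p hp
    change ξ p 1 = _
    rw [hval p hp]
    congr 1
    have h1 : ∀ v ∈ uIcc (0 : ℝ) 1, f (IccExtend zero_le_one (ξ p) v) = f (φ (p.1, p.2 * v)) := by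
      intro v hv
      rw [uIcc_of_le zero_le_one] at hv
      rw [IccExtend_of_mem _ _ hv, hscale p hp]
    rw [show ((1 : unitInterval) : ℝ) = 1 from rfl]
    rw [intervalIntegral.integral_congr h1]
    have := intervalIntegral.smul_integral_comp_mul_left (a := 0) (b := 1)
      (fun v ↦ f (φ (p.1, v))) p.2
    rw [this]
    simp
  refine ⟨1 / (K + 1), by positivity, φ, fun p hp ↦ hφs p (hδ _ hp), fun x ↦ ?_, ?_, ?_⟩
  · rw [hint (x, 0) (by simp)]
    simp
  · intro p hp
    have hopen : ∀ᶠ τ in 𝓝 p.2, |τ| < 1 / (K + 1) :=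
      continuous_abs.continuousAt.eventually_lt continuousAt_const hp
    have hc : ∀ τ : ℝ, |τ| < 1 / (K + 1) → ContinuousAt (fun v ↦ f (φ (p.1, v))) τ := by
      intro τ hτ
      exact hf.continuous.continuousAt.comp
        ((hφs (p.1, τ) (hδ _ hτ)).continuousAt.comp (by fun_prop))
    have hder : HasDerivAt (fun τ ↦ p.1 + ∫ v in (0 : ℝ)..τ, f (φ (p.1, v))) (f (φ p)) p.2 := by
      refine HasDerivAt.const_add _ ?_
      refine intervalIntegral.integral_hasDerivAt_right ?_ ?_ (hc _ hp)
      · refine ContinuousOn.intervalIntegrable fun v hv ↦ (hc v ?_).continuousWithinAt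
        refine lt_of_le_of_lt ?_ hp
        rcases le_total 0 p.2 with h | h
        · rw [uIcc_of_le h] at hv
          rw [abs_of_nonneg hv.1, abs_of_nonneg h]
          exact hv.2
        · rw [uIcc_of_ge h] at hv
          rw [abs_of_nonpos hv.2, abs_of_nonpos h]
          linarith [hv.1]
      · refine ContinuousOn.stronglyMeasurableAtFilter (s := {τ : ℝ | |τ| < 1 / (K + 1)})
          (isOpen_lt continuous_abs continuous_const)
          (fun τ hτ ↦ (hc τ hτ).continuousWithinAt) _ hp
    refine hder.congr_of_eventuallyEq ?_
    filter_upwards [hopen] with τ hτ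
    exact hint (p.1, τ) (hδ _ hτ)
  · intro e he p hp
    -- A translate of a trajectory by a period of `f` is again a trajectory.
    have h1 : picardDefect hf ((p.1 + e, p.2), ξ p + ContinuousMap.const _ e) = 0 := by
      have h2 : ContinuousMap.comp ⟨f, hf.continuous⟩ (ξ p + ContinuousMap.const _ e)
          = ContinuousMap.comp ⟨f, hf.continuous⟩ (ξ p) := by
        ext s
        exact he _
      have h3 := hξ p (hδ _ hp)
      rw [← h3]
      unfold picardDefect
      simp only [h2]
      ext s
      simp
    have := hu (p.1 + e, p.2) (hδ _ hp) _ h1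
    change ξ (p.1 + e, p.2) 1 = _
    rw [← this]
    rfl

end Flow

/-! ### Exterior derivatives and pullbacks on normed spaces. -/

/-- The exterior derivative of a 1-form on a normed space. -/
noncomputable def extDVec {V : Type*} [NormedAddCommGroup V] [NormedSpace ℝ V]
    (β : V → V →L[ℝ] ℝ) (z u v : V) : ℝ :=
  fderiv ℝ β z u v - fderiv ℝ β z v u

/-- The pullback of a 1-form between normed spaces. -/
noncomputable def pullVec {V W : Type*} [NormedAddCommGroup V] [NormedSpace ℝ V]
    [NormedAddCommGroup W] [NormedSpace ℝ W] (g : V → W) (β : W → W →L[ℝ] ℝ) (z : V) : V →L[ℝ] ℝ :=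
  (β (g z)).comp (fderiv ℝ g z)

section Naturality

variable {V W : Type*} [NormedAddCommGroup V] [NormedSpace ℝ V]
    [NormedAddCommGroup W] [NormedSpace ℝ W]

theorem extDVec_congr {β β' : V → V →L[ℝ] ℝ} {z : V} (h : β =ᶠ[𝓝 z] β') (u v : V) :
    extDVec β z u v = extDVec β' z u v := by
  simp only [extDVec, h.fderiv_eq]

/-- The term with the second derivative of `g` is symmetric in `u` and `v`. It is separated here
because it cancels in the exterior derivative. -/
theorem fderiv_pullVec_apply {g : V → W} {β : W → W →L[ℝ] ℝ} {z : V} (hg : ContDiffAt ℝ 2 g z)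
    (hβ : DifferentiableAt ℝ β (g z)) (u v : V) :
    fderiv ℝ (pullVec g β) z u v =
      fderiv ℝ β (g z) (fderiv ℝ g z u) (fderiv ℝ g z v)
        + β (g z) (fderiv ℝ (fderiv ℝ g) z u v) := by
  have hg1 : HasFDerivAt g (fderiv ℝ g z) z := (hg.differentiableAt (by simp)).hasFDerivAt
  have hg2 : DifferentiableAt ℝ (fderiv ℝ g) z :=
    (hg.fderiv_right (m := 1) (by norm_num [one_add_one_eq_two])).differentiableAt (by simp)
  have h := (hβ.hasFDerivAt.comp z hg1).clm_comp hg2.hasFDerivAt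
  have h' : HasFDerivAt (pullVec g β) _ z := h
  rw [h'.fderiv]
  simp [add_comm]

/-- The exterior derivative commutes with pullbacks. -/
theorem extDVec_pullVec {g : V → W} {β : W → W →L[ℝ] ℝ} {z : V} (hg : ContDiffAt ℝ 2 g z)
    (hβ : DifferentiableAt ℝ β (g z)) (u v : V) :
    extDVec (pullVec g β) z u v = extDVec β (g z) (fderiv ℝ g z u) (fderiv ℝ g z v) := by
  have hs := (hg.isSymmSndFDerivAt (by simp)).eq u v
  rw [extDVec, fderiv_pullVec_apply hg hβ, fderiv_pullVec_apply hg hβ, hs, extDVec]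
  ring

end Naturality

/-- The form `dy + x dθ` on `ℝ³`. -/
noncomputable def stdForm (z : ℝ × ℝ × ℝ) : ℝ × ℝ × ℝ →L[ℝ] ℝ :=
  (ContinuousLinearMap.snd ℝ ℝ ℝ).comp (ContinuousLinearMap.snd ℝ ℝ (ℝ × ℝ))
    + z.2.1 • ContinuousLinearMap.fst ℝ ℝ (ℝ × ℝ)

@[simp]
theorem stdForm_apply (z u : ℝ × ℝ × ℝ) : stdForm z u = u.2.2 + z.2.1 * u.1 := by
  simp [stdForm]

/-- This is dx ∧ dθ. Its sign is responsible for positive singular points having a negative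
coefficient `a`. -/
theorem extDVec_stdForm (z u v : ℝ × ℝ × ℝ) :
    extDVec stdForm z u v = u.2.1 * v.1 - v.2.1 * u.1 := by
  have h : HasFDerivAt stdForm
      (((ContinuousLinearMap.fst ℝ ℝ ℝ).comp (ContinuousLinearMap.snd ℝ ℝ (ℝ × ℝ))).smulRight
        (ContinuousLinearMap.fst ℝ ℝ (ℝ × ℝ))) z := by
    unfold stdForm
    refine HasFDerivAt.const_add _ ?_
    exact HasFDerivAt.smul_const (𝕜 := ℝ) (𝕜' := ℝ) ((ContinuousLinearMap.fst ℝ ℝ ℝ).comp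
      (ContinuousLinearMap.snd ℝ ℝ (ℝ × ℝ))).hasFDerivAt (ContinuousLinearMap.fst ℝ ℝ (ℝ × ℝ))
  simp [extDVec, h.fderiv]

/-- A periodic open neighbourhood of the axis of `ℝ³` contains a tube. -/
theorem exists_tube_subset {A : Set (ℝ × ℝ × ℝ)} (hA : ∀ t : ℝ, A ∈ 𝓝 (t, (0 : ℝ × ℝ)))
    (hper : ∀ z, z ∈ A → z + (1, 0) ∈ A ∧ z - (1, 0) ∈ A) :
    ∃ δ > 0, ∀ z : ℝ × ℝ × ℝ, ‖z.2‖ < δ → z ∈ A := by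
  have h1 : ∀ᶠ w in 𝓝 (0 : ℝ × ℝ), ∀ t ∈ Icc (0 : ℝ) 1, (t, w) ∈ A := by
    refine isCompact_Icc.eventually_forall_of_forall_eventually fun t _ ↦ ?_
    have : Filter.Tendsto (fun z : (ℝ × ℝ) × ℝ ↦ (z.2, z.1)) (𝓝 ((0 : ℝ × ℝ), t)) (𝓝 (t, 0)) :=
      (continuous_snd.prodMk continuous_fst).tendsto _
    exact this (hA t)
  obtain ⟨δ, hδ, h⟩ := Metric.eventually_nhds_iff.1 h1
  refine ⟨δ, hδ, fun z hz ↦ ?_⟩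
  have h2 : ∀ n : ℕ, ∀ w, w ∈ A → w + ((n : ℝ), 0) ∈ A ∧ w - ((n : ℝ), 0) ∈ A := by
    intro n
    induction n with
    | zero =>
      intro w hw
      simpa [show ((0, 0) : ℝ × ℝ × ℝ) = 0 from rfl] using hw
    | succ n ih =>
      intro w hw
      have e : (((n + 1 : ℕ) : ℝ), (0 : ℝ × ℝ)) = ((n : ℝ), 0) + (1, 0) := by simp
      rw [e, ← add_assoc, ← sub_sub]
      exact ⟨(hper _ (ih w hw).1).1, (hper _ (ih w hw).2).2⟩
  have h3 : (Int.fract z.1, z.2) ∈ A :=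
    h (by simpa using hz) _ ⟨Int.fract_nonneg _, (Int.fract_lt_one _).le⟩
  have h4 : z = (Int.fract z.1, z.2) + ((⌊z.1⌋ : ℝ), 0) := by
    ext <;> simp [Int.fract_add_floor]
  rcases Int.eq_nat_or_neg ⌊z.1⌋ with ⟨n, hn | hn⟩
  · rw [h4, hn]
    exact_mod_cast (h2 n _ h3).1
  · rw [h4, hn]
    have := (h2 n _ h3).2
    convert this using 1
    ext <;> simp [sub_eq_add_neg]

/-! ### The Reeb field near the axis. -/

section Reeb

variable (β : ℝ × ℝ × ℝ → ℝ × ℝ × ℝ →L[ℝ] ℝ)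

/-- The kernel direction of `dβ` on `ℝ³`. -/
noncomputable def reebVec (z : ℝ × ℝ × ℝ) : ℝ × ℝ × ℝ :=
  (extDVec β z (0, 1, 0) (0, 0, 1), extDVec β z (0, 0, 1) (1, 0, 0),
    extDVec β z (1, 0, 0) (0, 1, 0))

variable {β}

theorem vec_eq (u : ℝ × ℝ × ℝ) :
    u = u.1 • ((1, 0, 0) : ℝ × ℝ × ℝ) + u.2.1 • ((0, 1, 0) : ℝ × ℝ × ℝ)
      + u.2.2 • ((0, 0, 1) : ℝ × ℝ × ℝ) := by
  ext <;> simp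

/-- `reebVec` is the curl of `β`, and dβ(u, v) is the inner product of the curl with u × v. -/
theorem extDVec_reebVec (z u : ℝ × ℝ × ℝ) : extDVec β z (reebVec β z) u = 0 := by
  have h := vec_eq (reebVec β z)
  have h2 := vec_eq u
  rw [extDVec, h, h2]
  simp only [map_add, map_smul, add_apply, smul_apply, smul_eq_mul]
  simp only [reebVec, extDVec]
  ring

theorem contDiff_reebVec (hβ : ContDiff ℝ ∞ β) : ContDiff ℝ ∞ (reebVec β) := by
  have h : ContDiff ℝ ∞ (fderiv ℝ β) := hβ.fderiv_right (by simp)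
  have h2 : ∀ u v, ContDiff ℝ ∞ fun z ↦ extDVec β z u v := fun u v ↦
    ((h.clm_apply contDiff_const).clm_apply contDiff_const).sub
      ((h.clm_apply contDiff_const).clm_apply contDiff_const)
  exact (h2 _ _).prodMk ((h2 _ _).prodMk (h2 _ _))

theorem fderiv_periodic {F : Type*} [NormedAddCommGroup F] [NormedSpace ℝ F]
    {f : ℝ × ℝ × ℝ → F} {e : ℝ × ℝ × ℝ} (h : ∀ z, f (z + e) = f z) (z : ℝ × ℝ × ℝ) :
    fderiv ℝ f (z + e) = fderiv ℝ f z := by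
  conv_rhs => rw [← funext h]
  rw [fderiv_comp_add_right]

theorem reebVec_periodic (h : ∀ z, β (z + (1, 0)) = β z) (z : ℝ × ℝ × ℝ) :
    reebVec β (z + (1, 0)) = reebVec β z := by
  simp only [reebVec, extDVec, fderiv_periodic h]

/-- A periodic contact form on `ℝ³` has a periodic vector field with bounded derivative which
agrees with the Reeb field near the axis. -/
theorem exists_reeb_field (hβ : ContDiff ℝ ∞ β) (hper : ∀ z, β (z + (1, 0)) = β z)
    (hD : ∀ t : ℝ, β (t, 0) (reebVec β (t, 0)) ≠ 0) :
    ∃ f : ℝ × ℝ × ℝ → ℝ × ℝ × ℝ, ContDiff ℝ ∞ f ∧ (∃ K, ∀ z, ‖fderiv ℝ f z‖ ≤ K) ∧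
      (∀ z, f (z + (1, 0)) = f z) ∧
      ∃ δ > 0, ∀ z : ℝ × ℝ × ℝ, ‖z.2‖ < δ →
        β z (f z) = 1 ∧ ∀ u, extDVec β z (f z) u = 0 := by
  set D : ℝ × ℝ × ℝ → ℝ := fun z ↦ β z (reebVec β z) with hDdef
  have hDs : ContDiff ℝ ∞ D := hβ.clm_apply (contDiff_reebVec hβ)
  have hDper : ∀ z, D (z + (1, 0)) = D z := fun z ↦ by
    simp only [hDdef, hper, reebVec_periodic hper]
  obtain ⟨δ, hδ, htube⟩ := exists_tube_subset (A := {z | D z ≠ 0})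
    (fun t ↦ (isOpen_ne_fun hDs.continuous continuous_const).mem_nhds (hD t))
    (fun z hz ↦ ⟨by rwa [mem_ofPred_eq, hDper], by
      have := hDper (z - (1, 0))
      rw [sub_add_cancel] at this
      rwa [mem_ofPred_eq, ← this]⟩)
  let ρ : ContDiffBump (0 : ℝ × ℝ) := ⟨δ / 4, δ / 2, by positivity, by linarith⟩
  -- The curl divided by its `β`-value is the Reeb field where `D` is non-zero. The cut-off depends
  -- only on the transverse variables, so the field stays periodic, and it vanishes far from the
  -- axis. Compactness of one period then bounds the derivative.
  set f : ℝ × ℝ × ℝ → ℝ × ℝ × ℝ := fun z ↦ (ρ z.2 * (D z)⁻¹) • reebVec β z with hf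
  have hfs : ContDiff ℝ ∞ f := by
    rw [contDiff_iff_contDiffAt]
    intro z
    by_cases hz : ‖z.2‖ < δ
    · exact ((ρ.contDiff.contDiffAt.comp z contDiffAt_snd).mul
        (hDs.contDiffAt.inv (htube z hz))).smul (contDiff_reebVec hβ).contDiffAt
    · have h0 : f =ᶠ[𝓝 z] fun _ ↦ 0 := by
        have : ∀ᶠ w : ℝ × ℝ × ℝ in 𝓝 z, δ / 2 < ‖w.2‖ :=
          continuousAt_const.eventually_lt (by fun_prop) (by linarith)
        filter_upwards [this] with w hw
        rw [hf]
        simp only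
        rw [ρ.zero_of_le_dist (by simpa using hw.le)]
        simp
      exact contDiffAt_const.congr_of_eventuallyEq h0
  have hfper : ∀ z, f (z + (1, 0)) = f z := fun z ↦ by
    simp only [hf, hDper, reebVec_periodic hper]
    simp
  refine ⟨f, hfs, ?_, hfper, δ / 4, by positivity, fun z hz ↦ ?_⟩
  · obtain ⟨K, hK⟩ := ((isCompact_Icc (a := (0 : ℝ)) (b := 1)).prod
      (isCompact_closedBall (0 : ℝ × ℝ) δ)).exists_bound_of_continuousOn
      (hfs.continuous_fderiv (by simp)).continuousOn
    refine ⟨max K 0, fun z ↦ ?_⟩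
    by_cases hz : ‖z.2‖ ≤ δ
    · have h1 : ∀ n : ℤ, ∀ w, fderiv ℝ f (w + ((n : ℝ), 0)) = fderiv ℝ f w := by
        intro n
        induction n with
        | zero => intro w; simp [show ((0, 0) : ℝ × ℝ × ℝ) = 0 from rfl]
        | succ n ih =>
          intro w
          have e : (((n + 1 : ℤ) : ℝ), (0 : ℝ × ℝ)) = ((n : ℝ), 0) + (1, 0) := by simp
          rw [e, ← add_assoc, fderiv_periodic hfper]
          exact ih w
        | pred n ih =>
          intro w
          rw [← fderiv_periodic hfper (w + _), ← ih w]
          congr 1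
          rw [add_assoc]
          congr 1
          simp
      have h4 : z = (Int.fract z.1, z.2) + ((⌊z.1⌋ : ℝ), 0) := by
        ext <;> simp [Int.fract_add_floor]
      rw [h4, h1]
      refine (hK _ ⟨⟨Int.fract_nonneg _, (Int.fract_lt_one _).le⟩, ?_⟩).trans (le_max_left _ _)
      simpa using hz
    · have h0 : f =ᶠ[𝓝 z] fun _ ↦ 0 := by
        have : ∀ᶠ w : ℝ × ℝ × ℝ in 𝓝 z, δ / 2 < ‖w.2‖ :=
          continuousAt_const.eventually_lt (by fun_prop) (by linarith)
        filter_upwards [this] with w hw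
        rw [hf]
        simp only
        rw [ρ.zero_of_le_dist (by simpa using hw.le)]
        simp
      rw [h0.fderiv_eq]
      simp
  · have h1 : ρ z.2 = 1 := ρ.one_of_mem_closedBall (by simpa using hz.le)
    have h2 : D z ≠ 0 := htube z (by linarith)
    have hfz : f z = (D z)⁻¹ • reebVec β z := by simp [hf, h1]
    constructor
    · rw [hfz, map_smul, smul_eq_mul]
      exact inv_mul_cancel₀ h2
    · intro u
      have := extDVec_reebVec (β := β) z u
      rw [hfz, extDVec, map_smul, map_smul, smul_apply, ← smul_sub]
      rw [extDVec] at this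
      rw [this, smul_zero]

end Reeb

theorem two_le_infty : (2 : WithTop ℕ∞) ≤ ∞ := by
  exact WithTop.coe_le_coe.2 (le_top : (2 : ℕ∞) ≤ ⊤)

/-! ### Smooth inverses of injective local diffeomorphisms. -/

section InverseOn

variable {V W : Type*} [NormedAddCommGroup V] [NormedSpace ℝ V] [CompleteSpace V]
    [NormedAddCommGroup W] [NormedSpace ℝ W] [CompleteSpace W]

/-- The inverse of an injective local diffeomorphism. -/
theorem exists_smooth_inverseOn [Nonempty V] {K : V → W} {Ω : Set V} (hΩ : IsOpen Ω)
    (hinj : InjOn K Ω) (hK : ∀ w ∈ Ω, ContDiffAt ℝ ∞ K w)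
    (hb : ∀ w ∈ Ω, Bijective (fderiv ℝ K w)) :
    ∃ L : W → V, (∀ w ∈ Ω, L (K w) = w) ∧ (∀ w ∈ Ω, ContDiffAt ℝ ∞ L (K w)) ∧
      (∀ w ∈ Ω, K '' Ω ∈ 𝓝 (K w)) ∧
      ∀ w ∈ Ω, ∀ u, fderiv ℝ L (K w) (fderiv ℝ K w u) = u := by
  have hleft : ∀ w ∈ Ω, invFunOn K Ω (K w) = w := fun w hw ↦ hinj.leftInvOn_invFunOn hw
  have hmain : ∀ w ∈ Ω, ContDiffAt ℝ ∞ (invFunOn K Ω) (K w) ∧ K '' Ω ∈ 𝓝 (K w) := by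
    intro w hw
    let A : V ≃L[ℝ] W := ContinuousLinearEquiv.ofBijective (fderiv ℝ K w)
      (LinearMap.ker_eq_bot.2 (hb w hw).1) (LinearMap.range_eq_top.2 (hb w hw).2)
    have hd : HasFDerivAt K (A : V →L[ℝ] W) w := by
      have := ((hK w hw).differentiableAt (by simp)).hasFDerivAt
      rwa [ContinuousLinearEquiv.coe_ofBijective]
    have hs := (hK w hw).hasStrictFDerivAt' hd (by simp)
    have h1 : K '' Ω ∈ 𝓝 (K w) := by
      rw [← hs.map_nhds_eq_of_equiv]
      exact Filter.image_mem_map (hΩ.mem_nhds hw)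
    refine ⟨?_, h1⟩
    refine ((hK w hw).to_localInverse hd (by simp)).congr_of_eventuallyEq ?_
    have h2 := hs.localInverse_tendsto.eventually (hΩ.mem_nhds hw)
    filter_upwards [h2, hs.eventually_right_inverse] with y hy hy2
    have := hleft _ hy
    rw [hy2] at this
    exact this
  refine ⟨invFunOn K Ω, hleft, fun w hw ↦ (hmain w hw).1, fun w hw ↦ (hmain w hw).2, ?_⟩
  intro w hw u
  have h1 := ((hmain w hw).1.differentiableAt (by simp)).hasFDerivAt.comp w
    ((hK w hw).differentiableAt (by simp)).hasFDerivAt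
  have h2 : HasFDerivAt (invFunOn K Ω ∘ K) (.id ℝ V) w := by
    refine (hasFDerivAt_id w).congr_of_eventuallyEq ?_
    filter_upwards [hΩ.mem_nhds hw] with y hy
    exact hleft y hy
  have := congrArg (fun T : V →L[ℝ] V ↦ T u) (h1.unique h2)
  simpa using this

end InverseOn

/-! ### Flow box of the Reeb field. -/

section ReebCoordinates

variable {β : ℝ × ℝ × ℝ → ℝ × ℝ × ℝ →L[ℝ] ℝ}

/-- Flow-box coordinates `(θ, s, τ)` of the Reeb field, in which the contact form is
`dτ + β₁(θ, s) dθ + β₂(θ, s) ds`. -/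
theorem exists_reeb_flowbox (hβ : ContDiff ℝ ∞ β) (hper : ∀ z, β (z + (1, 0)) = β z)
    (hD : ∀ t : ℝ, β (t, 0) (reebVec β (t, 0)) ≠ 0) :
    ∃ δ > 0, ∃ g : ℝ × ℝ × ℝ → ℝ × ℝ × ℝ, (∀ z : ℝ × ℝ × ℝ, ‖z.2‖ < δ → ContDiffAt ℝ ∞ g z) ∧
      (∀ t s, g (t, s, 0) = (t, s, 0)) ∧ (∀ z : ℝ × ℝ × ℝ, ‖z.2‖ < δ → g (z + (1, 0)) = g z + (1, 0)) ∧
      ∀ z : ℝ × ℝ × ℝ, ‖z.2‖ < δ → ∀ u, pullVec g β z u =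
        u.2.2 + β (z.1, z.2.1, 0) (1, 0, 0) * u.1 + β (z.1, z.2.1, 0) (0, 1, 0) * u.2.1 := by
  obtain ⟨f, hf, ⟨K, hK⟩, hfper, δ₀, hδ₀, hreeb⟩ := exists_reeb_field hβ hper hD
  obtain ⟨δ₁, hδ₁, φ, hφs, hφ0, hφd, hφper⟩ := exists_smooth_flow hf hK
  set p : ℝ × ℝ × ℝ → (ℝ × ℝ × ℝ) × ℝ := fun z ↦ ((z.1, z.2.1, 0), z.2.2) with hp
  -- `g (t, s, τ)` is obtained from the slice point `(t, s, 0)` by flowing for time `τ`.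
  have hps : ContDiff ℝ ∞ p := by rw [hp]; fun_prop
  set g : ℝ × ℝ × ℝ → ℝ × ℝ × ℝ := fun z ↦ φ (p z) with hg
  have htau : ∀ z : ℝ × ℝ × ℝ, |z.2.2| ≤ ‖z.2‖ := fun z ↦ by
    simpa using norm_snd_le z.2
  have hgs : ∀ z : ℝ × ℝ × ℝ, ‖z.2‖ < δ₁ → ContDiffAt ℝ ∞ g z := fun z hz ↦
    (hφs (p z) ((htau z).trans_lt hz)).comp z hps.contDiffAt
  have hg0 : ∀ t s, g (t, s, 0) = (t, s, 0) := fun t s ↦ hφ0 _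
  have hgper : ∀ z : ℝ × ℝ × ℝ, ‖z.2‖ < δ₁ → g (z + (1, 0)) = g z + (1, 0) := by
    intro z hz
    have := hφper (1, 0) hfper (p z) ((htau z).trans_lt hz)
    simp only [hg]
    rw [← this]
    congr 1
    simp [hp]
  have hgd : ∀ z : ℝ × ℝ × ℝ, ‖z.2‖ < δ₁ → fderiv ℝ g z (0, 0, 1) = f (g z) := by
    intro z hz
    have h1 := hφd (p z) ((htau z).trans_lt hz)
    have h2 : HasDerivAt (fun τ : ℝ ↦ ((z.1, z.2.1, τ) : ℝ × ℝ × ℝ)) (0, 0, 1) z.2.2 :=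
      (hasDerivAt_const _ _).prodMk ((hasDerivAt_const _ _).prodMk (hasDerivAt_id _))
    have h3 := ((hgs z hz).differentiableAt (by simp)).hasFDerivAt.comp_hasDerivAt z.2.2 h2
    exact h3.unique h1
  obtain ⟨δ₂, hδ₂, htube⟩ := exists_tube_subset (A := {z | ‖z.2‖ < δ₁ ∧ ‖(g z).2‖ < δ₀})
    (fun t ↦ by
      have h0 : ‖((t, 0) : ℝ × ℝ × ℝ).2‖ < δ₁ := by simpa using hδ₁
      have hc := (hgs (t, 0) h0).continuousAt
      refine Filter.Eventually.and ?_ ?_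
      · exact (by fun_prop : Continuous fun z : ℝ × ℝ × ℝ ↦ ‖z.2‖).continuousAt.eventually_lt
          continuousAt_const h0
      · refine ContinuousAt.eventually_lt (f := fun z ↦ ‖(g z).2‖) (by fun_prop)
          continuousAt_const ?_
        have := hg0 t 0
        change g (t, 0) = _ at this
        rw [this]
        simpa using hδ₀)
    (fun z hz ↦ by
      refine ⟨⟨by simpa using hz.1, ?_⟩, ⟨by simpa using hz.1, ?_⟩⟩
      · rw [hgper z hz.1]
        simpa using hz.2
      · have := hgper (z - (1, 0)) (by simpa using hz.1)
        rw [sub_add_cancel] at this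
        have h := hz.2
        rw [this] at h
        simpa using h)
  refine ⟨δ₂, hδ₂, g, fun z hz ↦ hgs z (htube z hz).1, hg0, fun z hz ↦ hgper z (htube z hz).1, ?_⟩
  have hμ3 : ∀ z : ℝ × ℝ × ℝ, ‖z.2‖ < δ₂ → pullVec g β z (0, 0, 1) = 1 := by
    intro z hz
    rw [pullVec, ContinuousLinearMap.comp_apply, hgd z (htube z hz).1]
    exact (hreeb _ (htube z hz).2).1
  have hopen : IsOpen {z : ℝ × ℝ × ℝ | ‖z.2‖ < δ₂} := isOpen_lt (by fun_prop) continuous_const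
  have hμs : ∀ z : ℝ × ℝ × ℝ, ‖z.2‖ < δ₂ → DifferentiableAt ℝ (pullVec g β) z := by
    intro z hz
    have h1 := hgs z (htube z hz).1
    exact (((hβ.contDiffAt.comp z h1).clm_comp (h1.fderiv_right (m := ∞) (by simp)))).differentiableAt
      (by simp)
  -- Invariance of the form under the flow, as in Cartan's formula: the pulled back form has
  -- constant value 1 on the τ-direction, and that direction lies in the kernel of its exterior
  -- derivative. Hence its coefficients do not depend on τ.
  have hμτ : ∀ z : ℝ × ℝ × ℝ, ‖z.2‖ < δ₂ → ∀ u, fderiv ℝ (pullVec g β) z (0, 0, 1) u = 0 := by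
    intro z hz u
    have h1 := extDVec_pullVec (u := (0, 0, 1)) (v := u)
      ((hgs z (htube z hz).1).of_le two_le_infty)
      (hβ.differentiable (by simp) (g z))
    rw [hgd z (htube z hz).1, (hreeb _ (htube z hz).2).2, extDVec] at h1
    have h2 : HasFDerivAt (fun w ↦ pullVec g β w (0, 0, 1)) (0 : ℝ × ℝ × ℝ →L[ℝ] ℝ) z := by
      refine (hasFDerivAt_const (1 : ℝ) z).congr_of_eventuallyEq ?_
      filter_upwards [hopen.mem_nhds hz] with w hw using hμ3 w hw
    have h3 : HasFDerivAt (fun w ↦ pullVec g β w (0, 0, 1))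
        ((fderiv ℝ (pullVec g β) z).flip (0, 0, 1)) z := by
      have := (hμs z hz).hasFDerivAt.clm_apply (hasFDerivAt_const ((0, 0, 1) : ℝ × ℝ × ℝ) z)
      simpa using this
    have h4 := congrArg (fun T : ℝ × ℝ × ℝ →L[ℝ] ℝ ↦ T u) (h3.unique h2)
    simp only [ContinuousLinearMap.flip_apply, zero_apply] at h4
    rw [h4] at h1
    linarith
  have hμconst : ∀ z : ℝ × ℝ × ℝ, ‖z.2‖ < δ₂ → pullVec g β z = pullVec g β (z.1, z.2.1, 0) := by
    intro z hz
    have hz' : |z.2.1| < δ₂ ∧ |z.2.2| < δ₂ := by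
      simpa [Prod.norm_def] using hz
    have key := (convex_ball (0 : ℝ) δ₂).norm_image_sub_le_of_norm_hasDerivWithin_le
      (f := fun τ ↦ pullVec g β (z.1, z.2.1, τ)) (f' := fun _ ↦ 0) (C := 0) (x := 0) (y := z.2.2)
      (fun τ hτ ↦ by
        have hτ' : ‖((z.1, z.2.1, τ) : ℝ × ℝ × ℝ).2‖ < δ₂ := by
          simpa [Prod.norm_def] using ⟨hz'.1, by simpa using hτ⟩
        have h2 : HasDerivAt (fun τ : ℝ ↦ ((z.1, z.2.1, τ) : ℝ × ℝ × ℝ)) (0, 0, 1) τ :=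
          (hasDerivAt_const _ _).prodMk ((hasDerivAt_const _ _).prodMk (hasDerivAt_id _))
        have h3 := (hμs _ hτ').hasFDerivAt.comp_hasDerivAt τ h2
        have h4 : fderiv ℝ (pullVec g β) (z.1, z.2.1, τ) (0, 0, 1) = 0 := by
          exact ContinuousLinearMap.ext fun u ↦ hμτ _ hτ' u
        rw [h4] at h3
        exact h3.hasDerivWithinAt)
      (by simp) (by simpa using hδ₂) (by simpa using hz'.2)
    simp only [zero_mul, norm_le_zero_iff, sub_eq_zero] at key
    exact key
  intro z hz
  have hz0 : ‖((z.1, z.2.1, 0) : ℝ × ℝ × ℝ).2‖ < δ₂ := by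
    simp only [Prod.norm_def, norm_zero] at hz ⊢
    exact max_lt (lt_of_le_of_lt (le_max_left _ _) hz) hδ₂
  have hgd0 := ((hgs _ (htube _ hz0).1).differentiableAt (by simp)).hasFDerivAt
  -- On the slice τ = 0 the map `g` is the identity, so the other two coefficients are read off from
  -- `β` there.
  have e1 : fderiv ℝ g (z.1, z.2.1, 0) (1, 0, 0) = (1, 0, 0) := by
    have h2 : HasDerivAt (fun τ : ℝ ↦ ((τ, z.2.1, 0) : ℝ × ℝ × ℝ)) (1, 0, 0) z.1 :=
      (hasDerivAt_id _).prodMk ((hasDerivAt_const _ _).prodMk (hasDerivAt_const _ _))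
    have h3 := hgd0.comp_hasDerivAt z.1 h2
    refine h3.unique (h2.congr_of_eventuallyEq (Filter.Eventually.of_forall fun τ ↦ hg0 _ _))
  have e2 : fderiv ℝ g (z.1, z.2.1, 0) (0, 1, 0) = (0, 1, 0) := by
    have h2 : HasDerivAt (fun τ : ℝ ↦ ((z.1, τ, 0) : ℝ × ℝ × ℝ)) (0, 1, 0) z.2.1 :=
      (hasDerivAt_const _ _).prodMk ((hasDerivAt_id _).prodMk (hasDerivAt_const _ _))
    have h3 := hgd0.comp_hasDerivAt z.2.1 h2
    refine h3.unique (h2.congr_of_eventuallyEq (Filter.Eventually.of_forall fun τ ↦ hg0 _ _))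
  intro u
  have hu := vec_eq u
  rw [hμconst z hz]
  conv_lhs => rw [hu]
  rw [map_add, map_add, map_smul, map_smul, map_smul, hμ3 _ hz0]
  simp only [pullVec, ContinuousLinearMap.comp_apply, e1, e2, hg0, smul_eq_mul]
  ring

end ReebCoordinates

/-! ### Straightening the contact form to dy + x dθ. -/

section Straightening

variable {β : ℝ × ℝ × ℝ → ℝ × ℝ × ℝ →L[ℝ] ℝ}

/-- A primitive in the second variable, depending smoothly on the first one. -/
theorem exists_smooth_primitive {h : ℝ × ℝ × ℝ → ℝ} (hh : ContDiff ℝ ∞ h) :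
    ∃ F : ℝ × ℝ × ℝ → ℝ, ContDiff ℝ ∞ F ∧ (∀ z, F z = F (z.1, z.2.1, 0)) ∧
      (∀ t, F (t, 0) = 0) ∧ (∀ z, fderiv ℝ F z (0, 1, 0) = h (z.1, z.2.1, 0)) ∧
      ((∀ z, h (z + (1, 0)) = h z) → ∀ z, F (z + (1, 0)) = F z) := by
  set c : ℝ × ℝ × ℝ → C(unitInterval, ℝ × ℝ × ℝ) := fun z ↦
    ⟨fun u ↦ (z.1, z.2.1 * u, 0), by fun_prop⟩ with hc
  have hcs : ContDiff ℝ ∞ c := by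
    refine IsBoundedLinearMap.contDiff ⟨⟨fun z w ↦ ?_, fun a z ↦ ?_⟩, 1, one_pos, fun z ↦ ?_⟩
    · ext u <;> simp [hc, add_mul]
    · ext u <;> simp [hc, mul_assoc]
    · rw [one_mul]
      refine (ContinuousMap.norm_le _ (norm_nonneg _)).2 fun u ↦ ?_
      simp only [hc, ContinuousMap.coe_mk, Prod.norm_def, norm_mul, norm_zero]
      refine max_le (le_max_left _ _) (le_max_of_le_right (max_le (le_max_of_le_left ?_) (by positivity)))
      refine mul_le_of_le_one_right (norm_nonneg _) ?_
      rw [Real.norm_eq_abs, abs_of_nonneg u.2.1]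
      exact u.2.2
  set I : ℝ × ℝ × ℝ → ℝ := fun z ↦ ∫ u in (0 : ℝ)..1, h (IccExtend zero_le_one (c z) u) with hI
  have hIs : ContDiff ℝ ∞ I := contDiff_integral_comp hh hcs
  -- Rescaling the primitive to a fixed interval of integration makes it visibly smooth in all
  -- variables.
  have hFs : ContDiff ℝ ∞ fun z ↦ z.2.1 * I z := by fun_prop
  have hint : ∀ z, z.2.1 * I z = ∫ v in (0 : ℝ)..z.2.1, h (z.1, v, 0) := by
    intro z
    have h1 : ∀ u ∈ uIcc (0 : ℝ) 1, h (IccExtend zero_le_one (c z) u) = h (z.1, z.2.1 * u, 0) := by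
      intro u hu
      rw [uIcc_of_le zero_le_one] at hu
      rw [IccExtend_of_mem _ _ hu]
      rfl
    rw [hI]
    simp only
    rw [intervalIntegral.integral_congr h1]
    have := intervalIntegral.smul_integral_comp_mul_left (a := 0) (b := 1)
      (fun v ↦ h (z.1, v, 0)) z.2.1
    rw [smul_eq_mul] at this
    rw [this]
    simp
  refine ⟨fun z ↦ z.2.1 * I z, hFs, fun z ↦ ?_, fun t ↦ ?_, fun z ↦ ?_, fun hp z ↦ ?_⟩
  · exact (hint z).trans (hint (z.1, z.2.1, 0)).symm
  · simp
  · have h2 : HasDerivAt (fun τ : ℝ ↦ ((z.1, τ, z.2.2) : ℝ × ℝ × ℝ)) (0, 1, 0) z.2.1 :=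
      (hasDerivAt_const _ _).prodMk ((hasDerivAt_id _).prodMk (hasDerivAt_const _ _))
    have h3 := ((hFs.differentiable (by simp)) z).hasFDerivAt.comp_hasDerivAt z.2.1 h2
    have hcont : Continuous fun v ↦ h (z.1, v, 0) := hh.continuous.comp (by fun_prop)
    have h4 : HasDerivAt (fun s ↦ ∫ v in (0 : ℝ)..s, h (z.1, v, 0)) (h (z.1, z.2.1, 0)) z.2.1 :=
      intervalIntegral.integral_hasDerivAt_right (hcont.intervalIntegrable _ _)
        (hcont.stronglyMeasurableAtFilter _ _) hcont.continuousAt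
    refine h3.unique (h4.congr_of_eventuallyEq (Filter.Eventually.of_forall fun τ ↦ ?_))
    exact hint (z.1, τ, z.2.2)
  · refine (hint (z + (1, 0))).trans (Eq.trans ?_ (hint z).symm)
    have : ∀ v, h (z.1 + 1, v, 0) = h (z.1, v, 0) := fun v ↦ by
      have := hp (z.1, v, 0)
      simpa using this
    simp [this]

/-- Coordinates in which `dτ + β₁(θ, s) dθ + β₂(θ, s) ds` becomes `dy + x dθ`. -/
theorem exists_straightening (hβ : ContDiff ℝ ∞ β) (hper : ∀ z, β (z + (1, 0)) = β z)
    (hleg : ∀ t : ℝ, β (t, 0) (1, 0, 0) = 0)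
    (hd : ∀ t : ℝ, extDVec β (t, 0) (1, 0, 0) (0, 1, 0) ≠ 0) :
    ∃ K : ℝ × ℝ × ℝ → ℝ × ℝ × ℝ, ContDiff ℝ ∞ K ∧ (∀ t : ℝ, K (t, 0) = (t, 0)) ∧
      (∀ z, K (z + (1, 0)) = K z + (1, 0)) ∧
      (∀ z u, pullVec K stdForm z u =
        u.2.2 + β (z.1, z.2.1, 0) (1, 0, 0) * u.1 + β (z.1, z.2.1, 0) (0, 1, 0) * u.2.1) ∧
      ∃ δ > 0, InjOn K {z | ‖z.2‖ < δ} ∧ ∀ z : ℝ × ℝ × ℝ, ‖z.2‖ < δ → Bijective (fderiv ℝ K z) := by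
  set p : ℝ × ℝ × ℝ → ℝ × ℝ × ℝ := fun z ↦ (z.1, z.2.1, 0) with hp
  have hps : ContDiff ℝ ∞ p := by rw [hp]; fun_prop
  have hpp : ∀ z, p (z + (1, 0)) = p z + (1, 0) := fun z ↦ by simp [hp]
  obtain ⟨F, hF, hFp, hF0, hFd, hFper⟩ := exists_smooth_primitive
    (h := fun z ↦ β z (0, 1, 0)) (hβ.clm_apply contDiff_const)
  replace hFper := hFper fun z ↦ by rw [hper]
  have hF1 : ContDiff ℝ ∞ (fderiv ℝ F) := hF.fderiv_right (by simp)
  have hF3 : ∀ z, fderiv ℝ F z (0, 0, 1) = 0 := by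
    intro z
    have h2 : HasDerivAt (fun τ : ℝ ↦ ((z.1, z.2.1, τ) : ℝ × ℝ × ℝ)) (0, 0, 1) z.2.2 :=
      (hasDerivAt_const _ _).prodMk ((hasDerivAt_const _ _).prodMk (hasDerivAt_id _))
    have h3 := ((hF.differentiable (by simp)) z).hasFDerivAt.comp_hasDerivAt z.2.2 h2
    refine h3.unique ((hasDerivAt_const z.2.2 (F (z.1, z.2.1, 0))).congr_of_eventuallyEq
      (Filter.Eventually.of_forall fun τ ↦ ?_))
    exact hFp (z.1, z.2.1, τ)
  -- With y = τ + F the form dy already contains β₂ ds and contributes ∂F/∂θ to the dθ-term; `X`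
  -- supplies the rest of β₁.
  set X : ℝ × ℝ × ℝ → ℝ := fun z ↦ β (p z) (1, 0, 0) - fderiv ℝ F z (1, 0, 0) with hX
  have hXs : ContDiff ℝ ∞ X :=
    ((hβ.comp hps).clm_apply contDiff_const).sub (hF1.clm_apply contDiff_const)
  have hXper : ∀ z, X (z + (1, 0)) = X z := fun z ↦ by
    simp only [hX, hpp, hper, fderiv_periodic hFper]
  have hXp : ∀ z, X z = X (p z) := by
    intro z
    have h1 : HasFDerivAt F ((fderiv ℝ F (p z)).comp (fderiv ℝ p z)) z := by
      refine HasFDerivAt.congr_of_eventuallyEq (f := F ∘ p) ?_ (Filter.Eventually.of_forall hFp)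
      exact ((hF.differentiable (by simp)) (p z)).hasFDerivAt.comp z
        ((hps.differentiable (by simp)) z).hasFDerivAt
    have h2 : fderiv ℝ p z (1, 0, 0) = (1, 0, 0) := by
      have : HasFDerivAt p ((ContinuousLinearMap.fst ℝ ℝ (ℝ × ℝ)).prod
        (((ContinuousLinearMap.fst ℝ ℝ ℝ).comp (ContinuousLinearMap.snd ℝ ℝ (ℝ × ℝ))).prod 0)) z :=
        hasFDerivAt_fst.prodMk ((hasFDerivAt_fst.comp z hasFDerivAt_snd).prodMk
          (hasFDerivAt_const _ _))
      rw [this.fderiv]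
      simp
    simp only [hX, h1.fderiv, ContinuousLinearMap.comp_apply, h2]
    rfl
  have hX0 : ∀ t : ℝ, X (t, 0) = 0 := by
    intro t
    have h2 : HasDerivAt (fun τ : ℝ ↦ ((τ, 0) : ℝ × ℝ × ℝ)) (1, 0, 0) t :=
      (hasDerivAt_id _).prodMk (hasDerivAt_const _ _)
    have h3 := ((hF.differentiable (by simp)) (t, 0)).hasFDerivAt.comp_hasDerivAt t h2
    have h4 := h3.unique ((hasDerivAt_const t (0 : ℝ)).congr_of_eventuallyEq
      (Filter.Eventually.of_forall fun τ ↦ hF0 τ))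
    simp only [hX]
    rw [h4]
    have : p (t, 0) = (t, 0) := by simp [hp]
    rw [this, hleg, sub_zero]
  -- Since the mixed derivatives of `F` commute and ∂F/∂s = β₂, this derivative is ∂β₁/∂s - ∂β₂/∂θ,
  -- which is -dβ on the first two directions.
  have hX2 : ∀ t : ℝ, fderiv ℝ X (t, 0) (0, 1, 0) ≠ 0 := by
    intro t
    have hp1 : HasFDerivAt p ((ContinuousLinearMap.fst ℝ ℝ (ℝ × ℝ)).prod
        (((ContinuousLinearMap.fst ℝ ℝ ℝ).comp (ContinuousLinearMap.snd ℝ ℝ (ℝ × ℝ))).prod 0))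
        (t, 0) :=
      hasFDerivAt_fst.prodMk ((hasFDerivAt_fst.comp _ hasFDerivAt_snd).prodMk
          (hasFDerivAt_const _ _))
    have hpt : p (t, 0) = (t, 0) := by simp [hp]
    have hβp : HasFDerivAt (fun z ↦ β (p z)) _ (t, 0) :=
      HasFDerivAt.comp (t, (0 : ℝ × ℝ)) (hβ.differentiable (by simp) (p (t, 0))).hasFDerivAt hp1
    have hXd : HasFDerivAt X _ (t, 0) :=
      (hβp.clm_apply (hasFDerivAt_const ((1, 0, 0) : ℝ × ℝ × ℝ) _)).sub
      ((hF1.differentiable (by simp) (t, 0)).hasFDerivAt.clm_apply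
        (hasFDerivAt_const ((1, 0, 0) : ℝ × ℝ × ℝ) _))
    have hsymm := (hF.contDiffAt (x := (t, 0)).isSymmSndFDerivAt (by simpa using two_le_infty)).eq
      (0, 1, 0) (1, 0, 0)
    have hFd' : fderiv ℝ (fderiv ℝ F) (t, 0) (1, 0, 0) (0, 1, 0) =
        fderiv ℝ β (t, 0) (1, 0, 0) (0, 1, 0) := by
      have h1 := (hF1.differentiable (by simp) (t, 0)).hasFDerivAt.clm_apply
        (hasFDerivAt_const ((0, 1, 0) : ℝ × ℝ × ℝ) _)
      have h2 := (hβp.clm_apply (hasFDerivAt_const ((0, 1, 0) : ℝ × ℝ × ℝ) _))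
      have h3 : (fun z ↦ fderiv ℝ F z (0, 1, 0)) = fun z ↦ β (p z) (0, 1, 0) := funext hFd
      rw [h3] at h1
      have h4 := congrArg (fun T : ℝ × ℝ × ℝ →L[ℝ] ℝ ↦ T (1, 0, 0)) (h1.unique h2)
      simpa [hpt] using h4
    rw [hXd.fderiv]
    have h5 := hd t
    rw [extDVec] at h5
    simp only [ContinuousLinearMap.comp_zero, zero_add, sub_apply,
      ContinuousLinearMap.flip_apply, ContinuousLinearMap.comp_apply, hpt, hsymm, hFd']
    intro h6
    apply h5
    simp at h6
    linarith
  set K : ℝ × ℝ × ℝ → ℝ × ℝ × ℝ := fun z ↦ (z.1, X z, z.2.2 + F z) with hK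
  have hKs : ContDiff ℝ ∞ K := by
    rw [hK]
    exact contDiff_fst.prodMk (hXs.prodMk ((contDiff_snd.comp contDiff_snd).add hF))
  have hKd : ∀ z u, fderiv ℝ K z u = (u.1, fderiv ℝ X z u, u.2.2 + fderiv ℝ F z u) := by
    intro z u
    have : HasFDerivAt K ((ContinuousLinearMap.fst ℝ ℝ (ℝ × ℝ)).prod ((fderiv ℝ X z).prod
        (((ContinuousLinearMap.snd ℝ ℝ ℝ).comp (ContinuousLinearMap.snd ℝ ℝ (ℝ × ℝ)))
          + fderiv ℝ F z))) z :=
      hasFDerivAt_fst.prodMk (((hXs.differentiable (by simp)) z).hasFDerivAt.prodMk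
        ((hasFDerivAt_snd.comp z hasFDerivAt_snd).add ((hF.differentiable (by simp)) z).hasFDerivAt))
    rw [this.fderiv]
    simp
  have hX3 : ∀ z, fderiv ℝ X z (0, 0, 1) = 0 := by
    intro z
    have h2 : HasDerivAt (fun τ : ℝ ↦ ((z.1, z.2.1, τ) : ℝ × ℝ × ℝ)) (0, 0, 1) z.2.2 :=
      (hasDerivAt_const _ _).prodMk ((hasDerivAt_const _ _).prodMk (hasDerivAt_id _))
    have h3 := ((hXs.differentiable (by simp)) z).hasFDerivAt.comp_hasDerivAt z.2.2 h2
    refine h3.unique ((hasDerivAt_const z.2.2 (X (p z))).congr_of_eventuallyEq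
      (Filter.Eventually.of_forall fun τ ↦ ?_))
    exact hXp (z.1, z.2.1, τ)
  have hX2per : ∀ z, fderiv ℝ X (z + (1, 0)) (0, 1, 0) = fderiv ℝ X z (0, 1, 0) := fun z ↦ by
    rw [fderiv_periodic hXper]
  obtain ⟨δ, hδ, htube⟩ := exists_tube_subset (A := {z | fderiv ℝ X z (0, 1, 0) ≠ 0})
    (fun t ↦ (isOpen_ne_fun ((hXs.fderiv_right (m := ∞) (by simp)).continuous.clm_apply
      continuous_const) continuous_const).mem_nhds (hX2 t))
    (fun z hz ↦ ⟨by rwa [mem_ofPred_eq, hX2per], by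
      have := hX2per (z - (1, 0))
      rw [sub_add_cancel] at this
      rwa [mem_ofPred_eq, ← this]⟩)
  refine ⟨K, hKs, fun t ↦ ?_, fun z ↦ ?_, fun z u ↦ ?_, δ, hδ, ?_, fun z hz ↦ ?_⟩
  · simp [hK, hX0, hF0]
  · simp [hK, hXper, hFper]
  · rw [pullVec, ContinuousLinearMap.comp_apply, stdForm_apply, hKd]
    simp only
    have h1 : fderiv ℝ F z u = fderiv ℝ F z (1, 0, 0) * u.1
        + β (z.1, z.2.1, 0) (0, 1, 0) * u.2.1 := by
      conv_lhs => rw [vec_eq u]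
      rw [map_add, map_add, map_smul, map_smul, map_smul, hF3, hFd]
      simp only [smul_eq_mul]
      ring
    rw [h1]
    simp only [hK, hX, hp]
    ring
  · intro z hz w hw h
    simp only [hK, Prod.mk.injEq] at h
    obtain ⟨h1, h2, h3⟩ := h
    -- Two points with equal θ and equal `X` but different s would, by Rolle's theorem, enclose a
    -- zero of the s-derivative of `X` inside the tube.
    have hs : z.2.1 = w.2.1 := by
      by_contra hne
      have hz' : |z.2.1| < δ := lt_of_le_of_lt (norm_fst_le z.2) hz
      have hw' : |w.2.1| < δ := lt_of_le_of_lt (norm_fst_le w.2) hw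
      have hder : ∀ s : ℝ, HasDerivAt (fun s : ℝ ↦ X (z.1, s, 0))
          (fderiv ℝ X (z.1, s, 0) (0, 1, 0)) s := by
        intro s
        have h2 : HasDerivAt (fun τ : ℝ ↦ ((z.1, τ, 0) : ℝ × ℝ × ℝ)) (0, 1, 0) s :=
          (hasDerivAt_const _ _).prodMk ((hasDerivAt_id _).prodMk (hasDerivAt_const _ _))
        exact ((hXs.differentiable (by simp)) _).hasFDerivAt.comp_hasDerivAt s h2
      have heq : X (z.1, z.2.1, 0) = X (z.1, w.2.1, 0) := by
        have e1 := hXp z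
        have e2 := hXp w
        simp only [hp] at e1 e2
        rw [← e1, h2, e2, h1]
      have hcont : Continuous fun s : ℝ ↦ X (z.1, s, 0) := hXs.continuous.comp (by fun_prop)
      have hno : ∀ s, |s| < δ → fderiv ℝ X (z.1, s, 0) (0, 1, 0) ≠ 0 := fun s hs ↦
        htube (z.1, s, 0) (by simpa [Prod.norm_def, hδ] using hs)
      rw [abs_lt] at hz' hw'
      rcases lt_or_gt_of_ne hne with hlt | hlt
      · obtain ⟨c, hc, hc0⟩ := exists_hasDerivAt_eq_zero hlt hcont.continuousOn heq
          (fun s _ ↦ hder s)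
        exact hno c (abs_lt.2 ⟨by linarith [hc.1], by linarith [hc.2]⟩) hc0
      · obtain ⟨c, hc, hc0⟩ := exists_hasDerivAt_eq_zero hlt hcont.continuousOn heq.symm
          (fun s _ ↦ hder s)
        exact hno c (abs_lt.2 ⟨by linarith [hc.1], by linarith [hc.2]⟩) hc0
    have hFF : F z = F w := by rw [hFp z, hFp w, h1, hs]
    refine Prod.ext h1 (Prod.ext hs ?_)
    rw [hFF] at h3
    linarith
  · have hinj : Injective (fderiv ℝ K z) := by
      rw [← ContinuousLinearMap.coe_coe, ← LinearMap.ker_eq_bot, LinearMap.ker_eq_bot']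
      intro u hu
      rw [ContinuousLinearMap.coe_coe, hKd] at hu
      simp only [Prod.mk_eq_zero] at hu
      obtain ⟨h1, h2, h3⟩ := hu
      have e : fderiv ℝ X z u = u.2.1 * fderiv ℝ X z (0, 1, 0) := by
        conv_lhs => rw [vec_eq u]
        rw [map_add, map_add, map_smul, map_smul, map_smul, hX3, h1]
        simp
      rw [e] at h2
      have h4 : u.2.1 = 0 := (mul_eq_zero.1 h2).resolve_right (htube z hz)
      have e' : fderiv ℝ F z u = 0 := by
        rw [vec_eq u, map_add, map_add, map_smul, map_smul, map_smul, hF3, h1, h4]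
        simp
      rw [e', add_zero] at h3
      exact Prod.ext h1 (Prod.ext h4 h3)
    have hsurj := (LinearMap.injective_iff_surjective
      (f := (fderiv ℝ K z : ℝ × ℝ × ℝ →ₗ[ℝ] ℝ × ℝ × ℝ))).1 hinj
    exact ⟨hinj, hsurj⟩

/-- **Normal form of a contact form on `ℝ³` near a Legendrian axis**, periodic version. -/
theorem exists_contact_normalForm (hβ : ContDiff ℝ ∞ β) (hper : ∀ z, β (z + (1, 0)) = β z)
    (hleg : ∀ t : ℝ, β (t, 0) (1, 0, 0) = 0)
    (hd : ∀ t : ℝ, extDVec β (t, 0) (1, 0, 0) (0, 1, 0) ≠ 0)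
    (hD : ∀ t : ℝ, β (t, 0) (reebVec β (t, 0)) ≠ 0) :
    ∃ δ > 0, ∃ P : ℝ × ℝ × ℝ → ℝ × ℝ × ℝ,
      (∀ z : ℝ × ℝ × ℝ, ‖z.2‖ < δ → ContDiffAt ℝ ∞ P z) ∧
      (∀ t : ℝ, P (t, 0) = (t, 0)) ∧
      (∀ z : ℝ × ℝ × ℝ, ‖z.2‖ < δ → P (z + (1, 0)) = P z + (1, 0)) ∧
      ∀ z : ℝ × ℝ × ℝ, ‖z.2‖ < δ → pullVec P β z = stdForm z := by
  obtain ⟨δ₁, hδ₁, g, hg, hg0, hgper, hgβ⟩ := exists_reeb_flowbox hβ hper hD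
  obtain ⟨K, hK, hK0, hKper, hKβ, δ₂, hδ₂, hinj, hbij⟩ := exists_straightening hβ hper hleg hd
  set Ω : Set (ℝ × ℝ × ℝ) := {z | ‖z.2‖ < min δ₁ δ₂} with hΩ
  have hΩo : IsOpen Ω := isOpen_lt (by fun_prop) continuous_const
  have hΩ1 : ∀ w ∈ Ω, ‖w.2‖ < δ₁ := fun w hw ↦ lt_of_lt_of_le hw (min_le_left _ _)
  have hΩ2 : ∀ w ∈ Ω, ‖w.2‖ < δ₂ := fun w hw ↦ lt_of_lt_of_le hw (min_le_right _ _)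
  have hΩ0 : ∀ t : ℝ, (t, 0) ∈ Ω := fun t ↦ by simp [hΩ, hδ₁, hδ₂]
  have hΩp : ∀ w, w ∈ Ω → w + (1, 0) ∈ Ω := fun w hw ↦ by simpa [hΩ] using hw
  have hΩm : ∀ w, w ∈ Ω → w - (1, 0) ∈ Ω := fun w hw ↦ by simpa [hΩ] using hw
  obtain ⟨L, hL, hLs, hLn, hLd⟩ := exists_smooth_inverseOn hΩo
    (hinj.mono fun w hw ↦ hΩ2 w hw) (fun w _ ↦ hK.contDiffAt) (fun w hw ↦ hbij w (hΩ2 w hw))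
  obtain ⟨δ, hδ, htube⟩ := exists_tube_subset (A := K '' Ω)
    (fun t ↦ by
      have := hLn _ (hΩ0 t)
      rwa [hK0] at this)
    (by
      rintro _ ⟨w, hw, rfl⟩
      refine ⟨⟨w + (1, 0), hΩp w hw, hKper w⟩, ⟨w - (1, 0), hΩm w hw, ?_⟩⟩
      have := hKper (w - (1, 0))
      rw [sub_add_cancel] at this
      rw [this, add_sub_cancel_right])
  -- `g` pulls `β` back to the very form that `K` obtains from `stdForm`; hence `g` composed with
  -- the inverse `L` of `K` pulls `β` back to `stdForm`.
  refine ⟨δ, hδ, g ∘ L, fun z hz ↦ ?_, fun t ↦ ?_, fun z hz ↦ ?_, fun z hz ↦ ?_⟩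
  · obtain ⟨w, hw, rfl⟩ := htube z hz
    refine ContDiffAt.comp _ ?_ (hLs w hw)
    rw [hL w hw]
    exact hg w (hΩ1 w hw)
  · have := hL _ (hΩ0 t)
    rw [hK0] at this
    rw [comp_apply, this]
    exact hg0 t 0
  · obtain ⟨w, hw, rfl⟩ := htube z hz
    rw [comp_apply, comp_apply, ← hKper, hL _ (hΩp w hw), hL w hw, hgper w (hΩ1 w hw)]
  · obtain ⟨w, hw, rfl⟩ := htube z hz
    refine ContinuousLinearMap.ext fun u ↦ ?_
    obtain ⟨v, rfl⟩ := (hbij w (hΩ2 w hw)).2 u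
    have h1 : DifferentiableAt ℝ g (L (K w)) := by
      rw [hL w hw]
      exact (hg w (hΩ1 w hw)).differentiableAt (by simp)
    have h2 := hgβ w (hΩ1 w hw) v
    rw [← hKβ w v] at h2
    rw [pullVec, ContinuousLinearMap.comp_apply,
      fderiv_comp _ h1 ((hLs w hw).differentiableAt (by simp)), ContinuousLinearMap.comp_apply,
      hLd w hw, comp_apply, hL w hw]
    exact h2

end Straightening

/-! ### One-forms on the manifold and their pullbacks to vector spaces. -/

section OneForm

variable {M : Type*} [TopologicalSpace M] [ChartedSpace E3 M] [IsManifold (𝓡 3) ∞ M]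
  {α : ∀ p : M, TangentSpace (𝓡 3) p →L[ℝ] ℝ}

/-- Smoothness of the section is smoothness in the bundle trivialization at `p`, and the tangent
trivialization is inverted by the derivative of the inverse chart. So the trivialized section is the
coordinate form. -/
theorem contDiffAt_oneFormInChart (hα : IsSmoothOneForm α) (p : M) {x : E3}
    (hx : x ∈ (extChartAt (𝓡 3) p).target) : ContDiffAt ℝ ∞ (oneFormInChart α p) x := by
  have h := hα ((extChartAt (𝓡 3) p).symm x)
  have hs : (extChartAt (𝓡 3) p).symm x ∈ (chartAt E3 p).source := by
    rw [← extChartAt_source (𝓡 3)]; exact (extChartAt (𝓡 3) p).map_target hx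
  rw [Bundle.Trivialization.contMDiffAt_section_iff
    (e := trivializationAt (E3 →L[ℝ] ℝ)
      (fun p : M ↦ TangentSpace (𝓡 3) p →L[ℝ] Bundle.Trivial M ℝ p) p)
    (by simpa using hs)] at h
  have hsymm : ContMDiffAt 𝓘(ℝ, E3) (𝓡 3) ∞ (extChartAt (𝓡 3) p).symm x :=
    (contMDiffOn_extChartAt_symm p).contMDiffAt
      ((isOpen_extChartAt_target p).mem_nhds hx)
  have h2 := (h.comp x hsymm).contDiffAt
  refine h2.congr_of_eventuallyEq ?_
  filter_upwards [(isOpen_extChartAt_target p).mem_nhds hx] with y hy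
  have hys : (extChartAt (𝓡 3) p).symm y ∈ (chartAt E3 p).source := by
    rw [← extChartAt_source (𝓡 3)]; exact (extChartAt (𝓡 3) p).map_target hy
  have h3 := TangentBundle.symmL_trivializationAt (I := 𝓡 3) hys
  rw [(extChartAt (𝓡 3) p).right_inv hy] at h3
  simp only [comp_apply, hom_trivializationAt_apply]
  rw [ContinuousLinearMap.inCoordinates, h3, oneFormInChart]
  simp

variable {V : Type*} [NormedAddCommGroup V] [NormedSpace ℝ V]

/-- The pullback of the 1-form `α` on `M` under a map `g` from a vector space. -/
noncomputable def pullForm (α : ∀ p : M, TangentSpace (𝓡 3) p →L[ℝ] ℝ) (g : V → M) (z : V) : V →L[ℝ] ℝ :=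
  (α (g z)).comp (mfderiv 𝓘(ℝ, V) (𝓡 3) g z)

theorem pullForm_eq_pullVec {g : V → M} {z : V} (p : M)
    (hg : MDifferentiableAt 𝓘(ℝ, V) (𝓡 3) g z) (hz : g z ∈ (extChartAt (𝓡 3) p).source) :
    pullForm α g z = pullVec (extChartAt (𝓡 3) p ∘ g) (oneFormInChart α p) z := by
  have hs : g z ∈ (chartAt E3 p).source := by rwa [← extChartAt_source (𝓡 3)]
  have hk : MDifferentiableAt (𝓡 3) 𝓘(ℝ, E3) (extChartAt (𝓡 3) p) (g z) :=
    mdifferentiableAt_extChartAt hs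
  have h1 : fderiv ℝ (extChartAt (𝓡 3) p ∘ g) z =
      (mfderiv (𝓡 3) 𝓘(ℝ, E3) (extChartAt (𝓡 3) p) (g z)).comp
        (mfderiv 𝓘(ℝ, V) (𝓡 3) g z) := by
    rw [← mfderiv_eq_fderiv]
    exact mfderiv_comp z hk hg
  have h2 := mfderivWithin_extChartAt_symm_comp_mfderiv_extChartAt' (I := 𝓡 3) hz
  have h3 : range (𝓡 3) = univ := by simp
  rw [h3, mfderivWithin_univ] at h2
  rw [pullForm, pullVec, h1, oneFormInChart, comp_apply, (extChartAt (𝓡 3) p).left_inv hz]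
  ext v
  have h4 := DFunLike.congr_fun h2 (mfderiv 𝓘(ℝ, V) (𝓡 3) g z v)
  exact congrArg (α (g z)) h4.symm

theorem eventually_pullForm_eq {g : V → M} {z : V} (p : M)
    (hg : ContMDiffAt 𝓘(ℝ, V) (𝓡 3) ∞ g z) (hz : g z ∈ (extChartAt (𝓡 3) p).source) :
    pullForm α g =ᶠ[𝓝 z] pullVec (extChartAt (𝓡 3) p ∘ g) (oneFormInChart α p) := by
  have h1 : ∀ᶠ y in 𝓝 z, ContMDiffAt 𝓘(ℝ, V) (𝓡 3) 1 g y := (contMDiffAt_iff_contMDiffAt_nhds (by simp)).1 (hg.of_le (by simp))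
  have h2 : ∀ᶠ y in 𝓝 z, g y ∈ (extChartAt (𝓡 3) p).source :=
    hg.continuousAt ((isOpen_extChartAt_source p).mem_nhds hz)
  filter_upwards [h1, h2] with y hy1 hy2
  exact pullForm_eq_pullVec p (hy1.mdifferentiableAt (by simp)) hy2

theorem contDiffAt_extChartAt_comp {g : V → M} {z : V} {p : M}
    (hg : ContMDiffAt 𝓘(ℝ, V) (𝓡 3) ∞ g z) (hz : g z ∈ (extChartAt (𝓡 3) p).source) :
    ContDiffAt ℝ ∞ (extChartAt (𝓡 3) p ∘ g) z := by
  have hs : g z ∈ (chartAt E3 p).source := by rwa [← extChartAt_source (𝓡 3)]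
  exact ((contMDiffAt_extChartAt' hs).comp z hg).contDiffAt

theorem contDiffAt_pullForm (hα : IsSmoothOneForm α) {g : V → M} {z : V}
    (hg : ContMDiffAt 𝓘(ℝ, V) (𝓡 3) ∞ g z) : ContDiffAt ℝ ∞ (pullForm α g) z := by
  have hz := mem_extChartAt_source (I := 𝓡 3) (g z)
  refine ContDiffAt.congr_of_eventuallyEq ?_ (eventually_pullForm_eq (g z) hg hz)
  have h1 := contDiffAt_extChartAt_comp hg hz
  exact ContDiffAt.clm_comp
    ((contDiffAt_oneFormInChart hα (g z) (by simp)).comp z h1)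
    (h1.fderiv_right (by simp))

theorem extD_eq (p : M) (u v : TangentSpace (𝓡 3) p) :
    extD α p u v = extDVec (oneFormInChart α p) (extChartAt (𝓡 3) p p) u v := by
  simp only [extD, extDVec, mfderiv_extChartAt_self]
  rfl

/-- The exterior derivative is natural. -/
theorem extDVec_pullForm (hα : IsSmoothOneForm α) {g : V → M} {z : V}
    (hg : ContMDiffAt 𝓘(ℝ, V) (𝓡 3) ∞ g z) (u v : V) :
    extDVec (pullForm α g) z u v =
      extD α (g z) (mfderiv 𝓘(ℝ, V) (𝓡 3) g z u) (mfderiv 𝓘(ℝ, V) (𝓡 3) g z v) := by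
  have hz := mem_extChartAt_source (I := 𝓡 3) (g z)
  have h1 := contDiffAt_extChartAt_comp hg hz
  have h2 : fderiv ℝ (extChartAt (𝓡 3) (g z) ∘ g) z = mfderiv 𝓘(ℝ, V) (𝓡 3) g z := by
    rw [← mfderiv_eq_fderiv]
    rw [mfderiv_comp z (mdifferentiableAt_extChartAt (mem_chart_source _ _))
      (hg.mdifferentiableAt (by simp)), mfderiv_extChartAt_self]
    rfl
  rw [extDVec_congr (eventually_pullForm_eq (g z) hg hz),
    extDVec_pullVec (h1.of_le two_le_infty)
    ((contDiffAt_oneFormInChart hα (g z) (by simp)).differentiableAt (by simp)), extD_eq, h2]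
  rfl

/-- The exterior derivative as a bilinear form. -/
theorem exists_extD_bilin (α : ∀ p : M, TangentSpace (𝓡 3) p →L[ℝ] ℝ) (p : M) :
    ∃ B : E3 →L[ℝ] E3 →L[ℝ] ℝ, (∀ u v : E3, extD α p u v = B u v) ∧ ∀ u v, B u v = -B v u := by
  refine ⟨fderiv ℝ (oneFormInChart α p) (extChartAt (𝓡 3) p p)
    - (fderiv ℝ (oneFormInChart α p) (extChartAt (𝓡 3) p p)).flip, fun u v ↦ ?_, fun u v ↦ ?_⟩
  · exact (extD_eq p u v).trans (by simp [extDVec])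
  · simp

end OneForm

/-- Linear algebra of a ∧ B ≠ 0: the form `B` is non-degenerate on the kernel of `a`, so the
non-zero vector `x` of this kernel pairs non-trivially with some `n` in it. A vector with `a`-value
1 is then corrected by a multiple of `n` to become `r`. -/
theorem exists_contact_frame {E : Type*} [NormedAddCommGroup E] [NormedSpace ℝ E]
    (hE : Module.finrank ℝ E = 3) (a : E →L[ℝ] ℝ) (B : E →L[ℝ] E →L[ℝ] ℝ)
    (hB : ∀ u v, B u v = -B v u) {u v w : E}
    (hW : a u * B v w + a v * B w u + a w * B u v ≠ 0) {x : E} (hx : x ≠ 0) (hax : a x = 0) :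
    ∃ n r : E, a n = 0 ∧ B x n = 1 ∧ a r = 1 ∧ B x r = 0 := by
  have hBs : ∀ y, B y y = 0 := fun y ↦ by have := hB y y; linarith
  have hli : LinearIndependent ℝ ![u, v, w] := by
    rw [Fintype.linearIndependent_iff]
    intro c hc
    simp only [Fin.sum_univ_three, Matrix.cons_val_zero, Matrix.cons_val_one,
      Matrix.cons_val] at hc
    have ha := congrArg a hc
    have hu := congrArg (B u) hc
    have hv := congrArg (B v) hc
    have hw := congrArg (B w) hc
    simp only [map_add, map_smul, smul_eq_mul, map_zero, hBs] at ha hu hv hw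
    rw [hB u w] at hu
    rw [hB v u] at hv
    rw [hB w v] at hw
    intro i
    have h0 : c 0 * (a u * B v w + a v * B w u + a w * B u v) = 0 := by
      linear_combination (B v w) * ha + a v * hw - a w * hv
    have h1 : c 1 * (a u * B v w + a v * B w u + a w * B u v) = 0 := by
      linear_combination (B w u) * ha - a u * hw + a w * hu
    have h2 : c 2 * (a u * B v w + a v * B w u + a w * B u v) = 0 := by
      linear_combination (B u v) * ha + a u * hv - a v * hu
    fin_cases i
    · exact (mul_eq_zero.1 h0).resolve_right hW
    · exact (mul_eq_zero.1 h1).resolve_right hW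
    · exact (mul_eq_zero.1 h2).resolve_right hW
  have hsp := hli.span_eq_top_of_card_eq_finrank (by simp [hE])
  have hr0 : ∃ r0, a r0 = 1 := by
    by_contra! h
    have : ∀ y, a y = 0 := fun y ↦ by
      by_contra hy
      exact h ((a y)⁻¹ • y) (by simp [hy])
    exact hW (by simp [this])
  obtain ⟨r0, hr0⟩ := hr0
  -- If `B x` vanished on the kernel of `a`, it would be a multiple of `a`. Replacing any basis
  -- vector by `x` would then annihilate a ∧ B, so every coordinate of `x` would be zero.
  have key : ∃ n, a n = 0 ∧ B x n ≠ 0 := by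
    by_contra! h
    have hc : ∀ y, B x y = B x r0 * a y := fun y ↦ by
      have := h (y - a y • r0) (by simp [hr0])
      simp only [map_sub, map_smul, smul_eq_mul] at this
      linarith
    have hx' : x ∈ Submodule.span ℝ (Set.range ![u, v, w]) := by rw [hsp]; trivial
    rw [Submodule.mem_span_range_iff_exists_fun] at hx'
    obtain ⟨c, hcx⟩ := hx'
    simp only [Fin.sum_univ_three, Matrix.cons_val_zero, Matrix.cons_val_one,
      Matrix.cons_val] at hcx
    have hcu := hc u
    have hcv := hc v
    have hcw := hc w
    have ha := hax
    rw [← hcx] at ha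
    set d := B x r0
    rw [← hcx] at hcu hcv hcw
    simp only [map_add, map_smul, smul_eq_mul, hBs, add_apply,
      smul_apply] at ha hcu hcv hcw
    rw [hB v u] at hcu
    rw [hB w v] at hcv
    rw [hB u w] at hcw
    have h0 : c 0 * (a u * B v w + a v * B w u + a w * B u v) = 0 := by
      linear_combination (B v w) * ha - a v * hcw + a w * hcv
    have h1 : c 1 * (a u * B v w + a v * B w u + a w * B u v) = 0 := by
      linear_combination (B w u) * ha + a u * hcw - a w * hcu
    have h2 : c 2 * (a u * B v w + a v * B w u + a w * B u v) = 0 := by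
      linear_combination (B u v) * ha - a u * hcv + a v * hcu
    refine hx ?_
    rw [← hcx, (mul_eq_zero.1 h0).resolve_right hW, (mul_eq_zero.1 h1).resolve_right hW,
      (mul_eq_zero.1 h2).resolve_right hW]
    simp
  obtain ⟨n, hn, hBn⟩ := key
  refine ⟨(B x n)⁻¹ • n, r0 - (B x r0 / B x n) • n, by simp [hn], by simp [hBn],
    by simp [hn, hr0], by simp [hBn]⟩

/-- Smooth periodic bump functions on the line. -/
theorem exists_periodic_bump (t₀ : ℝ) {δ : ℝ} (hδ : 0 < δ) :
    ∃ ρ : ℝ → ℝ, ContDiff ℝ ∞ ρ ∧ Periodic ρ 1 ∧ (∀ t, 0 ≤ ρ t) ∧ 0 < ρ t₀ ∧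
      ∀ t, (∃ n : ℤ, |t - n - t₀| < δ) ∨ ∀ᶠ s in 𝓝 t, ρ s = 0 := by
  set η := min (δ / 2) (1 / 4) with hη
  have hη0 : 0 < η := by positivity
  have hη1 : η ≤ 1 / 4 := min_le_right _ _
  have hη2 : η < δ := lt_of_le_of_lt (min_le_left _ _) (by linarith)
  have hcos : Real.cos (2 * Real.pi * η) < 1 := by
    rw [← Real.cos_zero]
    exact Real.strictAntiOn_cos ⟨le_rfl, Real.pi_pos.le⟩
      ⟨by positivity, by nlinarith [Real.pi_pos]⟩ (by positivity)
  -- A function of the cosine is periodic by construction, and this one is positive exactly at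
  -- distance less than `η` from t₀ + ℤ, because `η ≤ 1 / 4` keeps the cosine on a monotone branch.
  refine ⟨fun t ↦ expNegInvGlue (Real.cos (2 * Real.pi * (t - t₀)) - Real.cos (2 * Real.pi * η)),
    ?_, ?_, ?_, ?_, ?_⟩
  · refine expNegInvGlue.contDiff.comp (ContDiff.sub ?_ contDiff_const)
    exact Real.contDiff_cos.comp (contDiff_const.mul (contDiff_id.sub contDiff_const))
  · intro t
    have : 2 * Real.pi * (t + 1 - t₀) = 2 * Real.pi * (t - t₀) + 2 * Real.pi := by ring
    simp only [this, Real.cos_add_two_pi]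
  · exact fun t ↦ expNegInvGlue.nonneg _
  · refine expNegInvGlue.pos_of_pos ?_
    simpa using hcos
  · intro t
    set n := round (t - t₀) with hn
    have hr : |t - t₀ - n| ≤ 1 / 2 := abs_sub_round _
    by_cases h : |t - t₀ - n| < δ
    · left; refine ⟨n, ?_⟩; rwa [sub_right_comm]
    · right
      have h1 : Real.cos (2 * Real.pi * (t - t₀)) < Real.cos (2 * Real.pi * η) := by
        have : Real.cos (2 * Real.pi * (t - t₀)) = Real.cos (2 * Real.pi * |t - t₀ - n|) := by
          rw [← abs_of_pos Real.two_pi_pos, ← abs_mul, Real.cos_abs, abs_of_pos Real.two_pi_pos,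
            ← Real.cos_sub_int_mul_two_pi _ n]
          congr 1; ring
        rw [this]
        refine Real.strictAntiOn_cos ⟨by positivity, by nlinarith [Real.pi_pos]⟩
          ⟨by positivity, by nlinarith [Real.pi_pos]⟩ ?_
        have : η < |t - t₀ - n| := by linarith
        nlinarith [Real.pi_pos]
      have h2 : ContinuousAt (fun t ↦ Real.cos (2 * Real.pi * (t - t₀))) t := by fun_prop
      filter_upwards [h2.eventually_lt continuousAt_const h1] with s hs
      exact expNegInvGlue.zero_of_nonpos (by linarith)

/-! ### Tubular maps around the knot. -/

section Tube

variable {M : Type*} [TopologicalSpace M] [ChartedSpace E3 M]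
  {α : ∀ p : M, TangentSpace (𝓡 3) p →L[ℝ] ℝ} {γ : ℝ → M}

/-- `T` is a periodic map defined on `ℝ × ℝ²` which is smooth near the axis, where it is `γ`. -/
structure IsTube (γ : ℝ → M) (T : ℝ × ℝ × ℝ → M) : Prop where
  periodic : ∀ z, T (z + (1, 0)) = T z
  eventually_smooth : ∀ t : ℝ, ∀ᶠ z in 𝓝 (t, 0), ContMDiffAt 𝓘(ℝ, ℝ × ℝ × ℝ) (𝓡 3) ∞ T z
  axis : ∀ t : ℝ, T (t, 0) = γ t

theorem IsTube.smooth {T : ℝ × ℝ × ℝ → M} (hT : IsTube γ T) (t : ℝ) :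
    ContMDiffAt 𝓘(ℝ, ℝ × ℝ × ℝ) (𝓡 3) ∞ T (t, 0) :=
  (hT.eventually_smooth t).self_of_nhds

variable [IsManifold (𝓡 3) ∞ M]

theorem contMDiffAt_extChartAt_symm {p : M} {x : E3} (hx : x ∈ (extChartAt (𝓡 3) p).target) :
    ContMDiffAt 𝓘(ℝ, E3) (𝓡 3) ∞ (extChartAt (𝓡 3) p).symm x :=
  (contMDiffOn_extChartAt_symm p).contMDiffAt ((isOpen_extChartAt_target p).mem_nhds hx)

theorem mfderiv_symm_apply_mfderiv {p q : M} (hq : q ∈ (extChartAt (𝓡 3) p).source) (v : E3) :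
    (mfderiv 𝓘(ℝ, E3) (𝓡 3) (extChartAt (𝓡 3) p).symm (extChartAt (𝓡 3) p q)
      (mfderiv (𝓡 3) 𝓘(ℝ, E3) (extChartAt (𝓡 3) p) q v : E3) : E3) = v := by
  have h2 := mfderivWithin_extChartAt_symm_comp_mfderiv_extChartAt' (I := 𝓡 3) hq
  have h3 : range (𝓡 3) = univ := by simp
  rw [h3, mfderivWithin_univ] at h2
  exact DFunLike.congr_fun h2 v

/-- The derivative of a map from a vector space to `M`, as a map to the model space. -/
noncomputable def vecDeriv {V : Type*} [NormedAddCommGroup V] [NormedSpace ℝ V] (g : V → M) (z : V) :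
    V →L[ℝ] E3 :=
  mfderiv 𝓘(ℝ, V) (𝓡 3) g z

/-- Adding `ρ • L` in the chart at `p` changes the transverse derivative along the axis additively,
and changes nothing where `ρ` vanishes. Transverse frames defined only in charts can thus be summed
with periodic weights. -/
theorem IsTube.step {T : ℝ × ℝ × ℝ → M} (hT : IsTube γ T) (p : M) (L : ℝ × ℝ →L[ℝ] E3)
    {ρ : ℝ → ℝ} (hρ : ContDiff ℝ ∞ ρ) (hper : Periodic ρ 1)
    (hsupp : ∀ t, γ t ∈ (extChartAt (𝓡 3) p).source ∨ ∀ᶠ s in 𝓝 t, ρ s = 0) :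
    ∃ T' : ℝ × ℝ × ℝ → M, IsTube γ T' ∧ ∀ (t : ℝ) (w : ℝ × ℝ),
      vecDeriv T' (t, 0) (0, w) = vecDeriv T (t, 0) (0, w) +
        ρ t • vecDeriv (extChartAt (𝓡 3) p).symm (extChartAt (𝓡 3) p (γ t)) (L w) := by
  classical
  set κ := extChartAt (𝓡 3) p with hκ
  set G : ℝ × ℝ × ℝ → E3 := fun z ↦ κ (T z) + ρ z.1 • L z.2 with hG
  -- The case distinction may break smoothness away from the axis, but near each axis point either
  -- `T` stays in the chart or `ρ` is zero. `IsTube` requires no more.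
  set T' : ℝ × ℝ × ℝ → M := fun z ↦ if T z ∈ κ.source then κ.symm (G z) else T z with hT'
  have hG0 : ∀ t : ℝ, G (t, 0) = κ (γ t) := fun t ↦ by simp [hG, hT.axis]
  have hax : ∀ t : ℝ, T' (t, 0) = γ t := fun t ↦ by
    simp only [hT', hG0, hT.axis]
    split_ifs with h
    · exact κ.left_inv h
    · rfl
  have hin : ∀ t, γ t ∈ κ.source → T' =ᶠ[𝓝 (t, 0)] κ.symm ∘ G := fun t ht ↦ by
    have : ∀ᶠ z in 𝓝 ((t, 0) : ℝ × ℝ × ℝ), T z ∈ κ.source :=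
      (hT.smooth t).continuousAt ((isOpen_extChartAt_source p).mem_nhds (by rwa [hT.axis]))
    filter_upwards [this] with z hz
    simp [hT', hz]
  have hout : ∀ t, (∀ᶠ s in 𝓝 t, ρ s = 0) → T' =ᶠ[𝓝 (t, 0)] T := fun t ht ↦ by
    have : ∀ᶠ z in 𝓝 ((t, 0) : ℝ × ℝ × ℝ), ρ z.1 = 0 := 
      (continuous_fst.tendsto ((t, 0) : ℝ × ℝ × ℝ)).eventually ht
    filter_upwards [this] with z hz
    simp only [hT', hG, hz, zero_smul, add_zero]
    split_ifs with h
    · exact κ.left_inv h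
    · rfl
  have hkT : ∀ t, γ t ∈ κ.source → ContDiffAt ℝ ∞ (κ ∘ T) (t, 0) := fun t ht ↦
    contDiffAt_extChartAt_comp (hT.smooth t) (by rwa [hT.axis])
  have hGs : ∀ t, γ t ∈ κ.source → ContDiffAt ℝ ∞ G (t, 0) := fun t ht ↦
    (hkT t ht).add ((hρ.comp contDiff_fst).smul (L.contDiff.comp contDiff_snd)).contDiffAt
  have hsy : ∀ t, γ t ∈ κ.source →
      ContMDiffAt 𝓘(ℝ, E3) (𝓡 3) ∞ κ.symm (G (t, 0)) := fun t ht ↦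
    contMDiffAt_extChartAt_symm (by rw [hG0]; exact κ.map_source ht)
  refine ⟨T', ⟨fun z ↦ ?_, fun t ↦ ?_, hax⟩, fun t w ↦ ?_⟩
  · have h1 : ρ (z + (1, 0)).1 = ρ z.1 := hper z.1
    have h2 : (z + ((1 : ℝ), (0 : ℝ × ℝ))).2 = z.2 := by simp
    simp only [hT', hG, hT.periodic, h1, h2]
  · rcases hsupp t with ht | ht
    · have h1 : ∀ᶠ z in 𝓝 ((t, 0) : ℝ × ℝ × ℝ), T z ∈ κ.source :=
        (hT.smooth t).continuousAt ((isOpen_extChartAt_source p).mem_nhds (by rwa [hT.axis]))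
      have h2 : ∀ᶠ z in 𝓝 ((t, 0) : ℝ × ℝ × ℝ), G z ∈ κ.target :=
        (hGs t ht).continuousAt ((isOpen_extChartAt_target p).mem_nhds
          (by rw [hG0]; exact κ.map_source ht))
      filter_upwards [h1, h2, hT.eventually_smooth t, (hin t ht).eventually_nhds]
        with z hz1 hz2 hz3 hz4
      refine ContMDiffAt.congr_of_eventuallyEq
        ((contMDiffAt_extChartAt_symm hz2).comp z (ContDiffAt.contMDiffAt ?_)) hz4
      exact (contDiffAt_extChartAt_comp hz3 hz1).add
        ((hρ.comp contDiff_fst).smul (L.contDiff.comp contDiff_snd)).contDiffAt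
    · filter_upwards [hT.eventually_smooth t, (hout t ht).eventually_nhds] with z hz1 hz2
      exact hz1.congr_of_eventuallyEq hz2
  · rcases hsupp t with ht | ht
    · rw [vecDeriv, (hin t ht).mfderiv_eq, mfderiv_comp (I' := 𝓘(ℝ, E3)) _
        ((hsy t ht).mdifferentiableAt (by simp))
        ((hGs t ht).contMDiffAt.mdifferentiableAt (by simp)), mfderiv_eq_fderiv]
      have h1 : HasFDerivAt (fun z : ℝ × ℝ × ℝ ↦ ρ z.1 • L z.2) (ρ t • L.comp
          (ContinuousLinearMap.snd ℝ ℝ (ℝ × ℝ))) (t, 0) := by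
        have ha : HasFDerivAt (fun z : ℝ × ℝ × ℝ ↦ ρ z.1) _ (t, (0 : ℝ × ℝ)) :=
          ((hρ.differentiable (by simp)).comp differentiable_fst).differentiableAt.hasFDerivAt
        have hb : HasFDerivAt (fun z : ℝ × ℝ × ℝ ↦ L z.2) (L.comp
          (ContinuousLinearMap.snd ℝ ℝ (ℝ × ℝ))) (t, (0 : ℝ × ℝ)) :=
          (L.comp (ContinuousLinearMap.snd ℝ ℝ (ℝ × ℝ))).hasFDerivAt
        refine (ha.smul hb).congr_fderiv ?_
        ext z <;> simp
      have h2 : fderiv ℝ G (t, 0) = fderiv ℝ (κ ∘ T) (t, 0) + ρ t • L.comp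
          (ContinuousLinearMap.snd ℝ ℝ (ℝ × ℝ)) :=
        (((hkT t ht).differentiableAt (by simp)).hasFDerivAt.add h1).fderiv
      have h3 : ∃ A : E3 →L[ℝ] E3, fderiv ℝ (κ ∘ T) (t, 0) = A.comp (vecDeriv T (t, 0)) ∧
          ∀ v, vecDeriv κ.symm (κ (γ t)) (A v) = v := by
        refine ⟨mfderiv (𝓡 3) 𝓘(ℝ, E3) κ (T (t, 0)), ?_, fun v ↦ ?_⟩
        · rw [← mfderiv_eq_fderiv]
          refine mfderiv_comp _ (mdifferentiableAt_extChartAt ?_)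
            ((hT.smooth t).mdifferentiableAt (by simp))
          rw [← extChartAt_source (𝓡 3), hT.axis]; exact ht
        · rw [hT.axis]
          exact mfderiv_symm_apply_mfderiv ht v
      obtain ⟨A, hA1, hA2⟩ := h3
      have h6 : ∀ (A : E3 →L[ℝ] E3) (B : ℝ × ℝ × ℝ →L[ℝ] E3) (x : ℝ × ℝ × ℝ),
        (A.comp B) x = A (B x) := fun _ _ _ ↦ rfl
      refine (h6 (vecDeriv κ.symm (G (t, 0))) (fderiv ℝ G (t, 0)) _).trans ?_
      rw [h2, hA1, hG0]
      simp [hA2]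
    · rw [vecDeriv, (hout t ht).mfderiv_eq, vecDeriv, ht.self_of_nhds, zero_smul, add_zero]

theorem vecDeriv_comp {V V' : Type*} [NormedAddCommGroup V] [NormedSpace ℝ V]
    [NormedAddCommGroup V'] [NormedSpace ℝ V'] {g : V' → M} {f : V → V'} {z : V}
    (hg : ContMDiffAt 𝓘(ℝ, V') (𝓡 3) ∞ g (f z)) (hf : DifferentiableAt ℝ f z) :
    vecDeriv (g ∘ f) z = (vecDeriv g (f z)).comp (fderiv ℝ f z) := by
  rw [vecDeriv, mfderiv_comp (I' := 𝓘(ℝ, V')) _ (hg.mdifferentiableAt (by simp))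
    hf.mdifferentiableAt, mfderiv_eq_fderiv]
  rfl

/-- The form `α` along the curve `γ`. -/
noncomputable def axisForm (α : ∀ p : M, TangentSpace (𝓡 3) p →L[ℝ] ℝ) (γ : ℝ → M) (t : ℝ) : E3 →L[ℝ] ℝ :=
  α (γ t)

/-- The form `dα(γ', ·)` along the curve `γ`. -/
noncomputable def axisDeriv (α : ∀ p : M, TangentSpace (𝓡 3) p →L[ℝ] ℝ) (γ : ℝ → M) (t : ℝ) : E3 →L[ℝ] ℝ :=
  (exists_extD_bilin α (γ t)).choose (velocity γ t)

theorem axisDeriv_apply (t : ℝ) (v : E3) :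
    axisDeriv α γ t v = extD α (γ t) (velocity γ t) v :=
  ((exists_extD_bilin α (γ t)).choose_spec.1 _ _).symm

theorem velocity_add_int (hγ : Periodic γ 1) (n : ℤ) (t : ℝ) :
    (velocity γ (t + n) : E3) = velocity γ t := by
  have h : (fun s ↦ γ (s + n)) = γ := funext fun s ↦ by
    have := hγ.int_mul n s
    simpa using this
  by_cases hd : MDifferentiableAt 𝓘(ℝ, ℝ) (𝓡 3) γ (t + n)
  · have h1 : (mfderiv 𝓘(ℝ, ℝ) (𝓡 3) (fun s ↦ γ (s + n)) t (1 : ℝ) : E3) = velocity γ (t + n) := by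
      have h2 : mfderiv 𝓘(ℝ, ℝ) (𝓡 3) (γ ∘ fun s ↦ s + (n : ℝ)) t = _ :=
        mfderiv_comp (I' := 𝓘(ℝ, ℝ)) (f := fun s ↦ s + (n : ℝ)) t hd
          (by fun_prop : DifferentiableAt ℝ (fun s ↦ s + (n : ℝ)) t).mdifferentiableAt
      have h3 : fderiv ℝ (fun s ↦ s + (n : ℝ)) t = ContinuousLinearMap.id ℝ ℝ := by
        rw [fderiv_add_const]; exact fderiv_id
      rw [mfderiv_eq_fderiv, h3] at h2
      exact DFunLike.congr_fun h2 (1 : ℝ)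
    rw [← h1, h]; rfl
  · have hd' : ¬ MDifferentiableAt 𝓘(ℝ, ℝ) (𝓡 3) γ t := fun h2 ↦ hd (by
      have h4 : MDifferentiableAt 𝓘(ℝ, ℝ) (𝓡 3) γ ((fun s ↦ s - (n : ℝ)) (t + n)) := by simpa
      have h3 := MDifferentiableAt.comp (I' := 𝓘(ℝ, ℝ)) (f := fun s ↦ s - (n : ℝ)) (t + n) h4
        (by fun_prop : DifferentiableAt ℝ (fun s ↦ s - (n : ℝ)) (t + n)).mdifferentiableAt
      convert h3 using 1
      ext s
      have := congrFun h (s - n)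
      simpa using this)
    rw [velocity, velocity, mfderiv_zero_of_not_mdifferentiableAt hd,
      mfderiv_zero_of_not_mdifferentiableAt hd']
    rfl

theorem axisForm_add_int (hγ : Periodic γ 1) (n : ℤ) (t : ℝ) :
    axisForm α γ (t + n) = axisForm α γ t := by
  have h : γ (t + n) = γ t := by simpa using hγ.int_mul n t
  exact congrArg (fun p : M ↦ (show E3 →L[ℝ] ℝ from α p)) h

theorem axisDeriv_add_int (hγ : Periodic γ 1) (n : ℤ) (t : ℝ) :
    axisDeriv α γ (t + n) = axisDeriv α γ t := by
  have h : γ (t + n) = γ t := by simpa using hγ.int_mul n t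
  have h2 : ∀ (p q : M) (u v : E3), p = q → u = v →
      (exists_extD_bilin α p).choose u = (exists_extD_bilin α q).choose v := by
    rintro p q u v rfl rfl; rfl
  exact h2 _ _ _ _ h (velocity_add_int hγ n t)

section AxisForms

variable {g : ℝ × ℝ × ℝ → M} {t : ℝ}

theorem vecDeriv_axis (hg : ContMDiffAt 𝓘(ℝ, ℝ × ℝ × ℝ) (𝓡 3) ∞ g (t, 0))
    (hax : ∀ᶠ s in 𝓝 t, g (s, 0) = γ s) :
    vecDeriv g (t, 0) (1, 0) = (velocity γ t : E3) := by
  have h1 : HasFDerivAt (fun s : ℝ ↦ (s, (0 : ℝ × ℝ))) (ContinuousLinearMap.inl ℝ ℝ (ℝ × ℝ)) t :=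
    (ContinuousLinearMap.inl ℝ ℝ (ℝ × ℝ)).hasFDerivAt
  have h2 : vecDeriv (g ∘ fun s : ℝ ↦ (s, (0 : ℝ × ℝ))) t = _ :=
    vecDeriv_comp (g := g) hg h1.differentiableAt
  have h3 : (g ∘ fun s : ℝ ↦ (s, (0 : ℝ × ℝ))) =ᶠ[𝓝 t] γ := hax
  rw [h1.fderiv] at h2
  have h4 : vecDeriv γ t = vecDeriv (g ∘ fun s : ℝ ↦ (s, (0 : ℝ × ℝ))) t := h3.mfderiv_eq.symm
  have h5 := DFunLike.congr_fun (h4.trans h2) (1 : ℝ)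
  refine Eq.trans ?_ h5.symm
  simp

theorem pullForm_axis (hax : g (t, 0) = γ t) (u : ℝ × ℝ × ℝ) :
    pullForm α g (t, 0) u = axisForm α γ t (vecDeriv g (t, 0) u) :=
  congrArg (fun p : M ↦ (α p : E3 →L[ℝ] ℝ) (vecDeriv g (t, 0) u)) hax

theorem extDVec_pullForm_axis (hα : IsSmoothOneForm α)
    (hg : ContMDiffAt 𝓘(ℝ, ℝ × ℝ × ℝ) (𝓡 3) ∞ g (t, 0))
    (hax : ∀ᶠ s in 𝓝 t, g (s, 0) = γ s) (u : ℝ × ℝ × ℝ) :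
    extDVec (pullForm α g) (t, 0) (1, 0) u = axisDeriv α γ t (vecDeriv g (t, 0) u) := by
  rw [extDVec_pullForm hα hg, axisDeriv_apply]
  have h2 : ∀ (p q : M) (u v w : E3), p = q → u = v →
      extD α p u w = extD α q v w := by
    rintro p q u v w rfl rfl; rfl
  exact h2 _ _ _ _ (vecDeriv g (t, 0) u) hax.self_of_nhds (vecDeriv_axis hg hax)

end AxisForms

theorem IsTube.ofCurve (hγ : IsLegendrianKnot α γ) : IsTube γ fun z : ℝ × ℝ × ℝ ↦ γ z.1 where
  periodic z := hγ.periodic z.1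
  eventually_smooth _ := Filter.Eventually.of_forall fun z ↦
    (hγ.smooth _).comp z (contMDiff_iff_contDiff.2 contDiff_fst _)
  axis _ := rfl

/-- Repeated use of `IsTube.step`, starting from the degenerate tube that ignores the transverse
variables and so has zero transverse derivative. -/
theorem exists_tube_sum (hγ : IsLegendrianKnot α γ) {ι : Type*} (s : Finset ι) (p : ι → M)
    (L : ι → ℝ × ℝ →L[ℝ] E3) {ρ : ι → ℝ → ℝ} (hρ : ∀ i, ContDiff ℝ ∞ (ρ i))
    (hper : ∀ i, Periodic (ρ i) 1)
    (hsupp : ∀ i t, γ t ∈ (extChartAt (𝓡 3) (p i)).source ∨ ∀ᶠ s in 𝓝 t, ρ i s = 0) :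
    ∃ T : ℝ × ℝ × ℝ → M, IsTube γ T ∧ ∀ (t : ℝ) (w : ℝ × ℝ),
      vecDeriv T (t, 0) (0, w) = ∑ i ∈ s, ρ i t •
        vecDeriv (extChartAt (𝓡 3) (p i)).symm (extChartAt (𝓡 3) (p i) (γ t)) (L i w) := by
  classical
  induction s using Finset.induction_on with
  | empty =>
    refine ⟨_, IsTube.ofCurve hγ, fun t w ↦ ?_⟩
    have h : vecDeriv (γ ∘ fun z : ℝ × ℝ × ℝ ↦ z.1) (t, 0) = _ :=
      vecDeriv_comp (g := γ) (hγ.smooth _) differentiable_fst.differentiableAt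
    have h2 := DFunLike.congr_fun h (0, w)
    refine h2.trans ?_
    have h3 : fderiv ℝ (fun z : ℝ × ℝ × ℝ ↦ z.1) (t, 0) = ContinuousLinearMap.fst ℝ ℝ (ℝ × ℝ) :=
      hasFDerivAt_fst.fderiv
    rw [h3]
    simp
  | insert i s hi ih =>
    obtain ⟨T, hT, hd⟩ := ih
    obtain ⟨T', hT', hd'⟩ := hT.step (p i) (L i) (hρ i) (hper i) (hsupp i)
    refine ⟨T', hT', fun t w ↦ ?_⟩
    rw [hd', hd, Finset.sum_insert hi, add_comm]

/-- The frame of `exists_contact_frame` satisfies the four equations exactly at `t₀`, hence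
approximately nearby. Each estimate bounds a linear functional of the frame, so it survives weighted
sums of frames chosen at different `t₀`. -/
theorem exists_cone_frame (hα : IsContactForm α) (hγ : IsLegendrianKnot α γ) (t₀ : ℝ) :
    ∃ L : ℝ × ℝ →L[ℝ] E3, ∀ᶠ t in 𝓝 t₀, γ t ∈ (extChartAt (𝓡 3) (γ t₀)).source ∧
      ∀ v : ℝ × ℝ → E3, (∀ w, v w = vecDeriv (extChartAt (𝓡 3) (γ t₀)).symm
        (extChartAt (𝓡 3) (γ t₀) (γ t)) (L w)) →
      |axisDeriv α γ t (v (1, 0)) - 1| < 1 / 8 ∧ |axisForm α γ t (v (1, 0))| < 1 / 8 ∧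
      |axisDeriv α γ t (v (0, 1))| < 1 / 8 ∧ |axisForm α γ t (v (0, 1)) - 1| < 1 / 8 := by
  obtain ⟨u, v, w, hW⟩ := hα.wedge_ne_zero (γ t₀)
  obtain ⟨B, hB, hBa⟩ := exists_extD_bilin α (γ t₀)
  obtain ⟨n, r, h1, h2, h3, h4⟩ := exists_contact_frame (E := E3) (by simp) (α (γ t₀)) B hBa
    (u := u) (v := v) (w := w) (by
      have := hW
      rw [show extD α (γ t₀) v w = _ from hB v w, show extD α (γ t₀) w u = _ from hB w u,
        show extD α (γ t₀) u v = _ from hB u v] at this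
      exact this) (x := velocity γ t₀) (hγ.regular t₀) (hγ.legendrian t₀)
  set κ := extChartAt (𝓡 3) (γ t₀) with hκ
  set L : ℝ × ℝ →L[ℝ] E3 := (ContinuousLinearMap.fst ℝ ℝ ℝ).smulRight n
    + (ContinuousLinearMap.snd ℝ ℝ ℝ).smulRight r with hL
  set G : ℝ × ℝ × ℝ → E3 := fun z ↦ κ (γ z.1) + L z.2 with hG
  have hG0 : ∀ t : ℝ, G (t, 0) = κ (γ t) := fun t ↦ by simp [hG]
  have hsrc : ∀ᶠ t in 𝓝 t₀, γ t ∈ κ.source :=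
    hγ.smooth.continuous.continuousAt
      ((isOpen_extChartAt_source _).mem_nhds (mem_extChartAt_source (γ t₀)))
  have hkg : ∀ t, γ t ∈ κ.source → ContDiffAt ℝ ∞ (κ ∘ γ) t := fun t ht ↦
    contDiffAt_extChartAt_comp (hγ.smooth t) ht
  have hGs : ∀ t, γ t ∈ κ.source → ContDiffAt ℝ ∞ G (t, 0) := fun t ht ↦
    (ContDiffAt.comp (t, (0 : ℝ × ℝ)) (hkg t ht) contDiffAt_fst).add
      (L.contDiff.comp contDiff_snd).contDiffAt
  have hsy : ∀ t, γ t ∈ κ.source →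
      ContMDiffAt 𝓘(ℝ, E3) (𝓡 3) ∞ κ.symm (G (t, 0)) := fun t ht ↦
    contMDiffAt_extChartAt_symm (by rw [hG0]; exact κ.map_source ht)
  have hhs : ∀ t, γ t ∈ κ.source →
      ContMDiffAt 𝓘(ℝ, ℝ × ℝ × ℝ) (𝓡 3) ∞ (κ.symm ∘ G) (t, 0) := fun t ht ↦
    (hsy t ht).comp _ (hGs t ht).contMDiffAt
  have hax : ∀ᶠ t in 𝓝 t₀, ∀ᶠ s in 𝓝 t, (κ.symm ∘ G) (s, 0) = γ s := by
    refine Filter.Eventually.eventually_nhds ?_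
    filter_upwards [hsrc] with t ht
    simp only [comp_apply, hG0]
    exact κ.left_inv ht
  have hdv : ∀ t, γ t ∈ κ.source → ∀ w, vecDeriv (κ.symm ∘ G) (t, 0) (0, w) =
      vecDeriv κ.symm (κ (γ t)) (L w) := fun t ht w ↦ by
    rw [vecDeriv_comp (hsy t ht) ((hGs t ht).differentiableAt (by simp)), hG0]
    have h5 : HasFDerivAt G ((fderiv ℝ (κ ∘ γ) t).comp (ContinuousLinearMap.fst ℝ ℝ (ℝ × ℝ))
        + L.comp (ContinuousLinearMap.snd ℝ ℝ (ℝ × ℝ))) (t, 0) := by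
      refine HasFDerivAt.add ?_ (L.comp (ContinuousLinearMap.snd ℝ ℝ (ℝ × ℝ))).hasFDerivAt
      exact HasFDerivAt.comp (g := κ ∘ γ) (f := Prod.fst) (t, (0 : ℝ × ℝ))
        ((hkg t ht).differentiableAt (by simp)).hasFDerivAt hasFDerivAt_fst
    rw [h5.fderiv]
    simp
  -- The quantities to be estimated are coefficients of `lam` and of its exterior derivative along
  -- the axis of this local tube; that is why they are continuous in `t`.
  set lam := pullForm α (κ.symm ∘ G) with hlam
  have ht₀ : γ t₀ ∈ κ.source := hsrc.self_of_nhds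
  have hls : ContDiffAt ℝ ∞ lam (t₀, 0) := contDiffAt_pullForm hα.smooth (hhs t₀ ht₀)
  have hcin : ContinuousAt (fun t : ℝ ↦ (t, (0 : ℝ × ℝ))) t₀ := by fun_prop
  have hc1 : ∀ u, ContinuousAt (fun t : ℝ ↦ lam (t, 0) u) t₀ := fun u ↦
    (ContinuousAt.comp (g := lam) (f := fun t : ℝ ↦ (t, (0 : ℝ × ℝ))) hls.continuousAt hcin).clm_apply
      continuousAt_const
  have hc2 : ∀ u v, ContinuousAt (fun t : ℝ ↦ extDVec lam (t, 0) u v) t₀ := fun u v ↦ by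
    have h := ContinuousAt.comp (g := fderiv ℝ lam) (f := fun t : ℝ ↦ (t, (0 : ℝ × ℝ)))
      (hls.fderiv_right (m := ∞) (by simp)).continuousAt hcin
    exact ((h.clm_apply continuousAt_const).clm_apply continuousAt_const).sub
      ((h.clm_apply continuousAt_const).clm_apply continuousAt_const)
  have hid : ∀ x, vecDeriv κ.symm (κ (γ t₀)) x = x := fun x ↦ by
    have := mfderiv_symm_apply_mfderiv ht₀ x
    rw [mfderiv_extChartAt_self] at this
    exact this
  have e1 : lam (t₀, 0) (0, 1, 0) = 0 := by
    rw [hlam, pullForm_axis hax.self_of_nhds.self_of_nhds, hdv _ ht₀, hid, hL]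
    have h : L (1, 0) = n := by simp [hL]
    exact (congrArg (axisForm α γ t₀) h).trans h1
  have e2 : lam (t₀, 0) (0, 0, 1) = 1 := by
    rw [hlam, pullForm_axis hax.self_of_nhds.self_of_nhds, hdv _ ht₀, hid, hL]
    have h : L (0, 1) = r := by simp [hL]
    exact (congrArg (axisForm α γ t₀) h).trans h3
  have e3 : extDVec lam (t₀, 0) (1, 0) (0, 1, 0) = 1 := by
    rw [hlam, extDVec_pullForm_axis hα.smooth (hhs _ ht₀) hax.self_of_nhds, hdv _ ht₀, hid, hL,
      axisDeriv_apply]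
    refine (hB _ _).trans ?_
    simpa using h2
  have e4 : extDVec lam (t₀, 0) (1, 0) (0, 0, 1) = 0 := by
    rw [hlam, extDVec_pullForm_axis hα.smooth (hhs _ ht₀) hax.self_of_nhds, hdv _ ht₀, hid, hL,
      axisDeriv_apply]
    refine (hB _ _).trans ?_
    simpa using h4
  have c1 := ((hc1 (0, 1, 0)).abs).eventually_lt (g := fun _ ↦ (1 / 8 : ℝ)) continuousAt_const
    (by simp only [e1]; norm_num)
  have c2 := (((hc1 (0, 0, 1)).sub_const 1).abs).eventually_lt (g := fun _ ↦ (1 / 8 : ℝ))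
    continuousAt_const (by simp only [e2]; norm_num)
  have c3 := (((hc2 (1, 0) (0, 1, 0)).sub_const 1).abs).eventually_lt (g := fun _ ↦ (1 / 8 : ℝ))
    continuousAt_const (by simp only [e3]; norm_num)
  have c4 := ((hc2 (1, 0) (0, 0, 1)).abs).eventually_lt (g := fun _ ↦ (1 / 8 : ℝ))
    continuousAt_const (by simp only [e4]; norm_num)
  refine ⟨L, ?_⟩
  filter_upwards [c1, c2, c3, c4, hsrc, hax] with t d1 d2 d3 d4 ht hat
  refine ⟨ht, fun v hv ↦ ?_⟩
  rw [hlam, pullForm_axis hat.self_of_nhds, hdv _ ht, ← hv] at d1 d2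
  rw [hlam, extDVec_pullForm_axis hα.smooth (hhs _ ht) hat, hdv _ ht, ← hv] at d3 d4
  exact ⟨d3, d1, d4, d2⟩

/-- A Legendrian knot has a tubular map along which the pulled back form satisfies the
hypotheses of the normal form theorem. -/
theorem exists_tube (hα : IsContactForm α) (hγ : IsLegendrianKnot α γ) :
    ∃ T : ℝ × ℝ × ℝ → M, IsTube γ T ∧ ∀ t : ℝ, pullForm α T (t, 0) (1, 0) = 0 ∧
      extDVec (pullForm α T) (t, 0) (1, 0, 0) (0, 1, 0) ≠ 0 ∧
      pullForm α T (t, 0) (reebVec (pullForm α T) (t, 0)) ≠ 0 := by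
  choose L hL using exists_cone_frame hα hγ
  have hδ : ∀ t₀ : ℝ, ∃ δ > 0, ∀ t, |t - t₀| < δ → _ := fun t₀ ↦ by
    obtain ⟨δ, h, h'⟩ := Metric.eventually_nhds_iff.1 (hL t₀)
    exact ⟨δ, h, fun t ht ↦ h' (by rwa [Real.dist_eq])⟩
  choose δ hδ0 hcone using hδ
  have hbump := fun t₀ ↦ exists_periodic_bump t₀ (hδ0 t₀)
  choose ρ hρs hρp hρ0 hρt hρz using hbump
  have hper : ∀ (n : ℤ) t, γ (t - n) = γ t := fun n t ↦ by
    have := hγ.periodic.int_mul (-n) t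
    simpa [sub_eq_add_neg] using this
  have hcone' : ∀ (t₀ t : ℝ) (n : ℤ), |t - n - t₀| < δ t₀ →
      γ t ∈ (extChartAt (𝓡 3) (γ t₀)).source ∧
      ∀ v : ℝ × ℝ → E3, (∀ w, v w = vecDeriv (extChartAt (𝓡 3) (γ t₀)).symm
        (extChartAt (𝓡 3) (γ t₀) (γ t)) (L t₀ w)) →
      |axisDeriv α γ t (v (1, 0)) - 1| < 1 / 8 ∧ |axisForm α γ t (v (1, 0))| < 1 / 8 ∧
      |axisDeriv α γ t (v (0, 1))| < 1 / 8 ∧ |axisForm α γ t (v (0, 1)) - 1| < 1 / 8 := by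
    intro t₀ t n h
    have := hcone t₀ (t - n) h
    rw [hper, ← axisForm_add_int hγ.periodic n (t - n), ← axisDeriv_add_int hγ.periodic n (t - n),
      sub_add_cancel] at this
    exact this
  obtain ⟨s, -, hs⟩ := (isCompact_Icc (a := (0 : ℝ)) (b := 1)).elim_nhds_subcover
    (fun t₀ ↦ {t | 0 < ρ t₀ t}) fun t₀ _ ↦
      ((hρs t₀).continuous.continuousAt (x := t₀)).eventually (lt_mem_nhds (hρt t₀))
  obtain ⟨T, hT, hd⟩ := exists_tube_sum hγ s γ L hρs hρp fun t₀ t ↦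
    (hρz t₀ t).imp_left fun ⟨n, hn⟩ ↦ (hcone' t₀ t n hn).1
  refine ⟨T, hT, fun t ↦ ?_⟩
  have hax : ∀ᶠ s in 𝓝 t, T (s, 0) = γ s := Filter.Eventually.of_forall hT.axis
  set m := ∑ i ∈ s, ρ i t with hm
  have hm0 : 0 < m := by
    obtain ⟨i, hi, hit⟩ : ∃ i ∈ s, 0 < ρ i (Int.fract t) := by
      have := hs ⟨Int.fract_nonneg t, (Int.fract_lt_one t).le⟩
      simpa using this
    refine Finset.sum_pos' (fun i _ ↦ hρ0 i t) ⟨i, hi, ?_⟩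
    have h2 := (hρp i).sub_int_mul_eq (x := t) ⌊t⌋
    rw [mul_one] at h2
    change ρ i (Int.fract t) = ρ i t at h2
    rwa [← h2]
  -- The weights are not normalized: with total weight `m`, both the value and the error scale by
  -- `m`.
  have key : ∀ (A : E3 →L[ℝ] ℝ) (w : ℝ × ℝ) (c : ℝ),
      (∀ i (n : ℤ), |t - n - i| < δ i → |A (vecDeriv (extChartAt (𝓡 3) (γ i)).symm
        (extChartAt (𝓡 3) (γ i) (γ t)) (L i w)) - c| < 1 / 8) →
      |A (vecDeriv T (t, 0) (0, w)) - c * m| ≤ m / 8 := by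
    intro A w c h
    rw [hd, map_sum, hm, Finset.mul_sum, ← Finset.sum_sub_distrib, Finset.sum_div]
    refine (Finset.abs_sum_le_sum_abs _ _).trans (Finset.sum_le_sum fun i _ ↦ ?_)
    rw [map_smul, smul_eq_mul, mul_comm c, ← mul_sub, abs_mul, abs_of_nonneg (hρ0 i t)]
    rcases hρz i t with ⟨n, hn⟩ | h0
    · have := h i n hn
      nlinarith [hρ0 i t]
    · rw [h0.self_of_nhds]; simp
  have k1 := key (axisDeriv α γ t) (1, 0) 1 fun i n h ↦ ((hcone' i t n h).2 _ fun _ ↦ rfl).1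
  have k2 := key (axisForm α γ t) (1, 0) 0 fun i n h ↦ by
    simpa using ((hcone' i t n h).2 _ fun _ ↦ rfl).2.1
  have k3 := key (axisDeriv α γ t) (0, 1) 0 fun i n h ↦ by
    simpa using ((hcone' i t n h).2 _ fun _ ↦ rfl).2.2.1
  have k4 := key (axisForm α γ t) (0, 1) 1 fun i n h ↦ ((hcone' i t n h).2 _ fun _ ↦ rfl).2.2.2
  rw [← extDVec_pullForm_axis hα.smooth (hT.smooth t) hax] at k1 k3
  rw [← pullForm_axis (hT.axis t)] at k2 k4
  have e0 : pullForm α T (t, 0) (1, 0) = 0 := by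
    rw [pullForm_axis (hT.axis t), vecDeriv_axis (hT.smooth t) hax]
    exact hγ.legendrian t
  rw [abs_le] at k1 k2 k3 k4
  have e31 : extDVec (pullForm α T) (t, 0) (0, 0, 1) (1, 0, 0)
      = - extDVec (pullForm α T) (t, 0) (1, 0) (0, 0, 1) := by
    simp only [extDVec]; exact (neg_sub _ _).symm
  refine ⟨e0, fun h ↦ ?_, ?_⟩
  · have : extDVec (pullForm α T) (t, 0) (1, 0) (0, 1, 0) = 0 := h
    rw [this] at k1; linarith
  · rw [vec_eq (reebVec (pullForm α T) (t, 0)), map_add, map_add, map_smul, map_smul, map_smul]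
    have e0' : pullForm α T (t, 0) (1, 0, 0) = 0 := e0
    rw [e0']
    simp only [reebVec, e31, smul_eq_mul]
    set p := extDVec (pullForm α T) (t, 0) (1, 0) (0, 1, 0) with hp
    set q := extDVec (pullForm α T) (t, 0) (1, 0) (0, 0, 1) with hq
    have hp' : extDVec (pullForm α T) (t, 0) (1, 0, 0) (0, 1, 0) = p := rfl
    rw [hp']
    set a := pullForm α T (t, 0) (0, 1, 0)
    set b := pullForm α T (t, 0) (0, 0, 1)
    -- The value on the Reeb direction is `b * p - q * a`, and (7/8)² exceeds (1/8)².
    have f1 : 7 / 8 * m * (7 / 8 * m) ≤ b * p :=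
      mul_le_mul (by linarith) (by linarith) (by positivity) (by linarith)
    have f2 : |q * a| ≤ m / 8 * (m / 8) := by
      rw [abs_mul]
      exact mul_le_mul (abs_le.2 ⟨by linarith, by linarith⟩) (abs_le.2 ⟨by linarith, by linarith⟩)
        (abs_nonneg _) (by positivity)
    have := (abs_le.1 f2).2
    have hm2 : 0 < m * m := by positivity
    refine ne_of_gt ?_
    nlinarith

end Tube

/-! ### The inverse function theorem for maps into the manifold. -/

section LocalInverse

variable {M : Type*} [TopologicalSpace M] [ChartedSpace E3 M] [IsManifold (𝓡 3) ∞ M]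
  {V : Type*} [NormedAddCommGroup V] [NormedSpace ℝ V] [CompleteSpace V]

/-- The inverse function theorem in the chart at `F z₀`. Smoothness of the inverse at neighbouring
points is a conditional clause, because it needs the hypotheses on `F` near `z₀` and not only at
`z₀`. -/
theorem exists_local_inverse {F : V → M} {z₀ : V} (hF : ContMDiffAt 𝓘(ℝ, V) (𝓡 3) ∞ F z₀)
    (hb : Bijective (vecDeriv F z₀)) :
    ∃ l : M → V, ContMDiffAt (𝓡 3) 𝓘(ℝ, V) ∞ l (F z₀) ∧
      ((∀ᶠ z in 𝓝 z₀, ContMDiffAt 𝓘(ℝ, V) (𝓡 3) ∞ F z ∧ Bijective (vecDeriv F z)) →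
        ∀ᶠ p in 𝓝 (F z₀), ContMDiffAt (𝓡 3) 𝓘(ℝ, V) ∞ l p) ∧
      (∀ᶠ p in 𝓝 (F z₀), F (l p) = p) ∧
      ∀ᶠ z in 𝓝 z₀, l (F z) = z := by
  set κ := extChartAt (𝓡 3) (F z₀) with hκ
  have hsrc : F z₀ ∈ κ.source := mem_extChartAt_source (F z₀)
  have hK : ContDiffAt ℝ ∞ (κ ∘ F) z₀ := contDiffAt_extChartAt_comp hF hsrc
  have hequiv : ∀ z, ContMDiffAt 𝓘(ℝ, V) (𝓡 3) ∞ F z → Bijective (vecDeriv F z) →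
      F z ∈ κ.source → ∃ A : V ≃L[ℝ] E3, HasFDerivAt (κ ∘ F) (A : V →L[ℝ] E3) z := by
    intro z hz hzb hzs
    have hzs' : F z ∈ (chartAt E3 (F z₀)).source := by rwa [← extChartAt_source (𝓡 3)]
    have hd : fderiv ℝ (κ ∘ F) z = (mfderiv (𝓡 3) 𝓘(ℝ, E3) κ (F z)).comp (vecDeriv F z) := by
      rw [← mfderiv_eq_fderiv]
      exact mfderiv_comp z (mdifferentiableAt_extChartAt hzs') (hz.mdifferentiableAt (by simp))
    have hi := isInvertible_mfderiv_extChartAt (I := 𝓡 3) hzs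
    have hd2 : Bijective (fderiv ℝ (κ ∘ F) z) := by
      rw [hd]; exact Bijective.comp (g := mfderiv (𝓡 3) 𝓘(ℝ, E3) κ (F z)) hi.bijective hzb
    refine ⟨ContinuousLinearEquiv.ofBijective (fderiv ℝ (κ ∘ F) z)
      (LinearMap.ker_eq_bot.2 hd2.1) (LinearMap.range_eq_top.2 hd2.2), ?_⟩
    have := ((contDiffAt_extChartAt_comp hz hzs).differentiableAt (by simp)).hasFDerivAt
    rwa [ContinuousLinearEquiv.coe_ofBijective]
  obtain ⟨A, hA⟩ := hequiv z₀ hF hb hsrc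
  have hs := hK.hasStrictFDerivAt' hA (by simp)
  refine ⟨hs.localInverse (κ ∘ F) A z₀ ∘ κ, ?_, fun hev ↦ ?_, ?_, ?_⟩
  · refine ContMDiffAt.comp (I' := 𝓘(ℝ, E3)) _ (ContDiffAt.contMDiffAt ?_) contMDiffAt_extChartAt
    exact hK.to_localInverse hA (by simp)
  · have hc : ContinuousAt κ (F z₀) := continuousAt_extChartAt _
    have h3 : Filter.Tendsto (hs.localInverse (κ ∘ F) A z₀ ∘ κ) (𝓝 (F z₀)) (𝓝 z₀) :=
      hs.localInverse_tendsto.comp hc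
    have h5 : ∀ᶠ p in 𝓝 (F z₀), κ p ∈ (hs.toOpenPartialHomeomorph (κ ∘ F)).target :=
      hc ((hs.toOpenPartialHomeomorph (κ ∘ F)).open_target.mem_nhds
        hs.image_mem_toOpenPartialHomeomorph_target)
    filter_upwards [h3.eventually hev, extChartAt_source_mem_nhds (I := 𝓡 3) (F z₀), h5,
      h3.eventually (hF.continuousAt (extChartAt_source_mem_nhds (I := 𝓡 3) (F z₀)))]
      with p hp hps hp5 hp6
    obtain ⟨B, hB⟩ := hequiv _ hp.1 hp.2 hp6
    have hps' : p ∈ (chartAt E3 (F z₀)).source := by rwa [← extChartAt_source (𝓡 3)]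
    refine ContMDiffAt.comp (I' := 𝓘(ℝ, E3)) _ (ContDiffAt.contMDiffAt ?_)
      (contMDiffAt_extChartAt' hps')
    exact (hs.toOpenPartialHomeomorph (κ ∘ F)).contDiffAt_symm hp5 hB
      (contDiffAt_extChartAt_comp hp.1 hp6)
  · have hc : ContinuousAt κ (F z₀) := continuousAt_extChartAt _
    have h1 := hc.eventually hs.eventually_right_inverse
    have h2 : ∀ᶠ p in 𝓝 (F z₀), p ∈ κ.source := extChartAt_source_mem_nhds _
    have h3 : Filter.Tendsto (hs.localInverse (κ ∘ F) A z₀ ∘ κ) (𝓝 (F z₀)) (𝓝 z₀) :=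
      hs.localInverse_tendsto.comp hc
    have h4 := (hF.continuousAt.tendsto.comp h3).eventually h2
    filter_upwards [h1, h2, h4] with p hp1 hp2 hp4
    exact κ.injOn hp4 hp2 hp1
  · exact hs.eventually_left_inverse

theorem map_nhds_of_bijective {F : V → M} {z₀ : V} (hF : ContMDiffAt 𝓘(ℝ, V) (𝓡 3) ∞ F z₀)
    (hb : Bijective (vecDeriv F z₀)) : Filter.map F (𝓝 z₀) = 𝓝 (F z₀) := by
  obtain ⟨l, hl, -, h1, h2⟩ := exists_local_inverse hF hb
  refine le_antisymm hF.continuousAt ?_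
  have h3 : Filter.Tendsto l (𝓝 (F z₀)) (𝓝 z₀) := by
    have := hl.continuousAt.tendsto
    rwa [h2.self_of_nhds] at this
  calc 𝓝 (F z₀) = Filter.map (F ∘ l) (𝓝 (F z₀)) := by
        conv_lhs => rw [← Filter.map_id (f := 𝓝 (F z₀))]
        exact Filter.map_congr (h1.mono fun p hp ↦ hp.symm)
    _ ≤ _ := by rw [← Filter.map_map]; exact Filter.map_mono h3

theorem exists_injOn_of_bijective {F : V → M} {z₀ : V} (hF : ContMDiffAt 𝓘(ℝ, V) (𝓡 3) ∞ F z₀)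
    (hb : Bijective (vecDeriv F z₀)) : ∃ U ∈ 𝓝 z₀, InjOn F U := by
  obtain ⟨l, hl, -, h1, h2⟩ := exists_local_inverse hF hb
  exact ⟨_, h2, fun x hx y hy h ↦ by rw [← show l (F x) = x from hx, h]; exact hy⟩

end LocalInverse

/-! ### Contact coordinates on the universal cover. -/

section Coordinates

variable {M : Type*} [TopologicalSpace M] [ChartedSpace E3 M] [IsManifold (𝓡 3) ∞ M]
  {α : ∀ p : M, TangentSpace (𝓡 3) p →L[ℝ] ℝ} {γ : ℝ → M}

/-- The pulled back form is smooth only near the axis, so it is multiplied by a transverse cut-off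
before `exists_contact_normalForm` applies. The radius is then shrunk until the resulting coordinate
change stays where the cut-off is 1. -/
theorem exists_contact_tube (hα : IsContactForm α) (hγ : IsLegendrianKnot α γ) :
    ∃ δ > 0, ∃ F : ℝ × ℝ × ℝ → M,
      (∀ z : ℝ × ℝ × ℝ, ‖z.2‖ < δ → F (z + (1, 0)) = F z) ∧
      (∀ z : ℝ × ℝ × ℝ, ‖z.2‖ < δ → ContMDiffAt 𝓘(ℝ, ℝ × ℝ × ℝ) (𝓡 3) ∞ F z) ∧
      (∀ t, F (t, 0) = γ t) ∧
      ∀ z : ℝ × ℝ × ℝ, ‖z.2‖ < δ → pullForm α F z = stdForm z := by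
  obtain ⟨T, hT, hTα⟩ := exists_tube hα hγ
  have hTe : T ∘ (fun z ↦ z + (1, 0)) = T := funext hT.periodic
  have hsm : ∀ z, ContMDiffAt 𝓘(ℝ, ℝ × ℝ × ℝ) (𝓡 3) ∞ T (z + (1, 0)) →
      ContMDiffAt 𝓘(ℝ, ℝ × ℝ × ℝ) (𝓡 3) ∞ T z := fun z hz ↦ by
    rw [← hTe]
    exact hz.comp (f := fun z : ℝ × ℝ × ℝ ↦ z + (1, 0)) z
      (contDiff_id.add contDiff_const).contDiffAt.contMDiffAt
  have hsm' : ∀ z, ContMDiffAt 𝓘(ℝ, ℝ × ℝ × ℝ) (𝓡 3) ∞ T z →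
      ContMDiffAt 𝓘(ℝ, ℝ × ℝ × ℝ) (𝓡 3) ∞ T (z + (1, 0)) := fun z hz ↦ by
    have h : T = T ∘ (fun z ↦ z - (1, 0)) := funext fun w ↦ by
      have := hT.periodic (w - (1, 0)); rw [sub_add_cancel] at this; exact this
    rw [h]
    refine ContMDiffAt.comp (f := fun z : ℝ × ℝ × ℝ ↦ z - (1, 0)) _ (by simpa using hz)
      (contDiff_id.sub contDiff_const).contDiffAt.contMDiffAt
  obtain ⟨δ₀, hδ₀, hTs⟩ := exists_tube_subset
    (A := {z | ContMDiffAt 𝓘(ℝ, ℝ × ℝ × ℝ) (𝓡 3) ∞ T z}) hT.eventually_smooth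
    (fun z hz ↦ ⟨hsm' z hz, hsm _ (by simpa using hz)⟩)
  have hTp : ∀ z : ℝ × ℝ × ℝ, ‖z.2‖ < δ₀ → pullForm α T (z + (1, 0)) = pullForm α T z := by
    intro z hz
    have h1 : vecDeriv (T ∘ (fun z ↦ z + (1, 0))) z = _ :=
      vecDeriv_comp (f := fun z : ℝ × ℝ × ℝ ↦ z + (1, 0)) (hsm' z (hTs z hz))
        (by fun_prop)
    rw [hTe, fderiv_add_const, fderiv_fun_id] at h1
    have h2 : vecDeriv T z = vecDeriv T (z + (1, 0)) := h1
    have h3 : ∀ (p q : M) (u v : ℝ × ℝ × ℝ →L[ℝ] E3), p = q → u = v →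
      (show E3 →L[ℝ] ℝ from α p).comp u = (show E3 →L[ℝ] ℝ from α q).comp v := by
      rintro p q u v rfl rfl; rfl
    exact h3 _ _ _ _ (hT.periodic z) h2.symm
  let χ : ContDiffBump (0 : ℝ × ℝ) := ⟨δ₀ / 4, δ₀ / 2, by linarith, by linarith⟩
  set β : ℝ × ℝ × ℝ → ℝ × ℝ × ℝ →L[ℝ] ℝ := fun z ↦ χ z.2 • pullForm α T z with hβ
  have hβ1 : ∀ z : ℝ × ℝ × ℝ, ‖z.2‖ < δ₀ / 4 → β z = pullForm α T z := fun z hz ↦ by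
    have : χ z.2 = 1 := χ.one_of_mem_closedBall (by
      rw [mem_closedBall_zero_iff]; exact hz.le)
    simp [hβ, this]
  have hβ0 : ∀ z : ℝ × ℝ × ℝ, δ₀ / 2 < ‖z.2‖ → β z = 0 := fun z hz ↦ by
    have : χ z.2 = 0 := χ.zero_of_le_dist (by rw [dist_zero_right]; exact hz.le)
    simp [hβ, this]
  have hβs : ContDiff ℝ ∞ β := by
    rw [contDiff_iff_contDiffAt]
    intro z
    by_cases hz : ‖z.2‖ < δ₀
    · exact (χ.contDiff.comp contDiff_snd).contDiffAt.smul
        (contDiffAt_pullForm hα.smooth (hTs z hz))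
    · refine (contDiffAt_const (c := (0 : ℝ × ℝ × ℝ →L[ℝ] ℝ))).congr_of_eventuallyEq ?_
      have h1 : ∀ᶠ w : ℝ × ℝ × ℝ in 𝓝 z, δ₀ / 2 < ‖w.2‖ :=
        ContinuousAt.eventually_lt continuousAt_const (by fun_prop) (by linarith)
      filter_upwards [h1] with w hw
      exact hβ0 w hw
  have hβp : ∀ z, β (z + (1, 0)) = β z := by
    intro z
    have h2 : (z + ((1 : ℝ), (0 : ℝ × ℝ))).2 = z.2 := by simp
    by_cases hz : ‖z.2‖ < δ₀
    · simp only [hβ, h2, hTp z hz]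
    · rw [hβ0 _ (by rw [h2]; linarith), hβ0 _ (by linarith)]
  have hβe : ∀ t : ℝ, β =ᶠ[𝓝 (t, 0)] pullForm α T := fun t ↦ by
    have h1 : ∀ᶠ w : ℝ × ℝ × ℝ in 𝓝 (t, 0), ‖w.2‖ < δ₀ / 4 :=
      ContinuousAt.eventually_lt (by fun_prop) continuousAt_const (by simpa using hδ₀)
    filter_upwards [h1] with w hw
    exact hβ1 w hw
  have hreeb : ∀ t : ℝ, reebVec β (t, 0) = reebVec (pullForm α T) (t, 0) := fun t ↦ by
    simp only [reebVec, extDVec_congr (hβe t)]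
  obtain ⟨δ₁, hδ₁, P, hPs, hP0, hPp, hPβ⟩ := exists_contact_normalForm hβs hβp
    (fun t ↦ by rw [(hβe t).self_of_nhds]; exact (hTα t).1)
    (fun t ↦ by rw [extDVec_congr (hβe t)]; exact (hTα t).2.1)
    (fun t ↦ by rw [hreeb, (hβe t).self_of_nhds]; exact (hTα t).2.2)
  obtain ⟨δ₂, hδ₂, hP⟩ := exists_tube_subset
    (A := {z | ‖z.2‖ < δ₁ ∧ ‖(P z).2‖ < δ₀ / 4})
    (fun t ↦ by
      have hc : ContinuousAt P (t, 0) := (hPs (t, 0) (by simpa using hδ₁)).continuousAt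
      have h1 : ∀ᶠ w : ℝ × ℝ × ℝ in 𝓝 (t, 0), ‖w.2‖ < δ₁ :=
        ContinuousAt.eventually_lt (by fun_prop) continuousAt_const (by simpa using hδ₁)
      have h2 : ∀ᶠ w : ℝ × ℝ × ℝ in 𝓝 (t, 0), ‖(P w).2‖ < δ₀ / 4 :=
        ContinuousAt.eventually_lt (by fun_prop) continuousAt_const (by
          rw [hP0]; simpa using hδ₀)
      exact h1.and h2)
    (fun z hz ↦ by
      have h1 : (z + ((1 : ℝ), (0 : ℝ × ℝ))).2 = z.2 := by simp
      have h2 : (z - ((1 : ℝ), (0 : ℝ × ℝ))).2 = z.2 := by simp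
      refine ⟨⟨by rw [h1]; exact hz.1, ?_⟩, ⟨by rw [h2]; exact hz.1, ?_⟩⟩
      · rw [hPp z hz.1]; simpa using hz.2
      · have := hPp (z - (1, 0)) (by rw [h2]; exact hz.1)
        rw [sub_add_cancel] at this
        have h3 : (P (z - (1, 0))).2 = (P z).2 := by rw [this]; simp
        rw [h3]; exact hz.2)
  refine ⟨δ₂, hδ₂, T ∘ P, fun z hz ↦ ?_, fun z hz ↦ ?_, fun t ↦ ?_, fun z hz ↦ ?_⟩
  · simp only [comp_apply, hPp z (hP z hz).1, hT.periodic]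
  · have h4 := (hP z hz).2
    exact (hTs _ (by linarith)).comp z (hPs z (hP z hz).1).contMDiffAt
  · simp only [comp_apply, hP0, hT.axis]
  · have h4 := (hP z hz).2
    rw [← hPβ z (hP z hz).1, pullVec, hβ1 _ h4]
    have h5 : vecDeriv (T ∘ P) z = _ := vecDeriv_comp (hTs (P z) (by linarith))
      ((hPs z (hP z hz).1).differentiableAt (by simp))
    have h6 : pullForm α (T ∘ P) z =
      (show E3 →L[ℝ] ℝ from α (T (P z))).comp (vecDeriv (T ∘ P) z) := rfl
    rw [h6, h5]
    rfl

/-- A vector in the kernel of the derivative is killed by the pulled back form and by its exterior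
derivative. For `stdForm`, a contact form, only zero has this property. -/
theorem bijective_vecDeriv (hα : IsSmoothOneForm α) {F : ℝ × ℝ × ℝ → M} {z : ℝ × ℝ × ℝ}
    (hF : ContMDiffAt 𝓘(ℝ, ℝ × ℝ × ℝ) (𝓡 3) ∞ F z) (h : pullForm α F =ᶠ[𝓝 z] stdForm) :
    Bijective (vecDeriv F z) := by
  have hinj : Injective (vecDeriv F z).toLinearMap := by
    rw [injective_iff_map_eq_zero]
    intro u hu
    have hu' : vecDeriv F z u = 0 := hu
    have h1 : stdForm z u = 0 := by
      rw [← h.self_of_nhds]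
      exact (congrArg (show E3 →L[ℝ] ℝ from α (F z)) hu').trans (map_zero _)
    have h2 : ∀ v, extDVec stdForm z u v = 0 := fun v ↦ by
      rw [← extDVec_congr h, extDVec_pullForm hα hF]
      obtain ⟨B, hB, -⟩ := exists_extD_bilin α (F z)
      refine (hB _ _).trans ?_
      have : B (vecDeriv F z u) = 0 := by rw [hu', map_zero]
      exact DFunLike.congr_fun this _
    have h3 := h2 (1, 0, 0)
    have h4 := h2 (0, 1, 0)
    rw [extDVec_stdForm] at h3 h4
    rw [stdForm_apply] at h1
    simp only [mul_one, zero_mul, sub_zero, mul_zero, zero_sub, one_mul] at h3 h4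
    have h5 : u.1 = 0 := by linarith
    rw [h5] at h1
    refine Prod.ext h5 (Prod.ext h3 ?_)
    simpa using h1
  refine ⟨hinj, (LinearMap.injective_iff_surjective_of_finrank_eq_finrank ?_).1 hinj⟩
  simp

end Coordinates

/-! ### Descent from the universal cover to S¹ × ℝ². -/

theorem isOpenQuotientMap_cover : IsOpenQuotientMap cover :=
  (QuotientAddGroup.isOpenQuotientMap_mk (G := ℝ)
    (N := AddSubgroup.zmultiples (1 : ℝ))).prodMap IsOpenQuotientMap.id

theorem addCircle_coe_eq_iff {s t : ℝ} :
    (s : AddCircle (1 : ℝ)) = t ↔ ∃ n : ℤ, t = s + n := by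
  rw [eq_comm, ← sub_eq_zero, ← AddCircle.coe_sub, AddCircle.coe_eq_zero_iff]
  simp only [zsmul_eq_mul, mul_one]
  exact exists_congr fun n ↦ ⟨fun h ↦ by linarith, fun h ↦ by linarith⟩

theorem cover_eq_iff {z w : ℝ × ℝ × ℝ} : cover z = cover w ↔ ∃ n : ℤ, w = z + ((n : ℝ), 0) := by
  have : cover z = cover w ↔ (z.1 : AddCircle (1 : ℝ)) = w.1 ∧ z.2 = w.2 := by
    simp [cover, Prod.ext_iff]
  rw [this, addCircle_coe_eq_iff]
  constructor
  · rintro ⟨⟨n, h1⟩, h2⟩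
    exact ⟨n, by rw [Prod.ext_iff]; simp [h1, h2]⟩
  · rintro ⟨n, rfl⟩
    exact ⟨⟨n, rfl⟩, by simp⟩

theorem cover_snd (z : ℝ × ℝ × ℝ) : (cover z).2 = z.2 := rfl

section Tube

variable {M : Type*} [TopologicalSpace M] [T2Space M] [ChartedSpace E3 M] [IsManifold (𝓡 3) ∞ M]

/-- A periodic local diffeomorphism which is injective on the axis modulo the period induces
coordinates near the axis. -/
theorem exists_openPartialHomeomorph_of_tube {F : ℝ × ℝ × ℝ → M} {δ : ℝ} (hδ : 0 < δ)
    (hper : ∀ z : ℝ × ℝ × ℝ, ‖z.2‖ < δ → F (z + (1, 0)) = F z)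
    (hsm : ∀ z : ℝ × ℝ × ℝ, ‖z.2‖ < δ → ContMDiffAt 𝓘(ℝ, ℝ × ℝ × ℝ) (𝓡 3) ∞ F z)
    (hb : ∀ z : ℝ × ℝ × ℝ, ‖z.2‖ < δ → Bijective (vecDeriv F z))
    (hinj : ∀ s t : ℝ, F (s, 0) = F (t, 0) → ∃ n : ℤ, t = s + n) :
    ∃ δ' > 0, δ' ≤ δ ∧ ∃ Φ : OpenPartialHomeomorph M (AddCircle (1 : ℝ) × ℝ × ℝ),
      Φ.target = {c | ‖c.2‖ < δ'} ∧ ∀ z : ℝ × ℝ × ℝ, ‖z.2‖ < δ' → Φ.symm (cover z) = F z := by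
  set G : AddCircle (1 : ℝ) × ℝ × ℝ → M :=
    fun c ↦ F (surjInv isOpenQuotientMap_cover.surjective c) with hG
  have hGF : ∀ z : ℝ × ℝ × ℝ, ‖z.2‖ < δ → G (cover z) = F z := by
    intro z hz
    obtain ⟨n, hn⟩ := cover_eq_iff.1 (surjInv_eq isOpenQuotientMap_cover.surjective (cover z)).symm
    have hp : Periodic (fun s : ℝ ↦ F (s, z.2)) 1 := fun s ↦ by
      have := hper (s, z.2) hz
      simpa using this
    have h1 := hp.int_mul n z.1
    simp only [mul_one] at h1
    simp only [hG, hn]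
    refine Eq.trans ?_ h1
    congr 1
    ext <;> simp
  have hnorm : ∀ δ : ℝ, IsOpen {c : AddCircle (1 : ℝ) × ℝ × ℝ | ‖c.2‖ < δ} := fun δ ↦
    isOpen_lt (by fun_prop) continuous_const
  have hGe : ∀ z : ℝ × ℝ × ℝ, ‖z.2‖ < δ → G ∘ cover =ᶠ[𝓝 z] F := fun z hz ↦ by
    have h1 : ∀ᶠ w : ℝ × ℝ × ℝ in 𝓝 z, ‖w.2‖ < δ :=
      ContinuousAt.eventually_lt (by fun_prop) continuousAt_const hz
    filter_upwards [h1] with w hw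
    exact hGF w hw
  have hmap : ∀ z : ℝ × ℝ × ℝ, ‖z.2‖ < δ → Filter.map G (𝓝 (cover z)) = 𝓝 (G (cover z)) := by
    intro z hz
    rw [← isOpenQuotientMap_cover.map_nhds_eq, Filter.map_map, Filter.map_congr (hGe z hz),
      map_nhds_of_bijective (hsm z hz) (hb z hz), hGF z hz]
  have hcont : ∀ z : ℝ × ℝ × ℝ, ‖z.2‖ < δ → ContinuousAt G (cover z) := fun z hz ↦
    (hmap z hz).le
  have hloc : ∀ z : ℝ × ℝ × ℝ, ‖z.2‖ < δ → ∃ u ∈ 𝓝 (cover z), InjOn G u := by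
    intro z hz
    obtain ⟨U, hU, hUi⟩ := exists_injOn_of_bijective (hsm z hz) (hb z hz)
    have h1 : ∀ᶠ w : ℝ × ℝ × ℝ in 𝓝 z, ‖w.2‖ < δ :=
      ContinuousAt.eventually_lt (by fun_prop) continuousAt_const hz
    refine ⟨cover '' (U ∩ {w | ‖w.2‖ < δ}), ?_, ?_⟩
    · exact isOpenQuotientMap_cover.isOpenMap.image_mem_nhds (Filter.inter_mem hU h1)
    · rintro _ ⟨w, ⟨hw, hw'⟩, rfl⟩ _ ⟨v, ⟨hv, hv'⟩, rfl⟩ h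
      rw [hGF w hw', hGF v hv'] at h
      rw [hUi hw hv h]
  set C : Set (AddCircle (1 : ℝ) × ℝ × ℝ) := {c | c.2 = 0} with hC
  have hCrep : ∀ c ∈ C, ∃ t : ℝ, c = cover (t, 0) := by
    rintro ⟨c, w⟩ hc
    obtain ⟨t, rfl⟩ := QuotientAddGroup.mk_surjective c
    have : w = 0 := hc
    exact ⟨t, by rw [this]; rfl⟩
  have hCc : IsCompact C := by
    have : C = univ ×ˢ {0} := by ext c; simp [hC]
    rw [this]
    exact isCompact_univ.prod isCompact_singleton
  have h0 : ∀ t : ℝ, ‖((t, 0) : ℝ × ℝ × ℝ).2‖ < δ := fun t ↦ by simpa using hδ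
  have hCi : InjOn G C := by
    intro c hc d hd h
    obtain ⟨s, rfl⟩ := hCrep c hc
    obtain ⟨t, rfl⟩ := hCrep d hd
    rw [hGF _ (h0 s), hGF _ (h0 t)] at h
    obtain ⟨n, hn⟩ := hinj s t h
    exact cover_eq_iff.2 ⟨n, by simp [hn]⟩
  -- Injectivity on the compact axis together with local injectivity at its points gives injectivity
  -- on a neighbourhood of the axis.
  obtain ⟨O, hO, hCO, hOi⟩ := hCi.exists_isOpen_superset hCc
    (fun c hc ↦ by obtain ⟨s, rfl⟩ := hCrep c hc; exact hcont _ (h0 s))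
    (fun c hc ↦ by obtain ⟨s, rfl⟩ := hCrep c hc; exact hloc _ (h0 s))
  obtain ⟨δ₁, hδ₁, hsub⟩ := exists_tube_subset (A := cover ⁻¹' O)
    (fun t ↦ isOpenQuotientMap_cover.continuous.continuousAt (hO.mem_nhds (hCO rfl)))
    (fun z hz ↦ by
      have h1 : cover (z + (1, 0)) = cover z := (cover_eq_iff.2 ⟨1, by simp⟩).symm
      have h2 : cover (z - (1, 0)) = cover z := cover_eq_iff.2 ⟨1, by simp⟩
      simp only [mem_preimage, h1, h2]
      exact ⟨hz, hz⟩)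
  set δ' := min δ δ₁ with hδ'
  set Ω : Set (AddCircle (1 : ℝ) × ℝ × ℝ) := {c | ‖c.2‖ < δ'} with hΩ
  have hΩrep : ∀ c ∈ Ω, ∃ z : ℝ × ℝ × ℝ, c = cover z ∧ ‖z.2‖ < δ ∧ ‖z.2‖ < δ₁ := by
    intro c hc
    obtain ⟨z, rfl⟩ := isOpenQuotientMap_cover.surjective c
    exact ⟨z, rfl, lt_min_iff.1 hc⟩
  have hΩi : InjOn G Ω := by
    refine hOi.mono fun c hc ↦ ?_
    obtain ⟨z, rfl, -, h2⟩ := hΩrep c hc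
    exact hsub z h2
  let e := hΩi.toPartialEquiv
  have hes : e.source = Ω := rfl
  let Ψ : OpenPartialHomeomorph (AddCircle (1 : ℝ) × ℝ × ℝ) M :=
    OpenPartialHomeomorph.ofContinuousOpenRestrict e
    (fun c hc ↦ by
      obtain ⟨z, rfl, h1, -⟩ := hΩrep c hc
      exact (hcont z h1).continuousWithinAt)
    (by
      rw [isOpenMap_iff_nhds_le]
      rintro ⟨c, hc⟩
      obtain ⟨z, hz, h1, -⟩ := hΩrep c hc
      have h2 : e.source.domRestrict e = G ∘ Subtype.val := rfl
      rw [h2, ← Filter.map_map, map_nhds_subtype_coe_eq_nhds hc ((hnorm δ').mem_nhds hc),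
        comp_apply]
      simp only
      rw [hz, hmap z h1])
    (hnorm δ')
  exact ⟨δ', lt_min hδ hδ₁, min_le_left _ _, Ψ.symm, rfl, fun z hz ↦
    hGF z (lt_of_lt_of_le hz (min_le_left _ _))⟩

variable {α : ∀ p : M, TangentSpace (𝓡 3) p →L[ℝ] ℝ} {γ : ℝ → M}

theorem IsLegendrianKnot.eq_iff (hγ : IsLegendrianKnot α γ) {s t : ℝ} :
    γ s = γ t ↔ ∃ n : ℤ, t = s + n := by
  constructor
  · intro h
    have h1 : ∀ s, γ (Int.fract s) = γ s := fun s ↦ by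
      have := hγ.periodic.sub_int_mul_eq (x := s) ⌊s⌋
      rwa [mul_one] at this
    have h2 := hγ.injective ⟨Int.fract_nonneg s, Int.fract_lt_one s⟩
      ⟨Int.fract_nonneg t, Int.fract_lt_one t⟩ (by rw [h1, h1, h])
    refine ⟨⌊t⌋ - ⌊s⌋, ?_⟩
    have h3 := Int.fract_add_floor s
    have h4 := Int.fract_add_floor t
    push_cast
    linarith
  · rintro ⟨n, rfl⟩
    have := hγ.periodic.int_mul n s
    rw [mul_one] at this
    exact this.symm

theorem IsLegendrianKnot.velocity_shift (hγ : IsLegendrianKnot α γ) (c t : ℝ) :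
    (velocity (fun t ↦ γ (t + c)) t : E3) = velocity γ (t + c) := by
  have h2 : vecDeriv (γ ∘ fun s ↦ s + c) t = _ :=
    vecDeriv_comp (f := fun s ↦ s + c) (hγ.smooth (t + c)) (by fun_prop)
  rw [fderiv_add_const, fderiv_fun_id] at h2
  exact DFunLike.congr_fun h2 (1 : ℝ)

theorem IsLegendrianKnot.shift (hγ : IsLegendrianKnot α γ) (c : ℝ) :
    IsLegendrianKnot α (fun t ↦ γ (t + c)) := by
  have hv := hγ.velocity_shift c
  refine ⟨?_, ?_, ?_, fun t ↦ ?_, fun t ↦ ?_⟩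
  · exact hγ.smooth.comp (contDiff_id.add contDiff_const).contMDiff
  · intro t
    have := hγ.periodic (t + c)
    simp only [← this]; congr 1; ring
  · intro s hs t ht h
    obtain ⟨n, hn⟩ := hγ.eq_iff.1 h
    have hn' : t = s + n := by linarith
    have h1 : (n : ℝ) < 1 := by linarith [hs.1, ht.2]
    have h2 : (-1 : ℝ) < n := by linarith [hs.2, ht.1]
    have h3 : n = 0 := by
      have : n < 1 := by exact_mod_cast h1
      have : -1 < n := by exact_mod_cast h2
      omega
    rw [hn', h3]; simp
  · have := hγ.regular (t + c)
    intro h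
    exact this ((hv t).symm.trans h)
  · exact (congrArg (show E3 →L[ℝ] ℝ from α (γ (t + c))) (hv t)).trans (hγ.legendrian (t + c))

/-- Contact coordinates near a Legendrian knot. -/
theorem exists_contact_coordinates (hα : IsContactForm α) (hγ : IsLegendrianKnot α γ) :
    ∃ Φ : OpenPartialHomeomorph M (AddCircle (1 : ℝ) × ℝ × ℝ), IsContactCoordinates α Φ ∧
      (∃ δ > 0, Φ.target = {c | ‖c.2‖ < δ}) ∧
      ∀ t : ℝ, γ t ∈ Φ.source ∧ Φ (γ t) = cover (t, 0) := by
  obtain ⟨δ, hδ, F, hper, hsm, hax, hF⟩ := exists_contact_tube hα hγ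
  have hFe : ∀ z : ℝ × ℝ × ℝ, ‖z.2‖ < δ → pullForm α F =ᶠ[𝓝 z] stdForm := fun z hz ↦ by
    have h1 : ∀ᶠ w : ℝ × ℝ × ℝ in 𝓝 z, ‖w.2‖ < δ :=
      ContinuousAt.eventually_lt (by fun_prop) continuousAt_const hz
    filter_upwards [h1] with w hw
    exact hF w hw
  have hb : ∀ z : ℝ × ℝ × ℝ, ‖z.2‖ < δ → Bijective (vecDeriv F z) := fun z hz ↦
    bijective_vecDeriv hα.smooth (hsm z hz) (hFe z hz)
  obtain ⟨δ', hδ', hle, Φ, hΦ, hΦF⟩ := exists_openPartialHomeomorph_of_tube hδ hper hsm hb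
    fun s t h ↦ by rw [hax, hax] at h; exact hγ.eq_iff.1 h
  have hmem : ∀ z, z ∈ cover ⁻¹' Φ.target ↔ ‖z.2‖ < δ' := fun z ↦ by rw [hΦ]; rfl
  have hEq : ∀ z, ‖z.2‖ < δ' → Φ.symm ∘ cover =ᶠ[𝓝 z] F := fun z hz ↦ by
    have h1 : ∀ᶠ w : ℝ × ℝ × ℝ in 𝓝 z, ‖w.2‖ < δ' :=
      ContinuousAt.eventually_lt (by fun_prop) continuousAt_const hz
    filter_upwards [h1] with w hw
    exact hΦF w hw
  refine ⟨Φ, ⟨fun z hz ↦ ?_, fun z hz ↦ ?_, fun z hz u ↦ ?_⟩, ⟨δ', hδ', hΦ⟩, fun t ↦ ?_⟩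
  · rw [hmem] at hz
    exact ((hsm z (hz.trans_le hle)).congr_of_eventuallyEq (hEq z hz)).contMDiffWithinAt
  · rw [hmem] at hz
    rw [(hEq z hz).mfderiv_eq]
    exact hb z (hz.trans_le hle)
  · rw [hmem] at hz
    have h1 : pullForm α (Φ.symm ∘ cover) z = pullForm α F z := by
      have h2 : ∀ (p q : M) (u v : ℝ × ℝ × ℝ →L[ℝ] E3), p = q → u = v →
        (show E3 →L[ℝ] ℝ from α p).comp u = (show E3 →L[ℝ] ℝ from α q).comp v := by
        rintro p q u v rfl rfl; rfl
      exact h2 _ _ _ _ (hEq z hz).self_of_nhds (hEq z hz).mfderiv_eq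
    rw [← stdForm_apply, ← hF z (hz.trans_le hle), ← h1]
    rfl
  · have h0 : ‖((t, 0) : ℝ × ℝ × ℝ).2‖ < δ' := by simpa using hδ'
    have h1 := hΦF (t, 0) h0
    rw [hax] at h1
    have h2 : cover (t, 0) ∈ Φ.target := (hmem _).2 h0
    rw [← h1]
    exact ⟨Φ.map_target h2, Φ.right_inv h2⟩

end Tube

/-! ### Charts of a surface with boundary. -/

section HalfPlaneCharts

variable {S : Type*} [TopologicalSpace S] [ChartedSpace (EuclideanHalfSpace 2) S]
  [IsManifold (𝓡∂ 2) ∞ S] {φ : OpenPartialHomeomorph S (EuclideanHalfSpace 2)} {q : S}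

theorem range_halfPlane : range (𝓡∂ 2) = {u : E2 | 0 ≤ u 0} :=
  range_modelWithCornersEuclideanHalfSpace 2

theorem extend_nonneg (φ : OpenPartialHomeomorph S (EuclideanHalfSpace 2)) (q : S) :
    0 ≤ (φ.extend (𝓡∂ 2) q : E2) 0 := by
  have : φ.extend (𝓡∂ 2) q ∈ range (𝓡∂ 2) := by simp
  rwa [range_halfPlane] at this

theorem map_extend_nhds_halfPlane (hq : q ∈ φ.source) :
    Filter.map (φ.extend (𝓡∂ 2)) (𝓝 q) = 𝓝[{u : E2 | 0 ≤ u 0}] (φ.extend (𝓡∂ 2) q) := by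
  rw [φ.map_extend_nhds hq, range_halfPlane]

/-- The boundary is defined through preferred charts; any other chart of the atlas detects it too,
since a local diffeomorphism preserves boundary points. -/
theorem mem_boundary_iff_extend (hφ : φ ∈ IsManifold.maximalAtlas (𝓡∂ 2) ∞ S)
    (hq : q ∈ φ.source) : q ∈ (𝓡∂ 2).boundary S ↔ (φ.extend (𝓡∂ 2) q : E2) 0 = 0 := by
  have h : IsLocalDiffeomorphAt (𝓡∂ 2) (𝓡∂ 2) ∞ φ q :=
    ⟨{ φ with
        open_source := φ.open_source
        open_target := φ.open_target
        contMDiffOn_toFun := contMDiffOn_of_mem_maximalAtlas hφ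
        contMDiffOn_invFun := contMDiffOn_symm_of_mem_maximalAtlas hφ }, hq, fun _ _ ↦ rfl⟩
  have h2 := h.isBoundaryPoint_iff (by simp)
  refine h2.trans ?_
  rw [ModelWithCorners.isBoundaryPoint_iff, frontier_range_modelWithCornersEuclideanHalfSpace]
  exact eq_comm

theorem mdifferentiable_of_mem_maximalAtlas (hφ : φ ∈ IsManifold.maximalAtlas (𝓡∂ 2) ∞ S) :
    φ.MDifferentiable (𝓡∂ 2) (𝓡∂ 2) :=
  ⟨(contMDiffOn_of_mem_maximalAtlas hφ).mdifferentiableOn (by simp),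
    (contMDiffOn_symm_of_mem_maximalAtlas hφ).mdifferentiableOn (by simp)⟩

theorem bijective_mfderiv_extend (hφ : φ ∈ IsManifold.maximalAtlas (𝓡∂ 2) ∞ S)
    (hq : q ∈ φ.source) :
    Bijective (mfderiv (𝓡∂ 2) 𝓘(ℝ, E2) (φ.extend (𝓡∂ 2)) q) := by
  have h1 := mdifferentiable_of_mem_maximalAtlas hφ
  have h2 : mfderiv (𝓡∂ 2) 𝓘(ℝ, E2) ((𝓡∂ 2) ∘ φ) q = _ :=
    mfderiv_comp q ((𝓡∂ 2).hasMFDerivAt (x := φ q)).mdifferentiableAt (h1.mdifferentiableAt hq)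
  have h3 : φ.extend (𝓡∂ 2) = (𝓡∂ 2) ∘ φ := φ.extend_coe
  rw [h3, h2, ((𝓡∂ 2).hasMFDerivAt (x := φ q)).mfderiv]
  exact h1.mfderiv_bijective hq

theorem contMDiffAt_extend_halfPlane (hφ : φ ∈ IsManifold.maximalAtlas (𝓡∂ 2) ∞ S)
    (hq : q ∈ φ.source) : ContMDiffAt (𝓡∂ 2) 𝓘(ℝ, E2) ∞ (φ.extend (𝓡∂ 2)) q :=
  φ.contMDiffAt_extend hφ hq

end HalfPlaneCharts

/-! ### Immersions of surfaces with boundary, extended across the boundary. -/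

section Immersion

variable {M : Type*} [TopologicalSpace M] [ChartedSpace E3 M] [IsManifold (𝓡 3) ∞ M]
  {S : Type*} [TopologicalSpace S] [ChartedSpace (EuclideanHalfSpace 2) S]
  [IsManifold (𝓡∂ 2) ∞ S] {j : S → M} {q₀ : S}

/-- An immersion of a surface with boundary extends, in suitable charts, to an immersion of
a neighbourhood in the plane. -/
theorem exists_chart_extension {F : Type*} [NormedAddCommGroup F] [NormedSpace ℝ F]
    (hj : Manifold.IsImmersionAtOfComplement F (𝓡∂ 2) (𝓡 3) ∞ j q₀) :
    ∃ φ ∈ IsManifold.maximalAtlas (𝓡∂ 2) ∞ S, q₀ ∈ φ.source ∧ ∃ h : E2 → M,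
      (∀ᶠ u in 𝓝 (φ.extend (𝓡∂ 2) q₀), ContMDiffAt 𝓘(ℝ, E2) (𝓡 3) ∞ h u ∧
        Injective (vecDeriv h u)) ∧
      ∀ q ∈ φ.source, j q = h (φ.extend (𝓡∂ 2) q) := by
  set κ := hj.codChart with hκ
  set i : E2 → E3 := fun u ↦ hj.equiv (u, 0) with hi
  have hic : ContDiff ℝ ∞ i := hj.equiv.contDiff.comp (contDiff_id.prodMk contDiff_const)
  have hid : ∀ u, HasFDerivAt i ((hj.equiv : E2 × F →L[ℝ] E3).comp
      (ContinuousLinearMap.inl ℝ E2 F)) u := fun u ↦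
    ((hj.equiv : E2 × F →L[ℝ] E3).comp (ContinuousLinearMap.inl ℝ E2 F)).hasFDerivAt
  have hval : ∀ q ∈ hj.domChart.source,
      κ.extend (𝓡 3) (j q) = i (hj.domChart.extend (𝓡∂ 2) q) := fun q hq ↦ by
    have hq' : q ∈ (hj.domChart.extend (𝓡∂ 2)).source := by
      rwa [hj.domChart.extend_source]
    have h1 := hj.writtenInCharts ((hj.domChart.extend (𝓡∂ 2)).map_source hq')
    simp only [comp_apply, (hj.domChart.extend (𝓡∂ 2)).left_inv hq'] at h1
    exact h1
  have htar : IsOpen (κ.extend (𝓡 3)).target := by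
    rw [κ.extend_target']
    simpa using κ.open_target
  have hmem : ∀ q ∈ hj.domChart.source, i (hj.domChart.extend (𝓡∂ 2) q) ∈
      (κ.extend (𝓡 3)).target := fun q hq ↦ by
    rw [← hval q hq]
    refine (κ.extend (𝓡 3)).map_source ?_
    rw [κ.extend_source]
    exact hj.source_subset_preimage_source hq
  have hsm : ∀ x ∈ (κ.extend (𝓡 3)).target,
      ContMDiffAt 𝓘(ℝ, E3) (𝓡 3) ∞ (κ.extend (𝓡 3)).symm x := fun x hx ↦ by
    have h1 := contMDiffOn_extend_symm (I := 𝓡 3) hj.codChart_mem_maximalAtlas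
    rw [← κ.extend_target'] at h1
    exact h1.contMDiffAt (htar.mem_nhds hx)
  refine ⟨hj.domChart, hj.domChart_mem_maximalAtlas, hj.mem_domChart_source,
    (κ.extend (𝓡 3)).symm ∘ i, ?_, fun q hq ↦ ?_⟩
  · filter_upwards [hic.continuous.continuousAt (htar.mem_nhds (hmem q₀ hj.mem_domChart_source))]
      with u hu
    have h2 : ContMDiffAt 𝓘(ℝ, E2) (𝓡 3) ∞ ((κ.extend (𝓡 3)).symm ∘ i) u :=
      (hsm _ hu).comp u hic.contMDiff.contMDiffAt
    refine ⟨h2, ?_⟩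
    have h3 : κ.extend (𝓡 3) ∘ ((κ.extend (𝓡 3)).symm ∘ i) =ᶠ[𝓝 u] i := by
      filter_upwards [hic.continuous.continuousAt (htar.mem_nhds hu)] with v hv
      exact (κ.extend (𝓡 3)).right_inv hv
    have h4 : ContMDiffAt (𝓡 3) 𝓘(ℝ, E3) ∞ (κ.extend (𝓡 3)) (((κ.extend (𝓡 3)).symm ∘ i) u) :=
      κ.contMDiffAt_extend hj.codChart_mem_maximalAtlas (by
        have := (κ.extend (𝓡 3)).map_target hu
        rwa [κ.extend_source] at this)
    have h5 := mfderiv_comp u (h4.mdifferentiableAt (by simp)) (h2.mdifferentiableAt (by simp))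
    rw [h3.mfderiv_eq, mfderiv_eq_fderiv, (hid u).fderiv] at h5
    refine Injective.of_comp (f := mfderiv (𝓡 3) 𝓘(ℝ, E3) (κ.extend (𝓡 3))
      (((κ.extend (𝓡 3)).symm ∘ i) u)) ?_
    have h6 : Injective ((hj.equiv : E2 × F →L[ℝ] E3).comp (ContinuousLinearMap.inl ℝ E2 F)) :=
      hj.equiv.injective.comp fun a b hab ↦ by simpa using hab
    rw [h5] at h6
    exact h6
  · rw [comp_apply, ← hval q hq]
    refine ((κ.extend (𝓡 3)).left_inv ?_).symm
    rw [κ.extend_source]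
    exact hj.source_subset_preimage_source hq

/-- The complement `F` of an immersion is prescribed in advance. Counting dimensions allows it to be
identified with any complement of the range of `A`. -/
theorem exists_complementary_map {F : Type*} [NormedAddCommGroup F] [NormedSpace ℝ F]
    (e : (E2 × F) ≃L[ℝ] E3) {A : E2 →L[ℝ] E3} (hA : Injective A) :
    ∃ (B : (E2 × F) ≃L[ℝ] E3) (l : F →L[ℝ] E3), ∀ u f, B (u, f) = A u + l f := by
  have hF : FiniteDimensional ℝ F := by
    refine Module.Finite.of_injective
      ((e : E2 × F →L[ℝ] E3).comp (ContinuousLinearMap.inr ℝ E2 F)).toLinearMap ?_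
    exact e.injective.comp fun a b hab ↦ by simpa using hab
  have hd : 2 + Module.finrank ℝ F = 3 := by
    have := e.toLinearEquiv.finrank_eq
    simpa using this
  obtain ⟨C, hC⟩ := Submodule.exists_isCompl (LinearMap.range A.toLinearMap)
  have hr : Module.finrank ℝ (LinearMap.range A.toLinearMap) = 2 := by
    rw [LinearMap.finrank_range_of_inj hA]; simp
  have hc := Submodule.finrank_add_eq_of_isCompl hC
  rw [hr] at hc
  have hCF : Module.finrank ℝ F = Module.finrank ℝ C := by
    simp only [finrank_euclideanSpace, Fintype.card_fin] at hc
    omega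
  let l : F →ₗ[ℝ] E3 := C.subtype.comp (LinearEquiv.ofFinrankEq F C hCF).toLinearMap
  have hl : Injective l := C.injective_subtype.comp (LinearEquiv.ofFinrankEq F C hCF).injective
  have hlC : ∀ f, l f ∈ C := fun f ↦ ((LinearEquiv.ofFinrankEq F C hCF) f).2
  let T : E2 × F →ₗ[ℝ] E3 := A.toLinearMap.coprod l
  have hT : Injective T := by
    rw [injective_iff_map_eq_zero]
    rintro ⟨u, f⟩ h
    have h1 : A u + l f = 0 := h
    have h2 : l f ∈ LinearMap.range A.toLinearMap :=
      ⟨-u, by simp only [map_neg]; exact neg_eq_of_add_eq_zero_right h1⟩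
    have h3 : l f = 0 := Submodule.disjoint_def.1 hC.disjoint _ h2 (hlC f)
    rw [h3, add_zero] at h1
    exact Prod.ext (hA (h1.trans (map_zero A).symm)) (hl (h3.trans (map_zero l).symm))
  have hTs : Surjective T := (LinearMap.injective_iff_surjective_of_finrank_eq_finrank
    e.toLinearEquiv.finrank_eq).1 hT
  exact ⟨(LinearEquiv.ofBijective T ⟨hT, hTs⟩).toContinuousLinearEquiv,
    LinearMap.toContinuousLinearMap l, fun u f ↦ rfl⟩

/-- A converse to `exists_chart_extension`. In a chart of the target, (u, f) ↦ h(u) + l(f) is a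
local diffeomorphism for a suitable complementary `l`; its inverse followed by `e` is a chart in
which the surface is u ↦ e(u, 0). -/
theorem isImmersionAtOfComplement_of_extension {F : Type*} [NormedAddCommGroup F]
    [NormedSpace ℝ F] (e : (E2 × F) ≃L[ℝ] E3) {φ : OpenPartialHomeomorph S (EuclideanHalfSpace 2)}
    (hφ : φ ∈ IsManifold.maximalAtlas (𝓡∂ 2) ∞ S) (hq : q₀ ∈ φ.source) {h : E2 → M}
    (hh : ∀ᶠ u in 𝓝 (φ.extend (𝓡∂ 2) q₀), ContMDiffAt 𝓘(ℝ, E2) (𝓡 3) ∞ h u)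
    (hi : Injective (vecDeriv h (φ.extend (𝓡∂ 2) q₀)))
    (hj : ∀ᶠ q in 𝓝 q₀, j q = h (φ.extend (𝓡∂ 2) q)) :
    Manifold.IsImmersionAtOfComplement F (𝓡∂ 2) (𝓡 3) ∞ j q₀ := by
  set u₀ := φ.extend (𝓡∂ 2) q₀ with hu₀
  set p := h u₀ with hp
  set κ := chartAt E3 p with hκ
  have hu₀p : ContMDiffAt 𝓘(ℝ, E2) (𝓡 3) ∞ h u₀ := hh.self_of_nhds
  have hA : Injective (fderiv ℝ (κ ∘ h) u₀) := by
    have h1 : fderiv ℝ (extChartAt (𝓡 3) p ∘ h) u₀ = vecDeriv h u₀ := by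
      rw [← mfderiv_eq_fderiv]
      rw [mfderiv_comp u₀ (mdifferentiableAt_extChartAt (mem_chart_source _ _))
        (hu₀p.mdifferentiableAt (by simp)), mfderiv_extChartAt_self]
      rfl
    have h2 : (extChartAt (𝓡 3) p ∘ h) = κ ∘ h := by ext; simp [mfld_simps, hκ]
    rw [← h2, h1]; exact hi
  obtain ⟨B, l, hB⟩ := exists_complementary_map e hA
  set K : E2 × F → E3 := fun x ↦ κ (h x.1) + l x.2 with hK
  have hksrc : ∀ᶠ u in 𝓝 u₀, h u ∈ κ.source :=
    hu₀p.continuousAt (κ.open_source.mem_nhds (mem_chart_source _ _))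
  have hKs : ∀ᶠ x in 𝓝 ((u₀, 0) : E2 × F), ContDiffAt ℝ ∞ K x := by
    have h1 : Filter.Tendsto (Prod.fst : E2 × F → E2) (𝓝 (u₀, 0)) (𝓝 u₀) :=
      continuous_fst.continuousAt
    filter_upwards [h1.eventually hh, h1.eventually hksrc] with x hx hx2
    have h2 : ContDiffAt ℝ ∞ (extChartAt (𝓡 3) p ∘ h) x.1 :=
      contDiffAt_extChartAt_comp hx (by rwa [extChartAt_source])
    have h3 : (extChartAt (𝓡 3) p ∘ h) = κ ∘ h := by ext; simp [mfld_simps, hκ]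
    rw [h3] at h2
    exact (h2.comp x contDiffAt_fst).add (l.contDiff.comp contDiff_snd).contDiffAt
  have hKd : HasFDerivAt K (B : E2 × F →L[ℝ] E3) (u₀, 0) := by
    have h2 : ContDiffAt ℝ ∞ (extChartAt (𝓡 3) p ∘ h) u₀ :=
      contDiffAt_extChartAt_comp hu₀p (by simp [hp])
    have h3 : (extChartAt (𝓡 3) p ∘ h) = κ ∘ h := by ext; simp [mfld_simps, hκ]
    rw [h3] at h2
    have h4 : HasFDerivAt (fun x : E2 × F ↦ (κ ∘ h) x.1) _ ((u₀, 0) : E2 × F) :=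
      HasFDerivAt.comp (g := κ ∘ h) (f := Prod.fst) ((u₀, 0) : E2 × F)
        (h2.differentiableAt (by simp)).hasFDerivAt hasFDerivAt_fst
    have h5 : HasFDerivAt (fun x : E2 × F ↦ l x.2) (l.comp (ContinuousLinearMap.snd ℝ E2 F))
      ((u₀, 0) : E2 × F) := (l.comp (ContinuousLinearMap.snd ℝ E2 F)).hasFDerivAt
    refine (h4.add h5).congr_fderiv ?_
    refine ContinuousLinearMap.ext fun x ↦ ?_
    simpa using (hB x.1 x.2).symm
  have hFD : FiniteDimensional ℝ F := by
    refine Module.Finite.of_injective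
      ((e : E2 × F →L[ℝ] E3).comp (ContinuousLinearMap.inr ℝ E2 F)).toLinearMap ?_
    exact e.injective.comp fun a b hab ↦ by simpa using hab
  have hCS : CompleteSpace F := FiniteDimensional.complete ℝ F
  -- The new chart must be smooth in both directions on its whole domain, so the derivative has to
  -- be invertible at all nearby points.
  have hinv : ∀ᶠ x in 𝓝 ((u₀, 0) : E2 × F), ∃ B' : (E2 × F) ≃L[ℝ] E3,
      HasFDerivAt K (B' : E2 × F →L[ℝ] E3) x := by
    have h1 : ContinuousAt (fderiv ℝ K) (u₀, 0) :=
      (hKs.self_of_nhds.fderiv_right (m := ∞) (by simp)).continuousAt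
    have h2 : range ((↑) : ((E2 × F) ≃L[ℝ] E3) → E2 × F →L[ℝ] E3) ∈ 𝓝 (fderiv ℝ K (u₀, 0)) := by
      rw [hKd.fderiv]; exact B.nhds
    filter_upwards [h1 h2, hKs] with x hx hx2
    obtain ⟨B', hB'⟩ := hx
    exact ⟨B', by rw [hB']; exact (hx2.differentiableAt (by simp)).hasFDerivAt⟩
  obtain ⟨O, hOsub, hO, hOmem⟩ := mem_nhds_iff.1 (hKs.and hinv)
  have hs := hKs.self_of_nhds.hasStrictFDerivAt' hKd (by simp)
  set e' := (hs.toOpenPartialHomeomorph K).restrOpen O hO with he'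
  have he'K : ∀ x, e' x = K x := fun x ↦ rfl
  have he'm : ((u₀, 0) : E2 × F) ∈ e'.source :=
    ⟨hs.mem_toOpenPartialHomeomorph_source, hOmem⟩
  have he'O : ∀ x ∈ e'.source, x ∈ O := fun x hx ↦ hx.2
  have he's : ContDiffOn ℝ ∞ e'.symm e'.target := fun y hy ↦ by
    have h1 := hOsub (he'O _ (e'.map_target hy))
    obtain ⟨B', hB'⟩ := h1.2
    exact (e'.contDiffAt_symm hy hB' h1.1).contDiffWithinAt
  have he'f : ContDiffOn ℝ ∞ e' e'.source := fun x hx ↦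
    (hOsub (he'O x hx)).1.contDiffWithinAt
  set c : OpenPartialHomeomorph M E3 :=
    κ.trans (e'.symm.trans e.toHomeomorph.toOpenPartialHomeomorph) with hc
  have hκm : κ ∈ IsManifold.maximalAtlas (𝓡 3) ∞ M := IsManifold.chart_mem_maximalAtlas p
  have hcm : c ∈ IsManifold.maximalAtlas (𝓡 3) ∞ M := by
    refine c.mem_maximalAtlas_of_contMDiffOn ?_ ?_
    · have h1 : ContMDiffOn 𝓘(ℝ, E3) 𝓘(ℝ, E3) ∞ (e ∘ e'.symm) e'.target :=
        (e.contDiff.comp_contDiffOn he's).contMDiffOn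
      have h2 : ContMDiffOn (𝓡 3) 𝓘(ℝ, E3) ∞ κ κ.source := contMDiffOn_of_mem_maximalAtlas hκm
      refine h1.comp (h2.mono ?_) ?_
      · intro x hx; simp [hc] at hx; exact hx.1
      · intro x hx; simp [hc] at hx; exact hx.2
    · have h1 : ContMDiffOn 𝓘(ℝ, E3) 𝓘(ℝ, E3) ∞ (e' ∘ e.symm) (e.symm ⁻¹' e'.source) :=
        (he'f.comp e.symm.contDiff.contDiffOn fun x hx ↦ hx).contMDiffOn
      have h2 : ContMDiffOn 𝓘(ℝ, E3) (𝓡 3) ∞ κ.symm κ.target :=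
        contMDiffOn_symm_of_mem_maximalAtlas hκm
      refine h2.comp (h1.mono ?_) ?_
      · intro x hx; simp [hc] at hx; exact hx.1
      · intro x hx; simp [hc] at hx; exact hx.2
  have hext : ∀ᶠ q in 𝓝 q₀, q ∈ φ.source ∧ j q = h (φ.extend (𝓡∂ 2) q) ∧
      h (φ.extend (𝓡∂ 2) q) ∈ κ.source ∧ ((φ.extend (𝓡∂ 2) q, 0) : E2 × F) ∈ e'.source := by
    have h1 : ContinuousAt (φ.extend (𝓡∂ 2)) q₀ := φ.continuousAt_extend hq
    have h2 : ContinuousAt (fun q ↦ ((φ.extend (𝓡∂ 2) q, 0) : E2 × F)) q₀ :=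
      h1.prodMk continuousAt_const
    filter_upwards [φ.open_source.mem_nhds hq, hj, h1.eventually hksrc,
      h2.eventually (e'.open_source.mem_nhds he'm)] with q a1 a2 a3 a4
    exact ⟨a1, a2, a3, a4⟩
  obtain ⟨O', hO'sub, hO', hO'mem⟩ := mem_nhds_iff.1 hext
  have hjc : ContinuousAt j q₀ := by
    refine ContinuousAt.congr ?_ (hj.mono fun q hq ↦ hq.symm)
    exact ContinuousAt.comp (f := φ.extend (𝓡∂ 2)) hu₀p.continuousAt (φ.continuousAt_extend hq)
  have hcsrc : ∀ q ∈ O', j q ∈ c.source ∧ c (j q) = e (φ.extend (𝓡∂ 2) q, 0) := by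
    intro q hq
    obtain ⟨a1, a2, a3, a4⟩ := hO'sub hq
    have h1 : κ (j q) = e' (φ.extend (𝓡∂ 2) q, 0) := by rw [he'K, a2]; simp [hK]
    constructor
    · simp only [hc, OpenPartialHomeomorph.trans_source, mem_inter_iff, mem_preimage, h1]
      refine ⟨by rw [a2]; exact a3, by simpa using e'.map_source a4, by simp⟩
    · have : c (j q) = e (e'.symm (κ (j q))) := rfl
      rw [this, h1, e'.left_inv a4]
  refine Manifold.IsImmersionAtOfComplement.mk_of_continuousAt hjc e (φ.restr O') c
    (by rw [φ.restr_source' O' hO']; exact ⟨hq, hO'mem⟩) (hcsrc q₀ hO'mem).1 ?_ hcm ?_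
  · exact restr_mem_maximalAtlas (contDiffGroupoid ∞ (𝓡∂ 2)) hφ hO'
  · intro x hx
    set ψ := (φ.restr O').extend (𝓡∂ 2) with hψ
    have h1 : ψ.symm x ∈ ψ.source := ψ.map_target hx
    rw [hψ, OpenPartialHomeomorph.extend_source, φ.restr_source' O' hO'] at h1
    have h2 : ψ.symm x ∈ O' := h1.2
    have h3 := hcsrc _ h2
    have h4 : φ.extend (𝓡∂ 2) (ψ.symm x) = x := ψ.right_inv hx
    have h5 : c.extend (𝓡 3) (j (ψ.symm x)) = c (j (ψ.symm x)) := by simp [mfld_simps]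
    simp only [comp_apply]
    rw [h5, h3.2, h4]

end Immersion

/-! ### Polar description of a surface around its boundary. -/

/-- The Euclidean norm on `ℝ × ℝ`. -/
noncomputable def planeNorm (v : ℝ × ℝ) : ℝ := √(v.1 ^ 2 + v.2 ^ 2)

theorem planeNorm_nonneg (v : ℝ × ℝ) : 0 ≤ planeNorm v := Real.sqrt_nonneg _

theorem planeNorm_sq (v : ℝ × ℝ) : planeNorm v ^ 2 = v.1 ^ 2 + v.2 ^ 2 :=
  Real.sq_sqrt (by positivity)

theorem planeNorm_eq_zero {v : ℝ × ℝ} : planeNorm v = 0 ↔ v = 0 := by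
  rw [planeNorm, Real.sqrt_eq_zero (by positivity), Prod.ext_iff]
  constructor
  · intro h
    exact ⟨pow_eq_zero_iff two_ne_zero |>.1 (by nlinarith [sq_nonneg v.1, sq_nonneg v.2]),
      pow_eq_zero_iff two_ne_zero |>.1 (by nlinarith [sq_nonneg v.1, sq_nonneg v.2])⟩
  · rintro ⟨h1, h2⟩
    simp only [Prod.fst_zero, Prod.snd_zero] at h1 h2
    simp [h1, h2]

theorem planeNorm_pos {v : ℝ × ℝ} (hv : v ≠ 0) : 0 < planeNorm v :=
  lt_of_le_of_ne (planeNorm_nonneg v) fun h ↦ hv (planeNorm_eq_zero.1 h.symm)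

theorem planeNorm_smul (c : ℝ) (v : ℝ × ℝ) : planeNorm (c • v) = |c| * planeNorm v := by
  rw [planeNorm, planeNorm, ← Real.sqrt_sq_eq_abs, ← Real.sqrt_mul (sq_nonneg c)]
  congr 1
  simp only [Prod.smul_fst, Prod.smul_snd, smul_eq_mul]
  ring

theorem continuous_planeNorm : Continuous planeNorm := by
  unfold planeNorm; fun_prop

/-- This is what the supremum norm of `ℝ × ℝ` lacks, and why distances from the axis are Euclidean.
-/
theorem contDiffAt_planeNorm {v : ℝ × ℝ} (hv : v ≠ 0) : ContDiffAt ℝ ∞ planeNorm v := by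
  have h : v.1 ^ 2 + v.2 ^ 2 ≠ 0 := by
    have := planeNorm_pos hv
    rw [← planeNorm_sq]; positivity
  exact ContDiffAt.sqrt (by fun_prop) h

theorem norm_le_planeNorm (v : ℝ × ℝ) : ‖v‖ ≤ planeNorm v := by
  rw [Prod.norm_def, planeNorm]
  exact max_le (Real.abs_le_sqrt (by nlinarith [sq_nonneg v.2]))
    (Real.abs_le_sqrt (by nlinarith [sq_nonneg v.1]))

theorem exists_contDiff_eventuallyEq {E F : Type*} [NormedAddCommGroup E] [NormedSpace ℝ E]
    [HasContDiffBump E] [NormedAddCommGroup F] [NormedSpace ℝ F] {f : E → F} {x : E}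
    (hf : ∀ᶠ y in 𝓝 x, ContDiffAt ℝ ∞ f y) : ∃ f' : E → F, ContDiff ℝ ∞ f' ∧ f' =ᶠ[𝓝 x] f := by
  obtain ⟨ε, hε, h⟩ := Metric.eventually_nhds_iff_ball.1 hf
  let χ : ContDiffBump x := ⟨ε / 4, ε / 2, by linarith, by linarith⟩
  refine ⟨fun y ↦ χ y • f y, contDiff_iff_contDiffAt.2 fun y ↦ ?_, ?_⟩
  · by_cases hy : y ∈ Metric.ball x ε
    · exact χ.contDiff.contDiffAt.smul (h y hy)
    · refine (contDiffAt_const (c := (0 : F))).congr_of_eventuallyEq ?_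
      have h1 : ∀ᶠ w in 𝓝 y, ε / 2 < dist w x :=
        ContinuousAt.eventually_lt continuousAt_const (by fun_prop) (by
          rw [Metric.mem_ball, not_lt] at hy; linarith)
      filter_upwards [h1] with w hw
      rw [χ.zero_of_le_dist (by exact hw.le), zero_smul]
  · filter_upwards [χ.eventuallyEq_one] with y hy
    rw [hy]; simp

/-- Hadamard's lemma: `H` integrates the normal derivative of `f` along the segment from the
projection of `u` on the line `u 0 = 0` to `u`. -/
theorem exists_smooth_quotient {F : Type} [NormedAddCommGroup F] [NormedSpace ℝ F]
    [CompleteSpace F] {f : E2 → F} {u₀ : E2} (hu₀ : u₀ 0 = 0)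
    (hf : ∀ᶠ u in 𝓝 u₀, ContDiffAt ℝ ∞ f u) (hz : ∀ᶠ u in 𝓝 u₀, u 0 = 0 → f u = 0) :
    ∃ H : E2 → F, ContDiff ℝ ∞ H ∧ ∀ᶠ u in 𝓝 u₀, f u = u 0 • H u := by
  obtain ⟨f', hf', hff'⟩ := exists_contDiff_eventuallyEq hf
  set e₀ : E2 := EuclideanSpace.single 0 1 with he₀
  set b : E2 →L[ℝ] E2 := ContinuousLinearMap.id ℝ E2 - (EuclideanSpace.proj (0 : Fin 2)).smulRight e₀
    with hb
  have hbu : ∀ u : E2, b u = u - u 0 • e₀ := fun u ↦ by simp [hb]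
  have hb0 : ∀ u : E2, b u 0 = 0 := fun u ↦ by simp [hbu, he₀]
  set c : E2 → C(unitInterval, E2) := fun u ↦ ⟨fun s ↦ b u + (s : ℝ) • u 0 • e₀, by fun_prop⟩ with hc
  have hcs : ContDiff ℝ ∞ c := by
    refine IsBoundedLinearMap.contDiff ⟨⟨fun z w ↦ ?_, fun a z ↦ ?_⟩, 2, two_pos, fun z ↦ ?_⟩
    · ext1 s
      simp only [hc, map_add, ContinuousMap.coe_mk, ContinuousMap.add_apply, PiLp.add_apply]
      module
    · ext1 s
      simp only [hc, map_smul, ContinuousMap.coe_mk, ContinuousMap.smul_apply, PiLp.smul_apply,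
        smul_eq_mul]
      module
    · refine (ContinuousMap.norm_le _ (by positivity)).2 fun s ↦ ?_
      simp only [hc, ContinuousMap.coe_mk, hbu]
      have h1 : z - z 0 • e₀ + (s : ℝ) • z 0 • e₀ = z - ((1 - (s : ℝ)) * z 0) • e₀ := by module
      rw [h1]
      refine (norm_sub_le _ _).trans ?_
      have h2 : ‖e₀‖ = 1 := by simp [he₀]
      rw [norm_smul, h2, norm_mul, mul_one]
      have h3 : ‖z 0‖ ≤ ‖z‖ := PiLp.norm_apply_le z 0
      have h4 : ‖1 - (s : ℝ)‖ ≤ 1 := by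
        rw [Real.norm_eq_abs, abs_le]; constructor <;> linarith [s.2.1, s.2.2]
      nlinarith [norm_nonneg (z 0)]
  have hd : ContDiff ℝ ∞ fun u ↦ fderiv ℝ f' u e₀ :=
    (hf'.fderiv_right (m := ∞) (by simp)).clm_apply contDiff_const
  refine ⟨fun z ↦ ∫ s in (0 : ℝ)..1, fderiv ℝ f' (IccExtend zero_le_one (c z) s) e₀,
    contDiff_integral_comp hd hcs, ?_⟩
  have hbt : Filter.Tendsto b (𝓝 u₀) (𝓝 u₀) := by
    have h1 : b u₀ = u₀ := by simp [hbu, hu₀]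
    have := b.continuous.tendsto u₀
    rwa [h1] at this
  filter_upwards [hff', hbt.eventually hff', hbt.eventually hz] with u hu hu2 hu3
  have h1 : ∀ s : ℝ, HasDerivAt (fun s : ℝ ↦ f' (b u + s • u 0 • e₀))
      (u 0 • fderiv ℝ f' (b u + s • u 0 • e₀) e₀) s := fun s ↦ by
    have h2 : HasDerivAt (fun s : ℝ ↦ b u + s • u 0 • e₀) (u 0 • e₀) s := by
      simpa using ((hasDerivAt_id s).smul_const (u 0 • e₀)).const_add (b u)
    have h3 := ((hf'.differentiable (by simp)) (b u + s • u 0 • e₀)).hasFDerivAt.comp_hasDerivAt s h2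
    refine h3.congr_deriv ?_
    rw [map_smul]
  have h4 := intervalIntegral.integral_eq_sub_of_hasDerivAt (a := 0) (b := 1)
    (fun s _ ↦ h1 s) (by
      refine Continuous.intervalIntegrable ?_ _ _
      have := hd.continuous
      exact continuous_const.smul (this.comp (by fun_prop)))
  have h5 : b u + (1 : ℝ) • u 0 • e₀ = u := by rw [hbu]; module
  have h6 : b u + (0 : ℝ) • u 0 • e₀ = b u := by simp
  rw [h5, h6, hu, hu2, hu3 (hb0 u), sub_zero, intervalIntegral.integral_smul] at h4
  rw [← h4]
  congr 1
  refine intervalIntegral.integral_congr fun s hs ↦ ?_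
  rw [uIcc_of_le zero_le_one] at hs
  simp only [IccExtend_of_mem _ _ hs]
  rfl

/-- Divide the transverse part of `g` by the boundary coordinate: (g u).2 = u₀ H(u). Then u₀ |H| is
the distance from the axis on the half-plane and continues it smoothly beyond. With the angle it
forms the coordinates `P`, and `d` is H/|H| written in them. -/
theorem exists_ribbon_coordinates {g : E2 → ℝ × ℝ × ℝ} {u₀ : E2} (hu₀ : u₀ 0 = 0)
    (hg : ∀ᶠ u in 𝓝 u₀, ContDiffAt ℝ ∞ g u) (hi : Injective (fderiv ℝ g u₀))
    (hz : ∀ᶠ u in 𝓝 u₀, u 0 = 0 → (g u).2 = 0) :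
    ∃ (P : E2 → ℝ × ℝ) (d : ℝ × ℝ → ℝ × ℝ) (k : ℝ × ℝ → E2),
      (∀ᶠ u in 𝓝 u₀, ContDiffAt ℝ ∞ P u ∧ Bijective (fderiv ℝ P u)) ∧
      P u₀ = ((g u₀).1, 0) ∧ (∀ᶠ x in 𝓝 (P u₀), ContDiffAt ℝ ∞ d x) ∧
      (∀ᶠ u in 𝓝 u₀, 0 ≤ u 0 → (P u).1 = (g u).1 ∧ (P u).2 = planeNorm (g u).2 ∧
        (g u).2 = (P u).2 • d (P u)) ∧
      ContinuousAt k (P u₀) ∧ k (P u₀) = u₀ ∧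
      (∀ᶠ x in 𝓝 (P u₀), P (k x) = x ∧ (0 ≤ x.2 → 0 ≤ k x 0)) ∧
      ∀ᶠ u in 𝓝 u₀, k (P u) = u := by
  obtain ⟨H, hH, hgH⟩ := exists_smooth_quotient hu₀
    (hg.mono fun u hu ↦ contDiff_snd.contDiffAt.comp u hu) hz
  have hg0 := hg.self_of_nhds
  set pr : E2 →L[ℝ] ℝ := EuclideanSpace.proj (0 : Fin 2) with hpr
  have hpu : ∀ u : E2, pr u = u 0 := fun u ↦ rfl
  have hd1 : HasFDerivAt (fun u ↦ (g u).1)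
      ((ContinuousLinearMap.fst ℝ ℝ (ℝ × ℝ)).comp (fderiv ℝ g u₀)) u₀ :=
    hasFDerivAt_fst.comp u₀ (hg0.differentiableAt (by simp)).hasFDerivAt
  have hd2 : (ContinuousLinearMap.snd ℝ ℝ (ℝ × ℝ)).comp (fderiv ℝ g u₀) = pr.smulRight (H u₀) := by
    have h1 : HasFDerivAt (fun u ↦ (g u).2)
      ((ContinuousLinearMap.snd ℝ ℝ (ℝ × ℝ)).comp (fderiv ℝ g u₀)) u₀ :=
      hasFDerivAt_snd.comp u₀ (hg0.differentiableAt (by simp)).hasFDerivAt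
    have h2 : HasFDerivAt (fun u : E2 ↦ pr u • H u)
        (pr u₀ • fderiv ℝ H u₀ + pr.smulRight (H u₀)) u₀ :=
      pr.hasFDerivAt.smul ((hH.differentiable (by simp)) u₀).hasFDerivAt
    have h3 := h1.unique (h2.congr_of_eventuallyEq hgH)
    rw [h3, hpu, hu₀]; simp
  have hker : ∀ v : E2, (fderiv ℝ g u₀ v).1 = 0 → v 0 • H u₀ = 0 → v = 0 := fun v h1 h2 ↦ by
    refine hi ?_
    rw [map_zero]
    have := DFunLike.congr_fun hd2 v
    exact Prod.ext h1 (this.trans h2)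
  -- Otherwise the derivative of `g` would factor through its first component, and no such map of
  -- the plane is injective.
  have hH0 : H u₀ ≠ 0 := by
    intro h0
    have h1 : Injective ((ContinuousLinearMap.fst ℝ ℝ (ℝ × ℝ)).comp (fderiv ℝ g u₀)).toLinearMap := by
      rw [injective_iff_map_eq_zero]
      exact fun v hv ↦ hker v hv (by rw [h0, smul_zero])
    have := LinearMap.finrank_le_finrank_of_injective h1
    simp at this
  have hHn : ∀ᶠ u in 𝓝 u₀, H u ≠ 0 := hH.continuous.continuousAt.eventually_ne hH0
  set P : E2 → ℝ × ℝ := fun u ↦ ((g u).1, u 0 * planeNorm (H u)) with hP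
  have hPs : ∀ᶠ u in 𝓝 u₀, ContDiffAt ℝ ∞ P u := by
    filter_upwards [hg, hHn] with u h1 h2
    exact (contDiff_fst.contDiffAt.comp u h1).prodMk
      (pr.contDiff.contDiffAt.mul ((contDiffAt_planeNorm h2).comp u hH.contDiffAt))
  have hP0 : P u₀ = ((g u₀).1, 0) := by simp [hP, hu₀]
  have hPd : HasFDerivAt P (((ContinuousLinearMap.fst ℝ ℝ (ℝ × ℝ)).comp (fderiv ℝ g u₀)).prod
      (planeNorm (H u₀) • pr)) u₀ := by
    refine hd1.prodMk ?_
    have h3 : DifferentiableAt ℝ (fun u ↦ planeNorm (H u)) u₀ :=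
      ((contDiffAt_planeNorm hH0).comp u₀ hH.contDiffAt).differentiableAt (by simp)
    have h2 := pr.hasFDerivAt (x := u₀) |>.mul h3.hasFDerivAt
    refine h2.congr_fderiv ?_
    rw [hpu, hu₀]; simp
  have hPinj : Injective (((ContinuousLinearMap.fst ℝ ℝ (ℝ × ℝ)).comp (fderiv ℝ g u₀)).prod
      (planeNorm (H u₀) • pr)).toLinearMap := by
    rw [injective_iff_map_eq_zero]
    intro v hv
    have h1 : (fderiv ℝ g u₀ v).1 = 0 := congrArg Prod.fst hv
    have h2 : planeNorm (H u₀) * v 0 = 0 := congrArg Prod.snd hv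
    have h3 : v 0 = 0 := (mul_eq_zero.1 h2).resolve_left (planeNorm_pos hH0).ne'
    exact hker v h1 (by rw [h3, zero_smul])
  have hPsurj := (LinearMap.injective_iff_surjective_of_finrank_eq_finrank (by simp)).1 hPinj
  let A : E2 ≃L[ℝ] ℝ × ℝ := ContinuousLinearEquiv.ofBijective _
    (LinearMap.ker_eq_bot.2 hPinj) (LinearMap.range_eq_top.2 hPsurj)
  have hA : HasFDerivAt P (A : E2 →L[ℝ] ℝ × ℝ) u₀ := by
    rwa [ContinuousLinearEquiv.coe_ofBijective]
  have hs := hPs.self_of_nhds.hasStrictFDerivAt' hA (by simp)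
  set k := hs.localInverse P A u₀ with hk
  have hbij : ∀ᶠ u in 𝓝 u₀, Bijective (fderiv ℝ P u) := by
    have h1 : ContinuousAt (fderiv ℝ P) u₀ :=
      (hPs.self_of_nhds.fderiv_right (m := ∞) (by simp)).continuousAt
    have h2 : range ((↑) : (E2 ≃L[ℝ] ℝ × ℝ) → E2 →L[ℝ] ℝ × ℝ) ∈ 𝓝 (fderiv ℝ P u₀) := by
      rw [hA.fderiv]; exact A.nhds
    filter_upwards [h1 h2] with x hx
    obtain ⟨B', hB'⟩ := hx
    rw [← hB']
    exact B'.bijective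
  have hkc : ContinuousAt k (P u₀) := hs.localInverse_continuousAt
  have hk0 : k (P u₀) = u₀ := hs.localInverse_apply_image
  have hkt : Filter.Tendsto k (𝓝 (P u₀)) (𝓝 u₀) := hs.localInverse_tendsto
  have hks : ∀ᶠ x in 𝓝 (P u₀), ContDiffAt ℝ ∞ k x := by
    have h1 : ∀ᶠ x in 𝓝 (P u₀), x ∈ (hs.toOpenPartialHomeomorph P).target :=
      (hs.toOpenPartialHomeomorph P).open_target.mem_nhds hs.image_mem_toOpenPartialHomeomorph_target
    filter_upwards [h1, hkt.eventually hPs, hkt.eventually hbij] with x hx1 hx2 hx3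
    let B : E2 ≃L[ℝ] ℝ × ℝ := ContinuousLinearEquiv.ofBijective (fderiv ℝ P (k x))
      (LinearMap.ker_eq_bot.2 hx3.1) (LinearMap.range_eq_top.2 hx3.2)
    have hB : HasFDerivAt P (B : E2 →L[ℝ] ℝ × ℝ) (k x) := by
      rw [ContinuousLinearEquiv.coe_ofBijective]
      exact (hx2.differentiableAt (by simp)).hasFDerivAt
    exact (hs.toOpenPartialHomeomorph P).contDiffAt_symm hx1 hB hx2
  refine ⟨P, fun x ↦ (planeNorm (H (k x)))⁻¹ • H (k x), k, hPs.and hbij, hP0, ?_, ?_, hkc, hk0,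
    ?_, hs.eventually_left_inverse⟩
  · filter_upwards [hks, hkt.eventually hHn] with x hx1 hx2
    have h1 : ContDiffAt ℝ ∞ (fun x ↦ H (k x)) x := hH.contDiffAt.comp x hx1
    have h2 : ContDiffAt ℝ ∞ (fun x ↦ planeNorm (H (k x))) x :=
      ContDiffAt.comp (g := planeNorm) x (contDiffAt_planeNorm hx2) h1
    exact (h2.inv (planeNorm_pos hx2).ne').smul h1
  · filter_upwards [hs.eventually_left_inverse, hgH, hHn] with u h1 h2 h3 h4
    have h2' : (g u).2 = u 0 • H u := h2
    refine ⟨rfl, ?_, ?_⟩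
    · rw [h2', planeNorm_smul, abs_of_nonneg h4]
    · have h5 : k (P u) = u := h1
      change (g u).2 = (P u).2 • ((planeNorm (H (k (P u))))⁻¹ • H (k (P u)))
      rw [h5, h2']
      change _ = (u 0 * planeNorm (H u)) • _
      rw [smul_smul, mul_assoc, mul_inv_cancel₀ (planeNorm_pos h3).ne', mul_one]
  · filter_upwards [hs.eventually_right_inverse, hkt.eventually hHn] with x h1 h2
    refine ⟨h1, fun h3 ↦ ?_⟩
    have h4 : k x 0 * planeNorm (H (k x)) = x.2 := congrArg Prod.snd h1
    by_contra h5
    have := mul_neg_of_neg_of_pos (not_le.1 h5) (planeNorm_pos h2)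
    linarith

/-- The map `(t, r) ↦ (t, r D(t, r))`, which parametrizes a ribbon around the axis. -/
def ribbon (D : ℝ × ℝ → ℝ × ℝ) (x : ℝ × ℝ) : ℝ × ℝ × ℝ := (x.1, x.2 • D x)

/-! ### Collar coordinates at a boundary point. -/

section CollarChart

variable {M : Type*} [TopologicalSpace M] [ChartedSpace E3 M] [IsManifold (𝓡 3) ∞ M]
  {S : Type*} [TopologicalSpace S] [ChartedSpace (EuclideanHalfSpace 2) S]
  [IsManifold (𝓡∂ 2) ∞ S] {α : ∀ p : M, TangentSpace (𝓡 3) p →L[ℝ] ℝ}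
  {Φ : OpenPartialHomeomorph M (AddCircle (1 : ℝ) × ℝ × ℝ)} {j : S → M} {q₀ : S}

/-- The distance of the point `j q` from the axis in the coordinates `Φ`. -/
noncomputable def collarRadius (Φ : OpenPartialHomeomorph M (AddCircle (1 : ℝ) × ℝ × ℝ))
    (j : S → M) (q : S) : ℝ := planeNorm (Φ (j q)).2

/-- `P ∘ φ` are smooth coordinates `(t, r)` on the surface near `q`, where `t` lifts the angle
and `r` is the distance from the axis in the coordinates `Φ`. -/
structure IsCollarChart (Φ : OpenPartialHomeomorph M (AddCircle (1 : ℝ) × ℝ × ℝ)) (j : S → M)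
    (q : S) (φ : OpenPartialHomeomorph S (EuclideanHalfSpace 2)) (P : E2 → ℝ × ℝ) : Prop where
  mem_atlas : φ ∈ IsManifold.maximalAtlas (𝓡∂ 2) ∞ S
  mem_source : q ∈ φ.source
  smooth : ∀ᶠ u in 𝓝 (φ.extend (𝓡∂ 2) q), ContDiffAt ℝ ∞ P u ∧ Bijective (fderiv ℝ P u)
  angle : ∀ᶠ q' in 𝓝 q, ((P (φ.extend (𝓡∂ 2) q')).1 : AddCircle (1 : ℝ)) = (Φ (j q')).1
  radius : ∀ᶠ q' in 𝓝 q, (P (φ.extend (𝓡∂ 2) q')).2 = collarRadius Φ j q'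

theorem IsCollarChart.eventually {φ : OpenPartialHomeomorph S (EuclideanHalfSpace 2)}
    {P : E2 → ℝ × ℝ} (h : IsCollarChart Φ j q₀ φ P) : ∀ᶠ q in 𝓝 q₀, IsCollarChart Φ j q φ P := by
  filter_upwards [φ.open_source.mem_nhds h.mem_source, h.angle.eventually_nhds,
    h.radius.eventually_nhds,
    (φ.continuousAt_extend h.mem_source).eventually h.smooth.eventually_nhds] with q h1 h2 h3 h4
  exact ⟨h.mem_atlas, h1, h4, h2, h3⟩

theorem IsContactCoordinates.contMDiffAt (hΦ : IsContactCoordinates α Φ) {z : ℝ × ℝ × ℝ}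
    (hz : cover z ∈ Φ.target) :
    ∀ᶠ w in 𝓝 z, cover w ∈ Φ.target ∧ ContMDiffAt 𝓘(ℝ, ℝ × ℝ × ℝ) (𝓡 3) ∞ (Φ.symm ∘ cover) w ∧
      Bijective (vecDeriv (Φ.symm ∘ cover) w) := by
  have ho : IsOpen (cover ⁻¹' Φ.target) :=
    Φ.open_target.preimage isOpenQuotientMap_cover.continuous
  filter_upwards [ho.mem_nhds hz] with w hw
  exact ⟨hw, (hΦ.smooth w hw).contMDiffAt (ho.mem_nhds hw), hΦ.bijective w hw⟩

/-- The extension of `j` across the boundary is lifted through `Φ.symm ∘ cover`, and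
`exists_ribbon_coordinates` applies to the lift. The last clause holds because charts map
neighbourhoods of a boundary point onto neighbourhoods in the half-plane. -/
theorem exists_local_collar (hΦ : IsContactCoordinates α Φ)
    (hj : Manifold.IsSmoothEmbedding (𝓡∂ 2) (𝓡 3) ∞ j)
    (hbd : ∀ q ∈ (𝓡∂ 2).boundary S, (Φ (j q)).2 = 0) (hq₀ : q₀ ∈ (𝓡∂ 2).boundary S)
    (hs : j q₀ ∈ Φ.source) {t₀ : ℝ} (ht₀ : Φ (j q₀) = cover (t₀, 0)) :
    ∃ (φ : OpenPartialHomeomorph S (EuclideanHalfSpace 2)) (P : E2 → ℝ × ℝ) (d : ℝ × ℝ → ℝ × ℝ),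
      IsCollarChart Φ j q₀ φ P ∧ P (φ.extend (𝓡∂ 2) q₀) = (t₀, 0) ∧
      (∀ᶠ x in 𝓝 (t₀, (0 : ℝ)), ContDiffAt ℝ ∞ d x) ∧
      (∀ᶠ q in 𝓝 q₀, (Φ (j q)).2 =
        (P (φ.extend (𝓡∂ 2) q)).2 • d (P (φ.extend (𝓡∂ 2) q))) ∧
      ∀ N ∈ 𝓝 q₀, ∀ᶠ x : ℝ × ℝ in 𝓝 (t₀, (0 : ℝ)), 0 ≤ x.2 →
        ∃ q ∈ N, P (φ.extend (𝓡∂ 2) q) = x := by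
  obtain ⟨K, _, _, hK⟩ := hj.isImmersion
  obtain ⟨φ, hφ, hq, h, hh, hjh⟩ := exists_chart_extension (hK q₀)
  set u₀ : E2 := φ.extend (𝓡∂ 2) q₀ with hu₀
  set F : ℝ × ℝ × ℝ → M := Φ.symm ∘ cover with hF
  have htar : cover (t₀, 0) ∈ Φ.target := by rw [← ht₀]; exact Φ.map_source hs
  have hFs := hΦ.contMDiffAt htar
  have hF0 : F (t₀, 0) = j q₀ := by
    rw [hF, comp_apply, ← ht₀]; exact Φ.left_inv hs
  have hh0 : h u₀ = F (t₀, 0) := by rw [hF0, hjh q₀ hq]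
  obtain ⟨l, hl, hl', hFl, hlF⟩ := exists_local_inverse hFs.self_of_nhds.2.1 hFs.self_of_nhds.2.2
  have hls := hl' (hFs.mono fun _ h ↦ h.2)
  have hl0 : l (F (t₀, 0)) = (t₀, 0) := hlF.self_of_nhds
  have hht : Filter.Tendsto h (𝓝 u₀) (𝓝 (F (t₀, 0))) := by
    have := hh.self_of_nhds.1.continuousAt
    rwa [ContinuousAt, hh0] at this
  have hlt : Filter.Tendsto l (𝓝 (F (t₀, 0))) (𝓝 (t₀, 0)) := by
    have := hl.continuousAt
    rwa [ContinuousAt, hl0] at this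
  set g : E2 → ℝ × ℝ × ℝ := l ∘ h with hg
  have hg0 : g u₀ = (t₀, 0) := by rw [hg, comp_apply, hh0, hl0]
  have hgs : ∀ᶠ u in 𝓝 u₀, ContDiffAt ℝ ∞ g u := by
    filter_upwards [hh, hht.eventually hls] with u h1 h2
    exact (h2.comp u h1.1).contDiffAt
  have hgi : Injective (fderiv ℝ g u₀) := by
    have h1 : vecDeriv (F ∘ g) u₀ = (vecDeriv F (g u₀)).comp (fderiv ℝ g u₀) :=
      vecDeriv_comp (by rw [hg0]; exact hFs.self_of_nhds.2.1)
        (hgs.self_of_nhds.differentiableAt (by simp))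
    have h2 : vecDeriv (F ∘ g) u₀ = vecDeriv h u₀ := by
      have : F ∘ g =ᶠ[𝓝 u₀] h := hht.eventually hFl
      exact this.mfderiv_eq
    have h3 := hh.self_of_nhds.2
    rw [← h2, h1] at h3
    exact Injective.of_comp (f := vecDeriv F (g u₀)) h3
  have hΦg : ∀ᶠ u in 𝓝 u₀, Φ (h u) = cover (g u) := by
    filter_upwards [hht.eventually hFl, hht.eventually (hlt.eventually hFs)] with u h1 h2
    have h3 : Φ.symm (cover (g u)) = h u := h1
    rw [← h3]
    exact Φ.right_inv h2.1
  have hnn : ∀ q, 0 ≤ (φ.extend (𝓡∂ 2) q : E2) 0 := extend_nonneg φ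
  have hmap := map_extend_nhds_halfPlane hq
  have hu0 : u₀ 0 = 0 := (mem_boundary_iff_extend hφ hq).1 hq₀
  have hφc : Filter.Tendsto (φ.extend (𝓡∂ 2)) (𝓝 q₀) (𝓝 u₀) := φ.continuousAt_extend hq
  have hhalf : ∀ N ∈ 𝓝 q₀, ∀ᶠ u in 𝓝 u₀, 0 ≤ u 0 → ∃ q ∈ N, φ.extend (𝓡∂ 2) q = u := by
    intro N hN
    have : φ.extend (𝓡∂ 2) '' N ∈ 𝓝[{u : E2 | 0 ≤ u 0}] u₀ := by
      rw [← hmap]; exact Filter.image_mem_map hN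
    filter_upwards [mem_nhdsWithin_iff_eventually.1 this] with u hu h0
    exact hu h0
  have hz : ∀ᶠ u in 𝓝 u₀, u 0 = 0 → (g u).2 = 0 := by
    filter_upwards [hΦg, hhalf _ (φ.open_source.mem_nhds hq)] with u h1 h2 h3
    obtain ⟨q, hqs, rfl⟩ := h2 h3.ge
    have h4 := hbd q ((mem_boundary_iff_extend hφ hqs).2 h3)
    rwa [hjh q hqs, h1, cover_snd] at h4
  obtain ⟨P, d, k, hP, hP0, hd, hPg, hkc, hk0, hkP, -⟩ := exists_ribbon_coordinates hu0 hgs hgi hz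
  have hP0' : P u₀ = (t₀, 0) := by rw [hP0, hg0]
  have hloc : ∀ᶠ q in 𝓝 q₀, Φ (j q) = cover (g (φ.extend (𝓡∂ 2) q)) := by
    filter_upwards [hφc.eventually hΦg, φ.open_source.mem_nhds hq] with q h1 h2
    rw [hjh q h2, h1]
  rw [hP0'] at hd hkc hkP hk0
  refine ⟨φ, P, d, ⟨hφ, hq, hP, ?_, ?_⟩, hP0', hd, ?_, ?_⟩
  · filter_upwards [hloc, hφc.eventually hPg] with q h1 h2
    rw [h1, (h2 (hnn q)).1]; rfl
  · filter_upwards [hloc, hφc.eventually hPg] with q h1 h2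
    rw [collarRadius, h1, (h2 (hnn q)).2.1]; rfl
  · filter_upwards [hloc, hφc.eventually hPg] with q h1 h2
    rw [h1, ← (h2 (hnn q)).2.2]; rfl
  · intro N hN
    have hkt : Filter.Tendsto k (𝓝 (t₀, (0 : ℝ))) (𝓝 u₀) := by
      rw [← hk0]; exact hkc
    filter_upwards [hkP, hkt.eventually (hhalf N hN)] with x h1 h2 h3
    obtain ⟨q, hqN, hqk⟩ := h2 (h1.2 h3)
    exact ⟨q, hqN, by rw [hqk, h1.1]⟩

end CollarChart

/-! ### Uniform neighbourhoods and periodic selections. -/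

/-- The tube lemma over one period. It makes local choices along the circle uniform in `t`. -/
theorem exists_strip {E : Type*} [NormedAddCommGroup E] {p : ℝ → E → Prop}
    (hper : ∀ t x, p (t + 1) x ↔ p t x) (h : ∀ t, ∀ᶠ z : ℝ × E in 𝓝 (t, 0), p z.1 z.2) :
    ∃ δ > 0, ∀ t x, ‖x‖ < δ → p t x := by
  have h1 : ∀ᶠ x in 𝓝 (0 : E), ∀ t ∈ Icc (0 : ℝ) 1, p t x := by
    refine isCompact_Icc.eventually_forall_of_forall_eventually fun t _ ↦ ?_
    have : Filter.Tendsto (fun z : E × ℝ ↦ (z.2, z.1)) (𝓝 ((0 : E), t)) (𝓝 (t, 0)) :=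
      (continuous_snd.prodMk continuous_fst).tendsto _
    exact this.eventually (h t)
  obtain ⟨δ, hδ, h2⟩ := Metric.eventually_nhds_iff.1 h1
  refine ⟨δ, hδ, fun t x hx ↦ ?_⟩
  have h3 : Periodic (fun s ↦ p s x) 1 := fun s ↦ propext (hper s x)
  have h4 : p (Int.fract t) x = p t x := by
    have := h3.sub_int_mul_eq (x := t) ⌊t⌋
    rwa [mul_one] at this
  rw [← h4]
  exact h2 (by simpa using hx) _ ⟨Int.fract_nonneg t, (Int.fract_lt_one t).le⟩

/-- A partition of unity gives a selection f₀, possibly not periodic. The convex interpolation from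
f₀(t, x) for t ≤ 1/3 to f₀(t - 1, x) for t ≥ 2/3 is again a selection, and its restriction to one
period extends periodically and smoothly because the two ends match. -/
theorem exists_periodic_selection {E F : Type*} [NormedAddCommGroup E] [NormedSpace ℝ E]
    [FiniteDimensional ℝ E] [NormedAddCommGroup F] [NormedSpace ℝ F] {T : ℝ × E → Set F}
    (hconv : ∀ z, Convex ℝ (T z)) (hper : ∀ t x, T (t + 1, x) = T (t, x))
    (hloc : ∀ z, ∃ g : ℝ × E → F, ∀ᶠ w in 𝓝 z, ContDiffAt ℝ ∞ g w ∧ g w ∈ T w) :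
    ∃ f : ℝ × E → F, ContDiff ℝ ∞ f ∧ (∀ t x, f (t + 1, x) = f (t, x)) ∧ ∀ z, f z ∈ T z := by
  obtain ⟨f₀, hf₀⟩ := exists_contMDiffMap_forall_mem_convex_of_local (n := ⊤) 𝓘(ℝ, ℝ × E) hconv
    (fun z ↦ by
      obtain ⟨g, hg⟩ := hloc z
      exact ⟨_, hg, g, fun w hw ↦ (ContDiffAt.contMDiffAt hw.1).contMDiffWithinAt,
        fun w hw ↦ hw.2⟩)
  have hs₀ : ContDiff ℝ ∞ f₀ := f₀.contMDiff.contDiff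
  set s : ℝ → ℝ := fun t ↦ Real.smoothTransition (3 * t - 1) with hs
  have hs1 : ∀ t, t ≤ 1 / 3 → s t = 0 := fun t ht ↦
    Real.smoothTransition.zero_of_nonpos (by linarith)
  have hs2 : ∀ t, 2 / 3 ≤ t → s t = 1 := fun t ht ↦
    Real.smoothTransition.one_of_one_le (by linarith)
  have hss : ContDiff ℝ ∞ s := Real.smoothTransition.contDiff.comp (by fun_prop)
  set G : ℝ × E → F := fun z ↦ (1 - s z.1) • f₀ z + s z.1 • f₀ (z.1 - 1, z.2) with hG
  have hGs : ContDiff ℝ ∞ G := by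
    have h1 : ContDiff ℝ ∞ fun z : ℝ × E ↦ s z.1 := hss.comp contDiff_fst
    exact ((contDiff_const.sub h1).smul hs₀).add (h1.smul (hs₀.comp (by fun_prop)))
  have hG1 : ∀ t x, t ≤ 1 / 3 → G (t, x) = f₀ (t, x) := fun t x ht ↦ by
    simp only [hG, hs1 t ht]; simp
  have hG2 : ∀ t x, 2 / 3 ≤ t → G (t, x) = f₀ (t - 1, x) := fun t x ht ↦ by
    simp only [hG, hs2 t ht]; simp
  have hTint : ∀ (n : ℤ) t x, T (t + n, x) = T (t, x) := fun n t x ↦ by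
    have h1 : Periodic (fun t ↦ T (t, x)) 1 := fun t ↦ hper t x
    simpa using h1.int_mul n t
  have hGT : ∀ z, G z ∈ T z := fun z ↦ by
    have h1 : f₀ (z.1 - 1, z.2) ∈ T z := by
      have := hf₀ (z.1 - 1, z.2)
      rwa [← hper, sub_add_cancel] at this
    exact hconv z (hf₀ z) h1 (sub_nonneg.2 (Real.smoothTransition.le_one _))
      (Real.smoothTransition.nonneg _) (by ring)
  refine ⟨fun z ↦ G (Int.fract z.1, z.2), contDiff_iff_contDiffAt.2 fun z ↦ ?_, fun t x ↦ ?_,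
    fun z ↦ ?_⟩
  · set n := ⌊z.1⌋ with hn
    have h1 : ∀ᶠ w : ℝ × E in 𝓝 z, (n : ℝ) - 1 / 3 < w.1 ∧ w.1 < n + 1 :=
      (continuous_fst.continuousAt.eventually_const_lt (by
        have := Int.floor_le z.1; linarith)).and
        (continuous_fst.continuousAt.eventually_lt_const (Int.lt_floor_add_one z.1))
    have h2 : ContDiff ℝ ∞ fun w : ℝ × E ↦ G (w.1 - n, w.2) := hGs.comp (by fun_prop)
    refine h2.contDiffAt.congr_of_eventuallyEq ?_
    filter_upwards [h1] with w hw
    by_cases h : (n : ℝ) ≤ w.1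
    · have h3 : ⌊w.1⌋ = n := Int.floor_eq_iff.2 ⟨h, hw.2⟩
      rw [Int.fract, h3]
    · have h3 : ⌊w.1⌋ = n - 1 := Int.floor_eq_iff.2 ⟨by push_cast; linarith, by push_cast; linarith⟩
      rw [Int.fract, h3, hG2 _ _ (by push_cast; linarith), hG1 _ _ (by linarith)]
      push_cast
      congr 2; ring
  · simp only [Int.fract_add_one]
  · have h1 := hTint ⌊z.1⌋ (Int.fract z.1) z.2
    rw [Int.fract_add_floor] at h1
    change _ ∈ T (z.1, z.2)
    rw [h1]
    exact hGT _

/-! ### The global collar. -/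

section Collar

variable {M : Type*} [TopologicalSpace M] [ChartedSpace E3 M] [IsManifold (𝓡 3) ∞ M]
  {S : Type*} [TopologicalSpace S] [ChartedSpace (EuclideanHalfSpace 2) S]
  [IsManifold (𝓡∂ 2) ∞ S] {α : ∀ p : M, TangentSpace (𝓡 3) p →L[ℝ] ℝ} {γ : ℝ → M}
  {Φ : OpenPartialHomeomorph M (AddCircle (1 : ℝ) × ℝ × ℝ)} {j : S → M}

/-- In the coordinates `Φ` the surface is, near the axis, the ribbon `(t, r) ↦ (t, r D(t, r))`. -/
structure IsCollar (Φ : OpenPartialHomeomorph M (AddCircle (1 : ℝ) × ℝ × ℝ)) (j : S → M)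
    (D : ℝ × ℝ → ℝ × ℝ) (r₁ : ℝ) : Prop where
  pos : 0 < r₁
  smooth : ContDiff ℝ ∞ D
  periodic : ∀ t r, D (t + 1, r) = D (t, r)
  map : ∀ q, j q ∈ Φ.source → collarRadius Φ j q < r₁ → ∀ t : ℝ, (t : AddCircle (1 : ℝ)) =
    (Φ (j q)).1 → (Φ (j q)).2 = collarRadius Φ j q • D (t, collarRadius Φ j q)
  surj : ∀ t r, 0 ≤ r → r < r₁ → ∃ q, j q ∈ Φ.source ∧ Φ (j q) = cover (ribbon D (t, r))
  norm : ∀ t r, 0 ≤ r → r < r₁ → planeNorm (D (t, r)) = 1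
  chart : ∀ q, j q ∈ Φ.source → collarRadius Φ j q < r₁ → ∃ φ P, IsCollarChart Φ j q φ P

theorem IsCollar.mono {D : ℝ × ℝ → ℝ × ℝ} {r₁ r₂ : ℝ} (h : IsCollar Φ j D r₁) (h0 : 0 < r₂)
    (hr : r₂ ≤ r₁) : IsCollar Φ j D r₂ :=
  ⟨h0, h.smooth, h.periodic, fun q h1 h2 ↦ h.map q h1 (h2.trans_le hr),
    fun t r h1 h2 ↦ h.surj t r h1 (h2.trans_le hr), fun t r h1 h2 ↦ h.norm t r h1 (h2.trans_le hr),
    fun q h1 h2 ↦ h.chart q h1 (h2.trans_le hr)⟩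

/-- The map `d` describes the surface at the point with collar coordinates `x`. -/
structure IsCollarAt (Φ : OpenPartialHomeomorph M (AddCircle (1 : ℝ) × ℝ × ℝ)) (j : S → M)
    (d : ℝ × ℝ → ℝ × ℝ) (x : ℝ × ℝ) : Prop where
  smooth : ContDiffAt ℝ ∞ d x
  map : ∀ q, j q ∈ Φ.source → (Φ (j q)).1 = (x.1 : AddCircle (1 : ℝ)) → collarRadius Φ j q = x.2 →
    (Φ (j q)).2 = x.2 • d x ∧ ∃ φ P, IsCollarChart Φ j q φ P
  surj : 0 ≤ x.2 → ∃ q, j q ∈ Φ.source ∧ (Φ (j q)).1 = (x.1 : AddCircle (1 : ℝ)) ∧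
    collarRadius Φ j q = x.2

/-- Small collar coordinates mean a position near `j q₀` in the manifold, and for a topological
embedding this means nearness in `S`. No other sheet of the surface can interfere. -/
theorem eventually_mem_of_collar_coordinates (hj : IsEmbedding j) {q₀ : S} {t₀ : ℝ}
    (hs : j q₀ ∈ Φ.source) (ht₀ : Φ (j q₀) = cover (t₀, 0)) {N : Set S} (hN : N ∈ 𝓝 q₀) :
    ∀ᶠ x : ℝ × ℝ in 𝓝 (t₀, (0 : ℝ)), ∀ q, j q ∈ Φ.source →
      (Φ (j q)).1 = (x.1 : AddCircle (1 : ℝ)) → collarRadius Φ j q = x.2 → q ∈ N := by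
  rw [hj.nhds_eq_comap, Filter.mem_comap] at hN
  obtain ⟨O, hO, hON⟩ := hN
  have h1 : Filter.Tendsto (Φ.symm ∘ cover) (𝓝 (t₀, 0)) (𝓝 (j q₀)) := by
    have h2 := (Φ.symm.continuousAt (x := cover (t₀, 0)) (by rw [← ht₀]; exact Φ.map_source hs))
    have h3 := h2.comp (f := cover) isOpenQuotientMap_cover.continuous.continuousAt
    have h4 : Φ.symm (cover (t₀, 0)) = j q₀ := by rw [← ht₀]; exact Φ.left_inv hs
    rwa [ContinuousAt, comp_apply, h4] at h3
  obtain ⟨ε, hε, h2⟩ := Metric.eventually_nhds_iff.1 (h1.eventually hO)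
  refine Metric.eventually_nhds_iff.2 ⟨ε, hε, fun x hx q h3 h4 h5 ↦ hON ?_⟩
  rw [Prod.dist_eq, max_lt_iff] at hx
  have h6 : dist ((x.1, (Φ (j q)).2) : ℝ × ℝ × ℝ) (t₀, 0) < ε := by
    rw [Prod.dist_eq, max_lt_iff]
    refine ⟨hx.1, ?_⟩
    have h7 := norm_le_planeNorm (Φ (j q)).2
    have h8 : |x.2| < ε := by simpa [Real.dist_eq] using hx.2
    rw [dist_zero_right]
    exact (h7.trans (h5.le.trans (le_abs_self _))).trans_lt h8
  have h7 := h2 h6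
  have h8 : cover (x.1, (Φ (j q)).2) = Φ (j q) := Prod.ext h4.symm rfl
  rw [mem_preimage]
  rwa [comp_apply, h8, Φ.left_inv h3] at h7

theorem eventually_isCollarAt (hΦ : IsContactCoordinates α Φ)
    (hj : Manifold.IsSmoothEmbedding (𝓡∂ 2) (𝓡 3) ∞ j)
    (hbd : ∀ q ∈ (𝓡∂ 2).boundary S, (Φ (j q)).2 = 0) {q₀ : S} (hq₀ : q₀ ∈ (𝓡∂ 2).boundary S)
    (hs : j q₀ ∈ Φ.source) {t₀ : ℝ} (ht₀ : Φ (j q₀) = cover (t₀, 0)) :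
    ∃ d, ∀ᶠ x in 𝓝 (t₀, (0 : ℝ)), IsCollarAt Φ j d x := by
  obtain ⟨φ, P, d, hc, hP0, hd, hloc, hsurj⟩ := exists_local_collar hΦ hj hbd hq₀ hs ht₀
  refine ⟨d, ?_⟩
  have hP : Filter.Tendsto (fun q ↦ P (φ.extend (𝓡∂ 2) q)) (𝓝 q₀) (𝓝 (t₀, 0)) := by
    have h1 := hc.smooth.self_of_nhds.1.continuousAt
    rw [ContinuousAt, hP0] at h1
    exact h1.comp (φ.continuousAt_extend hc.mem_source)
  have hnear : ∀ᶠ y : ℝ × ℝ in 𝓝 (t₀, (0 : ℝ)), |y.1 - t₀| < 1 / 2 :=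
    ContinuousAt.eventually_lt (by fun_prop) continuousAt_const (by simp)
  have hsrc : ∀ᶠ q in 𝓝 q₀, j q ∈ Φ.source :=
    hj.isEmbedding.continuous.continuousAt.eventually (Φ.open_source.mem_nhds hs)
  filter_upwards [hd, hnear, hsurj _ ((hsrc.and hc.angle).and hc.radius),
    eventually_mem_of_collar_coordinates hj.isEmbedding hs ht₀
      ((((hP.eventually hnear).and hc.angle).and (hc.radius.and hloc)).and hc.eventually)]
    with x h1 h2 h3 h4
  refine ⟨h1, fun q hq1 hq2 hq3 ↦ ?_, fun h0 ↦ ?_⟩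
  · obtain ⟨⟨⟨h5, h6⟩, h7, h8⟩, h9⟩ := h4 q hq1 hq2 hq3
    refine ⟨?_, φ, P, h9⟩
    have h10 : P (φ.extend (𝓡∂ 2) q) = x := by
      refine Prod.ext ?_ (h7.trans hq3)
      obtain ⟨n, hn⟩ := addCircle_coe_eq_iff.1 (h6.trans hq2)
      have h11 : |(n : ℝ)| < 1 := by
        rw [abs_lt] at h2 h5 ⊢
        constructor <;> linarith
      -- Two lifts of one angle that are both within 1/2 of `t₀` coincide.
      have h12 : n = 0 := Int.abs_lt_one_iff.1 (by exact_mod_cast h11)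
      rw [hn, h12]; simp
    rw [h8, h10]
  · obtain ⟨q, ⟨⟨hq1, hq2⟩, hq3⟩, hq4⟩ := h3 h0
    have hq2' : ((P (φ.extend (𝓡∂ 2) q)).1 : AddCircle (1 : ℝ)) = (Φ (j q)).1 := hq2
    have hq3' : (P (φ.extend (𝓡∂ 2) q)).2 = collarRadius Φ j q := hq3
    rw [hq4] at hq2' hq3'
    exact ⟨q, hq1, hq2'.symm, hq3'.symm⟩

/-- For small positive `r` the position r D of a surface point determines D, so the constraint on D
is convex. For r ≤ 0 there is none. Local solutions smooth across r = 0 come from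
`eventually_isCollarAt`, and `exists_periodic_selection` glues them. -/
theorem exists_collar (hΦ : IsContactCoordinates α Φ)
    (hj : Manifold.IsSmoothEmbedding (𝓡∂ 2) (𝓡 3) ∞ j)
    (hγ : ∀ t : ℝ, γ t ∈ Φ.source ∧ Φ (γ t) = cover (t, 0))
    (hbd : j '' (𝓡∂ 2).boundary S = range γ) : ∃ D r₁, IsCollar Φ j D r₁ := by
  have hbd' : ∀ q ∈ (𝓡∂ 2).boundary S, (Φ (j q)).2 = 0 := fun q hq ↦ by
    obtain ⟨t, ht⟩ := hbd.subset (mem_image_of_mem j hq)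
    rw [← ht, (hγ t).2, cover_snd]
  have hcirc : ∀ t : ℝ, ((t + 1 : ℝ) : AddCircle (1 : ℝ)) = t := fun t ↦ by simp
  obtain ⟨δ, hδ, hstrip⟩ := exists_strip
    (p := fun t r ↦ ∃ d, ∀ᶠ x in 𝓝 (t, r), IsCollarAt Φ j d x)
    (fun t r ↦ by
      have key : ∀ (c : ℝ) (hc : ((c : ℝ) : AddCircle (1 : ℝ)) = 0) (t : ℝ),
          (∃ d, ∀ᶠ x in 𝓝 (t, r), IsCollarAt Φ j d x) →
          ∃ d, ∀ᶠ x in 𝓝 (t + c, r), IsCollarAt Φ j d x := by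
        rintro c hc t ⟨d, hd⟩
        have h1 : Filter.Tendsto (fun x : ℝ × ℝ ↦ (x.1 - c, x.2)) (𝓝 (t + c, r)) (𝓝 (t, r)) := by
          have : Continuous fun x : ℝ × ℝ ↦ (x.1 - c, x.2) := by fun_prop
          have h2 := this.tendsto (t + c, r)
          simpa using h2
        refine ⟨fun x ↦ d (x.1 - c, x.2), (h1.eventually hd).mono fun x hx ↦ ?_⟩
        have h3 : ((x.1 - c : ℝ) : AddCircle (1 : ℝ)) = x.1 := by
          rw [AddCircle.coe_sub, hc, sub_zero]
        refine ⟨hx.smooth.comp (g := d) (f := fun x : ℝ × ℝ ↦ (x.1 - c, x.2)) x (by fun_prop), ?_, ?_⟩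
        · have := hx.map
          simp only [h3] at this
          exact this
        · have := hx.surj
          simp only [h3] at this
          exact this
      refine ⟨fun h ↦ ?_, key 1 (by simp) t⟩
      have := key (-1) (by simp) _ h
      simpa using this)
    (fun t ↦ by
      obtain ⟨q, hq, hqt⟩ := hbd.superset (mem_range_self t)
      obtain ⟨d, hd⟩ := eventually_isCollarAt hΦ hj hbd' hq (hqt ▸ (hγ t).1) (hqt ▸ (hγ t).2)
      exact hd.eventually_nhds.mono fun z hz ↦ ⟨d, hz⟩)
  set T : ℝ × ℝ → Set (ℝ × ℝ) := fun x ↦ {d | 0 < x.2 → x.2 < δ / 2 → ∀ q, j q ∈ Φ.source →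
    (Φ (j q)).1 = (x.1 : AddCircle (1 : ℝ)) → collarRadius Φ j q = x.2 →
    (Φ (j q)).2 = x.2 • d} with hT
  obtain ⟨D, hD, hDper, hDT⟩ := exists_periodic_selection (T := T)
    (fun x d hd d' hd' a b ha hb hab h1 h2 q hq1 hq2 hq3 ↦ by
      have h3 := hd h1 h2 q hq1 hq2 hq3
      have h4 := hd' h1 h2 q hq1 hq2 hq3
      rw [smul_add, smul_comm _ a, smul_comm _ b, ← h3, ← h4, ← add_smul, hab, one_smul])
    (fun t r ↦ by simp only [hT, hcirc])
    (fun x ↦ by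
      by_cases hx : |x.2| < δ
      · obtain ⟨d, hd⟩ := hstrip x.1 x.2 hx
        exact ⟨d, hd.mono fun y hy ↦ ⟨hy.smooth, fun _ _ q h1 h2 h3 ↦ (hy.map q h1 h2 h3).1⟩⟩
      · refine ⟨fun _ ↦ 0, ?_⟩
        have h1 : ∀ᶠ y : ℝ × ℝ in 𝓝 x, δ / 2 < |y.2| :=
          ContinuousAt.eventually_lt continuousAt_const (by fun_prop) (by rw [not_lt] at hx; linarith)
        filter_upwards [h1] with y hy
        refine ⟨contDiffAt_const, fun h2 h3 ↦ ?_⟩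
        rw [abs_of_pos h2] at hy
        exact absurd hy h3.not_gt)
  have hmap : ∀ q, j q ∈ Φ.source → collarRadius Φ j q < δ / 2 → ∀ t : ℝ,
      (t : AddCircle (1 : ℝ)) = (Φ (j q)).1 →
      (Φ (j q)).2 = collarRadius Φ j q • D (t, collarRadius Φ j q) := fun q h1 h2 t h3 ↦ by
    rcases (planeNorm_nonneg (Φ (j q)).2).eq_or_lt with h4 | h4
    · have h5 : collarRadius Φ j q = 0 := h4.symm
      rw [h5, zero_smul]
      exact planeNorm_eq_zero.1 h5
    · exact hDT (t, collarRadius Φ j q) h4 h2 q h1 h3.symm rfl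
  have hsurj : ∀ t r, 0 ≤ r → r < δ / 2 → ∃ q, j q ∈ Φ.source ∧
      Φ (j q) = cover (ribbon D (t, r)) ∧ collarRadius Φ j q = r := fun t r h1 h2 ↦ by
    obtain ⟨d, hd⟩ := hstrip t r (by rw [Real.norm_eq_abs, abs_of_nonneg h1]; linarith)
    obtain ⟨q, hq1, hq2, hq3⟩ := hd.self_of_nhds.surj h1
    have h3 := hmap q hq1 (hq3.trans_lt h2) t hq2.symm
    rw [show collarRadius Φ j q = r from hq3] at h3
    exact ⟨q, hq1, Prod.ext hq2 h3, hq3⟩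
  have hnorm : ∀ t r, 0 < r → r < δ / 2 → planeNorm (D (t, r)) = 1 := fun t r h1 h2 ↦ by
    obtain ⟨q, hq1, hq2, hq3⟩ := hsurj t r h1.le h2
    rw [collarRadius, hq2, cover_snd, ribbon, planeNorm_smul, abs_of_pos h1] at hq3
    exact mul_left_cancel₀ h1.ne' (hq3.trans (mul_one r).symm)
  refine ⟨D, δ / 2, by positivity, hD, hDper, hmap, fun t r h1 h2 ↦ ?_, fun t r h1 h2 ↦ ?_,
    fun q h1 h2 ↦ ?_⟩
  · obtain ⟨q, hq1, hq2, -⟩ := hsurj t r h1 h2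
    exact ⟨q, hq1, hq2⟩
  · rcases h1.eq_or_lt with rfl | h1
    -- At r = 0 the surface does not constrain the length of `D`; it is obtained as a limit from r >
    -- 0.
    · have h3 : Filter.Tendsto (fun r ↦ planeNorm (D (t, r))) (𝓝[>] 0) (𝓝 (planeNorm (D (t, 0)))) := by
        have : Continuous fun r ↦ planeNorm (D (t, r)) :=
          continuous_planeNorm.comp (hD.continuous.comp (by fun_prop))
        exact this.continuousAt.mono_left nhdsWithin_le_nhds
      refine tendsto_nhds_unique h3 (tendsto_const_nhds.congr' ?_)
      filter_upwards [Ioo_mem_nhdsGT h2] with r hr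
      exact (hnorm t r hr.1 hr.2).symm
    · exact hnorm t r h1 h2
  · obtain ⟨t, ht⟩ := QuotientAddGroup.mk_surjective (Φ (j q)).1
    obtain ⟨d, hd⟩ := hstrip t (collarRadius Φ j q) (by
      rw [Real.norm_eq_abs, collarRadius, abs_of_nonneg (planeNorm_nonneg _)]
      change collarRadius Φ j q < δ
      linarith)
    exact (hd.self_of_nhds.map q h1 ht.symm rfl).2

end Collar

/-! ### Ribbons and the contact form along them. -/

section RibbonCalculus

variable {D : ℝ × ℝ → ℝ × ℝ}

theorem contDiff_ribbon (hD : ContDiff ℝ ∞ D) : ContDiff ℝ ∞ (ribbon D) :=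
  contDiff_fst.prodMk (contDiff_snd.smul hD)

theorem fderiv_ribbon (hD : ContDiff ℝ ∞ D) (x v : ℝ × ℝ) :
    fderiv ℝ (ribbon D) x v = (v.1, x.2 • fderiv ℝ D x v + v.2 • D x) := by
  have h1 := hasFDerivAt_snd (𝕜 := ℝ) (p := x)
  have h2 := (hD.differentiable (by simp) x).hasFDerivAt
  have h3 : HasFDerivAt (ribbon D) _ x :=
    (hasFDerivAt_fst (𝕜 := ℝ) (p := x)).prodMk (h1.smul h2)
  rw [h3.fderiv]
  simp

/-- The pullback of `dy + x dθ` under the ribbon parametrization. -/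
noncomputable def ribbonForm (D : ℝ × ℝ → ℝ × ℝ) (x : ℝ × ℝ) : ℝ × ℝ →L[ℝ] ℝ :=
  (stdForm (ribbon D x)).comp (fderiv ℝ (ribbon D) x)

theorem ribbonForm_apply (hD : ContDiff ℝ ∞ D) (x v : ℝ × ℝ) :
    ribbonForm D x v = x.2 * ((fderiv ℝ D x v).2 + (D x).1 * v.1) + v.2 * (D x).2 := by
  rw [ribbonForm, ContinuousLinearMap.comp_apply, stdForm_apply, fderiv_ribbon hD]
  simp only [ribbon, Prod.snd_add, Prod.smul_snd, Prod.smul_fst, smul_eq_mul]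
  ring

end RibbonCalculus

section Ribbon

variable {M : Type*} [TopologicalSpace M] [ChartedSpace E3 M] [IsManifold (𝓡 3) ∞ M]
  {S : Type*} [TopologicalSpace S] [ChartedSpace (EuclideanHalfSpace 2) S]
  [IsManifold (𝓡∂ 2) ∞ S] {α : ∀ p : M, TangentSpace (𝓡 3) p →L[ℝ] ℝ}
  {Φ : OpenPartialHomeomorph M (AddCircle (1 : ℝ) × ℝ × ℝ)} {f : S → M} {q : S}
  {D : ℝ × ℝ → ℝ × ℝ} {φ : OpenPartialHomeomorph S (EuclideanHalfSpace 2)} {P : E2 → ℝ × ℝ}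

/-- Near `q` the map `f` is the ribbon of `D`, in the coordinates `P ∘ φ` on the surface. -/
structure IsRibbonAt (Φ : OpenPartialHomeomorph M (AddCircle (1 : ℝ) × ℝ × ℝ))
    (D : ℝ × ℝ → ℝ × ℝ) (f : S → M) (q : S)
    (φ : OpenPartialHomeomorph S (EuclideanHalfSpace 2)) (P : E2 → ℝ × ℝ) : Prop where
  mem_atlas : φ ∈ IsManifold.maximalAtlas (𝓡∂ 2) ∞ S
  mem_source : q ∈ φ.source
  smooth : ∀ᶠ u in 𝓝 (φ.extend (𝓡∂ 2) q), ContDiffAt ℝ ∞ P u ∧ Bijective (fderiv ℝ P u)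
  mem_target : cover (ribbon D (P (φ.extend (𝓡∂ 2) q))) ∈ Φ.target
  eq : ∀ᶠ q' in 𝓝 q, f q' = Φ.symm (cover (ribbon D (P (φ.extend (𝓡∂ 2) q'))))

/-- The derivative of the coordinates `P ∘ φ` on the surface. -/
noncomputable def planeDeriv (φ : OpenPartialHomeomorph S (EuclideanHalfSpace 2))
    (P : E2 → ℝ × ℝ) (q : S) : E2 →L[ℝ] ℝ × ℝ :=
  mfderiv (𝓡∂ 2) 𝓘(ℝ, ℝ × ℝ) (P ∘ φ.extend (𝓡∂ 2)) q

/-- The derivative of a map from the surface to `M`, as a map between the model spaces. -/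
noncomputable def surfDeriv (f : S → M) (q : S) : E2 →L[ℝ] E3 := mfderiv (𝓡∂ 2) (𝓡 3) f q

namespace IsRibbonAt

theorem contMDiffAt (h : IsRibbonAt Φ D f q φ P) :
    ContMDiffAt (𝓡∂ 2) 𝓘(ℝ, ℝ × ℝ) ∞ (P ∘ φ.extend (𝓡∂ 2)) q :=
  h.smooth.self_of_nhds.1.contMDiffAt.comp q (contMDiffAt_extend_halfPlane h.mem_atlas h.mem_source)

theorem eventually (hD : ContDiff ℝ ∞ D) (h : IsRibbonAt Φ D f q φ P) :
    ∀ᶠ q' in 𝓝 q, IsRibbonAt Φ D f q' φ P := by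
  have h0 : ContinuousAt (fun q ↦ cover (ribbon D (P (φ.extend (𝓡∂ 2) q)))) q :=
    ContinuousAt.comp (f := P ∘ φ.extend (𝓡∂ 2)) (g := fun x ↦ cover (ribbon D x))
      (isOpenQuotientMap_cover.continuous.comp (contDiff_ribbon hD).continuous).continuousAt
      h.contMDiffAt.continuousAt
  filter_upwards [φ.open_source.mem_nhds h.mem_source, h.eq.eventually_nhds,
    h0.eventually (Φ.open_target.mem_nhds h.mem_target),
    (φ.continuousAt_extend h.mem_source).eventually h.smooth.eventually_nhds] with q' h1 h2 h3 h4
  exact ⟨h.mem_atlas, h1, h4, h3, h2⟩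

theorem planeDeriv_bijective (h : IsRibbonAt Φ D f q φ P) : Bijective (planeDeriv φ P q) := by
  have h1 := h.smooth.self_of_nhds
  have h2 : planeDeriv φ P q = _ := mfderiv_comp (I' := 𝓘(ℝ, E2)) q
    (h1.1.contMDiffAt.mdifferentiableAt (by simp))
    ((contMDiffAt_extend_halfPlane h.mem_atlas h.mem_source).mdifferentiableAt (by simp))
  rw [h2, mfderiv_eq_fderiv]
  exact h1.2.comp (bijective_mfderiv_extend h.mem_atlas h.mem_source)

theorem mfderiv_eq (hΦ : IsContactCoordinates α Φ) (hD : ContDiff ℝ ∞ D)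
    (h : IsRibbonAt Φ D f q φ P) :
    surfDeriv f q =
      (vecDeriv (Φ.symm ∘ cover) (ribbon D (P (φ.extend (𝓡∂ 2) q)))).comp
        ((fderiv ℝ (ribbon D) (P (φ.extend (𝓡∂ 2) q))).comp (planeDeriv φ P q)) := by
  have h1 : mfderiv (𝓡∂ 2) (𝓡 3) f q = _ := Filter.EventuallyEq.mfderiv_eq
    (f₁ := f) (f := (Φ.symm ∘ cover) ∘ (ribbon D ∘ (P ∘ φ.extend (𝓡∂ 2)))) h.eq
  have h2 := (hΦ.contMDiffAt h.mem_target).self_of_nhds.2.1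
  have h3 : ContMDiffAt 𝓘(ℝ, ℝ × ℝ) 𝓘(ℝ, ℝ × ℝ × ℝ) ∞ (ribbon D) (P (φ.extend (𝓡∂ 2) q)) :=
    (contDiff_ribbon hD).contDiffAt.contMDiffAt
  have h4 : mfderiv (𝓡∂ 2) 𝓘(ℝ, ℝ × ℝ × ℝ) (ribbon D ∘ (P ∘ φ.extend (𝓡∂ 2))) q = _ :=
    mfderiv_comp (I' := 𝓘(ℝ, ℝ × ℝ)) q (h3.mdifferentiableAt (by simp))
      (h.contMDiffAt.mdifferentiableAt (by simp))
  have h5 : mfderiv (𝓡∂ 2) (𝓡 3) ((Φ.symm ∘ cover) ∘ (ribbon D ∘ (P ∘ φ.extend (𝓡∂ 2)))) q = _ :=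
    mfderiv_comp (I' := 𝓘(ℝ, ℝ × ℝ × ℝ)) q (h2.mdifferentiableAt (by simp))
      ((h3.comp q h.contMDiffAt).mdifferentiableAt (by simp))
  refine h1.trans (h5.trans ?_)
  rw [h4, mfderiv_eq_fderiv]
  rfl

theorem self_eq (h : IsRibbonAt Φ D f q φ P) :
    f q = (Φ.symm ∘ cover) (ribbon D (P (φ.extend (𝓡∂ 2) q))) := h.eq.self_of_nhds

theorem form_mfderiv (hΦ : IsContactCoordinates α Φ) (hD : ContDiff ℝ ∞ D)
    (h : IsRibbonAt Φ D f q φ P) (v : E2) :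
    α (f q) (mfderiv (𝓡∂ 2) (𝓡 3) f q v) =
      ribbonForm D (P (φ.extend (𝓡∂ 2) q)) (planeDeriv φ P q v) := by
  have h1 := hΦ.pullback _ h.mem_target
    (fderiv ℝ (ribbon D) (P (φ.extend (𝓡∂ 2) q)) (planeDeriv φ P q v))
  rw [← stdForm_apply] at h1
  refine Eq.trans ?_ h1
  have h2 : ∀ (p p' : M) (u u' : E3), p = p' → u = u' → α p u = α p' u' := by
    rintro p p' u u' rfl rfl; rfl
  exact h2 _ _ _ _ h.self_eq (DFunLike.congr_fun (h.mfderiv_eq hΦ hD) v)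

theorem extD_mfderiv (hα : IsSmoothOneForm α) (hΦ : IsContactCoordinates α Φ)
    (hD : ContDiff ℝ ∞ D) (h : IsRibbonAt Φ D f q φ P) (v w : E2) :
    extD α (f q) (mfderiv (𝓡∂ 2) (𝓡 3) f q v) (mfderiv (𝓡∂ 2) (𝓡 3) f q w) =
      extDVec stdForm (ribbon D (P (φ.extend (𝓡∂ 2) q)))
        (fderiv ℝ (ribbon D) (P (φ.extend (𝓡∂ 2) q)) (planeDeriv φ P q v))
        (fderiv ℝ (ribbon D) (P (φ.extend (𝓡∂ 2) q)) (planeDeriv φ P q w)) := by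
  have h1 := hΦ.contMDiffAt h.mem_target
  have h3 : pullForm α (Φ.symm ∘ cover) =ᶠ[𝓝 (ribbon D (P (φ.extend (𝓡∂ 2) q)))] stdForm := by
    filter_upwards [h1] with z hz
    refine ContinuousLinearMap.ext fun u ↦ ?_
    rw [stdForm_apply]
    exact hΦ.pullback z hz.1 u
  rw [← extDVec_congr h3, extDVec_pullForm hα h1.self_of_nhds.2.1]
  have h2 : ∀ (p p' : M) (u u' v v' : E3), p = p' → u = u' → v = v' →
      extD α p u v = extD α p' u' v' := by
    rintro p p' u u' v v' rfl rfl rfl; rfl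
  exact h2 _ _ _ _ _ _ h.self_eq (DFunLike.congr_fun (h.mfderiv_eq hΦ hD) v)
    (DFunLike.congr_fun (h.mfderiv_eq hΦ hD) w)

theorem mfderiv_injective (hΦ : IsContactCoordinates α Φ) (hD : ContDiff ℝ ∞ D)
    (h : IsRibbonAt Φ D f q φ P)
    (hi : Injective (fderiv ℝ (ribbon D) (P (φ.extend (𝓡∂ 2) q)))) :
    Injective (surfDeriv f q) := by
  rw [h.mfderiv_eq hΦ hD]
  exact (hΦ.bijective _ h.mem_target).1.comp (hi.comp h.planeDeriv_bijective.1)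

/-- The tangent plane and the kernel of the non-zero form both have dimension 2, so they agree as
soon as the form vanishes on the tangent plane. -/
theorem isSingular_iff (hΦ : IsContactCoordinates α Φ) (hD : ContDiff ℝ ∞ D)
    (h : IsRibbonAt Φ D f q φ P)
    (hi : Injective (fderiv ℝ (ribbon D) (P (φ.extend (𝓡∂ 2) q)))) :
    IsSingular α f q ↔ ribbonForm D (P (φ.extend (𝓡∂ 2) q)) = 0 := by
  constructor
  · intro hs
    refine ContinuousLinearMap.ext fun w ↦ ?_
    obtain ⟨v, rfl⟩ := h.planeDeriv_bijective.2 w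
    rw [← h.form_mfderiv hΦ hD]
    have h1 : mfderiv (𝓡∂ 2) (𝓡 3) f q v ∈ LinearMap.ker (α (f q)).toLinearMap := by
      rw [← hs]; exact ⟨v, rfl⟩
    exact h1
  · intro hz
    set L : E2 →L[ℝ] E3 := surfDeriv f q with hL
    set A : E3 →L[ℝ] ℝ := α (f q) with hA
    have h0 : A ≠ 0 := by
      intro h0
      have h1 := hΦ.pullback _ h.mem_target (0, 0, 1)
      have h2 : ∀ (p p' : M) (u : E3), p = p' → α p u = α p' u := by
        rintro p p' u rfl; rfl
      have h3 := (h2 _ _ (vecDeriv (Φ.symm ∘ cover) (ribbon D (P (φ.extend (𝓡∂ 2) q)))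
        (0, 0, 1)) h.self_eq).trans h1
      have h4 : A (vecDeriv (Φ.symm ∘ cover) (ribbon D (P (φ.extend (𝓡∂ 2) q))) (0, 0, 1)) = 0 := by
        rw [h0]; rfl
      rw [show α (f q) _ = 0 from h4] at h3
      simp at h3
    change LinearMap.range L.toLinearMap = LinearMap.ker A.toLinearMap
    refine Submodule.eq_of_le_of_finrank_eq ?_ ?_
    · rintro _ ⟨v, rfl⟩
      have := h.form_mfderiv (α := α) hΦ hD v
      rw [hz] at this
      exact this
    · have h1 : Module.finrank ℝ (LinearMap.range L.toLinearMap) = 2 := by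
        rw [LinearMap.finrank_range_of_inj (h.mfderiv_injective hΦ hD hi)]; simp
      have h2 := A.toLinearMap.finrank_range_add_finrank_ker
      have h3 : LinearMap.range A.toLinearMap = ⊤ := by
        rw [LinearMap.range_eq_top]
        exact LinearMap.surjective fun h4 ↦ h0 (ContinuousLinearMap.coe_injective h4)
      rw [h3, finrank_top] at h2
      simp only [Module.finrank_self, finrank_euclideanSpace, Fintype.card_fin] at h2
      omega

end IsRibbonAt
end Ribbon

/-! ### Linearization of the characteristic field in ribbon coordinates. -/

theorem eigenvalues_of_triangular {A : E2 →L[ℝ] E2} (L : E2 ≃ₗ[ℝ] ℝ × ℝ) {p r w : ℝ}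
    (h : ∀ v, L (A v) = (p * (L v).1 + r * (L v).2, w * (L v).2)) :
    eigenvalues A = {(p : ℂ), (w : ℂ)} := by
  set b : Module.Basis (Fin 2) ℝ E2 := (Module.Basis.finTwoProd ℝ).map L.symm with hb
  have hm : LinearMap.toMatrix b b (A : E2 →ₗ[ℝ] E2) = !![p, r; 0, w] := by
    ext i k
    rw [LinearMap.toMatrix_apply]
    have : L (A (b k)) = (p * (L (b k)).1 + r * (L (b k)).2, w * (L (b k)).2) := h _
    have h1 : (b.repr (A (b k))) i = (Module.Basis.finTwoProd ℝ).repr (L (A (b k))) i := by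
      simp [hb]
    change (b.repr (A (b k))) i = _
    rw [h1, this]
    fin_cases i <;> fin_cases k <;> simp [hb]
  rw [eigenvalues, ← LinearMap.charpoly_toMatrix (A : E2 →ₗ[ℝ] E2) b, hm]
  have hc : (!![p, r; 0, w] : Matrix (Fin 2) (Fin 2) ℝ).charpoly =
      (Polynomial.X - Polynomial.C p) * (Polynomial.X - Polynomial.C w) := by
    rw [Matrix.charpoly, Matrix.det_fin_two]
    simp [Matrix.charmatrix_apply]
  rw [hc, Polynomial.map_mul]
  simp only [Polynomial.map_sub, Polynomial.map_X, Polynomial.map_C]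
  rw [Polynomial.roots_mul (mul_ne_zero (Polynomial.X_sub_C_ne_zero _)
    (Polynomial.X_sub_C_ne_zero _)), Polynomial.roots_X_sub_C, Polynomial.roots_X_sub_C]
  rfl

/-- At a zero of `Y` the term with the derivative of `c` drops out of the product rule, so
continuity of `c` suffices. The density of the area form and the change of frame therefore need not
be differentiated. -/
theorem hasFDerivWithinAt_clm_apply_of_zero {E F G : Type*} [NormedAddCommGroup E]
    [NormedSpace ℝ E] [NormedAddCommGroup F] [NormedSpace ℝ F] [NormedAddCommGroup G]
    [NormedSpace ℝ G] {c : E → F →L[ℝ] G} {Y : E → F} {Y' : E →L[ℝ] F} {s : Set E} {x : E}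
    (hc : ContinuousWithinAt c s x) (hY : HasFDerivWithinAt Y Y' s x) (h0 : Y x = 0) :
    HasFDerivWithinAt (fun y ↦ c y (Y y)) ((c x).comp Y') s x := by
  have h1 : HasFDerivWithinAt (fun y ↦ c x (Y y)) ((c x).comp Y') s x :=
    (c x).hasFDerivAt.comp_hasFDerivWithinAt x hY
  have h2 : HasFDerivWithinAt (fun y ↦ (c y - c x) (Y y)) (0 : E →L[ℝ] G) s x := by
    refine .of_isLittleO ?_
    have h3 : (fun y ↦ Y y) =O[𝓝[s] x] fun y ↦ y - x := by
      have := hY.isBigO_sub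
      simpa [h0] using this
    have h4 : (fun y ↦ c y - c x) =o[𝓝[s] x] fun _ ↦ (1 : ℝ) := by
      rw [Asymptotics.isLittleO_one_iff]
      have := hc.tendsto.sub_const (c x)
      simpa using this
    have h5 : (fun y ↦ ‖c y - c x‖ * ‖Y y‖) =o[𝓝[s] x] fun y ↦ (1 : ℝ) * ‖y - x‖ :=
      h4.norm_left.mul_isBigO h3.norm_norm
    have h6 : (fun y ↦ (c y - c x) (Y y)) =o[𝓝[s] x] fun y ↦ y - x := by
      refine (Asymptotics.IsBigO.of_norm_le fun y ↦ ?_).trans_isLittleO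
        (h5.trans_isBigO (Asymptotics.IsBigO.of_norm_le (g := fun y ↦ ‖y - x‖) fun y ↦ by simp)) |>.of_norm_right
      exact (c y - c x).le_opNorm _
    simpa [h0] using h6
  have h7 := h1.add h2
  rw [add_zero] at h7
  refine h7.congr_of_eventuallyEq (.of_forall fun y ↦ ?_) (by simp)
  simp

section AreaForm

variable {S : Type*} [TopologicalSpace S] [ChartedSpace (EuclideanHalfSpace 2) S]
  [IsManifold (𝓡∂ 2) ∞ S]
  {σ : ∀ q : S, TangentSpace (𝓡∂ 2) q →L[ℝ] TangentSpace (𝓡∂ 2) q →L[ℝ] ℝ}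

/-- The frame of the surface at `q` which is constant in the preferred chart at `q₀`. -/
noncomputable def chartFrame (q₀ q : S) : E2 →L[ℝ] E2 :=
  mfderivWithin 𝓘(ℝ, E2) (𝓡∂ 2) (extChartAt (𝓡∂ 2) q₀).symm (range (𝓡∂ 2))
    (extChartAt (𝓡∂ 2) q₀ q)

theorem chartFrame_self (q : S) : chartFrame q q = ContinuousLinearMap.id ℝ E2 := by
  have h1 := mfderivWithin_extChartAt_symm_comp_mfderiv_extChartAt' (I := 𝓡∂ 2)
    (mem_extChartAt_source q)
  rw [mfderiv_extChartAt_self] at h1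
  exact h1

theorem continuousAt_areaForm_chartFrame (hσ : IsAreaForm σ) (q₀ : S) (u v : E2) :
    ContinuousAt (fun q ↦ σ q (chartFrame q₀ q u) (chartFrame q₀ q v)) q₀ := by
  have hframe : ∀ u : E2, ContMDiffAt (𝓡∂ 2) ((𝓡∂ 2).prod 𝓘(ℝ, E2)) ∞
      (fun q ↦ Bundle.TotalSpace.mk' E2 (E := (TangentSpace (𝓡∂ 2) : S → Type)) q
        (chartFrame q₀ q u)) q₀ := fun u ↦ by
    refine (Bundle.Trivialization.contMDiffAt_section_iff
      (s := fun q ↦ (show TangentSpace (𝓡∂ 2) q from chartFrame q₀ q u))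
      (trivializationAt E2 (TangentSpace (𝓡∂ 2)) q₀) (by simp)).2 ?_
    refine (contMDiffAt_const (c := u)).congr_of_eventuallyEq ?_
    filter_upwards [(chartAt (EuclideanHalfSpace 2) q₀).open_source.mem_nhds
      (mem_chart_source _ q₀)] with q hq
    have h3 := TangentBundle.symmL_trivializationAt (I := 𝓡∂ 2) hq
    have h4 : (trivializationAt E2 (TangentSpace (𝓡∂ 2)) q₀).symmL ℝ q u = chartFrame q₀ q u := by
      rw [h3]; rfl
    have h5 := (trivializationAt E2 (TangentSpace (𝓡∂ 2) : S → Type)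
      q₀).continuousLinearMapAt_symmL (R := ℝ) (b := q) (by simpa using hq) u
    rw [h4, Bundle.Trivialization.continuousLinearMapAt_apply,
      Bundle.Trivialization.coe_linearMapAt_of_mem _ (by simpa using hq)] at h5
    exact h5
  have h := ContMDiffAt.clm_bundle_apply₂ (hσ.smooth q₀) (hframe u) (hframe v)
  rw [Bundle.contMDiffAt_totalSpace] at h
  simpa using h.2.continuousAt

end AreaForm

/-- The determinant of a pair of plane vectors. -/
def planeDet (u v : ℝ × ℝ) : ℝ := u.1 * v.2 - u.2 * v.1

theorem bilin_eq_planeDet {B : E2 →L[ℝ] E2 →L[ℝ] ℝ} (hB : ∀ v, B v v = 0) {L : E2 →L[ℝ] ℝ × ℝ}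
    (hL : Bijective L) {e₀ e₁ : E2} (h0 : e₀ = EuclideanSpace.single 0 1)
    (h1 : e₁ = EuclideanSpace.single 1 1) : planeDet (L e₀) (L e₁) ≠ 0 ∧
    ∀ u v, B u v = B e₀ e₁ / planeDet (L e₀) (L e₁) * planeDet (L u) (L v) := by
  have hdec : ∀ u : E2, u = u 0 • e₀ + u 1 • e₁ := fun u ↦ by
    ext i; fin_cases i <;> simp [h0, h1]
  have hBa : ∀ u v, B u v = (u 0 * v 1 - u 1 * v 0) * B e₀ e₁ := fun u v ↦ by
    have h2 : B e₁ e₀ = -B e₀ e₁ := by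
      have := hB (e₀ + e₁)
      simp only [map_add, add_apply, hB, zero_add, add_zero] at this
      linarith
    conv_lhs => rw [hdec u, hdec v]
    simp only [map_add, map_smul, add_apply, smul_apply, smul_eq_mul, hB, h2]
    ring
  have hLa : ∀ u v, planeDet (L u) (L v) = (u 0 * v 1 - u 1 * v 0) * planeDet (L e₀) (L e₁) :=
    fun u v ↦ by
      conv_lhs => rw [hdec u, hdec v]
      simp only [map_add, map_smul, planeDet, Prod.fst_add, Prod.snd_add, Prod.smul_fst,
        Prod.smul_snd, smul_eq_mul]
      ring
  have hne : planeDet (L e₀) (L e₁) ≠ 0 := by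
    intro h
    obtain ⟨u, hu⟩ := hL.2 (1, 0)
    obtain ⟨v, hv⟩ := hL.2 (0, 1)
    have h2 := hLa u v
    rw [h, hu, hv] at h2
    simp [planeDet] at h2
  refine ⟨hne, fun u v ↦ ?_⟩
  rw [hBa u v, hLa u v]
  field_simp

/-- The vector field dual to the ribbon form with respect to the standard area form. -/
noncomputable def ribbonField (D : ℝ × ℝ → ℝ × ℝ) (x : ℝ × ℝ) : ℝ × ℝ :=
  (ribbonForm D x (0, 1), -ribbonForm D x (1, 0))

section Linearization

variable {M : Type*} [TopologicalSpace M] [ChartedSpace E3 M] [IsManifold (𝓡 3) ∞ M]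
  {S : Type*} [TopologicalSpace S] [ChartedSpace (EuclideanHalfSpace 2) S]
  [IsManifold (𝓡∂ 2) ∞ S] {α : ∀ p : M, TangentSpace (𝓡 3) p →L[ℝ] ℝ}
  {σ : ∀ q : S, TangentSpace (𝓡∂ 2) q →L[ℝ] TangentSpace (𝓡∂ 2) q →L[ℝ] ℝ}
  {Φ : OpenPartialHomeomorph M (AddCircle (1 : ℝ) × ℝ × ℝ)} {j : S → M} {q₀ : S}
  {D : ℝ × ℝ → ℝ × ℝ} {φ : OpenPartialHomeomorph S (EuclideanHalfSpace 2)} {P : E2 → ℝ × ℝ}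

theorem IsRibbonAt.fderivWithin_chart {q : S} (h : IsRibbonAt Φ D j q φ P)
    (hq : q ∈ (extChartAt (𝓡∂ 2) q₀).source) :
    fderivWithin ℝ ((P ∘ φ.extend (𝓡∂ 2)) ∘ (extChartAt (𝓡∂ 2) q₀).symm) (range (𝓡∂ 2))
      (extChartAt (𝓡∂ 2) q₀ q) = (planeDeriv φ P q).comp (chartFrame q₀ q) := by
  have h0 := (extChartAt (𝓡∂ 2) q₀).left_inv hq
  have h1 := h.contMDiffAt.mdifferentiableAt (by simp)
  rw [← mfderivWithin_eq_fderivWithin]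
  have h2 := mfderiv_comp_mfderivWithin (I' := 𝓡∂ 2) (s := range (𝓡∂ 2))
    (f := (extChartAt (𝓡∂ 2) q₀).symm) (g := P ∘ φ.extend (𝓡∂ 2))
    (extChartAt (𝓡∂ 2) q₀ q) (by rw [h0]; exact h1)
    (mdifferentiableWithinAt_extChartAt_symm ((extChartAt (𝓡∂ 2) q₀).map_source hq))
    ((𝓡∂ 2).uniqueDiffOn.uniqueMDiffOn _ (extChartAt_target_subset_range q₀
      ((extChartAt (𝓡∂ 2) q₀).map_source hq)))
  refine h2.trans ?_
  have h3 : ∀ q', q' = q → (show E2 →L[ℝ] ℝ × ℝ from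
      mfderiv (𝓡∂ 2) 𝓘(ℝ, ℝ × ℝ) (P ∘ φ.extend (𝓡∂ 2)) q') = planeDeriv φ P q := by
    rintro _ rfl; rfl
  exact congrArg (fun A : E2 →L[ℝ] ℝ × ℝ ↦ A.comp (chartFrame q₀ q)) (h3 _ h0)

theorem chartFrame_bijective {q : S} (hq : q ∈ (extChartAt (𝓡∂ 2) q₀).source) :
    Bijective (chartFrame q₀ q) := by
  obtain ⟨e, he⟩ := isInvertible_mfderivWithin_extChartAt_symm (I := 𝓡∂ 2)
    ((extChartAt (𝓡∂ 2) q₀).map_source hq)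
  have : (chartFrame q₀ q : E2 → E2) = e := by
    ext1 v; exact (DFunLike.congr_fun he v).symm
  rw [this]
  exact e.bijective

/-- In the coordinates `P ∘ φ` the area form is a multiple s of the determinant, so the
characteristic field is `ribbonField` divided by s. At a zero, neither the variation of s nor the
passage to the preferred chart contributes beyond conjugation. -/
theorem exists_linearization_conj (hσ : IsAreaForm σ) (hΦ : IsContactCoordinates α Φ)
    (hD : ContDiff ℝ ∞ D) (h : IsRibbonAt Φ D j q₀ φ P) {Y' : ℝ × ℝ →L[ℝ] ℝ × ℝ}
    (hY : HasFDerivAt (ribbonField D) Y' (P (φ.extend (𝓡∂ 2) q₀)))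
    (hz : ribbonField D (P (φ.extend (𝓡∂ 2) q₀)) = 0) :
    ∃ s : ℝ, s ≠ 0 ∧
      (∀ u v : E2, σ q₀ u v = s * planeDet (planeDeriv φ P q₀ u) (planeDeriv φ P q₀ v)) ∧
      ∀ v, planeDeriv φ P q₀ (linearization (charField α σ j) q₀ v) =
        s⁻¹ • Y' (planeDeriv φ P q₀ v) := by
  set e := extChartAt (𝓡∂ 2) q₀ with he
  set Ψ : E2 → ℝ × ℝ := (P ∘ φ.extend (𝓡∂ 2)) ∘ e.symm with hΨ
  set e₀ : E2 := EuclideanSpace.single 0 1 with he₀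
  set e₁ : E2 := EuclideanSpace.single 1 1 with he₁
  set Λ : E2 → E2 →L[ℝ] ℝ × ℝ := fderivWithin ℝ Ψ (range (𝓡∂ 2)) with hΛ
  set T : S → E2 →L[ℝ] E2 := chartFrame q₀ with hT
  set B : S → E2 →L[ℝ] E2 →L[ℝ] ℝ := fun q ↦ σ q with hB
  set s : S → ℝ := fun q ↦ B q (T q e₀) (T q e₁) / planeDet (Λ (e q) e₀) (Λ (e q) e₁) with hs
  have hx₀ : e q₀ ∈ range (𝓡∂ 2) := extChartAt_target_subset_range q₀ (mem_extChartAt_target q₀)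
  have hsymm0 : e.symm (e q₀) = q₀ := extChartAt_to_inv q₀
  have hΛT : ∀ q, IsRibbonAt Φ D j q φ P → q ∈ e.source →
      Λ (e q) = (planeDeriv φ P q).comp (T q) ∧ Bijective (Λ (e q)) := fun q h1 h2 ↦ by
    have h3 := h1.fderivWithin_chart h2
    refine ⟨h3, ?_⟩
    change Bijective (fderivWithin ℝ _ _ _)
    rw [h3]
    exact h1.planeDeriv_bijective.comp (chartFrame_bijective h2)
  have hsB : ∀ q, IsRibbonAt Φ D j q φ P → q ∈ e.source → s q ≠ 0 ∧
      ∀ u v, B q (T q u) (T q v) = s q * planeDet (Λ (e q) u) (Λ (e q) v) := fun q h1 h2 ↦ by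
    set B' : E2 →L[ℝ] E2 →L[ℝ] ℝ :=
      (ContinuousLinearMap.precomp ℝ (T q)).comp ((B q).comp (T q)) with hB'
    have hB'a : ∀ u v, B' u v = B q (T q u) (T q v) := fun u v ↦ rfl
    obtain ⟨h3, h4⟩ := bilin_eq_planeDet (B := B') (fun v ↦ hσ.alternating q (T q v))
      (hΛT q h1 h2).2 he₀ he₁
    have h5 : ∀ u v, B q (T q u) (T q v) = s q * planeDet (Λ (e q) u) (Λ (e q) v) := h4
    refine ⟨fun h0 ↦ ?_, h5⟩
    obtain ⟨v, w, hvw⟩ := hσ.ne_zero q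
    obtain ⟨v', hv'⟩ := (chartFrame_bijective h2).2 v
    obtain ⟨w', hw'⟩ := (chartFrame_bijective h2).2 w
    have h6 := h5 v' w'
    rw [h0, zero_mul] at h6
    refine hvw ?_
    rw [← hv', ← hw']
    exact h6
  have hΨs : ContDiffWithinAt ℝ ∞ Ψ (range (𝓡∂ 2)) (e q₀) := by
    have := (contMDiffAt_iff.1 h.contMDiffAt).2
    simpa using! this
  have hΛc : ContinuousWithinAt Λ (range (𝓡∂ 2)) (e q₀) :=
    hΨs.continuousWithinAt_fderivWithin (𝓡∂ 2).uniqueDiffOn (by simp) hx₀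
  have hec : Filter.Tendsto e (𝓝 q₀) (𝓝[range (𝓡∂ 2)] (e q₀)) := by
    rw [he, ← map_extChartAt_nhds]
    exact Filter.tendsto_map
  have hΛq : ContinuousAt (fun q ↦ Λ (e q)) q₀ := hΛc.tendsto.comp hec
  have hsc : ContinuousAt s q₀ := by
    refine (continuousAt_areaForm_chartFrame hσ q₀ e₀ e₁).div ?_ ?_
    · have h1 : ∀ u : E2, ContinuousAt (fun q ↦ Λ (e q) u) q₀ := fun u ↦
        (continuous_eval_const u).continuousAt.comp hΛq
      exact ((h1 e₀).fst.mul (h1 e₁).snd).sub ((h1 e₀).snd.mul (h1 e₁).fst)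
    · exact (bilin_eq_planeDet (B := 0) (by simp) (hΛT q₀ h (mem_extChartAt_source q₀)).2 he₀ he₁).1
  obtain ⟨hs0, hsB0⟩ := hsB q₀ h (mem_extChartAt_source q₀)
  have hinv : ∀ A : E2 →L[ℝ] ℝ × ℝ, Bijective A → ∃ A' : E2 ≃L[ℝ] ℝ × ℝ, (A' : E2 →L[ℝ] ℝ × ℝ) = A :=
    fun A hA ↦ ⟨ContinuousLinearEquiv.ofBijective A (LinearMap.ker_eq_bot.2 hA.1)
      (LinearMap.range_eq_top.2 hA.2), ContinuousLinearEquiv.coe_ofBijective _ _ _⟩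
  have hesymm : Filter.Tendsto e.symm (𝓝[range (𝓡∂ 2)] (e q₀)) (𝓝 q₀) := by
    have := (continuousAt_extChartAt_symm (I := 𝓡∂ 2) q₀).tendsto
    rw [← he, hsymm0] at this
    exact this.mono_left nhdsWithin_le_nhds
  -- `c` turns the ribbon field into the characteristic field in the preferred chart; only its
  -- continuity is needed.
  set c : E2 → (ℝ × ℝ) →L[ℝ] E2 := fun x ↦ (s (e.symm x))⁻¹ • (Λ x).inverse with hc
  have hcc : ContinuousWithinAt c (range (𝓡∂ 2)) (e q₀) := by
    have h1 : ContinuousWithinAt (fun x ↦ s (e.symm x)) (range (𝓡∂ 2)) (e q₀) := by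
      have := hsc.tendsto.comp hesymm
      rw [ContinuousWithinAt, hsymm0]
      exact this
    refine (h1.inv₀ (by rwa [hsymm0])).smul ?_
    obtain ⟨A', hA'⟩ := hinv _ (hΛT q₀ h (mem_extChartAt_source q₀)).2
    have h2 : ContinuousAt ContinuousLinearMap.inverse (Λ (e q₀)) := by
      rw [← hA']
      exact (contDiffAt_map_inverse (n := 0) A').continuousAt
    exact h2.comp_continuousWithinAt hΛc
  have hΨ0 : Ψ (e q₀) = P (φ.extend (𝓡∂ 2) q₀) := by
    rw [hΨ, comp_apply, hsymm0]; rfl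
  have hY2 : HasFDerivAt (ribbonField D) Y' (Ψ (e q₀)) := by rw [hΨ0]; exact hY
  have hYd : HasFDerivWithinAt (fun x ↦ ribbonField D (Ψ x)) (Y'.comp (Λ (e q₀)))
      (range (𝓡∂ 2)) (e q₀) :=
    hY2.comp_hasFDerivWithinAt (e q₀)
      (hΨs.differentiableWithinAt (by simp)).hasFDerivWithinAt
  have hmain := hasFDerivWithinAt_clm_apply_of_zero hcc hYd (by rw [hΨ0, hz])
  set Zc : E2 → E2 := fun x ↦ VectorField.mpullbackWithin 𝓘(ℝ, E2) (𝓡∂ 2) e.symm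
    (charField α σ j) (range (𝓡∂ 2)) x with hZc
  have hZ : ∀ q, IsRibbonAt Φ D j q φ P → q ∈ e.source →
      Zc (e q) = c (e q) (ribbonField D (Ψ (e q))) := fun q h1 h2 ↦ by
    obtain ⟨hΛ1, hΛ2⟩ := hΛT q h1 h2
    obtain ⟨hs1, hs2⟩ := hsB q h1 h2
    have h3 : e.symm (e q) = q := e.left_inv h2
    have h4 : T q (Zc (e q)) = charField α σ j q := by
      have h5 := isInvertible_mfderivWithin_extChartAt_symm (I := 𝓡∂ 2) (e.map_source h2)
      have h6 : T q (Zc (e q)) = charField α σ j (e.symm (e q)) :=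
        h5.self_apply_inverse _
      rw [h6, h3]
    have h5 : ∀ y : ℝ × ℝ, s q * planeDet (Λ (e q) (Zc (e q))) y = ribbonForm D (Ψ (e q)) y := by
      intro y
      obtain ⟨v, rfl⟩ := hΛ2.2 y
      rw [← hs2, h4]
      refine (charField_spec α σ j hσ q (T q v)).trans ?_
      refine (h1.form_mfderiv hΦ hD (T q v)).trans ?_
      rw [hΛ1, hΨ, comp_apply, h3]
      rfl
    have h6 : Λ (e q) (Zc (e q)) = (s q)⁻¹ • ribbonField D (Ψ (e q)) := by
      have h7 := h5 (0, 1)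
      have h8 := h5 (1, 0)
      simp only [planeDet, mul_one, mul_zero, sub_zero, zero_sub, mul_neg] at h7 h8
      refine Prod.ext ?_ ?_
      · rw [ribbonField, ← h7]; simp [hs1]
      · rw [ribbonField, ← h8]; simp [hs1]
    obtain ⟨A', hA'⟩ := hinv _ hΛ2
    have h7 : c (e q) = (s q)⁻¹ • (A'.symm : ℝ × ℝ →L[ℝ] E2) := by
      simp only [hc]
      rw [h3, ← hA', ContinuousLinearMap.inverse_equiv]
    rw [h7, smul_apply]
    rw [← map_smul, ← h6, ← hA']
    simp
  have hlin : linearization (charField α σ j) q₀ =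
      (c (e q₀)).comp (Y'.comp (Λ (e q₀))) := by
    have h1 : HasFDerivWithinAt Zc ((c (e q₀)).comp (Y'.comp (Λ (e q₀)))) (range (𝓡∂ 2)) (e q₀) := by
      refine hmain.congr_of_eventuallyEq ?_ (hZ q₀ h (mem_extChartAt_source q₀))
      filter_upwards [hesymm.eventually (h.eventually hD),
        hesymm.eventually (extChartAt_source_mem_nhds (I := 𝓡∂ 2) q₀),
        extChartAt_target_mem_nhdsWithin (I := 𝓡∂ 2) q₀] with x h2 h3 h4
      have := hZ _ h2 h3
      rwa [e.right_inv h4] at this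
    exact h1.fderivWithin ((𝓡∂ 2).uniqueDiffOn _ hx₀)
  have hT0 : T q₀ = ContinuousLinearMap.id ℝ E2 := chartFrame_self q₀
  obtain ⟨hΛ1, hΛ2⟩ := hΛT q₀ h (mem_extChartAt_source q₀)
  rw [hT0, ContinuousLinearMap.comp_id] at hΛ1
  rw [hT0, hΛ1] at hsB0
  refine ⟨s q₀, hs0, hsB0, fun v ↦ ?_⟩
  obtain ⟨A', hA'⟩ := hinv _ hΛ2
  have h7 : c (e q₀) = (s q₀)⁻¹ • (A'.symm : ℝ × ℝ →L[ℝ] E2) := by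
    simp only [hc]
    rw [hsymm0, ← hA', ContinuousLinearMap.inverse_equiv]
  rw [hlin, h7, ← hΛ1, ← hA']
  simp

end Linearization

/-! ### Signs and types of the boundary singular points. -/

section BoundaryPoints

variable {M : Type*} [TopologicalSpace M] [ChartedSpace E3 M] [IsManifold (𝓡 3) ∞ M]
  {S : Type*} [TopologicalSpace S] [ChartedSpace (EuclideanHalfSpace 2) S]
  [IsManifold (𝓡∂ 2) ∞ S] {α : ∀ p : M, TangentSpace (𝓡 3) p →L[ℝ] ℝ} {γ : ℝ → M}
  {σ : ∀ q : S, TangentSpace (𝓡∂ 2) q →L[ℝ] TangentSpace (𝓡∂ 2) q →L[ℝ] ℝ}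
  {Φ : OpenPartialHomeomorph M (AddCircle (1 : ℝ) × ℝ × ℝ)} {j : S → M} {q : S}
  {D : ℝ × ℝ → ℝ × ℝ} {φ : OpenPartialHomeomorph S (EuclideanHalfSpace 2)} {P : E2 → ℝ × ℝ} {t : ℝ}

theorem ribbon_axis (D : ℝ × ℝ → ℝ × ℝ) (t : ℝ) : ribbon D (t, 0) = (t, 0) := by simp [ribbon]

theorem hasDerivAt_snd_comp_axis (hD : ContDiff ℝ ∞ D) (t : ℝ) :
    HasDerivAt (fun s ↦ (D (s, 0)).2) (fderiv ℝ D (t, 0) (1, 0)).2 t := by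
  have h1 : HasDerivAt (fun s : ℝ ↦ (s, (0 : ℝ))) (1, 0) t :=
    (hasDerivAt_id t).prodMk (hasDerivAt_const t 0)
  have h2 := (hD.differentiable (by simp) (t, 0)).hasFDerivAt.comp_hasDerivAt t h1
  exact hasFDerivAt_snd.comp_hasDerivAt t h2

/-- The axis is invariant under the ribbon field, since its radial component is divisible by `r`.
This makes the derivative triangular, with the eigenvalues on the diagonal. -/
theorem hasFDerivAt_ribbonField (hD : ContDiff ℝ ∞ D) (t : ℝ) :
    ∃ Y' : ℝ × ℝ →L[ℝ] ℝ × ℝ, HasFDerivAt (ribbonField D) Y' (t, 0) ∧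
      ∀ v, Y' v = (deriv (fun s ↦ (D (s, 0)).2) t * v.1 + 2 * (fderiv ℝ D (t, 0) (0, 1)).2 * v.2,
        -(deriv (fun s ↦ (D (s, 0)).2) t + (D (t, 0)).1) * v.2) := by
  have hDd : HasFDerivAt D (fderiv ℝ D (t, 0)) (t, 0) :=
    (hD.differentiable (by simp) (t, 0)).hasFDerivAt
  have hD' : ∀ v : ℝ × ℝ, DifferentiableAt ℝ (fun x ↦ fderiv ℝ D x v) (t, 0) := fun v ↦
    (((hD.fderiv_right (m := ∞) (by simp)).clm_apply contDiff_const).differentiable (by simp)) _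
  have h1 := (hasFDerivAt_snd (𝕜 := ℝ) (p := (t, (0 : ℝ)))).mul (hD' (0, 1)).snd.hasFDerivAt
  have h2 := (hasFDerivAt_snd (𝕜 := ℝ) (p := (t, (0 : ℝ)))).mul
    ((hD' (1, 0)).snd.add (hDd.differentiableAt.fst)).hasFDerivAt
  refine ⟨_, ((h1.add hDd.snd).prodMk h2.neg).congr_of_eventuallyEq (.of_forall fun x ↦ ?_),
    fun v ↦ ?_⟩
  · simp only [ribbonField, ribbonForm_apply hD]
    ext <;> simp
  · have hv : fderiv ℝ D (t, 0) v = v.1 • fderiv ℝ D (t, 0) (1, 0) + v.2 • fderiv ℝ D (t, 0) (0, 1) := by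
      rw [← map_smul, ← map_smul, ← map_add]
      simp
    rw [(hasDerivAt_snd_comp_axis hD t).deriv]
    refine Prod.ext ?_ ?_
    · simp [hv]
      ring
    · simp
      ring

theorem fderiv_ribbon_axis_injective (hD : ContDiff ℝ ∞ D) (hn : D (t, 0) ≠ 0) :
    Injective (fderiv ℝ (ribbon D) (t, 0)) := by
  rw [injective_iff_map_eq_zero]
  intro v hv
  rw [fderiv_ribbon hD] at hv
  have h1 : v.1 = 0 := congrArg Prod.fst hv
  have h2 : (0 : ℝ) • fderiv ℝ D (t, 0) v + v.2 • D (t, 0) = 0 := congrArg Prod.snd hv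
  rw [zero_smul, zero_add] at h2
  exact Prod.ext h1 ((smul_eq_zero.1 h2).resolve_right hn)

theorem isSingular_axis_iff (hΦ : IsContactCoordinates α Φ) (hD : ContDiff ℝ ∞ D)
    (h : IsRibbonAt Φ D j q φ P) (hx : P (φ.extend (𝓡∂ 2) q) = (t, 0)) (hn : D (t, 0) ≠ 0) :
    IsSingular α j q ↔ (D (t, 0)).2 = 0 := by
  rw [h.isSingular_iff hΦ hD (by rw [hx]; exact fderiv_ribbon_axis_injective hD hn), hx]
  constructor
  · intro h0
    have := DFunLike.congr_fun h0 (0, 1)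
    rw [ribbonForm_apply hD] at this
    simpa using this
  · intro h0
    refine ContinuousLinearMap.ext fun v ↦ ?_
    rw [ribbonForm_apply hD, h0]
    simp

theorem IsContactCoordinates.velocity_eq (hΦ : IsContactCoordinates α Φ)
    (hγ : ∀ t : ℝ, γ t ∈ Φ.source ∧ Φ (γ t) = cover (t, 0)) (t : ℝ) :
    (velocity γ t : E3) = vecDeriv (Φ.symm ∘ cover) (t, 0) (1, 0) := by
  have h0 : γ = (Φ.symm ∘ cover) ∘ fun s : ℝ ↦ ((s, 0) : ℝ × ℝ × ℝ) := by
    ext1 s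
    simp only [comp_apply]
    rw [← (hγ s).2, Φ.left_inv (hγ s).1]
  have htar : cover (t, 0) ∈ Φ.target := by rw [← (hγ t).2]; exact Φ.map_source (hγ t).1
  have h1 : HasDerivAt (fun s : ℝ ↦ ((s, 0) : ℝ × ℝ × ℝ)) (1, 0) t :=
    (hasDerivAt_id t).prodMk (hasDerivAt_const t 0)
  have h2 : vecDeriv ((Φ.symm ∘ cover) ∘ fun s : ℝ ↦ ((s, 0) : ℝ × ℝ × ℝ)) t = _ :=
    vecDeriv_comp (hΦ.contMDiffAt htar).self_of_nhds.2.1 h1.differentiableAt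
  have h3 : (velocity γ t : E3) = vecDeriv γ t 1 := rfl
  rw [h3]
  conv_lhs => rw [h0]
  rw [h2, ContinuousLinearMap.comp_apply, fderiv_apply_one_eq_deriv, h1.deriv]

/-- The radius attains its minimum 0 at `q`, so it does not decrease to first order along vectors of
the half-plane. -/
theorem planeDeriv_snd_nonneg (h : IsRibbonAt Φ D j q φ P) (hq : q ∈ (𝓡∂ 2).boundary S)
    (hx : P (φ.extend (𝓡∂ 2) q) = (t, 0))
    (hR : ∀ᶠ q' in 𝓝 q, 0 ≤ (P (φ.extend (𝓡∂ 2) q')).2) {w : E2} (hw : 0 ≤ w 0) :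
    0 ≤ (planeDeriv φ P q w).2 := by
  set e := extChartAt (𝓡∂ 2) q with he
  have hx₀ : e q ∈ range (𝓡∂ 2) := extChartAt_target_subset_range q (mem_extChartAt_target q)
  have hsymm0 : e.symm (e q) = q := extChartAt_to_inv q
  have hΨs : ContDiffWithinAt ℝ ∞ ((P ∘ φ.extend (𝓡∂ 2)) ∘ e.symm) (range (𝓡∂ 2)) (e q) := by
    have := (contMDiffAt_iff.1 h.contMDiffAt).2
    simpa using! this
  have hd := (hΨs.differentiableWithinAt (by simp)).hasFDerivWithinAt
  rw [h.fderivWithin_chart (mem_extChartAt_source q), chartFrame_self,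
    ContinuousLinearMap.comp_id] at hd
  have hmin : IsLocalMinOn (fun x ↦ (((P ∘ φ.extend (𝓡∂ 2)) ∘ e.symm) x).2) (range (𝓡∂ 2)) (e q) := by
    have hesymm : Filter.Tendsto e.symm (𝓝[range (𝓡∂ 2)] (e q)) (𝓝 q) := by
      have := (continuousAt_extChartAt_symm (I := 𝓡∂ 2) q).tendsto
      rw [← he, hsymm0] at this
      exact this.mono_left nhdsWithin_le_nhds
    filter_upwards [hesymm.eventually hR] with x hx'
    have : (((P ∘ φ.extend (𝓡∂ 2)) ∘ e.symm) (e q)).2 = 0 := by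
      rw [comp_apply, hsymm0, comp_apply, hx]
    rw [this]
    exact hx'
  refine hmin.hasFDerivWithinAt_nonneg hd.snd (mem_posTangentConeAt_of_segment_subset ?_)
  refine (𝓡∂ 2).convex_range.segment_subset hx₀ ?_
  rw [range_halfPlane] at hx₀ ⊢
  exact add_nonneg hx₀ hw

/-- The eigenvalues are b'/s and -(b' + a)/s, where s is the density of the area form. Their product
is -(a/s)² ρ(ρ + 1) with ρ = b'/a, positive exactly for -1 < ρ < 0. -/
theorem boundary_singular_invariants (hα : IsSmoothOneForm α) (hσ : IsAreaForm σ)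
    (hΦ : IsContactCoordinates α Φ)
    (hγ : ∀ t : ℝ, γ t ∈ Φ.source ∧ Φ (γ t) = cover (t, 0)) (hbd : IsOrientedBoundary σ j γ)
    (hD : ContDiff ℝ ∞ D) (h : IsRibbonAt Φ D j q φ P) (hq : q ∈ (𝓡∂ 2).boundary S)
    (hx : P (φ.extend (𝓡∂ 2) q) = (t, 0))
    (hR : ∀ᶠ q' in 𝓝 q, 0 ≤ (P (φ.extend (𝓡∂ 2) q')).2) (hn : D (t, 0) ≠ 0)
    (hs : IsSingular α j q) (hnd : IsNondegenerate α σ j q) :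
    deriv (fun s ↦ (D (s, 0)).2) t ≠ 0 ∧ deriv (fun s ↦ (D (s, 0)).2) t + (D (t, 0)).1 ≠ 0 ∧
    (IsPositive α σ j q → (D (t, 0)).1 < 0) ∧ (IsNegative α σ j q → 0 < (D (t, 0)).1) ∧
    (IsElliptic α σ j q → -1 < deriv (fun s ↦ (D (s, 0)).2) t / (D (t, 0)).1 ∧
      deriv (fun s ↦ (D (s, 0)).2) t / (D (t, 0)).1 < 0) ∧
    (IsHyperbolic α σ j q → deriv (fun s ↦ (D (s, 0)).2) t / (D (t, 0)).1 < -1 ∨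
      0 < deriv (fun s ↦ (D (s, 0)).2) t / (D (t, 0)).1) := by
  have hb := (isSingular_axis_iff hΦ hD h hx hn).1 hs
  obtain ⟨Y', hY', hY'v⟩ := hasFDerivAt_ribbonField hD t
  set b' := deriv (fun s ↦ (D (s, 0)).2) t with hb'
  set a := (D (t, 0)).1 with ha
  have ha0 : a ≠ 0 := fun h0 ↦ hn (Prod.ext h0 hb)
  obtain ⟨s, hs0, hdet, hlin⟩ := exists_linearization_conj hσ hΦ hD h (by rwa [hx]) (by
    rw [hx, ribbonField, ribbonForm_apply hD, ribbonForm_apply hD, hb]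
    simp)
  obtain ⟨hΛi, hΛs⟩ := h.planeDeriv_bijective
  obtain ⟨v, hv⟩ := hΛs (1, 0)
  obtain ⟨w, hw⟩ := hΛs (0, 1)
  -- The orientation convention enters here: the knot's velocity is ∂/∂t, an inward vector does not
  -- decrease r, and the pair is positive for `σ`.
  have hspos : 0 < s := by
    have hsource : cover (t, 0) ∈ Φ.target := by
      have := h.mem_target; rwa [hx, ribbon_axis] at this
    have hjq : j q = γ t := by
      rw [h.self_eq, hx, ribbon_axis, comp_apply, ← (hγ t).2, Φ.left_inv (hγ t).1]
    have hvel : surfDeriv j q v = velocity γ t := by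
      rw [h.mfderiv_eq hΦ hD, ContinuousLinearMap.comp_apply, ContinuousLinearMap.comp_apply, hv, hx,
        fderiv_ribbon hD, ribbon_axis, hΦ.velocity_eq hγ]
      simp
    have hin : IsInward q (EuclideanSpace.single 0 1 : E2) := by
      have : 0 < (EuclideanSpace.single 0 1 : E2) 0 := by simp
      have h1 : (show E2 →L[ℝ] E2 from mfderiv (𝓡∂ 2) 𝓘(ℝ, E2) (extChartAt (𝓡∂ 2) q) q) =
        ContinuousLinearMap.id ℝ E2 := mfderiv_extChartAt_self
      change 0 < ((show E2 →L[ℝ] E2 from mfderiv (𝓡∂ 2) 𝓘(ℝ, E2) (extChartAt (𝓡∂ 2) q) q)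
        (EuclideanSpace.single 0 1)) 0
      rw [h1]
      exact this
    have h1 := hbd.oriented t q hq hjq v (EuclideanSpace.single 0 1 : E2) hvel hin
    have h2 := planeDeriv_snd_nonneg h hq hx hR (w := EuclideanSpace.single 0 1) (by simp)
    rw [hdet, hv, planeDet] at h1
    simp only [one_mul, zero_mul, sub_zero] at h1
    exact pos_of_mul_pos_left h1 h2
  have heig : eigenvalues (linearization (charField α σ j) q) =
      {((s⁻¹ * b' : ℝ) : ℂ), ((-(s⁻¹ * (b' + a)) : ℝ) : ℂ)} := by
    refine eigenvalues_of_triangular (LinearEquiv.ofBijective (planeDeriv φ P q).toLinearMap ⟨hΛi, hΛs⟩)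
      (r := s⁻¹ * (2 * (fderiv ℝ D (t, 0) (0, 1)).2)) fun u ↦ ?_
    refine (hlin u).trans ?_
    rw [hY'v]
    refine Prod.ext ?_ ?_
    · change s⁻¹ * _ = s⁻¹ * b' * (planeDeriv φ P q u).1 + _ * (planeDeriv φ P q u).2
      ring
    · change s⁻¹ * _ = _ * (planeDeriv φ P q u).2
      ring
  have hprod : (eigenvalues (linearization (charField α σ j) q)).prod.re =
      -(s⁻¹ * a) ^ 2 * (b' / a * (b' / a + 1)) := by
    rw [heig]
    simp only [Multiset.insert_eq_cons, Multiset.prod_cons, Multiset.prod_singleton]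
    rw [← Complex.ofReal_mul, Complex.ofReal_re]
    field_simp
  have hc : 0 < (s⁻¹ * a) ^ 2 := by positivity
  have hext : extD α (j q) (mfderiv (𝓡∂ 2) (𝓡 3) j q v) (mfderiv (𝓡∂ 2) (𝓡 3) j q w) = -a := by
    rw [h.extD_mfderiv hα hΦ hD, extDVec_stdForm, hv, hw, hx, fderiv_ribbon hD, fderiv_ribbon hD]
    simp [ha]
  have hσvw : 0 < σ q v w := by
    rw [hdet, hv, hw]; simpa [planeDet] using hspos
  refine ⟨fun h0 ↦ ?_, fun h0 ↦ ?_, fun hp ↦ ?_, fun hp ↦ ?_, fun hp ↦ ?_, fun hp ↦ ?_⟩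
  · exact hnd ((s⁻¹ * b' : ℝ) : ℂ) (by rw [heig]; simp) (by rw [Complex.ofReal_re, h0, mul_zero])
  · exact hnd ((-(s⁻¹ * (b' + a)) : ℝ) : ℂ) (by rw [heig]; simp)
      (by rw [Complex.ofReal_re, h0, mul_zero, neg_zero])
  · have := hp.2 v w hσvw
    rw [hext] at this; linarith
  · have := hp.2 v w hσvw
    rw [hext] at this; linarith
  · have h1 := hp.2.2
    rw [hprod] at h1
    have h2 : b' / a * (b' / a + 1) < 0 := by nlinarith
    constructor <;> nlinarith
  · have h1 := hp.2.2
    rw [hprod] at h1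
    have h2 : 0 < b' / a * (b' / a + 1) := by nlinarith
    by_contra! h3
    nlinarith [h3.1, h3.2]

end BoundaryPoints

/-! ### Modification of the coefficient a. -/

/-- The smooth extension of the difference quotient `(b t - b z) / (t - z)`. -/
noncomputable def smoothSlope (b : ℝ → ℝ) (z t : ℝ) : ℝ :=
  ∫ s in (0 : ℝ)..1, deriv b (z + s * (t - z))

theorem contDiff_smoothSlope {b : ℝ → ℝ} (hb : ContDiff ℝ ∞ b) (z : ℝ) :
    ContDiff ℝ ∞ (smoothSlope b z) := by
  have hd : ContDiff ℝ ∞ (deriv b) := by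
    have := (hb.fderiv_right (m := ∞) (by simp)).clm_apply (contDiff_const (c := (1 : ℝ)))
    exact this
  set c : ℝ → C(unitInterval, ℝ) := fun x ↦ ⟨fun s ↦ (s : ℝ) * x, by fun_prop⟩ with hc
  have hcs : ContDiff ℝ ∞ c := by
    refine IsBoundedLinearMap.contDiff ⟨⟨fun z w ↦ ?_, fun a z ↦ ?_⟩, 1, one_pos, fun z ↦ ?_⟩
    · ext1 s; simp [hc]; ring
    · ext1 s; simp [hc]; ring
    · refine (ContinuousMap.norm_le _ (by positivity)).2 fun s ↦ ?_
      simp only [hc, ContinuousMap.coe_mk, norm_mul, Real.norm_eq_abs, abs_of_nonneg s.2.1]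
      exact mul_le_mul_of_nonneg_right s.2.2 (abs_nonneg z)
  have h1 := contDiff_integral_comp (f := fun y : ℝ ↦ deriv b (z + y)) (hd.comp (by fun_prop)) hcs
  have h2 := h1.comp (f := fun t : ℝ ↦ t - z) (by fun_prop)
  convert h2 using 1
  ext1 t
  refine intervalIntegral.integral_congr fun s hs ↦ ?_
  rw [uIcc_of_le zero_le_one] at hs
  simp only [IccExtend_of_mem _ _ hs]
  rfl

theorem smoothSlope_mul {b : ℝ → ℝ} (hb : ContDiff ℝ ∞ b) (z t : ℝ) :
    (t - z) * smoothSlope b z t = b t - b z := by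
  have h1 : ∀ s : ℝ, HasDerivAt (fun s : ℝ ↦ b (z + s * (t - z)))
      (deriv b (z + s * (t - z)) * (t - z)) s := fun s ↦ by
    have h2 : HasDerivAt (fun s : ℝ ↦ z + s * (t - z)) (t - z) s := by
      simpa using ((hasDerivAt_id s).mul_const (t - z)).const_add z
    exact ((hb.differentiable (by simp)) _).hasDerivAt.comp s h2
  have hd : Continuous (deriv b) := hb.continuous_deriv (by simp)
  have h4 := intervalIntegral.integral_eq_sub_of_hasDerivAt (a := 0) (b := 1)
    (fun s _ ↦ h1 s) (by
      refine Continuous.intervalIntegrable ?_ _ _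
      exact (hd.comp (by fun_prop)).mul continuous_const)
  rw [intervalIntegral.integral_mul_const] at h4
  rw [smoothSlope, mul_comm, h4]
  simp

theorem smoothSlope_self (b : ℝ → ℝ) (z : ℝ) : smoothSlope b z z = deriv b z := by
  simp [smoothSlope]

theorem smoothSlope_add {b : ℝ → ℝ} {c : ℝ} (hc : ∀ t, b (t + c) = b t) (z t : ℝ) :
    smoothSlope b (z + c) (t + c) = smoothSlope b z t := by
  have h : ∀ t, deriv b (t + c) = deriv b t := fun t ↦ by
    rw [← deriv_comp_add_const]
    congr 1
    ext1 s; exact hc s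
  unfold smoothSlope
  refine intervalIntegral.integral_congr fun s _ ↦ ?_
  have h1 : z + c + s * (t + c - (z + c)) = z + s * (t - z) + c := by ring
  simp only [h1, h]

/-- The zero `z` of `b` is of elliptic type for the pair `(a, b)`. -/
def IsEllipticZero (a b : ℝ → ℝ) (z : ℝ) : Prop := -1 < deriv b z / a z ∧ deriv b z / a z < 0

/-- `z < z'` are consecutive zeros of `b`. -/
def AreConsecutiveZeros (b : ℝ → ℝ) (z z' : ℝ) : Prop :=
  b z = 0 ∧ b z' = 0 ∧ z < z' ∧ ∀ t, z < t → t < z' → b t ≠ 0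

open Classical in
/-- The germ at the zero `z` of `b` prescribed for the modification of the coefficient `a`. -/
noncomputable def modelGerm (a b : ℝ → ℝ) (z t : ℝ) : ℝ :=
  if IsEllipticZero a b z then -2 * smoothSlope b z t else a t

section Modification

variable {a b : ℝ → ℝ}

theorem contDiff_modelGerm (ha : ContDiff ℝ ∞ a) (hb : ContDiff ℝ ∞ b) (z : ℝ) :
    ContDiff ℝ ∞ (modelGerm a b z) := by
  unfold modelGerm
  split_ifs
  · exact contDiff_const.mul (contDiff_smoothSlope hb z)
  · exact ha

theorem modelGerm_add {c : ℝ} (hac : ∀ t, a (t + c) = a t) (hbc : ∀ t, b (t + c) = b t)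
    (z t : ℝ) : modelGerm a b (z + c) (t + c) = modelGerm a b z t := by
  have h : deriv b (z + c) = deriv b z := by
    rw [← smoothSlope_self, ← smoothSlope_self, smoothSlope_add hbc]
  have h2 : IsEllipticZero a b (z + c) ↔ IsEllipticZero a b z := by
    rw [IsEllipticZero, IsEllipticZero, h, hac]
  unfold modelGerm
  by_cases h3 : IsEllipticZero a b z
  · rw [if_pos h3, if_pos (h2.2 h3), smoothSlope_add hbc]
  · rw [if_neg h3, if_neg (fun h4 ↦ h3 (h2.1 h4)), hac]

/-- At an elliptic zero the germ has the value -2 b'(z), and b'(z) has the sign opposite to a(z). -/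
theorem modelGerm_self_pos {z : ℝ} (ha : a z ≠ 0) : 0 < a z * modelGerm a b z z := by
  unfold modelGerm
  split_ifs with h
  · rw [smoothSlope_self]
    have h1 : deriv b z = deriv b z / a z * a z := by field_simp
    have h2 : 0 < a z ^ 2 := by positivity
    rw [h1]
    nlinarith [h.2]
  · exact mul_self_pos.2 ha

/-- Zeros with non-zero derivative are isolated, and the germ keeps the sign of its value at the
zero for a while; periodicity makes both radii uniform. -/
theorem exists_zero_spacing (ha : ContDiff ℝ ∞ a) (hb : ContDiff ℝ ∞ b) (hpa : Periodic a 1)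
    (hpb : Periodic b 1) (hab : ∀ t, b t = 0 → a t ≠ 0) (hb' : ∀ t, b t = 0 → deriv b t ≠ 0) :
    ∃ δ > 0, ∀ z t, b z = 0 → |t - z| < δ → (b t = 0 → t = z) ∧ 0 < a z * modelGerm a b z t := by
  obtain ⟨δ, hδ, h⟩ := exists_strip
    (p := fun z x ↦ b z = 0 → (b (z + x) = 0 → x = 0) ∧ 0 < a z * modelGerm a b z (z + x))
    (fun z x ↦ by
      rw [hpa, hpb, add_right_comm, hpb, modelGerm_add hpa hpb])
    (fun t ↦ by
      by_cases ht : b t = 0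
      · have h1 := ((hb.differentiable (by simp)) t).hasDerivAt.eventually_ne (hb' t ht) (c := 0)
        rw [eventually_nhdsWithin_iff] at h1
        have h2 : ∀ᶠ s in 𝓝 t, 0 < a t * modelGerm a b t s :=
          ContinuousAt.eventually_lt continuousAt_const
            (continuous_const.mul (contDiff_modelGerm ha hb t).continuous).continuousAt
            (modelGerm_self_pos (hab t ht))
        have h3 : Filter.Tendsto (fun z : ℝ × ℝ ↦ t + z.2) (𝓝 (t, 0)) (𝓝 t) := by
          have : Continuous fun z : ℝ × ℝ ↦ t + z.2 := by fun_prop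
          simpa using this.tendsto (t, 0)
        have h4 : Filter.Tendsto (fun z : ℝ × ℝ ↦ z.1) (𝓝 (t, 0)) (𝓝 t) :=
          continuous_fst.tendsto _
        filter_upwards [h3.eventually h1, h3.eventually h2, h4.eventually h1] with z h5 h6 h7 h8
        have h9 : z.1 = t := by
          by_contra h9
          exact h7 h9 h8
        rw [h9]
        refine ⟨fun h10 ↦ ?_, h6⟩
        by_contra h11
        exact h5 (by simpa using h11) h10
      · have : ∀ᶠ z : ℝ × ℝ in 𝓝 (t, 0), b z.1 ≠ 0 :=
          (hb.continuous.comp continuous_fst).continuousAt.eventually_ne ht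
        filter_upwards [this] with z hz h0
        exact absurd h0 hz)
  refine ⟨δ, hδ, fun z t hz ht ↦ ?_⟩
  have := h z (t - z) ht hz
  rw [add_sub_cancel] at this
  exact ⟨fun h0 ↦ sub_eq_zero.1 (this.1 h0), this.2⟩

/-- The values at `t` allowed for the modification of the coefficient `a`. -/
def modificationSet (a b : ℝ → ℝ) (η t : ℝ) : Set ℝ :=
  {y | (∀ z, b z = 0 → |t - z| < η → y = modelGerm a b z t) ∧
    ∀ z z', AreConsecutiveZeros b z z' → (z < t → t < (z + z') / 2 → 0 < a z * y) ∧
      (t = (z + z') / 2 → y = 0) ∧ ((z + z') / 2 < t → t < z' → 0 < a z' * y)}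

theorem convex_modificationSet (η t : ℝ) : Convex ℝ (modificationSet a b η t) := by
  have hpos : ∀ {k y y' c d : ℝ}, 0 ≤ c → 0 ≤ d → c + d = 1 → 0 < k * y → 0 < k * y' →
      0 < k * (c • y + d • y') := by
    intro k y y' c d hc hd hcd h1 h2
    simp only [smul_eq_mul]
    rcases hc.eq_or_lt with rfl | hc
    · have : d = 1 := by linarith
      simpa [this] using h2
    · nlinarith [mul_pos hc h1, mul_nonneg hd h2.le]
  rintro y ⟨h1, h2⟩ y' ⟨h1', h2'⟩ c d hc hd hcd
  refine ⟨fun z hz ht ↦ ?_, fun z z' hz ↦ ⟨fun h3 h4 ↦ ?_, fun h3 ↦ ?_, fun h3 h4 ↦ ?_⟩⟩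
  · rw [h1 z hz ht, h1' z hz ht, ← add_smul, hcd, one_smul]
  · exact hpos hc hd hcd ((h2 z z' hz).1 h3 h4) ((h2' z z' hz).1 h3 h4)
  · rw [(h2 z z' hz).2.1 h3, (h2' z z' hz).2.1 h3]; simp
  · exact hpos hc hd hcd ((h2 z z' hz).2.2 h3 h4) ((h2' z z' hz).2.2 h3 h4)

theorem modificationSet_subset_add {c : ℝ} (hac : ∀ t, a (t + c) = a t)
    (hbc : ∀ t, b (t + c) = b t) (η t : ℝ) :
    modificationSet a b η t ⊆ modificationSet a b η (t + c) := by
  have hb : ∀ z, b (z - c) = b z := fun z ↦ by rw [← hbc, sub_add_cancel]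
  have ha : ∀ z, a (z - c) = a z := fun z ↦ by rw [← hac, sub_add_cancel]
  rintro y ⟨h1, h2⟩
  refine ⟨fun z hz ht ↦ ?_, fun z z' hz ↦ ?_⟩
  · rw [h1 (z - c) (by rwa [hb]) (by convert ht using 2; ring), ← modelGerm_add hac hbc,
      sub_add_cancel]
  · have h3 := h2 (z - c) (z' - c) ⟨by rw [hb, hz.1], by rw [hb, hz.2.1], by linarith [hz.2.2.1],
      fun s hs hs' ↦ by
        rw [← hbc]; exact hz.2.2.2 _ (by linarith) (by linarith)⟩
    rw [ha, ha] at h3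
    exact ⟨fun h4 h5 ↦ h3.1 (by linarith) (by linarith), fun h4 ↦ h3.2.1 (by linarith),
      fun h4 h5 ↦ h3.2.2 (by linarith) (by linarith)⟩

/-- Spacing 4η puts the midpoint between consecutive zeros at distance at least 2η from both, so
prescribed germs and prescribed midpoint zeros do not meet. Elsewhere a constant with the right sign
will do. -/
theorem exists_local_modification (ha : ContDiff ℝ ∞ a) (hb : ContDiff ℝ ∞ b)
    (hab : ∀ t, b t = 0 → a t ≠ 0) {η : ℝ} (hη : 0 < η)
    (hsp : ∀ z t, b z = 0 → |t - z| < 4 * η → (b t = 0 → t = z) ∧ 0 < a z * modelGerm a b z t)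
    (t₀ : ℝ) : ∃ g : ℝ → ℝ, ContDiff ℝ ∞ g ∧ ∀ᶠ t in 𝓝 t₀, g t ∈ modificationSet a b η t := by
  have hgap : ∀ z z', AreConsecutiveZeros b z z' → 4 * η ≤ z' - z := fun z z' h ↦ by
    by_contra! hlt
    have := (hsp z z' h.1 (by rw [abs_of_pos (by linarith [h.2.2.1])]; exact hlt)).1 h.2.1
    linarith [h.2.2.1]
  by_cases hA : ∃ z, b z = 0 ∧ |t₀ - z| < 2 * η
  · obtain ⟨z, hz, hzt⟩ := hA
    refine ⟨modelGerm a b z, contDiff_modelGerm ha hb z, ?_⟩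
    have h1 : ∀ᶠ t in 𝓝 t₀, |t - z| < 2 * η :=
      ContinuousAt.eventually_lt (by fun_prop) continuousAt_const hzt
    filter_upwards [h1] with t ht
    have hout : ∀ z₁ z₂, AreConsecutiveZeros b z₁ z₂ → z ≤ z₁ ∨ z₂ ≤ z := fun z₁ z₂ h ↦ by
      by_contra! h2
      exact h.2.2.2 z h2.1 h2.2 hz
    have hpos := (hsp z t hz (by linarith)).2
    rw [abs_lt] at ht
    refine ⟨fun z₁ hz₁ ht₁ ↦ ?_, fun z₁ z₂ h ↦ ⟨fun h3 h4 ↦ ?_, fun h3 ↦ ?_, fun h3 h4 ↦ ?_⟩⟩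
    · rw [abs_lt] at ht₁
      rw [(hsp z z₁ hz (by rw [abs_lt]; constructor <;> linarith)).1 hz₁]
    · have h5 := hgap z₁ z₂ h
      rcases hout z₁ z₂ h with h6 | h6
      · rwa [(hsp z z₁ hz (by rw [abs_lt]; constructor <;> linarith)).1 h.1]
      · linarith
    · have h5 := hgap z₁ z₂ h
      rcases hout z₁ z₂ h with h6 | h6 <;> linarith
    · have h5 := hgap z₁ z₂ h
      rcases hout z₁ z₂ h with h6 | h6
      · linarith
      · rwa [(hsp z z₂ hz (by rw [abs_lt]; constructor <;> linarith)).1 h.2.1]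
  · push Not at hA
    have hnear : ∀ᶠ t in 𝓝 t₀, |t - t₀| < η :=
      ContinuousAt.eventually_lt (by fun_prop) continuousAt_const (by simpa using hη)
    have hfar : ∀ t, |t - t₀| < η → ∀ z, b z = 0 → ¬ |t - z| < η := fun t ht z hz h ↦ by
      have h1 := hA z hz
      have h2 := abs_sub_le t₀ t z
      rw [abs_sub_comm t₀ t] at h2
      linarith
    have hin : ∀ t, |t - t₀| < η → ∀ z z', AreConsecutiveZeros b z z' → z < t → t < z' →
        z < t₀ ∧ t₀ < z' := fun t ht z z' h h1 h2 ↦ by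
      have h3 := hA z h.1
      have h4 := hA z' h.2.1
      rw [abs_lt] at ht
      rw [le_abs] at h3 h4
      constructor
      · rcases h3 with h3 | h3 <;> linarith
      · rcases h4 with h4 | h4 <;> linarith
    by_cases hB : ∃ z z', AreConsecutiveZeros b z z' ∧ z < t₀ ∧ t₀ < z'
    · obtain ⟨z, z', h, hz, hz'⟩ := hB
      have huniq : ∀ z₁ z₂, AreConsecutiveZeros b z₁ z₂ → z₁ < t₀ → t₀ < z₂ → z₁ = z ∧ z₂ = z' :=
        fun z₁ z₂ h1 h2 h3 ↦ by
          have h4 := h1.2.2.2 z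
          have h5 := h1.2.2.2 z'
          have h6 := h.2.2.2 z₁
          have h7 := h.2.2.2 z₂
          constructor
          · refine le_antisymm ?_ ?_
            · by_contra! h8; exact h6 h8 (by linarith) h1.1
            · by_contra! h8; exact h4 h8 (by linarith) h.1
          · refine le_antisymm ?_ ?_
            · by_contra! h8; exact h5 (by linarith) h8 h.2.1
            · by_contra! h8; exact h7 (by linarith) h8 h1.2.1
      have haz := hab z h.1
      have haz' := hab z' h.2.1
      have key : ∀ g : ℝ → ℝ, (∀ᶠ t in 𝓝 t₀, (t < (z + z') / 2 → 0 < a z * g t) ∧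
          (t = (z + z') / 2 → g t = 0) ∧ ((z + z') / 2 < t → 0 < a z' * g t)) →
          ∀ᶠ t in 𝓝 t₀, g t ∈ modificationSet a b η t := by
        intro g hg
        filter_upwards [hg, hnear] with t h1 h2
        refine ⟨fun z₁ hz₁ h3 ↦ absurd h3 (hfar t h2 z₁ hz₁), fun z₁ z₂ h3 ↦ ?_⟩
        have h4 := h3.2.2.1
        refine ⟨fun h5 h6 ↦ ?_, fun h5 ↦ ?_, fun h5 h6 ↦ ?_⟩
        · obtain ⟨h7, h8⟩ := hin t h2 z₁ z₂ h3 h5 (by linarith)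
          obtain ⟨rfl, rfl⟩ := huniq z₁ z₂ h3 h7 h8
          exact h1.1 h6
        · obtain ⟨h7, h8⟩ := hin t h2 z₁ z₂ h3 (by linarith) (by linarith)
          obtain ⟨rfl, rfl⟩ := huniq z₁ z₂ h3 h7 h8
          exact h1.2.1 h5
        · obtain ⟨h7, h8⟩ := hin t h2 z₁ z₂ h3 (by linarith) h6
          obtain ⟨rfl, rfl⟩ := huniq z₁ z₂ h3 h7 h8
          exact h1.2.2 h5
      rcases lt_trichotomy t₀ ((z + z') / 2) with hm | hm | hm
      · refine ⟨fun _ ↦ a z, contDiff_const, key _ ?_⟩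
        filter_upwards [eventually_lt_nhds hm] with t ht
        exact ⟨fun _ ↦ mul_self_pos.2 haz, fun h1 ↦ absurd h1 ht.ne, fun h1 ↦ absurd h1 ht.not_gt⟩
      -- At the midpoint the function crosses zero linearly if the signs at the two ends differ, and
      -- touches it quadratically if they agree. Only the uniqueness of the zero matters.
      · rcases (mul_ne_zero haz haz').lt_or_gt with hs | hs
        · refine ⟨fun t ↦ a z * ((z + z') / 2 - t), by fun_prop, key _ (.of_forall fun t ↦
            ⟨fun h1 ↦ ?_, fun h1 ↦ by rw [h1]; ring, fun h1 ↦ ?_⟩)⟩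
          · have : 0 < a z * a z := mul_self_pos.2 haz
            nlinarith
          · nlinarith
        · refine ⟨fun t ↦ a z * ((z + z') / 2 - t) ^ 2, by fun_prop, key _ (.of_forall fun t ↦
            ⟨fun h1 ↦ ?_, fun h1 ↦ by rw [h1]; ring, fun h1 ↦ ?_⟩)⟩
          · have h2 : 0 < a z * a z := mul_self_pos.2 haz
            have h3 : 0 < ((z + z') / 2 - t) ^ 2 := by
              have : (z + z') / 2 - t ≠ 0 := (sub_pos.2 h1).ne'
              positivity
            nlinarith [mul_pos h2 h3]
          · have h3 : 0 < ((z + z') / 2 - t) ^ 2 := by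
              have : (z + z') / 2 - t ≠ 0 := (sub_neg.2 h1).ne
              positivity
            nlinarith [mul_pos hs h3]
      · refine ⟨fun _ ↦ a z', contDiff_const, key _ ?_⟩
        filter_upwards [eventually_gt_nhds hm] with t ht
        exact ⟨fun h1 ↦ absurd h1 ht.not_gt, fun h1 ↦ absurd h1 ht.ne', fun _ ↦ mul_self_pos.2 haz'⟩
    · refine ⟨fun _ ↦ 0, contDiff_const, ?_⟩
      filter_upwards [hnear] with t h2
      have hno : ∀ z₁ z₂, AreConsecutiveZeros b z₁ z₂ → z₁ < t → t < z₂ → False :=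
        fun z₁ z₂ h3 h4 h5 ↦ hB ⟨z₁, z₂, h3, hin t h2 z₁ z₂ h3 h4 h5⟩
      refine ⟨fun z₁ hz₁ h3 ↦ absurd h3 (hfar t h2 z₁ hz₁), fun z₁ z₂ h3 ↦ ?_⟩
      have h4 := h3.2.2.1
      exact ⟨fun h5 h6 ↦ (hno z₁ z₂ h3 h5 (by linarith)).elim, fun _ ↦ rfl,
        fun h5 h6 ↦ (hno z₁ z₂ h3 (by linarith) h6).elim⟩

theorem exists_modified_coefficient (ha : ContDiff ℝ ∞ a) (hb : ContDiff ℝ ∞ b)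
    (hpa : Periodic a 1) (hpb : Periodic b 1) (hab : ∀ t, b t = 0 → a t ≠ 0)
    (hb' : ∀ t, b t = 0 → deriv b t ≠ 0) :
    ∃ a' : ℝ → ℝ, ContDiff ℝ ∞ a' ∧ Periodic a' 1 ∧ (∀ z, b z = 0 → 0 < a z * a' z) ∧
      (∀ z, b z = 0 → IsEllipticZero a b z → a' z = -2 * deriv b z ∧
        ∃ ε > 0, ∀ t, |t - z| < ε → b t = -(1 / 2) * a' t * (t - z)) ∧
      (∀ z, b z = 0 → ¬ IsEllipticZero a b z → a' z = a z) ∧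
      ∀ z z', AreConsecutiveZeros b z z' → ∃! t, t ∈ Icc z z' ∧ a' t = 0 := by
  obtain ⟨δ, hδ, hsp⟩ := exists_zero_spacing ha hb hpa hpb hab hb'
  set η := δ / 4 with hη
  have hη0 : 0 < η := by positivity
  have hδη : δ = 4 * η := by rw [hη]; ring
  rw [hδη] at hsp
  have hpa' : ∀ t, a (t + -1) = a t := fun t ↦ by rw [← hpa, neg_add_cancel_right]
  have hpb' : ∀ t, b (t + -1) = b t := fun t ↦ by rw [← hpb, neg_add_cancel_right]
  -- The selection theorem has a second variable; here it is a dummy, later set to 0.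
  obtain ⟨f, hf, hfp, hfT⟩ := exists_periodic_selection (E := ℝ)
    (T := fun x ↦ modificationSet a b η x.1) (fun x ↦ convex_modificationSet η x.1)
    (fun t x ↦ by
      refine Subset.antisymm ?_ (modificationSet_subset_add hpa hpb η t)
      have := modificationSet_subset_add hpa' hpb' η (t + 1)
      rwa [add_neg_cancel_right] at this)
    (fun x ↦ by
      obtain ⟨g, hg, hgT⟩ := exists_local_modification ha hb hab hη0 hsp x.1
      refine ⟨fun y ↦ g y.1, ?_⟩
      filter_upwards [continuous_fst.continuousAt.eventually hgT] with y hy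
      exact ⟨(hg.comp contDiff_fst).contDiffAt, hy⟩)
  have hT : ∀ t, f (t, 0) ∈ modificationSet a b η t := fun t ↦ hfT (t, 0)
  have hz0 : ∀ z, b z = 0 → f (z, 0) = modelGerm a b z z := fun z hz ↦
    (hT z).1 z hz (by simpa using hη0)
  have hzpos : ∀ z, b z = 0 → 0 < a z * f (z, 0) := fun z hz ↦ by
    rw [hz0 z hz]; exact modelGerm_self_pos (hab z hz)
  refine ⟨fun t ↦ f (t, 0), hf.comp (by fun_prop), fun t ↦ hfp t 0, hzpos, fun z hz he ↦ ⟨?_, η, hη0,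
    fun t ht ↦ ?_⟩, fun z hz he ↦ ?_, fun z z' h ↦ ?_⟩
  · change f (z, 0) = _
    rw [hz0 z hz, modelGerm, if_pos he, smoothSlope_self]
  · have h1 := smoothSlope_mul hb z t
    rw [hz, sub_zero] at h1
    change b t = -(1 / 2) * f (t, 0) * (t - z)
    rw [(hT t).1 z hz ht, modelGerm, if_pos he, ← h1]
    ring
  · change f (z, 0) = _
    rw [hz0 z hz, modelGerm, if_neg he]
  · have h4 := h.2.2.1
    refine ⟨(z + z') / 2, ⟨⟨by linarith, by linarith⟩, ((hT _).2 z z' h).2.1 rfl⟩, ?_⟩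
    rintro t ⟨⟨h1, h2⟩, h3⟩
    change f (t, 0) = 0 at h3
    have h5 := (hT t).2 z z' h
    rw [h3, mul_zero, mul_zero] at h5
    by_contra hne
    rcases lt_or_gt_of_ne hne with h6 | h6
    · rcases h1.eq_or_lt with rfl | h1
      · have := hzpos z h.1
        rw [h3, mul_zero] at this
        exact lt_irrefl _ this
      · exact lt_irrefl _ (h5.1 h1 h6)
    · rcases h2.eq_or_lt with rfl | h2
      · have := hzpos t h.2.1
        rw [h3, mul_zero] at this
        exact lt_irrefl _ this
      · exact lt_irrefl _ (h5.2.2 h6 h2)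

end Modification

/-! ### Logarithmic cut-off functions. -/

theorem exists_bound_deriv_smoothTransition :
    ∃ C > 0, ∀ x, |deriv Real.smoothTransition x| ≤ C := by
  have hs : ContDiff ℝ ∞ Real.smoothTransition := Real.smoothTransition.contDiff
  obtain ⟨C, hC⟩ := isCompact_Icc.exists_bound_of_continuousOn (s := Icc (0 : ℝ) 1)
    (hs.continuous_deriv (by simp)).continuousOn
  refine ⟨max C 1, by positivity, fun x ↦ ?_⟩
  by_cases hx : x ∈ Icc (0 : ℝ) 1
  · exact (hC x hx).trans (le_max_left _ _)
  · have : deriv Real.smoothTransition x = 0 := by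
      rw [mem_Icc, not_and_or, not_le, not_le] at hx
      rcases hx with hx | hx
      · have h1 : Real.smoothTransition =ᶠ[𝓝 x] fun _ ↦ 0 := by
          filter_upwards [eventually_lt_nhds hx] with y hy
          exact Real.smoothTransition.zero_of_nonpos hy.le
        rw [h1.deriv_eq]; simp
      · have h1 : Real.smoothTransition =ᶠ[𝓝 x] fun _ ↦ 1 := by
          filter_upwards [eventually_gt_nhds hx] with y hy
          exact Real.smoothTransition.one_of_one_le hy.le
        rw [h1.deriv_eq]; simp
    rw [this]; simp

/-- A smooth step in κ log(ρ/r) has r χ'(r) of size at most κ times the maximal slope, independently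
of ρ. A step in r/ρ would only have r χ'(r) of order one, too large for the interpolation of
ribbons. -/
theorem exists_logarithmic_cutoff {ε ρ : ℝ} (hε : 0 < ε) (hρ : 0 < ρ) :
    ∃ χ : ℝ → ℝ, ContDiff ℝ ∞ χ ∧ (∀ r, χ r ∈ Icc (0 : ℝ) 1) ∧
      (∃ r₀ > 0, r₀ < ρ ∧ ∀ r ≤ r₀, χ r = 1) ∧ (∀ r, ρ ≤ r → χ r = 0) ∧
      ∀ r, 0 ≤ r → |r * deriv χ r| < ε := by
  obtain ⟨C, hC0, hC⟩ := exists_bound_deriv_smoothTransition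
  set κ : ℝ := ε / (2 * C) with hκ
  have hκ0 : 0 < κ := by positivity
  set g : ℝ → ℝ := fun r ↦ κ * (Real.log ρ - Real.log r) with hg
  set χ : ℝ → ℝ := fun r ↦ if r ≤ 0 then 1 else Real.smoothTransition (g r) with hχ
  set r₀ : ℝ := ρ * Real.exp (-κ⁻¹) with hr₀
  have hr₀0 : 0 < r₀ := by positivity
  have hone : ∀ r ≤ r₀, χ r = 1 := fun r hr ↦ by
    by_cases h : r ≤ 0
    · simp [hχ, h]
    · have h1 : Real.log r ≤ Real.log ρ - κ⁻¹ := by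
        have := Real.log_le_log (not_le.1 h) hr
        rwa [hr₀, Real.log_mul hρ.ne' (Real.exp_ne_zero _), Real.log_exp, ← sub_eq_add_neg] at this
      simp only [hχ, h, if_false]
      refine Real.smoothTransition.one_of_one_le ?_
      have h2 : κ * κ⁻¹ = 1 := mul_inv_cancel₀ hκ0.ne'
      simp only [hg]
      nlinarith
  have hpos : ∀ r, 0 < r → χ =ᶠ[𝓝 r] Real.smoothTransition ∘ g := fun r hr ↦ by
    filter_upwards [eventually_gt_nhds hr] with s hs
    simp [hχ, hs.not_ge]
  have hconst : ∀ r < r₀, χ =ᶠ[𝓝 r] fun _ ↦ 1 := fun r hr ↦ by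
    filter_upwards [eventually_lt_nhds hr] with s hs
    exact hone s hs.le
  have hgd : ∀ r, 0 < r → HasDerivAt g (κ * (0 - r⁻¹)) r := fun r hr ↦
    ((hasDerivAt_const r (Real.log ρ)).sub (Real.hasDerivAt_log hr.ne')).const_mul κ
  refine ⟨χ, contDiff_iff_contDiffAt.2 fun r ↦ ?_, fun r ↦ ?_, ⟨r₀, hr₀0, ?_, hone⟩, fun r hr ↦ ?_,
    fun r hr ↦ ?_⟩
  · rcases lt_or_ge r r₀ with h | h
    · exact contDiffAt_const.congr_of_eventuallyEq (hconst r h)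
    · have h0 : r ≠ 0 := (hr₀0.trans_le h).ne'
      refine ContDiffAt.congr_of_eventuallyEq ?_ (hpos r (hr₀0.trans_le h))
      exact Real.smoothTransition.contDiff.contDiffAt.comp r
        (contDiffAt_const.mul (contDiffAt_const.sub (Real.contDiffAt_log.2 h0)))
  · simp only [hχ]
    split_ifs
    · simp
    · exact ⟨Real.smoothTransition.nonneg _, Real.smoothTransition.le_one _⟩
  · have : Real.exp (-κ⁻¹) < 1 := Real.exp_lt_one_iff.2 (by simpa using hκ0)
    rw [hr₀]; nlinarith
  · have h0 : ¬ r ≤ 0 := not_le.2 (hρ.trans_le hr)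
    simp only [hχ, h0, if_false]
    refine Real.smoothTransition.zero_of_nonpos ?_
    have := Real.log_le_log hρ hr
    simp only [hg]
    nlinarith
  · rcases hr.eq_or_lt with rfl | hr
    · simpa using hε
    · rw [(hpos r hr).deriv_eq]
      have h1 : HasDerivAt (Real.smoothTransition ∘ g) _ r :=
        ((Real.smoothTransition.contDiff (n := 1)).differentiable (by simp) (g r)).hasDerivAt.comp r
          (hgd r hr)
      rw [h1.deriv]
      have h2 : r * (deriv Real.smoothTransition (g r) * (κ * (0 - r⁻¹))) =
          -(κ * deriv Real.smoothTransition (g r)) := by field_simp; ring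
      rw [h2, abs_neg, abs_mul, abs_of_pos hκ0]
      have h3 : κ * |deriv Real.smoothTransition (g r)| ≤ κ * C :=
        mul_le_mul_of_nonneg_left (hC _) hκ0.le
      have h4 : κ * C = ε / 2 := by rw [hκ]; field_simp
      linarith

/-! ### Interpolation between the ribbon and a cone over the axis. -/

section Modification

variable {D : ℝ × ℝ → ℝ × ℝ} {a' : ℝ → ℝ}

/-- The cone directions `(a', b)`, where `b` is the second component of `D` on the axis. -/
def coneDirection (D : ℝ × ℝ → ℝ × ℝ) (a' : ℝ → ℝ) (t : ℝ) : ℝ × ℝ := (a' t, (D (t, 0)).2)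

/-- The interpolation between `D` and the cone directions, with a cut-off `χ`. -/
def modifiedRibbon (D : ℝ × ℝ → ℝ × ℝ) (a' χ : ℝ → ℝ) (x : ℝ × ℝ) : ℝ × ℝ :=
  (1 - χ x.2) • D x + χ x.2 • coneDirection D a' x.1

/-- The Euclidean inner product on `ℝ × ℝ`. -/
def planeDot (u v : ℝ × ℝ) : ℝ := u.1 * v.1 + u.2 * v.2

/-- The radial derivative of the modified ribbon, for the values `c` of the cut-off and `e` of
its logarithmic derivative. -/
noncomputable def radialVelocity (D : ℝ × ℝ → ℝ × ℝ) (a' : ℝ → ℝ) (t r e c : ℝ) : ℝ × ℝ :=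
  (1 - c) • (D (t, r) + r • fderiv ℝ D (t, r) (0, 1)) + c • coneDirection D a' t +
    e • (coneDirection D a' t - D (t, r))

/-- The coefficients of the form of the modified ribbon, for the values `c` of the cut-off and
`e` of its logarithmic derivative. -/
noncomputable def formCoefficients (D : ℝ × ℝ → ℝ × ℝ) (a' : ℝ → ℝ) (t r e c : ℝ) : ℝ × ℝ :=
  ((1 - c) * ((fderiv ℝ D (t, r) (1, 0)).2 + (D (t, r)).1) +
      c * (deriv (fun s ↦ (D (s, 0)).2) t + a' t),
    (1 - c) * ((D (t, r)).2 + r * (fderiv ℝ D (t, r) (0, 1)).2) + c * (D (t, 0)).2 +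
      e * ((D (t, 0)).2 - (D (t, r)).2))

/-- For r = e = 0 both vectors run, as c varies, along horizontal segments at height b. If b ≠ 0,
the covector (0, b) is positive on them; if b = 0, the sign hypotheses keep them on one side of the
origin. Continuity and periodicity give a uniform δ. -/
theorem exists_uniform_positivity (hD : ContDiff ℝ ∞ D) (hDp : ∀ t r, D (t + 1, r) = D (t, r))
    (ha' : ContDiff ℝ ∞ a') (hpa' : Periodic a' 1)
    (h1 : ∀ t, (D (t, 0)).2 = 0 → 0 < (D (t, 0)).1 * a' t)
    (h2 : ∀ t, (D (t, 0)).2 = 0 → 0 < (deriv (fun s ↦ (D (s, 0)).2) t + (D (t, 0)).1) *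
      (deriv (fun s ↦ (D (s, 0)).2) t + a' t)) :
    ∃ δ > 0, ∀ t, ∃ w w' : ℝ × ℝ, ∀ r e c : ℝ, |r| < δ → |e| < δ → c ∈ Icc (0 : ℝ) 1 →
      0 < planeDot w (radialVelocity D a' t r e c) ∧
      0 < planeDot w' (formCoefficients D a' t r e c) := by
  set b' : ℝ → ℝ := deriv fun s ↦ (D (s, 0)).2 with hb'
  have hbs : ContDiff ℝ ∞ fun s ↦ (D (s, 0)).2 := contDiff_snd.comp (hD.comp (by fun_prop))
  have hb'c : Continuous b' := hbs.continuous_deriv (by simp)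
  have hb'p : ∀ t, b' (t + 1) = b' t := fun t ↦ by
    rw [hb', ← deriv_comp_add_const]
    congr 1; ext1 s; rw [hDp]
  have hfp : ∀ t r, fderiv ℝ D (t + 1, r) = fderiv ℝ D (t, r) := fun t r ↦ by
    have h3 : D = fun x ↦ D (x + (1, 0)) := by
      ext1 x
      rw [show x + (1, 0) = (x.1 + 1, x.2) by ext <;> simp, hDp]
    conv_rhs => rw [h3, fderiv_comp_add_right]
    congr 1
    ext <;> simp
  have hDc : Continuous D := hD.continuous
  have hfc : ∀ v, Continuous fun x ↦ fderiv ℝ D x v := fun v ↦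
    (hD.continuous_fderiv (by simp)).clm_apply continuous_const
  have ha'c := ha'.continuous
  obtain ⟨δ, hδ, h⟩ := exists_strip
    (p := fun t x ↦ ∃ w w' : ℝ × ℝ, ∀ r e c : ℝ, |r| ≤ |x| → |e| ≤ |x| → c ∈ Icc (0 : ℝ) 1 →
      0 < planeDot w (radialVelocity D a' t r e c) ∧
      0 < planeDot w' (formCoefficients D a' t r e c))
    (fun t x ↦ by
      simp only [radialVelocity, formCoefficients, coneDirection, hDp, hfp, hpa' t]
      have : deriv (fun s ↦ (D (s, 0)).2) (t + 1) = deriv (fun s ↦ (D (s, 0)).2) t := hb'p t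
      rw [this])
    (fun t ↦ by
      obtain ⟨w, hw0, hw1⟩ : ∃ w : ℝ × ℝ, 0 < planeDot w (D (t, 0)) ∧
          0 < planeDot w (coneDirection D a' t) := by
        by_cases hb : (D (t, 0)).2 = 0
        · refine ⟨((D (t, 0)).1, 0), ?_, ?_⟩
          · have : (D (t, 0)).1 ≠ 0 := fun h0 ↦ by have := h1 t hb; simp [h0] at this
            simp only [planeDot, zero_mul, add_zero]
            exact mul_self_pos.2 this
          · simpa [planeDot, coneDirection] using h1 t hb
        · refine ⟨(0, (D (t, 0)).2), ?_, ?_⟩ <;>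
          · simp only [planeDot, coneDirection, zero_mul, zero_add]
            exact mul_self_pos.2 hb
      obtain ⟨w', hw'0, hw'1⟩ : ∃ w' : ℝ × ℝ,
          0 < planeDot w' (b' t + (D (t, 0)).1, (D (t, 0)).2) ∧
          0 < planeDot w' (b' t + a' t, (D (t, 0)).2) := by
        by_cases hb : (D (t, 0)).2 = 0
        · refine ⟨(b' t + (D (t, 0)).1, 0), ?_, ?_⟩
          · have : b' t + (D (t, 0)).1 ≠ 0 := fun h0 ↦ by have := h2 t hb; rw [h0] at this; simp at this
            simp only [planeDot, zero_mul, add_zero]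
            exact mul_self_pos.2 this
          · simpa [planeDot] using h2 t hb
        · refine ⟨(0, (D (t, 0)).2), ?_, ?_⟩ <;>
          · simp only [planeDot, zero_mul, zero_add]
            exact mul_self_pos.2 hb
      have hdot : ∀ w : ℝ × ℝ, ∀ f : ℝ × ℝ × ℝ → ℝ × ℝ, Continuous f →
          0 < planeDot w (f (t, 0, 0)) → ∀ᶠ y in 𝓝 (t, ((0 : ℝ), (0 : ℝ))), 0 < planeDot w (f y) :=
        fun w f hf h0 ↦ ContinuousAt.eventually_lt (f := fun _ ↦ (0 : ℝ)) continuousAt_const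
          (by unfold planeDot; fun_prop) h0
      have hcone : Continuous (coneDirection D a') := ha'c.prodMk hbs.continuous
      have hv0 := hdot w (fun y ↦ radialVelocity D a' y.1 y.2.1 y.2.2 0)
        (by
          have := hfc (0, 1)
          unfold radialVelocity; fun_prop) (by simpa [radialVelocity] using hw0)
      have hv1 := hdot w (fun y ↦ radialVelocity D a' y.1 y.2.1 y.2.2 1)
        (by
          have := hfc (0, 1)
          unfold radialVelocity; fun_prop) (by simpa [radialVelocity] using hw1)
      have hbt : (fderiv ℝ D (t, 0) (1, 0)).2 = b' t := (hasDerivAt_snd_comp_axis hD t).deriv.symm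
      have hf0 := hdot w' (fun y ↦ formCoefficients D a' y.1 y.2.1 y.2.2 0)
        (by
          have := hfc (0, 1)
          have := hfc (1, 0)
          unfold formCoefficients; rw [← hb']; fun_prop) (by simpa [formCoefficients, hbt] using hw'0)
      have hf1 := hdot w' (fun y ↦ formCoefficients D a' y.1 y.2.1 y.2.2 1)
        (by
          have := hfc (0, 1)
          have := hfc (1, 0)
          unfold formCoefficients; rw [← hb']; fun_prop) (by simpa [formCoefficients] using hw'1)
      obtain ⟨ε, hε, hball⟩ := Metric.eventually_nhds_iff.1 ((hv0.and hv1).and (hf0.and hf1))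
      refine Metric.eventually_nhds_iff.2 ⟨ε, hε, fun z hz ↦ ⟨w, w', fun r e c hr he hc ↦ ?_⟩⟩
      rw [Prod.dist_eq, max_lt_iff] at hz
      have hz2 : |z.2| < ε := by simpa [Real.dist_eq] using hz.2
      have hy : dist (z.1, r, e) (t, (0 : ℝ), (0 : ℝ)) < ε := by
        rw [Prod.dist_eq, Prod.dist_eq, max_lt_iff, max_lt_iff]
        refine ⟨hz.1, ?_, ?_⟩ <;> simp only [Real.dist_eq, sub_zero] <;> linarith
      obtain ⟨⟨h3, h4⟩, h5, h6⟩ := hball hy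
      -- Both vectors are affine in `c`, so the cases c = 0 and c = 1 suffice.
      have hconv : ∀ {x y : ℝ}, 0 < x → 0 < y → 0 < (1 - c) * x + c * y := fun {x y} hx hy ↦ by
        rcases hc.1.eq_or_lt with h0 | h0
        · rw [← h0]; simpa using hx
        · nlinarith [mul_pos h0 hy, mul_nonneg (sub_nonneg.2 hc.2) hx.le]
      have h7 := hconv h3 h4
      have h8 := hconv h5 h6
      constructor
      · convert h7 using 1
        simp only [planeDot, radialVelocity, Prod.fst_add, Prod.snd_add, Prod.smul_fst,
          Prod.smul_snd, smul_eq_mul, Prod.fst_sub, Prod.snd_sub]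
        ring
      · convert h8 using 1
        simp only [planeDot, formCoefficients]
        ring)
  refine ⟨δ / 2, by positivity, fun t ↦ ?_⟩
  obtain ⟨w, w', hw⟩ := h t (δ / 2) (by rw [Real.norm_eq_abs, abs_of_pos (by positivity)]; linarith)
  refine ⟨w, w', fun r e c hr he hc ↦ hw r e c ?_ ?_ hc⟩ <;>
  · rw [abs_of_pos (by positivity : 0 < δ / 2)]; linarith

variable {χ : ℝ → ℝ}

theorem contDiff_coneDirection (hD : ContDiff ℝ ∞ D) (ha' : ContDiff ℝ ∞ a') :
    ContDiff ℝ ∞ (coneDirection D a') :=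
  ha'.prodMk (contDiff_snd.comp (hD.comp (by fun_prop)))

theorem contDiff_modifiedRibbon (hD : ContDiff ℝ ∞ D) (ha' : ContDiff ℝ ∞ a')
    (hχ : ContDiff ℝ ∞ χ) : ContDiff ℝ ∞ (modifiedRibbon D a' χ) := by
  have h1 : ContDiff ℝ ∞ fun x : ℝ × ℝ ↦ χ x.2 := hχ.comp contDiff_snd
  exact ((contDiff_const.sub h1).smul hD).add
    (h1.smul ((contDiff_coneDirection hD ha').comp contDiff_fst))

theorem fderiv_modifiedRibbon (hD : ContDiff ℝ ∞ D) (ha' : ContDiff ℝ ∞ a')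
    (hχ : ContDiff ℝ ∞ χ) (x v : ℝ × ℝ) : fderiv ℝ (modifiedRibbon D a' χ) x v =
      (1 - χ x.2) • fderiv ℝ D x v + (χ x.2 * v.1) • (deriv a' x.1, deriv (fun s ↦ (D (s, 0)).2) x.1) +
        (deriv χ x.2 * v.2) • (coneDirection D a' x.1 - D x) := by
  have h1 : HasFDerivAt (fun x : ℝ × ℝ ↦ χ x.2) (deriv χ x.2 • ContinuousLinearMap.snd ℝ ℝ ℝ) x :=
    ((hχ.differentiable (by simp)) x.2).hasDerivAt.comp_hasFDerivAt x hasFDerivAt_snd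
  have hbs : ContDiff ℝ ∞ fun s ↦ (D (s, 0)).2 := contDiff_snd.comp (hD.comp (by fun_prop))
  have h2 : HasDerivAt (coneDirection D a') (deriv a' x.1, deriv (fun s ↦ (D (s, 0)).2) x.1) x.1 :=
    ((ha'.differentiable (by simp)) x.1).hasDerivAt.prodMk
      ((hbs.differentiable (by simp)) x.1).hasDerivAt
  have h3 := h2.hasFDerivAt.comp x (hasFDerivAt_fst (𝕜 := ℝ) (p := x))
  have h4 : HasFDerivAt (modifiedRibbon D a' χ) _ x :=
    ((h1.const_sub 1).smul (hD.differentiable (by simp) x).hasFDerivAt).add (h1.smul h3)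
  rw [h4.fderiv]
  simp only [add_apply, smul_apply, ContinuousLinearMap.smulRight_apply, neg_apply,
    ContinuousLinearMap.comp_apply, ContinuousLinearMap.coe_fst', ContinuousLinearMap.coe_snd',
    ContinuousLinearMap.toSpanSingleton_apply, comp_apply, smul_eq_mul]
  module

theorem radialVelocity_eq (hD : ContDiff ℝ ∞ D) (ha' : ContDiff ℝ ∞ a')
    (hχ : ContDiff ℝ ∞ χ) (t r : ℝ) : modifiedRibbon D a' χ (t, r) +
      r • fderiv ℝ (modifiedRibbon D a' χ) (t, r) (0, 1) =
      radialVelocity D a' t r (r * deriv χ r) (χ r) := by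
  rw [fderiv_modifiedRibbon hD ha' hχ, modifiedRibbon, radialVelocity]
  module

theorem ribbonForm_modifiedRibbon (hD : ContDiff ℝ ∞ D) (ha' : ContDiff ℝ ∞ a')
    (hχ : ContDiff ℝ ∞ χ) (t r : ℝ) :
    ribbonForm (modifiedRibbon D a' χ) (t, r) (1, 0) =
        r * (formCoefficients D a' t r (r * deriv χ r) (χ r)).1 ∧
      ribbonForm (modifiedRibbon D a' χ) (t, r) (0, 1) =
        (formCoefficients D a' t r (r * deriv χ r) (χ r)).2 := by
  have h := contDiff_modifiedRibbon hD ha' hχ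
  rw [ribbonForm_apply h, ribbonForm_apply h, fderiv_modifiedRibbon hD ha' hχ,
    fderiv_modifiedRibbon hD ha' hχ]
  simp only [modifiedRibbon, formCoefficients, coneDirection, Prod.fst_add, Prod.snd_add,
    Prod.smul_fst, Prod.smul_snd, smul_eq_mul, Prod.snd_sub]
  constructor <;> ring

/-- The linear functional `w` increases strictly along the ray, its derivative there being its value
on the radial velocity. -/
theorem injOn_radial_modifiedRibbon (hD : ContDiff ℝ ∞ D) (ha' : ContDiff ℝ ∞ a')
    (hχ : ContDiff ℝ ∞ χ) {t δ : ℝ} {w : ℝ × ℝ} (hw : ∀ r, 0 ≤ r → r < δ →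
      0 < planeDot w (radialVelocity D a' t r (r * deriv χ r) (χ r))) :
    InjOn (fun r ↦ r • modifiedRibbon D a' χ (t, r)) (Ico 0 δ) := by
  have h := contDiff_modifiedRibbon hD ha' hχ
  have hd : ∀ r, HasDerivAt (fun r ↦ planeDot w (r • modifiedRibbon D a' χ (t, r)))
      (planeDot w (radialVelocity D a' t r (r * deriv χ r) (χ r))) r := fun r ↦ by
    have h1 : HasDerivAt (fun r : ℝ ↦ (t, r)) (0, 1) r :=
      (hasDerivAt_const r t).prodMk (hasDerivAt_id r)
    have h2 := (h.differentiable (by simp) (t, r)).hasFDerivAt.comp_hasDerivAt r h1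
    have h3 := (hasDerivAt_id r).smul h2
    have h4 := (hasFDerivAt_fst.comp_hasDerivAt r h3).const_mul w.1 |>.add
      ((hasFDerivAt_snd.comp_hasDerivAt r h3).const_mul w.2)
    refine h4.congr_deriv ?_
    rw [← radialVelocity_eq hD ha' hχ]
    simp [planeDot]
    ring
  have hm : StrictMonoOn (fun r ↦ planeDot w (r • modifiedRibbon D a' χ (t, r))) (Ico 0 δ) := by
    refine strictMonoOn_of_deriv_pos (convex_Ico 0 δ)
      (fun r _ ↦ (hd r).continuousAt.continuousWithinAt) fun r hr ↦ ?_
    rw [interior_Ico] at hr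
    rw [(hd r).deriv]
    exact hw r hr.1.le hr.2
  intro r hr r' hr' heq
  exact hm.injOn hr hr' (congrArg (planeDot w) heq)

theorem fderiv_ribbon_modifiedRibbon_injective (hD : ContDiff ℝ ∞ D) (ha' : ContDiff ℝ ∞ a')
    (hχ : ContDiff ℝ ∞ χ) {t r : ℝ}
    (hw : radialVelocity D a' t r (r * deriv χ r) (χ r) ≠ 0) :
    Injective (fderiv ℝ (ribbon (modifiedRibbon D a' χ)) (t, r)) := by
  have h := contDiff_modifiedRibbon hD ha' hχ
  rw [injective_iff_map_eq_zero]
  intro v hv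
  rw [fderiv_ribbon h] at hv
  have h1 : v.1 = 0 := congrArg Prod.fst hv
  have h2 : r • fderiv ℝ (modifiedRibbon D a' χ) (t, r) v +
    v.2 • modifiedRibbon D a' χ (t, r) = 0 := congrArg Prod.snd hv
  have h3 : v = v.2 • ((0, 1) : ℝ × ℝ) := by ext <;> simp [h1]
  rw [h3, map_smul, ← h3, smul_comm, ← smul_add, add_comm, radialVelocity_eq hD ha' hχ] at h2
  exact Prod.ext h1 ((smul_eq_zero.1 h2).resolve_right hw)

end Modification

/-! ### The modified surface. -/

/-- A real number representing the given point of the circle. -/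
noncomputable def angleLift (c : AddCircle (1 : ℝ)) : ℝ :=
  surjInv QuotientAddGroup.mk_surjective c

theorem coe_angleLift (c : AddCircle (1 : ℝ)) : (angleLift c : AddCircle (1 : ℝ)) = c :=
  surjInv_eq QuotientAddGroup.mk_surjective c

theorem cover_ribbon_congr {D : ℝ × ℝ → ℝ × ℝ} (hD : ∀ t r, D (t + 1, r) = D (t, r)) {s t : ℝ}
    (h : (s : AddCircle (1 : ℝ)) = t) (r : ℝ) :
    cover (ribbon D (s, r)) = cover (ribbon D (t, r)) := by
  obtain ⟨n, rfl⟩ := addCircle_coe_eq_iff.1 h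
  have h1 : D (s + n, r) = D (s, r) := by
    have h2 : Periodic (fun t ↦ D (t, r)) 1 := fun t ↦ hD t r
    simpa using h2.int_mul n s
  exact Prod.ext h (by rw [cover_snd, cover_snd]; simp only [ribbon]; rw [h1])

section CollarSet

variable {M : Type*} [TopologicalSpace M]
  {S : Type*} [TopologicalSpace S]
  {Φ : OpenPartialHomeomorph M (AddCircle (1 : ℝ) × ℝ × ℝ)} {j : S → M} {r : ℝ} {q : S}

/-- The points of the surface at distance less than `r` from the axis. -/
def collarSet (Φ : OpenPartialHomeomorph M (AddCircle (1 : ℝ) × ℝ × ℝ)) (j : S → M) (r : ℝ) :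
    Set S := {q | j q ∈ Φ.source ∧ collarRadius Φ j q < r}

theorem collarSet_mono {r' : ℝ} (h : r ≤ r') : collarSet Φ j r ⊆ collarSet Φ j r' :=
  fun _ hq ↦ ⟨hq.1, hq.2.trans_le h⟩

theorem collarRadius_nonneg (q : S) : 0 ≤ collarRadius Φ j q := planeNorm_nonneg _

theorem continuousAt_collarRadius (hj : Continuous j) (hq : j q ∈ Φ.source) :
    ContinuousAt (collarRadius Φ j) q :=
  continuous_planeNorm.continuousAt.comp
    (continuous_snd.continuousAt.comp ((Φ.continuousAt hq).comp hj.continuousAt))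

theorem isOpen_collarSet (hj : Continuous j) : IsOpen (collarSet Φ j r) :=
  isOpen_iff_mem_nhds.2 fun _ hq ↦
    (hj.continuousAt.eventually (Φ.open_source.mem_nhds hq.1)).and
      ((continuousAt_collarRadius hj hq.1).eventually_lt continuousAt_const hq.2)

/-- The set is the preimage under `j` of a compact tube. This prevents points outside the domain of
`Φ` from being limits of collar points. -/
theorem isClosed_collar [T2Space M] (hj : Continuous j)
    (htube : ∀ c : AddCircle (1 : ℝ) × ℝ × ℝ, planeNorm c.2 ≤ r → c ∈ Φ.target) :
    IsClosed {q | j q ∈ Φ.source ∧ collarRadius Φ j q ≤ r} := by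
  set K : Set (AddCircle (1 : ℝ) × ℝ × ℝ) := {c | planeNorm c.2 ≤ r} with hK
  have : Fact ((0 : ℝ) < 1) := ⟨one_pos⟩
  have h1 : IsCompact K := by
    refine (isCompact_univ.prod (isCompact_closedBall (0 : ℝ × ℝ) r)).of_isClosed_subset
      (isClosed_le (continuous_planeNorm.comp continuous_snd) continuous_const) fun c hc ↦
      ⟨trivial, ?_⟩
    rw [mem_closedBall_zero_iff]
    exact (norm_le_planeNorm _).trans hc
  have h2 : IsCompact (Φ.symm '' K) :=
    h1.image_of_continuousOn (Φ.symm.continuousOn.mono fun c hc ↦ htube c hc)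
  convert h2.isClosed.preimage hj using 1
  ext q
  constructor
  · rintro ⟨h3, h4⟩
    exact ⟨Φ (j q), h4, Φ.left_inv h3⟩
  · rintro ⟨c, hc, hcq⟩
    have h3 : c ∈ Φ.target := htube c hc
    refine ⟨?_, ?_⟩
    · rw [← hcq]; exact Φ.map_target h3
    · rw [collarRadius, ← hcq, Φ.right_inv h3]; exact hc

open Classical in
/-- The map which replaces the ribbon of the surface `j` by the ribbon of `D'`. -/
noncomputable def modifiedMap (Φ : OpenPartialHomeomorph M (AddCircle (1 : ℝ) × ℝ × ℝ))
    (j : S → M) (D' : ℝ × ℝ → ℝ × ℝ) (r : ℝ) (q : S) : M :=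
  if q ∈ collarSet Φ j r then
    Φ.symm (cover (ribbon D' (angleLift (Φ (j q)).1, collarRadius Φ j q))) else j q

end CollarSet

section Modification

variable {M : Type*} [TopologicalSpace M] [ChartedSpace E3 M] [IsManifold (𝓡 3) ∞ M]
  {S : Type*} [TopologicalSpace S] [ChartedSpace (EuclideanHalfSpace 2) S]
  [IsManifold (𝓡∂ 2) ∞ S] {α : ∀ p : M, TangentSpace (𝓡 3) p →L[ℝ] ℝ} {γ : ℝ → M}
  {Φ : OpenPartialHomeomorph M (AddCircle (1 : ℝ) × ℝ × ℝ)} {j : S → M}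
  {D D' : ℝ × ℝ → ℝ × ℝ} {r₁ ρ : ℝ}

/-- `D'` describes a modification, for `r < ρ`, of the ribbon `D` of the surface `j`. -/
structure IsCollarModification (Φ : OpenPartialHomeomorph M (AddCircle (1 : ℝ) × ℝ × ℝ))
    (j : S → M) (D D' : ℝ × ℝ → ℝ × ℝ) (r₁ ρ : ℝ) : Prop where
  collar : IsCollar Φ j D r₁
  smooth : ContDiff ℝ ∞ D'
  periodic : ∀ t r, D' (t + 1, r) = D' (t, r)
  tube : ∀ c : AddCircle (1 : ℝ) × ℝ × ℝ, planeNorm c.2 < r₁ → c ∈ Φ.target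
  injOn : ∀ t, InjOn (fun r ↦ r • D' (t, r)) (Ico 0 r₁)
  deriv : ∀ t r, 0 ≤ r → r < r₁ → Injective (fderiv ℝ (ribbon D') (t, r))
  lt : ρ < r₁
  eq : ∀ t r, ρ ≤ r → D' (t, r) = D (t, r)
  small : ∀ t r, 0 ≤ r → r < ρ → planeNorm (r • D' (t, r)) < r₁

theorem IsCollar.apply_eq (h : IsCollar Φ j D r₁) {q : S} (hq : q ∈ collarSet Φ j r₁) {t : ℝ}
    (ht : (t : AddCircle (1 : ℝ)) = (Φ (j q)).1) :
    Φ (j q) = cover (ribbon D (t, collarRadius Φ j q)) :=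
  Prod.ext ht.symm (h.map q hq.1 hq.2 t ht)

theorem IsCollarChart.isRibbonAt {f : S → M} {q : S}
    {φ : OpenPartialHomeomorph S (EuclideanHalfSpace 2)} {P : E2 → ℝ × ℝ} (hj : Continuous j)
    (h : IsCollarChart Φ j q φ P) (hq : q ∈ collarSet Φ j r₁)
    (hf : ∀ q ∈ collarSet Φ j r₁, ∀ t : ℝ, (t : AddCircle (1 : ℝ)) = (Φ (j q)).1 →
      cover (ribbon D' (t, collarRadius Φ j q)) ∈ Φ.target ∧
      f q = Φ.symm (cover (ribbon D' (t, collarRadius Φ j q)))) :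
    IsRibbonAt Φ D' f q φ P := by
  have h1 : ∀ᶠ q' in 𝓝 q, cover (ribbon D' (P (φ.extend (𝓡∂ 2) q'))) ∈ Φ.target ∧
      f q' = Φ.symm (cover (ribbon D' (P (φ.extend (𝓡∂ 2) q')))) := by
    filter_upwards [(isOpen_collarSet hj).mem_nhds hq, h.angle, h.radius] with q' h1 h2 h3
    have h4 := hf q' h1 _ h2
    rwa [← h3] at h4
  exact ⟨h.mem_atlas, h.mem_source, h.smooth, h1.self_of_nhds.1, h1.mono fun _ h ↦ h.2⟩

theorem IsCollar.isRibbonAt {q : S} {φ : OpenPartialHomeomorph S (EuclideanHalfSpace 2)}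
    {P : E2 → ℝ × ℝ} (h : IsCollar Φ j D r₁) (hj : Continuous j) (hc : IsCollarChart Φ j q φ P)
    (hq : q ∈ collarSet Φ j r₁) : IsRibbonAt Φ D j q φ P :=
  hc.isRibbonAt hj hq fun q hq t ht ↦ by
    rw [← h.apply_eq hq ht]
    exact ⟨Φ.map_source hq.1, (Φ.left_inv hq.1).symm⟩

namespace IsCollarModification

variable {q : S}

theorem target (h : IsCollarModification Φ j D D' r₁ ρ) {t r : ℝ} (h0 : 0 ≤ r) (h1 : r < r₁) :
    planeNorm (ribbon D' (t, r)).2 < r₁ := by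
  rcases lt_or_ge r ρ with h2 | h2
  · exact h.small t r h0 h2
  · simp only [ribbon]
    rw [h.eq t r h2, planeNorm_smul, h.collar.norm t r h0 h1, abs_of_nonneg h0, mul_one]
    exact h1

theorem apply_modifiedMap (h : IsCollarModification Φ j D D' r₁ ρ) (hq : q ∈ collarSet Φ j r₁)
    {t : ℝ} (ht : (t : AddCircle (1 : ℝ)) = (Φ (j q)).1) :
    cover (ribbon D' (t, collarRadius Φ j q)) ∈ Φ.target ∧
      modifiedMap Φ j D' r₁ q = Φ.symm (cover (ribbon D' (t, collarRadius Φ j q))) := by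
  refine ⟨h.tube _ (h.target (collarRadius_nonneg q) hq.2), ?_⟩
  rw [modifiedMap, if_pos hq, cover_ribbon_congr h.periodic ((coe_angleLift _).trans ht.symm)]

theorem modifiedMap_eq (h : IsCollarModification Φ j D D' r₁ ρ) (hq : q ∉ collarSet Φ j ρ) :
    modifiedMap Φ j D' r₁ q = j q := by
  by_cases h1 : q ∈ collarSet Φ j r₁
  · have h2 : ρ ≤ collarRadius Φ j q := not_lt.1 fun h3 ↦ hq ⟨h1.1, h3⟩
    have ht := coe_angleLift (Φ (j q)).1
    have h4 : ribbon D' (angleLift (Φ (j q)).1, collarRadius Φ j q) =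
        ribbon D (angleLift (Φ (j q)).1, collarRadius Φ j q) := by
      simp only [ribbon]; rw [h.eq _ _ h2]
    rw [(h.apply_modifiedMap h1 ht).2, h4, ← h.collar.apply_eq h1 ht, Φ.left_inv h1.1]
  · rw [modifiedMap, if_neg h1]

theorem modifiedMap_mem (h : IsCollarModification Φ j D D' r₁ ρ) (hq : q ∈ collarSet Φ j r₁) :
    modifiedMap Φ j D' r₁ q ∈ Φ.source ∧ Φ (modifiedMap Φ j D' r₁ q) =
      cover (ribbon D' (angleLift (Φ (j q)).1, collarRadius Φ j q)) := by
  obtain ⟨h1, h2⟩ := h.apply_modifiedMap hq (coe_angleLift _)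
  rw [h2]
  exact ⟨Φ.map_target h1, Φ.right_inv h1⟩

theorem isRibbonAt (h : IsCollarModification Φ j D D' r₁ ρ) (hj : Continuous j)
    {φ : OpenPartialHomeomorph S (EuclideanHalfSpace 2)} {P : E2 → ℝ × ℝ}
    (hc : IsCollarChart Φ j q φ P) (hq : q ∈ collarSet Φ j r₁) :
    IsRibbonAt Φ D' (modifiedMap Φ j D' r₁) q φ P :=
  hc.isRibbonAt hj hq fun _ hq _ ht ↦ h.apply_modifiedMap hq ht

theorem eventuallyEq [T2Space M] (h : IsCollarModification Φ j D D' r₁ ρ) (hj : Continuous j)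
    (hq : q ∉ collarSet Φ j r₁) : j =ᶠ[𝓝 q] modifiedMap Φ j D' r₁ := by
  have h1 := (isClosed_collar hj fun c hc ↦ h.tube c (hc.trans_lt h.lt)).isOpen_compl.mem_nhds
    (x := q) fun h2 ↦ hq ⟨h2.1, h2.2.trans_lt h.lt⟩
  filter_upwards [h1] with q' h2
  exact (h.modifiedMap_eq fun h3 ↦ h2 ⟨h3.1, h3.2.le⟩).symm

/-- In the collar the new map extends across the boundary as an immersed ribbon; elsewhere it agrees
locally with `j`. The complement is the one that comes with `j`. -/
theorem isImmersion [T2Space M] (h : IsCollarModification Φ j D D' r₁ ρ)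
    (hΦ : IsContactCoordinates α Φ) (hj : Manifold.IsSmoothEmbedding (𝓡∂ 2) (𝓡 3) ∞ j) :
    Manifold.IsImmersion (𝓡∂ 2) (𝓡 3) ∞ (modifiedMap Φ j D' r₁) := by
  obtain ⟨K, i1, i2, hK⟩ := hj.isImmersion
  refine ⟨K, i1, i2, fun q ↦ ?_⟩
  by_cases hq : q ∈ collarSet Φ j r₁
  · obtain ⟨φ, P, hc⟩ := h.collar.chart q hq.1 hq.2
    have hr := h.isRibbonAt hj.isEmbedding.continuous hc hq
    set u := φ.extend (𝓡∂ 2) q with hu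
    have hR : ContDiff ℝ ∞ (ribbon D') := contDiff_ribbon h.smooth
    have hPs := hr.smooth.self_of_nhds
    have hRP : ∀ᶠ u' in 𝓝 u, ContDiffAt ℝ ∞ (ribbon D' ∘ P) u' :=
      hr.smooth.mono fun u' h1 ↦ hR.contDiffAt.comp u' h1.1
    have hF := hΦ.contMDiffAt hr.mem_target
    have hP2 : (P u).2 = collarRadius Φ j q := hc.radius.self_of_nhds
    refine isImmersionAtOfComplement_of_extension (hK q).equiv hc.mem_atlas hc.mem_source
      (h := (Φ.symm ∘ cover) ∘ (ribbon D' ∘ P)) ?_ ?_ hr.eq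
    · filter_upwards [hRP, hRP.self_of_nhds.continuousAt.eventually hF] with u' h1 h2
      exact h2.2.1.comp u' h1.contMDiffAt
    · rw [vecDeriv_comp (f := ribbon D' ∘ P) hF.self_of_nhds.2.1
          (hRP.self_of_nhds.differentiableAt (by simp)),
        fderiv_comp u (hR.differentiable (by simp) _) (hPs.1.differentiableAt (by simp))]
      have h1 := h.deriv (P u).1 (P u).2 (by rw [hP2]; exact collarRadius_nonneg q)
        (by rw [hP2]; exact hq.2)
      exact (hF.self_of_nhds.2.2.1).comp (h1.comp hPs.2.1)
  · exact (hK q).congr_of_eventuallyEq (h.eventuallyEq hj.isEmbedding.continuous hq)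

/-- A modified point stays at distance less than `r₁` from the axis, so it can collide only with
another collar point. That point has the same angle, and along a fixed angle the new ribbon is
injective in r. -/
theorem injective (h : IsCollarModification Φ j D D' r₁ ρ) (hj : Injective j) :
    Injective (modifiedMap Φ j D' r₁) := by
  have key : ∀ q q', q ∈ collarSet Φ j ρ → modifiedMap Φ j D' r₁ q = modifiedMap Φ j D' r₁ q' →
      q = q' := by
    intro q q' hq he
    have hq1 := collarSet_mono h.lt.le hq
    obtain ⟨h1, h2⟩ := h.modifiedMap_mem hq1
    have hq2 : q' ∈ collarSet Φ j r₁ := by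
      by_contra h3
      have h4 := h.modifiedMap_eq fun h5 ↦ h3 (collarSet_mono h.lt.le h5)
      rw [he, h4] at h1 h2
      refine h3 ⟨h1, ?_⟩
      rw [collarRadius, h2, cover_snd]
      exact h.target (collarRadius_nonneg q) hq1.2
    obtain ⟨h3, h4⟩ := h.modifiedMap_mem hq2
    rw [he, h4] at h2
    have h5 : (Φ (j q')).1 = (Φ (j q)).1 := by
      have h6 := congrArg Prod.fst h2
      exact ((coe_angleLift _).symm.trans h6).trans (coe_angleLift _)
    rw [h5] at h2
    have h6 := h.injOn (angleLift (Φ (j q)).1) ⟨collarRadius_nonneg q', hq2.2⟩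
      ⟨collarRadius_nonneg q, hq1.2⟩ (congrArg Prod.snd h2)
    have h7 : Φ (j q) = Φ (j q') := by
      rw [h.collar.apply_eq hq1 (coe_angleLift _), h.collar.apply_eq hq2 ((coe_angleLift _).trans h5.symm), h6]
    exact hj (Φ.injOn hq1.1 hq2.1 h7)
  intro q q' he
  by_cases hq : q ∈ collarSet Φ j ρ
  · exact key q q' hq he
  · by_cases hq' : q' ∈ collarSet Φ j ρ
    · exact (key q' q hq' he.symm).symm
    · rw [h.modifiedMap_eq hq, h.modifiedMap_eq hq'] at he
      exact hj he

theorem isSmoothEmbedding [T2Space M] [CompactSpace S] (h : IsCollarModification Φ j D D' r₁ ρ)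
    (hΦ : IsContactCoordinates α Φ) (hj : Manifold.IsSmoothEmbedding (𝓡∂ 2) (𝓡 3) ∞ j) :
    Manifold.IsSmoothEmbedding (𝓡∂ 2) (𝓡 3) ∞ (modifiedMap Φ j D' r₁) := by
  have h1 := h.isImmersion hΦ hj
  exact ⟨h1, (h1.contMDiff.continuous.isClosedEmbedding
    (h.injective hj.isEmbedding.injective)).isEmbedding⟩

end IsCollarModification
end Modification

/-! ### Singular points and ruled neighbourhood of the modified surface. -/

section Boundary

variable {M : Type*} [TopologicalSpace M] [ChartedSpace E3 M] [IsManifold (𝓡 3) ∞ M]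
  {S : Type*} [TopologicalSpace S] [ChartedSpace (EuclideanHalfSpace 2) S]
  [IsManifold (𝓡∂ 2) ∞ S] {α : ∀ p : M, TangentSpace (𝓡 3) p →L[ℝ] ℝ} {γ : ℝ → M}
  {σ : ∀ q : S, TangentSpace (𝓡∂ 2) q →L[ℝ] TangentSpace (𝓡∂ 2) q →L[ℝ] ℝ}
  {Φ : OpenPartialHomeomorph M (AddCircle (1 : ℝ) × ℝ × ℝ)} {j : S → M} {q : S}
  {D D' : ℝ × ℝ → ℝ × ℝ} {r₁ ρ t : ℝ}

theorem collarRadius_of_eq (hγ : ∀ t : ℝ, γ t ∈ Φ.source ∧ Φ (γ t) = cover (t, 0))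
    (hq : j q = γ t) : collarRadius Φ j q = 0 := by
  rw [collarRadius, hq, (hγ t).2, cover_snd]
  exact planeNorm_eq_zero.2 rfl

theorem mem_boundary_of_eq (hj : Injective j) (hbd : j '' (𝓡∂ 2).boundary S = range γ)
    (hq : j q = γ t) : q ∈ (𝓡∂ 2).boundary S := by
  obtain ⟨q', h1, h2⟩ := hbd.superset (mem_range_self t)
  rwa [← hj (h2.trans hq.symm)]

theorem periodic_deriv {b : ℝ → ℝ} (hb : Periodic b 1) : Periodic (deriv b) 1 := fun t ↦ by
  rw [← deriv_comp_add_const, funext hb]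

/-- A collar chart yields some lift of the angle, not necessarily the given `t`; periodicity of D
transfers the invariants. -/
theorem boundary_invariants (hα : IsSmoothOneForm α) (hσ : IsAreaForm σ)
    (hΦ : IsContactCoordinates α Φ)
    (hγ : ∀ t : ℝ, γ t ∈ Φ.source ∧ Φ (γ t) = cover (t, 0)) (hbd : IsOrientedBoundary σ j γ)
    (hj : IsEmbedding j) (hC : IsCollar Φ j D r₁) (hq : j q = γ t)
    (hnd : IsSingular α j q → IsNondegenerate α σ j q) :
    (IsSingular α j q ↔ (D (t, 0)).2 = 0) ∧ (IsSingular α j q →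
    deriv (fun s ↦ (D (s, 0)).2) t ≠ 0 ∧ deriv (fun s ↦ (D (s, 0)).2) t + (D (t, 0)).1 ≠ 0 ∧
    (IsPositive α σ j q → (D (t, 0)).1 < 0) ∧ (IsNegative α σ j q → 0 < (D (t, 0)).1) ∧
    (IsElliptic α σ j q → -1 < deriv (fun s ↦ (D (s, 0)).2) t / (D (t, 0)).1 ∧
      deriv (fun s ↦ (D (s, 0)).2) t / (D (t, 0)).1 < 0) ∧
    (IsHyperbolic α σ j q → deriv (fun s ↦ (D (s, 0)).2) t / (D (t, 0)).1 < -1 ∨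
      0 < deriv (fun s ↦ (D (s, 0)).2) t / (D (t, 0)).1)) := by
  have hR := collarRadius_of_eq hγ hq
  have hs : j q ∈ Φ.source := by rw [hq]; exact (hγ t).1
  have hqc : q ∈ collarSet Φ j r₁ := ⟨hs, by rw [hR]; exact hC.pos⟩
  obtain ⟨φ, P, hc⟩ := hC.chart q hqc.1 hqc.2
  have hr := hC.isRibbonAt hj.continuous hc hqc
  set t' := (P (φ.extend (𝓡∂ 2) q)).1 with ht'
  have hx : P (φ.extend (𝓡∂ 2) q) = (t', 0) := Prod.ext rfl (hc.radius.self_of_nhds.trans hR)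
  have hn : D (t', 0) ≠ 0 := fun h0 ↦ by
    have h1 := hC.norm t' 0 le_rfl hC.pos
    rw [h0, planeNorm_eq_zero.2 rfl] at h1
    exact zero_ne_one h1
  have htt : (t' : AddCircle (1 : ℝ)) = t := by
    have h1 := hc.angle.self_of_nhds
    rw [hq, (hγ t).2] at h1
    exact h1
  obtain ⟨n, hn'⟩ := addCircle_coe_eq_iff.1 htt
  have hDp : D (t, 0) = D (t', 0) := by
    have h2 : Periodic (fun t ↦ D (t, 0)) 1 := fun t ↦ hC.periodic t 0
    rw [hn']
    simpa using h2.int_mul n t'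
  have hbp : deriv (fun s ↦ (D (s, 0)).2) t = deriv (fun s ↦ (D (s, 0)).2) t' := by
    have h2 : Periodic (deriv fun s ↦ (D (s, 0)).2) 1 :=
      periodic_deriv fun s ↦ by rw [hC.periodic]
    rw [hn']
    simpa using h2.int_mul n t'
  rw [hDp, hbp]
  refine ⟨isSingular_axis_iff hΦ hC.smooth hr hx hn, fun hsing ↦ ?_⟩
  exact boundary_singular_invariants hα hσ hΦ hγ hbd hC.smooth hr
    (mem_boundary_of_eq hj.injective hbd.image_boundary hq) hx
    (hc.radius.mono fun q' h ↦ by rw [h]; exact collarRadius_nonneg q') hn hsing (hnd hsing)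

namespace IsCollarModification

theorem modifiedMap_axis (h : IsCollarModification Φ j D D' r₁ ρ) (hs : j q ∈ Φ.source)
    (hr : collarRadius Φ j q = 0) : modifiedMap Φ j D' r₁ q = j q := by
  have hq : q ∈ collarSet Φ j r₁ := ⟨hs, by rw [hr]; exact h.collar.pos⟩
  have ht := coe_angleLift (Φ (j q)).1
  have h1 := h.collar.apply_eq hq ht
  rw [hr, ribbon_axis] at h1
  rw [(h.apply_modifiedMap hq ht).2, hr, ribbon_axis, ← h1, Φ.left_inv hs]

theorem modifiedMap_boundary (h : IsCollarModification Φ j D D' r₁ ρ)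
    (hγ : ∀ t : ℝ, γ t ∈ Φ.source ∧ Φ (γ t) = cover (t, 0)) (hq : j q = γ t) :
    modifiedMap Φ j D' r₁ q = j q :=
  h.modifiedMap_axis (by rw [hq]; exact (hγ t).1) (collarRadius_of_eq hγ hq)

theorem isPerturbation [T2Space M] [CompactSpace S] (h : IsCollarModification Φ j D D' r₁ ρ)
    (hΦ : IsContactCoordinates α Φ) (hj : Manifold.IsSmoothEmbedding (𝓡∂ 2) (𝓡 3) ∞ j)
    (hγ : ∀ t : ℝ, γ t ∈ Φ.source ∧ Φ (γ t) = cover (t, 0))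
    (hbd : j '' (𝓡∂ 2).boundary S = range γ) {W : Set (M × M)} (hWd : diagonal M ⊆ W) {O : Set M}
    (hW : ∀ t r, 0 ≤ r → r < ρ →
      (Φ.symm (cover (ribbon D (t, r))), Φ.symm (cover (ribbon D' (t, r)))) ∈ W)
    (hO : ∀ t r, 0 ≤ r → r < ρ →
      Φ.symm (cover (ribbon D (t, r))) ∈ O ∧ Φ.symm (cover (ribbon D' (t, r))) ∈ O) :
    IsPerturbation j (modifiedMap Φ j D' r₁) W O := by
  have key : ∀ q ∈ collarSet Φ j ρ, ∃ t r, 0 ≤ r ∧ r < ρ ∧ j q = Φ.symm (cover (ribbon D (t, r))) ∧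
      modifiedMap Φ j D' r₁ q = Φ.symm (cover (ribbon D' (t, r))) := fun q hq ↦ by
    have hq1 := collarSet_mono h.lt.le hq
    have ht := coe_angleLift (Φ (j q)).1
    refine ⟨_, _, collarRadius_nonneg q, hq.2, ?_, (h.apply_modifiedMap hq1 ht).2⟩
    rw [← h.collar.apply_eq hq1 ht, Φ.left_inv hq.1]
  refine ⟨h.isSmoothEmbedding hΦ hj, fun q hq ↦ ?_, fun q ↦ ?_, fun q hq ↦ ?_, fun q hq ↦ ?_⟩
  · obtain ⟨t, ht⟩ := hbd.subset (mem_image_of_mem j hq)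
    exact h.modifiedMap_boundary hγ ht.symm
  · by_cases hq : q ∈ collarSet Φ j ρ
    · obtain ⟨t, r, h0, h1, h2, h3⟩ := key q hq
      rw [h2, h3]
      exact hW t r h0 h1
    · rw [h.modifiedMap_eq hq]
      exact hWd rfl
  · refine h.modifiedMap_eq fun hq' ↦ hq ?_
    obtain ⟨t, r, h0, h1, h2, h3⟩ := key q hq'
    rw [h2]
    exact (hO t r h0 h1).1
  · by_cases hq' : q ∈ collarSet Φ j ρ
    · obtain ⟨t, r, h0, h1, h2, h3⟩ := key q hq'
      rw [h3]
      exact (hO t r h0 h1).2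
    · rwa [h.modifiedMap_eq hq']

/-- Inside the collar and off the axis neither restricted form vanishes. On the axis both equal b dr
with the same b. Outside the collar the surface is unchanged. -/
theorem image_singular [T2Space M] (h : IsCollarModification Φ j D D' r₁ ρ)
    (hΦ : IsContactCoordinates α Φ) (hj : Continuous j)
    (hder : ∀ t r, 0 ≤ r → r < r₁ → Injective (fderiv ℝ (ribbon D) (t, r)))
    (hns : ∀ t r, 0 < r → r < r₁ → ribbonForm D (t, r) ≠ 0 ∧ ribbonForm D' (t, r) ≠ 0)
    (hax : ∀ t, (D' (t, 0)).2 = (D (t, 0)).2) :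
    modifiedMap Φ j D' r₁ '' {q | IsSingular α (modifiedMap Φ j D' r₁) q} =
      j '' {q | IsSingular α j q} := by
  have key : ∀ q, (IsSingular α (modifiedMap Φ j D' r₁) q ↔ IsSingular α j q) ∧
      (IsSingular α j q → modifiedMap Φ j D' r₁ q = j q) := by
    intro q
    by_cases hq : q ∈ collarSet Φ j r₁
    · obtain ⟨φ, P, hc⟩ := h.collar.chart q hq.1 hq.2
      have h1 := h.collar.isRibbonAt hj hc hq
      have h2 := h.isRibbonAt hj hc hq
      set x := P (φ.extend (𝓡∂ 2) q) with hx
      have hx2 : x.2 = collarRadius Φ j q := hc.radius.self_of_nhds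
      have h0 : 0 ≤ x.2 := by rw [hx2]; exact collarRadius_nonneg q
      have h3 : x.2 < r₁ := by rw [hx2]; exact hq.2
      rw [h1.isSingular_iff hΦ h.collar.smooth (hder x.1 x.2 h0 h3),
        h2.isSingular_iff hΦ h.smooth (h.deriv x.1 x.2 h0 h3)]
      rcases h0.eq_or_lt with h4 | h4
      · have h5 : x = (x.1, 0) := Prod.ext rfl h4.symm
        refine ⟨?_, fun _ ↦ h.modifiedMap_axis hq.1 (hx2.symm.trans h4.symm)⟩
        rw [← hx, h5, ContinuousLinearMap.ext_iff, ContinuousLinearMap.ext_iff]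
        refine forall_congr' fun v ↦ ?_
        rw [ribbonForm_apply h.smooth, ribbonForm_apply h.collar.smooth]
        simp only [zero_mul, zero_add, hax]
      · have h5 := hns x.1 x.2 h4 h3
        exact ⟨⟨fun h6 ↦ absurd h6 h5.2, fun h6 ↦ absurd h6 h5.1⟩, fun h6 ↦ absurd h6 h5.1⟩
    · have h1 := h.eventuallyEq hj hq
      refine ⟨?_, fun _ ↦ h1.self_of_nhds.symm⟩
      have h2 : surfDeriv (modifiedMap Φ j D' r₁) q = surfDeriv j q := h1.symm.mfderiv_eq
      have h3 : ∀ (p p' : M) (L L' : E2 →L[ℝ] E3), p = p' → L = L' →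
          (LinearMap.range L.toLinearMap = LinearMap.ker (show E3 →L[ℝ] ℝ from α p).toLinearMap ↔
          LinearMap.range L'.toLinearMap =
            LinearMap.ker (show E3 →L[ℝ] ℝ from α p').toLinearMap) := by
        rintro p p' L L' rfl rfl; rfl
      exact h3 _ _ _ _ h1.symm.self_of_nhds h2
  ext p
  constructor
  · rintro ⟨q, hq, rfl⟩
    have h1 := (key q).1.1 hq
    exact ⟨q, h1, ((key q).2 h1).symm⟩
  · rintro ⟨q, hq, rfl⟩
    exact ⟨q, (key q).1.2 hq, (key q).2 hq⟩

/-- U is the domain of `Φ` without the surface points beyond distance r₀ in the original collar, so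
it meets the new surface in exactly the closed ruled ribbon. It need not be open, as r = r₀ is kept.
-/
theorem exists_ruled_neighborhood [T2Space M] [CompactSpace S]
    (h : IsCollarModification Φ j D D' r₁ ρ) (hΦ : IsContactCoordinates α Φ)
    (hj : Manifold.IsSmoothEmbedding (𝓡∂ 2) (𝓡 3) ∞ j)
    (hγ : ∀ t : ℝ, γ t ∈ Φ.source ∧ Φ (γ t) = cover (t, 0))
    (hbd : j '' (𝓡∂ 2).boundary S = range γ) {r₀ : ℝ} (hr₀ : 0 < r₀) (hr₀ρ : r₀ < r₁)
    {C : ℝ → ℝ × ℝ} (hC : ∀ t r, r ≤ r₀ → D' (t, r) = C t) :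
    ∃ U ∈ 𝓝ˢ (range γ), U ⊆ Φ.source ∧ Φ '' (U ∩ range (modifiedMap Φ j D' r₁)) =
      {z | ∃ t ∈ Icc (0 : ℝ) 1, ∃ r ∈ Icc (0 : ℝ) 1,
        z = ((t : AddCircle (1 : ℝ)), (r₀ * r) • C t)} := by
  set f := modifiedMap Φ j D' r₁ with hf
  have hfe := h.isSmoothEmbedding hΦ hj
  have hfi : Injective f := hfe.isEmbedding.injective
  set A : Set S := {q | ¬(j q ∈ Φ.source ∧ collarRadius Φ j q ≤ r₀)} with hA
  refine ⟨Φ.source \ f '' A, ?_, sdiff_subset, ?_⟩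
  -- Removing also the points at distance exactly r₀ leaves an open set, by compactness of S, and it
  -- still contains the knot.
  · have h1 : IsClosed (f '' (collarSet Φ j r₀)ᶜ) :=
      ((isOpen_collarSet hj.isEmbedding.continuous).isClosed_compl.isCompact.image
        hfe.isEmbedding.continuous).isClosed
    refine Filter.mem_of_superset ((Φ.open_source.sdiff h1).mem_nhdsSet.2 ?_)
      (sdiff_subset_sdiff_right (image_mono fun q hq hq' ↦ hq ⟨hq'.1, hq'.2.le⟩))
    rintro _ ⟨t, rfl⟩
    refine ⟨(hγ t).1, ?_⟩
    rintro ⟨q, hq, hqt⟩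
    obtain ⟨q', -, hq't⟩ := hbd.superset (mem_range_self t)
    have h2 : f q' = γ t := (h.modifiedMap_boundary hγ hq't).trans hq't
    rw [hfi (hqt.trans h2.symm)] at hq
    refine hq ⟨by rw [hq't]; exact (hγ t).1, ?_⟩
    rw [collarRadius_of_eq hγ hq't]
    exact hr₀
  · ext z
    constructor
    · rintro ⟨_, ⟨⟨-, hqA⟩, q, rfl⟩, rfl⟩
      have hq : j q ∈ Φ.source ∧ collarRadius Φ j q ≤ r₀ := by
        by_contra h1
        exact hqA ⟨q, h1, rfl⟩
      have hq1 : q ∈ collarSet Φ j r₁ := ⟨hq.1, hq.2.trans_lt hr₀ρ⟩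
      set t := Int.fract (angleLift (Φ (j q)).1) with ht
      have ht' : (t : AddCircle (1 : ℝ)) = (Φ (j q)).1 := by
        rw [← coe_angleLift (Φ (j q)).1]
        exact addCircle_coe_eq_iff.2 ⟨⌊angleLift (Φ (j q)).1⌋, (Int.fract_add_floor _).symm⟩
      obtain ⟨h1, h2⟩ := h.apply_modifiedMap hq1 ht'
      refine ⟨t, ⟨Int.fract_nonneg _, (Int.fract_lt_one _).le⟩, collarRadius Φ j q / r₀,
        ⟨div_nonneg (collarRadius_nonneg q) hr₀.le, (div_le_one hr₀).2 hq.2⟩, ?_⟩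
      rw [hf, h2, Φ.right_inv h1, mul_div_cancel₀ _ hr₀.ne', ribbon, hC _ _ hq.2]
      rfl
    · rintro ⟨t, -, s, hs, rfl⟩
      have h0 : 0 ≤ r₀ * s := mul_nonneg hr₀.le hs.1
      have h0' : r₀ * s ≤ r₀ := mul_le_of_le_one_right hr₀.le hs.2
      have h1 : r₀ * s < r₁ := h0'.trans_lt hr₀ρ
      obtain ⟨q, hqs, hq⟩ := h.collar.surj t (r₀ * s) h0 h1
      have hR : collarRadius Φ j q = r₀ * s := by
        rw [collarRadius, hq, cover_snd, ribbon, planeNorm_smul, h.collar.norm t _ h0 h1,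
          abs_of_nonneg h0, mul_one]
      have hqc : q ∈ collarSet Φ j r₁ := ⟨hqs, by rwa [hR]⟩
      obtain ⟨h2, h3⟩ := h.apply_modifiedMap (t := t) hqc (by rw [hq]; rfl)
      refine ⟨f q, ⟨⟨(h.modifiedMap_mem hqc).1, ?_⟩, q, rfl⟩, ?_⟩
      · rintro ⟨q', hq', he⟩
        rw [hfi he] at hq'
        exact hq' ⟨hqs, by rwa [hR]⟩
      · rw [hf, h3, Φ.right_inv h2, hR, ribbon, hC _ _ h0']
        rfl

end IsCollarModification
end Boundary

/-! ### Choice of the parameters. -/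

theorem planeNorm_le_two_mul (v : ℝ × ℝ) : planeNorm v ≤ 2 * ‖v‖ := by
  refine le_of_sq_le_sq ?_ (by positivity)
  have h1 : v.1 ^ 2 ≤ ‖v‖ ^ 2 := sq_le_sq' (abs_le.1 (norm_fst_le v)).1 (abs_le.1 (norm_fst_le v)).2
  have h2 : v.2 ^ 2 ≤ ‖v‖ ^ 2 := sq_le_sq' (abs_le.1 (norm_snd_le v)).1 (abs_le.1 (norm_snd_le v)).2
  rw [planeNorm_sq]
  nlinarith [sq_nonneg ‖v‖]

theorem exists_bound_of_periodic {E : Type*} [NormedAddCommGroup E] {g : ℝ → E}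
    (hg : Continuous g) (hp : Periodic g 1) : ∃ K ≥ 0, ∀ t, ‖g t‖ ≤ K := by
  obtain ⟨K, hK⟩ := isCompact_Icc.exists_bound_of_continuousOn (s := Icc (0 : ℝ) 1) hg.continuousOn
  refine ⟨K, (norm_nonneg _).trans (hK 0 (by simp)), fun t ↦ ?_⟩
  obtain ⟨s, hs, h⟩ := hp.exists_mem_Ico₀ one_pos t
  rw [h]
  exact hK s ⟨hs.1, hs.2.le⟩

theorem modifiedRibbon_zero (D : ℝ × ℝ → ℝ × ℝ) (a' : ℝ → ℝ) :
    modifiedRibbon D a' (fun _ ↦ 0) = D := by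
  ext x <;> simp [modifiedRibbon]

section Nonvanishing

variable {D : ℝ × ℝ → ℝ × ℝ} {a' χ : ℝ → ℝ} {w : ℝ × ℝ} {t r : ℝ}

theorem ribbonForm_modifiedRibbon_ne_zero (hD : ContDiff ℝ ∞ D) (ha' : ContDiff ℝ ∞ a')
    (hχ : ContDiff ℝ ∞ χ) (hr : r ≠ 0)
    (hw : 0 < planeDot w (formCoefficients D a' t r (r * deriv χ r) (χ r))) :
    ribbonForm (modifiedRibbon D a' χ) (t, r) ≠ 0 := by
  intro h
  obtain ⟨h1, h2⟩ := ribbonForm_modifiedRibbon hD ha' hχ t r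
  rw [h] at h1 h2
  have h3 := (mul_eq_zero.1 h1.symm).resolve_left hr
  rw [planeDot, h3, ← h2] at hw
  simp at hw

theorem ne_zero_of_planeDot_pos {v : ℝ × ℝ} (hw : 0 < planeDot w v) : v ≠ 0 := by
  rintro rfl
  simp [planeDot] at hw

end Nonvanishing

section Parameters

variable {M : Type*} [TopologicalSpace M] [ChartedSpace E3 M] [IsManifold (𝓡 3) ∞ M]
  {S : Type*} [TopologicalSpace S] [ChartedSpace (EuclideanHalfSpace 2) S]
  [IsManifold (𝓡∂ 2) ∞ S] {γ : ℝ → M}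
  {Φ : OpenPartialHomeomorph M (AddCircle (1 : ℝ) × ℝ × ℝ)} {j : S → M}
  {D : ℝ × ℝ → ℝ × ℝ} {a' : ℝ → ℝ} {δ r₂ : ℝ}

theorem exists_tube_control (hδ : 0 < δ) (htar : Φ.target = {c | ‖c.2‖ < δ})
    (hγ : ∀ t : ℝ, γ t ∈ Φ.source ∧ Φ (γ t) = cover (t, 0)) {W : Set (M × M)}
    (hW : W ∈ 𝓝ˢ (diagonal M)) {O : Set M} (hO : IsOpen O) (hγO : range γ ⊆ O) :
    ∃ ε > 0, ∀ (t : ℝ) (v v' : ℝ × ℝ), ‖v‖ < ε → ‖v'‖ < ε →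
      (Φ.symm (cover (t, v)), Φ.symm (cover (t, v'))) ∈ W ∧
      Φ.symm (cover (t, v)) ∈ O ∧ Φ.symm (cover (t, v')) ∈ O := by
  obtain ⟨ε, hε, h⟩ := exists_strip (E := (ℝ × ℝ) × ℝ × ℝ)
    (p := fun t x ↦ (Φ.symm (cover (t, x.1)), Φ.symm (cover (t, x.2))) ∈ W ∧
      Φ.symm (cover (t, x.1)) ∈ O ∧ Φ.symm (cover (t, x.2)) ∈ O)
    (fun t x ↦ by
      have h1 : ∀ v : ℝ × ℝ, cover (t + 1, v) = cover (t, v) := fun v ↦ Prod.ext (by simp [cover]) rfl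
      simp only [h1])
    (fun t ↦ by
      have hmem : cover (t, 0) ∈ Φ.target := by rw [← (hγ t).2]; exact Φ.map_source (hγ t).1
      have h0 : Φ.symm (cover (t, 0)) = γ t := by rw [← (hγ t).2]; exact Φ.left_inv (hγ t).1
      have h1 : Filter.Tendsto (fun z : ℝ × ℝ × ℝ ↦ Φ.symm (cover z)) (𝓝 (t, 0)) (𝓝 (γ t)) := by
        have h2 := (Φ.symm.continuousAt hmem).comp (f := cover) (x := (t, 0))
          isOpenQuotientMap_cover.continuous.continuousAt
        rwa [ContinuousAt, comp_apply, h0] at h2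
      have h2 : Filter.Tendsto (fun z : ℝ × (ℝ × ℝ) × ℝ × ℝ ↦ Φ.symm (cover (z.1, z.2.1)))
          (𝓝 (t, 0)) (𝓝 (γ t)) :=
        h1.comp ((show Continuous fun z : ℝ × (ℝ × ℝ) × ℝ × ℝ ↦ (z.1, z.2.1) by fun_prop).tendsto _)
      have h3 : Filter.Tendsto (fun z : ℝ × (ℝ × ℝ) × ℝ × ℝ ↦ Φ.symm (cover (z.1, z.2.2)))
          (𝓝 (t, 0)) (𝓝 (γ t)) :=
        h1.comp ((show Continuous fun z : ℝ × (ℝ × ℝ) × ℝ × ℝ ↦ (z.1, z.2.2) by fun_prop).tendsto _)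
      have h4 := hO.mem_nhds (hγO (mem_range_self t))
      have h5 : W ∈ 𝓝 (γ t, γ t) := mem_nhdsSet_iff_forall.1 hW _ rfl
      exact ((h2.prodMk_nhds h3).eventually h5).and ((h2.eventually h4).and (h3.eventually h4)))
  refine ⟨ε, hε, fun t v v' hv hv' ↦ h t (v, v') ?_⟩
  rw [Prod.norm_def, max_lt_iff]
  exact ⟨hv, hv'⟩

/-- The order of choices matters: δ₁ from uniform positivity, then the collar width r₁, then the
support radius ρ small enough for `W`, `O` and the tube, and last a cut-off supported in r ≤ ρ with
r χ'(r) below δ₁. -/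
theorem exists_collar_modification (hδ : 0 < δ) (htar : Φ.target = {c | ‖c.2‖ < δ})
    (hγ : ∀ t : ℝ, γ t ∈ Φ.source ∧ Φ (γ t) = cover (t, 0)) (hC : IsCollar Φ j D r₂)
    (ha' : ContDiff ℝ ∞ a') (hpa' : Periodic a' 1)
    (h1 : ∀ t, (D (t, 0)).2 = 0 → 0 < (D (t, 0)).1 * a' t)
    (h2 : ∀ t, (D (t, 0)).2 = 0 → 0 < (deriv (fun s ↦ (D (s, 0)).2) t + (D (t, 0)).1) *
      (deriv (fun s ↦ (D (s, 0)).2) t + a' t)) {W : Set (M × M)}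
    (hW : W ∈ 𝓝ˢ (diagonal M)) {O : Set M} (hO : IsOpen O) (hγO : range γ ⊆ O) :
    ∃ D' r₁ ρ r₀, IsCollarModification Φ j D D' r₁ ρ ∧ 0 < r₀ ∧ r₀ < r₁ ∧
      (∀ t r, r ≤ r₀ → D' (t, r) = (a' t, (D (t, 0)).2)) ∧
      (∀ t r, 0 ≤ r → r < ρ →
        (Φ.symm (cover (ribbon D (t, r))), Φ.symm (cover (ribbon D' (t, r)))) ∈ W) ∧
      (∀ t r, 0 ≤ r → r < ρ →
        Φ.symm (cover (ribbon D (t, r))) ∈ O ∧ Φ.symm (cover (ribbon D' (t, r))) ∈ O) ∧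
      (∀ t r, 0 ≤ r → r < r₁ → Injective (fderiv ℝ (ribbon D) (t, r))) ∧
      ∀ t r, 0 < r → r < r₁ → ribbonForm D (t, r) ≠ 0 ∧ ribbonForm D' (t, r) ≠ 0 := by
  obtain ⟨δ₁, hδ₁, hpos⟩ := exists_uniform_positivity hC.smooth hC.periodic ha' hpa' h1 h2
  obtain ⟨ε, hε, htube⟩ := exists_tube_control hδ htar hγ hW hO hγO
  set r₁ := min (min r₂ δ₁) δ with hr₁
  have hr₁0 : 0 < r₁ := lt_min (lt_min hC.pos hδ₁) hδ
  have hr₁2 : r₁ ≤ r₂ := (min_le_left _ _).trans (min_le_left _ _)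
  have hr₁1 : r₁ ≤ δ₁ := (min_le_left _ _).trans (min_le_right _ _)
  have hr₁δ : r₁ ≤ δ := min_le_right _ _
  have hC₁ := hC.mono hr₁0 hr₁2
  obtain ⟨K, hK0, hK⟩ := exists_bound_of_periodic (g := coneDirection D a')
    (contDiff_coneDirection hC.smooth ha').continuous
    fun t ↦ by simp only [coneDirection]; rw [hpa', hC.periodic]
  -- The new direction has norm at most 1 + K; the factor 2 compares the Euclidean with the supremum
  -- norm.
  set L := 2 * (1 + K) with hL
  have hL0 : 1 < L := by linarith
  set ρ := min r₁ ε / L with hρ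
  have hρ0 : 0 < ρ := div_pos (lt_min hr₁0 hε) (by linarith)
  have hρL : ρ * L = min r₁ ε := div_mul_cancel₀ _ (by linarith)
  have hρm : ρ < min r₁ ε := by rw [← hρL]; exact lt_mul_of_one_lt_right hρ0 hL0
  have hρ1 : ρ < r₁ := hρm.trans_le (min_le_left _ _)
  obtain ⟨χ, hχ, hχI, ⟨r₀, hr₀, hr₀ρ, hχ1⟩, hχ0, hχd⟩ := exists_logarithmic_cutoff hδ₁ hρ0
  have hD' := contDiff_modifiedRibbon hC.smooth ha' hχ
  have hDn : ∀ t r, 0 ≤ r → r < r₁ → ‖D (t, r)‖ ≤ 1 := fun t r h0 h3 ↦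
    (norm_le_planeNorm _).trans (hC₁.norm t r h0 h3).le
  have hDn' : ∀ t r, 0 ≤ r → r < r₁ → ‖modifiedRibbon D a' χ (t, r)‖ ≤ 1 + K := fun t r h0 h3 ↦ by
    refine (norm_add_le _ _).trans (add_le_add ?_ ?_)
    · rw [norm_smul, Real.norm_of_nonneg (sub_nonneg.2 (hχI r).2)]
      exact mul_le_one₀ (sub_le_self _ (hχI r).1) (norm_nonneg _) (hDn t r h0 h3)
    · rw [norm_smul, Real.norm_of_nonneg (hχI r).1]
      exact (mul_le_of_le_one_left (norm_nonneg _) (hχI r).2).trans (hK t)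
  have hrn : ∀ t r, 0 ≤ r → r < ρ → ‖r • modifiedRibbon D a' χ (t, r)‖ ≤ ρ * (1 + K) :=
    fun t r h0 h3 ↦ by
      rw [norm_smul, Real.norm_of_nonneg h0]
      exact mul_le_mul h3.le (hDn' t r h0 (h3.trans hρ1)) (norm_nonneg _) hρ0.le
  have hctl : ∀ t r, 0 ≤ r → r < ρ → _ := fun t r (h0 : 0 ≤ r) (h3 : r < ρ) ↦
    htube t (r • D (t, r)) (r • modifiedRibbon D a' χ (t, r))
      (by
        rw [norm_smul, Real.norm_of_nonneg h0]
        exact ((mul_le_of_le_one_right h0 (hDn t r h0 (h3.trans hρ1))).trans_lt h3).trans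
          (hρm.trans_le (min_le_right _ _)))
      (by
        refine (hrn t r h0 h3).trans_lt ?_
        have h4 : ρ * (1 + K) < ρ * L := mul_lt_mul_of_pos_left (by linarith) hρ0
        exact (h4.trans_le hρL.le).trans_le (min_le_right _ _))
  have habs : ∀ r, 0 ≤ r → r < r₁ → |r| < δ₁ := fun r h0 h3 ↦ by
    rw [abs_of_nonneg h0]; exact h3.trans_le hr₁1
  choose w w' hww using hpos
  have hw : ∀ t r, 0 ≤ r → r < r₁ → _ := fun t r (h0 : 0 ≤ r) (h3 : r < r₁) ↦
    hww t r (r * deriv χ r) (χ r) (habs r h0 h3) (hχd r h0) (hχI r)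
  -- With zero cut-off the same positivity says that the original ribbon is immersed and has no
  -- singular points off the axis.
  have hw0 : ∀ t r, 0 ≤ r → r < r₁ → _ := fun t r (h0 : 0 ≤ r) (h3 : r < r₁) ↦
    hww t r (r * deriv (fun _ ↦ 0) r) 0 (habs r h0 h3) (by simpa using hδ₁) (by simp)
  refine ⟨modifiedRibbon D a' χ, r₁, ρ, r₀, ⟨hC₁, hD', fun t r ↦ ?_, fun c hc ↦ ?_, fun t ↦ ?_,
    fun t r h0 h3 ↦ ?_, hρ1, fun t r hr ↦ ?_, fun t r h0 h3 ↦ ?_⟩, hr₀, hr₀ρ.trans hρ1,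
    fun t r hr ↦ ?_, fun t r h0 h3 ↦ (hctl t r h0 h3).1, fun t r h0 h3 ↦ (hctl t r h0 h3).2,
    fun t r h0 h3 ↦ ?_, fun t r h0 h3 ↦ ⟨?_, ?_⟩⟩
  · simp only [modifiedRibbon, coneDirection]
    rw [hpa', hC.periodic, hC.periodic]
  · rw [htar]
    exact (norm_le_planeNorm _).trans_lt (hc.trans_le hr₁δ)
  · exact injOn_radial_modifiedRibbon hC.smooth ha' hχ fun r h0 h3 ↦ (hw t r h0 h3).1
  · exact fderiv_ribbon_modifiedRibbon_injective hC.smooth ha' hχ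
      (ne_zero_of_planeDot_pos (hw t r h0 h3).1)
  · simp [modifiedRibbon, hχ0 r hr]
  · refine (planeNorm_le_two_mul _).trans_lt ?_
    rcases h0.eq_or_lt with h4 | h4
    · simpa [← h4] using hr₁0
    · have h5 : ‖r • modifiedRibbon D a' χ (t, r)‖ ≤ r * (1 + K) := by
        rw [norm_smul, Real.norm_of_nonneg h0]
        exact mul_le_mul_of_nonneg_left (hDn' t r h0 (h3.trans hρ1)) h0
      have h6 : r * L < ρ * L := mul_lt_mul_of_pos_right h3 (by linarith)
      have h7 := min_le_left r₁ ε
      rw [hL] at h6 hρL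
      linarith
  · simp [modifiedRibbon, hχ1 r hr, coneDirection]
  · have := fderiv_ribbon_modifiedRibbon_injective (χ := fun _ ↦ 0) hC.smooth ha' contDiff_const
      (ne_zero_of_planeDot_pos (hw0 t r h0 h3).1)
    rwa [modifiedRibbon_zero] at this
  · have := ribbonForm_modifiedRibbon_ne_zero (χ := fun _ ↦ 0) hC.smooth ha' contDiff_const h0.ne'
      (hw0 t r h0.le h3).2
    rwa [modifiedRibbon_zero] at this
  · exact ribbonForm_modifiedRibbon_ne_zero hC.smooth ha' hχ h0.ne' (hw t r h0.le h3).2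

end Parameters

/-! ### Assembling the normal form. -/

theorem isNormalForm_of_modified_coefficient {N : ℕ} {a a' b : ℝ → ℝ} {θ : Fin N → ℝ}
    {pos neg ell hyp : Fin N → Prop} {r₀ : ℝ} (hr₀ : 0 < r₀) (hb : ContDiff ℝ ∞ b)
    (hpb : Periodic b 1) (hb' : ∀ t, b t = 0 → deriv b t ≠ 0)
    (ha' : ContDiff ℝ ∞ a') (hpa' : Periodic a' 1)
    (haa' : ∀ z, b z = 0 → 0 < a z * a' z)
    (hell : ∀ z, b z = 0 → IsEllipticZero a b z → a' z = -2 * deriv b z ∧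
        ∃ ε > 0, ∀ t, |t - z| < ε → b t = -(1 / 2) * a' t * (t - z))
    (hnell : ∀ z, b z = 0 → ¬ IsEllipticZero a b z → a' z = a z)
    (hz : ∀ z z', AreConsecutiveZeros b z z' → ∃! t, t ∈ Icc z z' ∧ a' t = 0)
    (hθ : StrictMono θ) (hθm : ∀ k, θ k ∈ Ico (0 : ℝ) 1)
    (hbθ : ∀ t ∈ Ico (0 : ℝ) 1, b t = 0 ↔ ∃ k, t = θ k)
    (h1 : ∀ k, pos k → a (θ k) < 0) (h2 : ∀ k, neg k → 0 < a (θ k))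
    (h3 : ∀ k, ell k → -1 < deriv b (θ k) / a (θ k) ∧ deriv b (θ k) / a (θ k) < 0)
    (h4 : ∀ k, hyp k → deriv b (θ k) / a (θ k) < -1 ∨ 0 < deriv b (θ k) / a (θ k)) :
    IsNormalForm (fun t ↦ r₀ * a' t) (fun t ↦ r₀ * b t) θ pos neg ell hyp := by
  have hbz : ∀ k, b (θ k) = 0 := fun k ↦ (hbθ _ (hθm k)).2 ⟨k, rfl⟩
  have hdiv : ∀ t, deriv (fun t ↦ r₀ * b t) t / (r₀ * a' t) = deriv b t / a' t := fun t ↦ by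
    rw [deriv_const_mul_field, mul_div_mul_left _ _ hr₀.ne']
  have hex : ∀ z z', AreConsecutiveZeros b z z' → ∃! t, t ∈ Icc z z' ∧ r₀ * a' t = 0 :=
    fun z z' h ↦ by
      simpa only [mul_eq_zero, hr₀.ne', false_or] using hz z z' h
  refine ⟨contDiff_const.mul ha', contDiff_const.mul hb, fun t ↦ by simp only [hpa' t],
    fun t ↦ by simp only [hpb t], hθ, hθm, fun t ht ↦ ?_, fun k hk ↦ ?_, fun k hk ↦ ?_,
    fun k hk ↦ ?_, fun k hk ↦ ?_, fun k l hkl ↦ hex _ _ ?_, fun k l hk hl ↦ hex _ _ ?_,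
    fun k hk ↦ ?_⟩
  · rw [← hbθ t ht]
    simp [hr₀.ne']
  · exact mul_neg_of_pos_of_neg hr₀ (neg_of_mul_pos_right (haa' _ (hbz k)) (h1 k hk).le)
  · exact mul_pos hr₀ (pos_of_mul_pos_right (haa' _ (hbz k)) (h2 k hk).le)
  -- At an elliptic point the new slope ratio is b'/(-2b') = -1/2; the common factor r₀ plays no
  -- role.
  · rw [hdiv, (hell _ (hbz k) (h3 k hk)).1, div_mul_cancel_right₀ (hb' _ (hbz k))]
    norm_num
  · rw [hdiv, hnell _ (hbz k) fun h ↦ by rcases h4 k hk with h5 | h5 <;> linarith [h.1, h.2]]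
    exact h4 k hk
  · have hlt : k < l := Fin.lt_def.2 (by omega)
    refine ⟨hbz k, hbz l, hθ hlt, fun t ht1 ht2 ht ↦ ?_⟩
    obtain ⟨m, rfl⟩ := (hbθ t ⟨(hθm k).1.trans ht1.le, ht2.trans (hθm l).2⟩).1 ht
    have h5 := Fin.lt_def.1 (hθ.lt_iff_lt.1 ht1)
    have h6 := Fin.lt_def.1 (hθ.lt_iff_lt.1 ht2)
    omega
  · refine ⟨hbz l, by rw [hpb]; exact hbz k, by linarith [(hθm k).1, (hθm l).2],
      fun t ht1 ht2 ht ↦ ?_⟩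
    rcases lt_or_ge t 1 with h5 | h5
    · obtain ⟨m, rfl⟩ := (hbθ t ⟨(hθm l).1.trans ht1.le, h5⟩).1 ht
      have h6 := Fin.lt_def.1 (hθ.lt_iff_lt.1 ht1)
      omega
    -- A zero in the part of the last arc beyond 1 would, shifted back by a period, precede the
    -- first zero.
    · have h6 : b (t - 1) = 0 := by rw [hpb.sub_eq]; exact ht
      obtain ⟨m, hm⟩ := (hbθ (t - 1) ⟨by linarith, by linarith [(hθm k).2]⟩).1 h6
      have h7 : θ m < θ k := by linarith
      have h8 := Fin.lt_def.1 (hθ.lt_iff_lt.1 h7)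
      omega
  · obtain ⟨-, ε, hε, h⟩ := hell _ (hbz k) (h3 k hk)
    refine ⟨ε, hε, fun t ht ↦ ?_⟩
    simp only [h t ht]
    ring

/-- Zeros at mutual distance at least δ lie in different cells of a grid of width δ. -/
theorem finite_zeros {b : ℝ → ℝ} {δ : ℝ} (hδ : 0 < δ)
    (h : ∀ z t, b z = 0 → |t - z| < δ → b t = 0 → t = z) : {t ∈ Ico (0 : ℝ) 1 | b t = 0}.Finite := by
  refine Set.Finite.of_injOn (f := fun t ↦ ⌊t / δ⌋) (t := Icc 0 ⌊1 / δ⌋) (fun t ht ↦ ⟨?_, ?_⟩)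
    (fun s hs t ht hst ↦ ?_) (finite_Icc _ _)
  · exact Int.floor_nonneg.2 (div_nonneg ht.1.1 hδ.le)
  · exact Int.floor_mono (div_le_div_of_nonneg_right ht.1.2.le hδ.le)
  · have h1 := Int.abs_sub_lt_one_of_floor_eq_floor hst
    rw [← sub_div, abs_div, abs_of_pos hδ, div_lt_one hδ] at h1
    exact h t s ht.2 h1 hs.2

section Knot

variable {M : Type*} [TopologicalSpace M] [ChartedSpace E3 M] [IsManifold (𝓡 3) ∞ M]
  {S : Type*} [TopologicalSpace S] [ChartedSpace (EuclideanHalfSpace 2) S]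
  [IsManifold (𝓡∂ 2) ∞ S] {α : ∀ p : M, TangentSpace (𝓡 3) p →L[ℝ] ℝ} {γ : ℝ → M}
  {σ : ∀ q : S, TangentSpace (𝓡∂ 2) q →L[ℝ] TangentSpace (𝓡∂ 2) q →L[ℝ] ℝ} {j : S → M}

theorem range_comp_add (γ : ℝ → M) (c : ℝ) : (range fun t ↦ γ (t + c)) = range γ :=
  (Equiv.addRight c).surjective.range_comp γ

theorem IsOrientedBoundary.shift [T2Space M] (h : IsOrientedBoundary σ j γ) (hγ : IsLegendrianKnot α γ)
    (c : ℝ) : IsOrientedBoundary σ j (fun t ↦ γ (t + c)) := by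
  refine ⟨by rw [h.image_boundary, range_comp_add], fun t q hq hqt v ν hv hν ↦ ?_⟩
  exact h.oriented (t + c) q hq hqt v ν (hv.trans (hγ.velocity_shift c t)) hν

variable {Φ : OpenPartialHomeomorph M (AddCircle (1 : ℝ) × ℝ × ℝ)} {D : ℝ × ℝ → ℝ × ℝ} {r₁ : ℝ}

theorem nondegenerate_zero (hα : IsSmoothOneForm α) (hσ : IsAreaForm σ)
    (hΦ : IsContactCoordinates α Φ)
    (hγ : ∀ t : ℝ, γ t ∈ Φ.source ∧ Φ (γ t) = cover (t, 0)) (hbd : IsOrientedBoundary σ j γ)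
    (hj : IsEmbedding j) (hC : IsCollar Φ j D r₁)
    (hnd : ∀ q, IsSingular α j q → IsNondegenerate α σ j q) {t : ℝ} (ht : (D (t, 0)).2 = 0) :
    (D (t, 0)).1 ≠ 0 ∧ deriv (fun s ↦ (D (s, 0)).2) t ≠ 0 ∧
      deriv (fun s ↦ (D (s, 0)).2) t + (D (t, 0)).1 ≠ 0 := by
  obtain ⟨q, -, hq⟩ := hbd.image_boundary.superset (mem_range_self t)
  obtain ⟨h1, h2⟩ := boundary_invariants hα hσ hΦ hγ hbd hj hC hq (hnd q)
  obtain ⟨h3, h4, -⟩ := h2 (h1.2 ht)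
  refine ⟨fun h5 ↦ ?_, h3, h4⟩
  have h6 := hC.norm t 0 le_rfl hC.pos
  rw [planeNorm_eq_zero.2 (Prod.ext h5 ht)] at h6
  exact zero_ne_one h6

end Knot

end ContactSurface

/-! ### The theorem. -/

open ContactSurface

theorem proposition2p1
    {M : Type*} [TopologicalSpace M] [T2Space M] [ChartedSpace (EuclideanSpace ℝ (Fin 3)) M]
    [IsManifold (𝓡 3) ∞ M]
    (α : ∀ p : M, TangentSpace (𝓡 3) p →L[ℝ] ℝ) (hα : ContactSurface.IsContactForm α)
    {S : Type*} [TopologicalSpace S] [CompactSpace S] [ChartedSpace (EuclideanHalfSpace 2) S]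
    [IsManifold (𝓡∂ 2) ∞ S]
    (σ : ∀ q : S, TangentSpace (𝓡∂ 2) q →L[ℝ] TangentSpace (𝓡∂ 2) q →L[ℝ] ℝ)
    (hσ : ContactSurface.IsAreaForm σ)
    (j : S → M) (hj : Manifold.IsSmoothEmbedding (𝓡∂ 2) (𝓡 3) ∞ j)
    (γ : ℝ → M) (hγ : ContactSurface.IsLegendrianKnot α γ)
    (hbd : ContactSurface.IsOrientedBoundary σ j γ)
    (hnd : ∀ q, ContactSurface.IsSingular α j q → ContactSurface.IsNondegenerate α σ j q) :
    {q ∈ (𝓡∂ 2).boundary S | ContactSurface.IsSingular α j q}.Finite ∧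
    ∀ (N : ℕ) (e : Fin N → S), ContactSurface.IsBoundaryListing α j γ e →
    ∀ W ∈ 𝓝ˢ (diagonal M), ∀ O : Set M, IsOpen O → range γ ⊆ O →
    ∃ j' : S → M, ContactSurface.IsPerturbation j j' W O ∧
      j' '' {q | ContactSurface.IsSingular α j' q} = j '' {q | ContactSurface.IsSingular α j q} ∧
      ∃ (U : Set M) (Φ : OpenPartialHomeomorph M (AddCircle (1 : ℝ) × ℝ × ℝ))
        (θ : Fin N → ℝ) (a b : ℝ → ℝ),
        U ∈ 𝓝ˢ (range γ) ∧ U ⊆ Φ.source ∧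
        ContactSurface.IsContactCoordinates α Φ ∧
        Φ '' range γ = {z | z.2 = (0, 0)} ∧
        (∀ k, Φ (j (e k)) = ((θ k : AddCircle (1 : ℝ)), 0, 0)) ∧
        Φ '' (U ∩ range j') =
          {z | ∃ t ∈ Icc (0 : ℝ) 1, ∃ r ∈ Icc (0 : ℝ) 1,
            z = ((t : AddCircle (1 : ℝ)), a t * r, b t * r)} ∧
        ContactSurface.IsNormalForm a b θ
          (fun k ↦ ContactSurface.IsPositive α σ j (e k))
          (fun k ↦ ContactSurface.IsNegative α σ j (e k))
          (fun k ↦ ContactSurface.IsElliptic α σ j (e k))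
          (fun k ↦ ContactSurface.IsHyperbolic α σ j (e k)) := by
  have hcont := hj.isEmbedding.continuous
  refine ⟨?_, fun N e he W hW O hO hγO ↦ ?_⟩
  · obtain ⟨Φ, hΦ, -, hax⟩ := exists_contact_coordinates hα hγ
    obtain ⟨D, r₁, hC⟩ := exists_collar hΦ hj hax hbd.image_boundary
    have hDs : ContDiff ℝ ∞ fun s ↦ D (s, 0) := hC.smooth.comp (by fun_prop)
    have hz : ∀ t, (D (t, 0)).2 = 0 → _ := fun t ht ↦
      nondegenerate_zero hα.smooth hσ hΦ hax hbd hj.isEmbedding hC hnd ht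
    obtain ⟨δ, hδ, hsp⟩ := exists_zero_spacing (contDiff_fst.comp hDs) (contDiff_snd.comp hDs)
      (fun t ↦ by simp only [comp_apply, hC.periodic]) (fun t ↦ by simp only [comp_apply, hC.periodic])
      (fun t ht ↦ (hz t ht).1) (fun t ht ↦ (hz t ht).2.1)
    have hfin := finite_zeros hδ fun z t h1 h2 ↦ (hsp z t h1 h2).1
    refine ((hfin.image γ).preimage hj.isEmbedding.injective.injOn).subset ?_
    rintro q ⟨hq, hs⟩
    obtain ⟨t, ht⟩ := hbd.image_boundary.subset (mem_image_of_mem j hq)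
    obtain ⟨s, hs1, hst⟩ := hγ.periodic.exists_mem_Ico₀ one_pos t
    have hqs : j q = γ s := ht.symm.trans hst
    exact ⟨s, ⟨hs1, (boundary_invariants hα.smooth hσ hΦ hax hbd hj.isEmbedding hC hqs
      (hnd q)).1.1 hs⟩, hqs.symm⟩
  · obtain ⟨τ, hτ, hτ1, hτe⟩ := he.ordered
    -- The knot is reparametrized so that the first listed point has angle 0; the listing spans less
    -- than one period, so all angles lie in [0, 1). For N = 0 any shift would do.
    set c : ℝ := if h : 0 < N then τ ⟨0, h⟩ else 0 with hc
    have hγ' := hγ.shift c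
    have hbd' := hbd.shift hγ c
    have hrange := range_comp_add γ c
    set η : ℝ → M := fun t ↦ γ (t + c) with hη
    set θ : Fin N → ℝ := fun k ↦ τ k - c with hθ
    have heθ : ∀ k, j (e k) = η (θ k) := fun k ↦ by simp [hη, hθ, hτe]
    have hθm : ∀ k, θ k ∈ Ico (0 : ℝ) 1 := fun k ↦ by
      have h0 : 0 < N := k.pos
      have h1 : c = τ ⟨0, h0⟩ := dif_pos h0
      have h2 : τ ⟨0, h0⟩ ≤ τ k := hτ.monotone (Fin.le_def.2 (Nat.zero_le _))
      have h3 := hτ1 ⟨0, h0⟩ k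
      simp only [hθ, h1]
      constructor <;> linarith
    obtain ⟨Φ, hΦ, ⟨δ, hδ, htar⟩, hax⟩ := exists_contact_coordinates hα hγ'
    obtain ⟨D, r₂, hC⟩ := exists_collar hΦ hj hax hbd'.image_boundary
    have hDs : ContDiff ℝ ∞ fun s ↦ D (s, 0) := hC.smooth.comp (by fun_prop)
    have hz : ∀ t, (D (t, 0)).2 = 0 → _ := fun t ht ↦
      nondegenerate_zero hα.smooth hσ hΦ hax hbd' hj.isEmbedding hC hnd ht
    have hinv : ∀ q t, j q = η t → _ := fun q t hq ↦
      boundary_invariants hα.smooth hσ hΦ hax hbd' hj.isEmbedding hC hq (hnd q)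
    have hpb : Periodic (fun t ↦ (D (t, 0)).2) 1 := fun t ↦ by simp only [hC.periodic]
    obtain ⟨a', ha', hpa', haa', hell, hnell, hzz⟩ := exists_modified_coefficient
      (a := fun t ↦ (D (t, 0)).1) (b := fun t ↦ (D (t, 0)).2)
      (contDiff_fst.comp hDs) (contDiff_snd.comp hDs) (fun t ↦ by simp only [hC.periodic]) hpb
      (fun t ht ↦ (hz t ht).1) (fun t ht ↦ (hz t ht).2.1)
    -- This sign condition prevents new singular points. With b' = s a the product is (1 + s)(-s) a²
    -- at an elliptic zero, positive as -1 < s < 0; at other zeros a' = a and it is the square of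
    -- the non-zero b' + a.
    have hsign : ∀ t, (D (t, 0)).2 = 0 → 0 < (deriv (fun s ↦ (D (s, 0)).2) t + (D (t, 0)).1) *
        (deriv (fun s ↦ (D (s, 0)).2) t + a' t) := fun t ht ↦ by
      by_cases h : IsEllipticZero (fun t ↦ (D (t, 0)).1) (fun t ↦ (D (t, 0)).2) t
      · rw [(hell t ht h).1]
        obtain ⟨h1, h2⟩ := h
        have h3 := (hz t ht).1
        set s := deriv (fun s ↦ (D (s, 0)).2) t / (D (t, 0)).1 with hs
        have h4 : deriv (fun s ↦ (D (s, 0)).2) t = s * (D (t, 0)).1 := (div_mul_cancel₀ _ h3).symm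
        have h5 : (s * (D (t, 0)).1 + (D (t, 0)).1) * (s * (D (t, 0)).1 + -2 * (s * (D (t, 0)).1)) =
          ((1 + s) * -s) * ((D (t, 0)).1 * (D (t, 0)).1) := by ring
        rw [h4, h5]
        exact mul_pos (mul_pos (by linarith) (by linarith)) (mul_self_pos.2 h3)
      · rw [hnell t ht h]
        exact mul_self_pos.2 (hz t ht).2.2
    obtain ⟨D', r₁, ρ, r₀, hmod, hr₀, hr₀₁, hD', hDW, hDO, hder, hns⟩ :=
      exists_collar_modification hδ htar hax hC ha' hpa' haa' hsign hW hO (hrange.trans_subset hγO)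
    obtain ⟨U, hU, hUs, hUim⟩ :=
      hmod.exists_ruled_neighborhood hΦ hj hax hbd'.image_boundary hr₀ hr₀₁ hD'
    have hbθ : ∀ t ∈ Ico (0 : ℝ) 1, (D (t, 0)).2 = 0 ↔ ∃ k, t = θ k := fun t ht ↦ by
      constructor
      · intro h
        obtain ⟨q, hq, hqt⟩ := hbd'.image_boundary.superset (mem_range_self t)
        obtain ⟨k, rfl⟩ := (he.mem_iff q).2 ⟨hq, (hinv q t hqt).1.2 h⟩
        exact ⟨k, hγ'.injective ht (hθm k) (hqt.symm.trans (heθ k))⟩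
      · rintro ⟨k, rfl⟩
        exact (hinv _ _ (heθ k)).1.1 ((he.mem_iff _).1 ⟨k, rfl⟩).2
    have hsing : ∀ k, IsSingular α j (e k) := fun k ↦ ((he.mem_iff _).1 ⟨k, rfl⟩).2
    refine ⟨modifiedMap Φ j D' r₁, hmod.isPerturbation hΦ hj hax hbd'.image_boundary
      (subset_of_mem_nhdsSet hW) hDW hDO, hmod.image_singular hΦ hcont hder hns
      fun t ↦ by rw [hD' t 0 hr₀.le], U, Φ, θ, fun t ↦ r₀ * a' t, fun t ↦ r₀ * (D (t, 0)).2,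
      hrange ▸ hU, hUs, hΦ, ?_, fun k ↦ ?_, ?_, ?_⟩
    · rw [← hrange]
      ext z
      constructor
      · rintro ⟨_, ⟨t, rfl⟩, rfl⟩
        rw [(hax t).2]; rfl
      · intro hz
        refine ⟨_, ⟨angleLift z.1, rfl⟩, ?_⟩
        rw [(hax _).2]
        exact Prod.ext (coe_angleLift _) hz.symm
    · rw [heθ, (hax _).2]; rfl
    · rw [hUim]
      simp only [Prod.smul_mk, smul_eq_mul, mul_right_comm r₀]
    · exact isNormalForm_of_modified_coefficient hr₀ (contDiff_snd.comp hDs) hpb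
        (fun t ht ↦ (hz t ht).2.1) ha' hpa' haa' hell hnell hzz
        (fun k l hkl ↦ sub_lt_sub_right (hτ hkl) c) hθm hbθ
        (fun k ↦ ((hinv _ _ (heθ k)).2 (hsing k)).2.2.1)
        (fun k ↦ ((hinv _ _ (heθ k)).2 (hsing k)).2.2.2.1)
        (fun k ↦ ((hinv _ _ (heθ k)).2 (hsing k)).2.2.2.2.1)
        (fun k ↦ ((hinv _ _ (heθ k)).2 (hsing k)).2.2.2.2.2)
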